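/- A rational plane tropical curve of degree $d$ with $m$ markings is a tuple $(\Gamma,x_1,\dots,x_m,h)$, where $\Gamma$ is a metric tree with vertices of valence $\ge 3$ and with bounded and unbounded edges, $x_1,\dots,x_m$ are distinct unbounded edges, and $h:\Gamma\to\mathbb R^2$ is continuous, affine of integral direction on each edge, balanced at each vertex, constant on each $x_i$, and has on the other (unlabelled) unbounded edges the directions $(-1,0),(0,-1),(1,1)$, each $d$ times. Let $\mathcal M_{d,m}$ be the space of isomorphism classes; its cells (the combinatorial types) have as coordinates the image of a root vertex and the lengths of the bounded edges, and the maximal cells are those in which all vertices are trivalent. The multiplicity of a curve of such a cell with respect to a map that is affine linear on the cell is the absolute value of the determinant of its linear part in these coordinates. A configuration of conditions is called general if every curve satisfying the conditions lies in a maximal cell (and, where a marking is required to lie on a fixed tropical curve, this marking is mapped to the relative interior of an edge of that curve). The number of curves satisfying a general configuration of conditions is the sum of their multiplicities with respect to the map given by the conditions; a condition $h(x_i)=p$ contributes the two coordinates of $h(x_i)$, and the condition that $h(x_i)$ lies on a tropical curve $K$ contributes the local integral linear equation of $K$ at $h(x_i)$, namely the primitive one multiplied by the weight of the edge. Only finitely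 many curves have nonzero multiplicity. Let $d,l\ge 1$ and let $\mathcal L^l$ be any plane tropical curve of degree $l$, i.e. the tropical curve of a tropical polynomial whose Newton polygon is the triangle with vertices $(0,0),(l,0),(0,l)$. The number of curves in $\mathcal M_{d,3d-1}$ through $3d-1$ general points (that is, with $h(x_i)=p_i$ for all $i$) does not depend on the points; call it $n_d$. Let $N_d^{\mathsf T_0}(n)$ be the number of curves in $\mathcal M_{d,m+1}$, $m=3d-1-n$ ($m=0$ if $n>3d-1$), for which $h(x_1),\dots,h(x_m)$ are $m$ given general points and * ($n=0$) $h(x_{m+1})$ lies on $\mathcal L^l$; * ($n=1$) $h(x_{m+1})$ is a fixed point $q$ of $\mathcal L^l$ (for instance one of the points of intersection of $\mathcal L^l$ with a general tropical line); * ($n\ge 2$) $h(x_{m+1})$ lies on $\mathcal L^l$ and on $n$ general tropical lines. Then, for all general configurations, $$N_d^{\mathsf T_0}(n)=\begin{cases} l\,d\,n_d, & n=0,\\ n_d, & n=1,\\ 0, & n\ge 2.\end{cases}$$ In each case the configurations that are not general lie in finitely many proper affine subspaces of the space of configurations (the points $p_i$ and, for $n\ge2$, the vertices of the lines vary; $\mathcal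 L^l$ and, for $n=1$, $q$ are fixed arbitrarily). For $n\ge 2$, outside finitely many proper affine subspaces there is no curve satisfying the conditions at all. -/

import Mathlib

/-- Points of the plane, with coordinates indexed by `Fin 2`. -/
abbrev Pt : Type := Fin 2 → ℝ

/-- The three directions `(-1,0)`, `(0,-1)`, `(1,1)` of the unmarked ends of a plane tropical curve
of degree `d`; each of them occurs `d` times. -/
def endDir : Fin 3 → Fin 2 → ℤ := ![![-1, 0], ![0, -1], ![1, 1]]

/-- A rational plane tropical curve of degree `d` with `m` markings. The underlying graph is a
metric tree with vertex set `Fin k`: `graph` records the bounded edges, `len` their lengths,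
`mark i` the vertex at which the `i`-th marked (contracted, unbounded) end is attached, and
`ends v j` the number of unmarked unbounded edges of direction `endDir j` at `v` (the unmarked ends
carry no labels). The map to the plane is given by the images `pos` of the vertices and the integral
direction vectors `dir u v` of the flags (the direction at `u` of the bounded edge from `u`
to `v`, with the convention `0` if there is no such edge). Contracted bounded edges are allowed. -/
structure PlaneTropCurve (d m : ℕ) where
  k : ℕ
  graph : SimpleGraph (Fin k)
  isTree : graph.IsTree
  len : Sym2 (Fin k) → ℝ
  len_pos : ∀ e ∈ graph.edgeSet, 0 < len e
  mark : Fin m → Fin k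
  ends : Fin k → Fin 3 → ℕ
  ends_sum : ∀ j, ∑ v, ends v j = d
  dir : Fin k → Fin k → Fin 2 → ℤ
  dir_antisymm : ∀ u v, dir v u = -dir u v
  dir_eq_zero : ∀ u v, ¬ graph.Adj u v → dir u v = 0
  pos : Fin k → Pt
  pos_eq : ∀ u v, graph.Adj u v → ∀ c, pos v c = pos u c + len s(u, v) * (dir u v c : ℝ)
  balanced : ∀ u c, ∑ v, dir u v c + ∑ j, (ends u j : ℤ) * endDir j c = 0
  three_le_valence : ∀ u,
    3 ≤ (graph.neighborSet u).ncard + {i | mark i = u}.ncard + ∑ j, ends u j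

namespace PlaneTropCurve

variable {d m : ℕ}

/-- The number of flags at a vertex. -/
noncomputable def valence (C : PlaneTropCurve d m) (u : Fin C.k) : ℕ :=
  (C.graph.neighborSet u).ncard + {i | C.mark i = u}.ncard + ∑ j, C.ends u j

/-- The combinatorial type of `C` has codimension `0`: `C` lies in the interior of a cell
of maximal dimension of the moduli space. -/
def Trivalent (C : PlaneTropCurve d m) : Prop := ∀ u, C.valence u = 3

/-- The evaluation at the `i`-th marking. -/
def ev (C : PlaneTropCurve d m) (i : Fin m) : Pt := C.pos (C.mark i)

/-- Two plane tropical curves are isomorphic if there is an isometry of the underlying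
metric trees that respects the markings and the maps to the plane. -/
def Iso (C D : PlaneTropCurve d m) : Prop :=
  ∃ σ : Fin C.k ≃ Fin D.k,
    (∀ u v, D.graph.Adj (σ u) (σ v) ↔ C.graph.Adj u v) ∧
    (∀ u v, C.graph.Adj u v → D.len s(σ u, σ v) = C.len s(u, v)) ∧
    (∀ i, D.mark i = σ (C.mark i)) ∧
    (∀ u, D.ends (σ u) = C.ends u) ∧
    (∀ u v, D.dir (σ u) (σ v) = C.dir u v) ∧
    (∀ u, D.pos (σ u) = C.pos u)

theorem Iso.refl (C : PlaneTropCurve d m) : Iso C C :=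
  ⟨Equiv.refl _, by simp⟩

theorem Iso.symm {C D : PlaneTropCurve d m} (h : Iso C D) : Iso D C := by
  obtain ⟨σ, h1, h2, h3, h4, h5, h6⟩ := h
  refine ⟨σ.symm, fun u v => ?_, fun u v huv => ?_, fun i => ?_, fun u => ?_, fun u v => ?_,
    fun u => ?_⟩
  · simpa using (h1 (σ.symm u) (σ.symm v)).symm
  · have := h2 (σ.symm u) (σ.symm v) (by simpa using (h1 (σ.symm u) (σ.symm v)).1 (by simpa))
    simpa using this.symm
  · simp [h3 i]
  · simpa using (h4 (σ.symm u)).symm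
  · simpa using (h5 (σ.symm u) (σ.symm v)).symm
  · simpa using (h6 (σ.symm u)).symm

theorem Iso.trans {C D E : PlaneTropCurve d m} (h : Iso C D) (h' : Iso D E) : Iso C E := by
  obtain ⟨σ, h1, h2, h3, h4, h5, h6⟩ := h
  obtain ⟨τ, k1, k2, k3, k4, k5, k6⟩ := h'
  refine ⟨σ.trans τ, fun u v => ?_, fun u v huv => ?_, fun i => ?_, fun u => ?_, fun u v => ?_,
    fun u => ?_⟩
  · simp [k1, h1]
  · simp [k2 _ _ ((h1 u v).2 huv), h2 u v huv]
  · simp [k3, h3]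
  · simp [k4, h4]
  · simp [k5, h5]
  · simp [k6, h6]

instance isoSetoid (d m : ℕ) : Setoid (PlaneTropCurve d m) where
  r := Iso
  iseqv := ⟨Iso.refl, Iso.symm, Iso.trans⟩

/-- A root vertex. (Multiplicities do not depend on its choice.) -/
noncomputable def root (C : PlaneTropCurve d m) : Fin C.k :=
  C.isTree.connected.nonempty.some

/-- Coordinates on the cell of `C` are the two coordinates of the image of the root vertex and the
lengths of the bounded edges. `C.coordCoeff v c` is the linear form which expresses the `c`-th
coordinate of the image of the vertex `v` in them: the image of `v` is the image of the root plus the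
sum of (length) * (direction) over the edges of the path from the root to `v`. -/
noncomputable def coordCoeff (C : PlaneTropCurve d m) (v : Fin C.k) (c : Fin 2) :
    Fin 2 ⊕ C.graph.edgeSet → ℤ
  | Sum.inl c' => if c = c' then 1 else 0
  | Sum.inr e => open Classical in
      (((C.isTree.existsUnique_path C.root v).choose.darts.map
        fun a => if a.edge = e.1 then C.dir a.fst a.snd c else 0)).sum

end PlaneTropCurve

/-- The moduli space of rational plane tropical curves of degree `d` with `m` markings. -/
abbrev TropModuli (d m : ℕ) : Type := Quotient (PlaneTropCurve.isoSetoid d m)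

/-- The absolute value of the determinant of a matrix whose rows and columns are indexed by
possibly different sets of the same size (it does not depend on the chosen bijection);
`0` if the matrix is not square. -/
noncomputable def absDet {ι κ : Type} [Fintype ι] [DecidableEq ι] (A : Matrix ι κ ℤ) : ℕ :=
  open Classical in
  if h : Nonempty (ι ≃ κ) then (A.submatrix id h.some).det.natAbs else 0

/-- The multiplicity of a curve with respect to the product `ev` of all evaluation maps. -/
noncomputable def evMult {d m : ℕ} (C : PlaneTropCurve d m) : ℕ :=
  absDet (fun (r : Fin m × Fin 2) => C.coordCoeff (C.mark r.1) r.2)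

/-- The curves with `ev = p`. -/
def evFibre (d : ℕ) {m : ℕ} (p : Fin m → Pt) : Set (PlaneTropCurve d m) :=
  {C | ∀ i, C.ev i = p i}

/-- `p` is in `ev`-general position. -/
def EvGeneral (d : ℕ) {m : ℕ} (p : Fin m → Pt) : Prop :=
  ∀ C ∈ evFibre d p, C.Trivalent

/-- The number of isomorphism classes of curves in `S`, counted with the multiplicity `μ`, is `N`
(`S` and `μ` are meant to be invariant under isomorphism; classes of multiplicity `0` do not
contribute, and there are only finitely many others). -/
def HasCount {d m : ℕ} (S : Set (PlaneTropCurve d m)) (μ : PlaneTropCurve d m → ℕ) (N : ℕ) : Prop :=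
  {x : TropModuli d m | x.out ∈ S ∧ μ x.out ≠ 0}.Finite ∧
    ∑ᶠ x ∈ {x : TropModuli d m | x.out ∈ S ∧ μ x.out ≠ 0}, μ x.out = N

/-- A bivariate tropical polynomial `max_{a ∈ supp} (coeff a + a 0 * x + a 1 * y)`. -/
structure TropPoly where
  supp : Finset (Fin 2 → ℕ)
  coeff : (Fin 2 → ℕ) → ℝ

namespace TropPoly

/-- The value at `q` of the monomial with exponent `a`. -/
def term (F : TropPoly) (a : Fin 2 → ℕ) (q : Pt) : ℝ := F.coeff a + ∑ c, (a c : ℝ) * q c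

/-- The exponents of the monomials that attain the maximum at `q`. -/
def argmax (F : TropPoly) (q : Pt) : Set (Fin 2 → ℕ) :=
  {a | a ∈ F.supp ∧ ∀ b ∈ F.supp, F.term b q ≤ F.term a q}

/-- The plane tropical curve defined by `F`: the points where the maximum is attained twice. -/
def locus (F : TropPoly) : Set Pt := {q | ∃ a ∈ F.argmax q, ∃ b ∈ F.argmax q, a ≠ b}

/-- `F` defines a tropical curve of degree `l`, that is, its Newton polygon is the triangle with
vertices `(0,0)`, `(l,0)`, `(0,l)`; equivalently, the curve has `l` ends, counted with
weight, in each of the directions `(-1,0)`, `(0,-1)`, `(1,1)`. -/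
def HasDegree (F : TropPoly) (l : ℕ) : Prop :=
  (∀ a ∈ F.supp, a 0 + a 1 ≤ l) ∧ ![0, 0] ∈ F.supp ∧ ![l, 0] ∈ F.supp ∧ ![0, l] ∈ F.supp

/-- `q` lies in the relative interior of an edge of the curve, and `w` is the normal vector of this
edge, of lattice length the weight of the edge: `w` is the difference of the end points of the dual
edge of the Newton subdivision. -/
def IsEdgeNormal (F : TropPoly) (q : Pt) (w : Fin 2 → ℤ) : Prop :=
  ∃ a ∈ F.argmax q, ∃ b ∈ F.argmax q, a ≠ b ∧ (∀ c, w c = (a c : ℤ) - (b c : ℤ)) ∧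
    ∀ e ∈ F.argmax q, ∃ t : ℝ, 0 ≤ t ∧ t ≤ 1 ∧
      ∀ c, (e c : ℝ) = (b c : ℝ) + t * ((a c : ℝ) - (b c : ℝ))

/-- `q` lies in the relative interior of an edge of the curve. -/
def IsEdgePoint (F : TropPoly) (q : Pt) : Prop := ∃ w, F.IsEdgeNormal q w

/-- The normal vector of `IsEdgeNormal` (unique up to sign). -/
noncomputable def edgeNormal (F : TropPoly) (q : Pt) : Fin 2 → ℤ :=
  open Classical in if h : F.IsEdgePoint q then h.choose else 0

/-- The tropical line with vertex `z`. -/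
noncomputable def line (z : Pt) : TropPoly where
  supp := {![0, 0], ![1, 0], ![0, 1]}
  coeff a := -∑ c, (a c : ℝ) * z c

end TropPoly

/-- The curves whose first `m` markings are mapped to the points `p`, and whose last marking is
mapped to a point common to all the tropical curves `K 0, …, K n`. -/
def incFibre (d : ℕ) {m n : ℕ} (K : Fin (n + 1) → TropPoly) (p : Fin m → Pt) :
    Set (PlaneTropCurve d (m + 1)) :=
  {C | (∀ i : Fin m, C.ev i.castSucc = p i) ∧ ∀ j, C.ev (Fin.last m) ∈ (K j).locus}

/-- The points `p` and the tropical curves `K 0, …, K n` are in general position with respect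
to the incidence conditions of `incFibre`: every curve that satisfies the conditions is generic in
the moduli space, and its last marking is mapped to generic points of the curves `K j`. -/
def IncGeneral (d : ℕ) {m n : ℕ} (K : Fin (n + 1) → TropPoly) (p : Fin m → Pt) : Prop :=
  ∀ C ∈ incFibre d K p, C.Trivalent ∧ ∀ j, (K j).IsEdgePoint (C.ev (Fin.last m))

/-- The multiplicity of a curve with respect to the conditions of `incFibre`: the absolute value of
the determinant of the map given by the first `m` evaluations together with the local equations
of the tropical curves `K j` at the image of the last marking. -/
noncomputable def incMult {d m n : ℕ} (K : Fin (n + 1) → TropPoly)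
    (C : PlaneTropCurve d (m + 1)) : ℕ :=
  absDet (Sum.elim
    (fun (r : Fin m × Fin 2) => C.coordCoeff (C.mark r.1.castSucc) r.2)
    (fun (j : Fin (n + 1)) x => ∑ c, (K j).edgeNormal (C.ev (Fin.last m)) c *
      C.coordCoeff (C.mark (Fin.last m)) c x))

/-- A property of the points of a real vector space that holds outside finitely many proper affine
subspaces. -/
def IsGeneric {E : Type} [AddCommGroup E] [Module ℝ E] (s : Set E) : Prop :=
  ∃ T : Set (AffineSubspace ℝ E), T.Finite ∧ ⊤ ∉ T ∧ ∀ x, x ∉ s → ∃ A ∈ T, x ∈ A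

/-! The substance lies in two places: the independence of `n_d` from the points, and the case `n =
0`. The rest is dimension counting. A curve with `m` markings has at most `m + 3d - 2` vertices,
with equality exactly when it is trivalent, so its cell has dimension at most `m + 3d - 1`, and less
if it is not trivalent. There are finitely many types, hence the configurations reached from cells
that are too small lie in finitely many proper affine subspaces (`isGeneric_of_cells`).

Invariance of `n_d`. Name the inner vertices and number all unbounded edges. For such a labelled
trivalent tree the positions of the markings relative to the first one depend linearly on the
lengths of the inner edges, through a square matrix (`triMatrix`) whose determinant is, up to sign,
the multiplicity. The number of curves through `p` thus becomes a weighted number of cones (images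
of open orthants) containing `relPos p`. The passage to labels multiplies it by the constant `|U|! *
(d!)^3`, because a curve of nonzero multiplicity has no automorphisms and at most one end of each
direction at every vertex. Now move the point along a general line. The weighted number can change
only on walls, where one inner edge shrinks to length zero and a vertex of valence four appears.
Three trees resolve this vertex, and their matrices differ in one column only. The column of an edge
is a quadratic expression in the indicator function of the leaves behind it, and polarisation
(`LeafData.col_add_col_add_col`) shows that the three columns add up to the columns of the four
flags around the vertex of valence four. Each of those occurs elsewhere in the matrix or is zero, so
the three determinants add up to zero (`treeTerm_add`) and the signed jumps cancel
(`coneDegree_eq`).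

The case `n = 0` is Bézout's theorem. Generality keeps the vertices of a curve `C` through the
points off the tropical curve `L`, so a curve with a further marking on `L` is a curve `C` with a
marking attached in the interior of an edge or end. Attaching it multiplies the determinant by the
absolute value of the pairing of the normal covector of `L` with the direction of the edge
(`incMult_attach`). The polynomial of `L` is convex and piecewise linear, and along an edge of `C`
its integral slope increases at a crossing by exactly this number. The total increase telescopes on
bounded edges, and by balancing it equals `d` times the sum of the largest slopes in the three end
directions, that is `d * l` (`TropType.sum_slope`).

For `n = 1` the point `q` is simply one more point condition. For `n ≥ 2` a point common to `L` and
two lines imposes a nontrivial affine equation on the vertices of these lines. Moreover the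
multiplicity always vanishes, since three or more covectors at one marking are dependent. -/

section

/-! ### Trees: potentials, flows and the sides of an edge -/

namespace SimpleGraph

variable {V : Type*} {G : SimpleGraph V}

/-- The sum of a function on darts along the path from `r` to `v` in a tree. -/
noncomputable def IsTree.pathSum {M : Type*} [AddCommGroup M] (hG : G.IsTree) (δ : V → V → M)
    (r v : V) : M :=
  (((hG.existsUnique_path r v).choose.darts.map fun a => δ a.fst a.snd)).sum

/-- Of two adjacent vertices one lies on the path from `r` to the other, and the longer path is the
shorter one with an edge appended. Antisymmetry of `δ` covers both orders. -/
theorem IsTree.pathSum_adj {M : Type*} [AddCommGroup M] (hG : G.IsTree) {δ : V → V → M}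
    (hδ : ∀ u v, δ v u = -δ u v) (r : V) {u v : V} (h : G.Adj u v) :
    hG.pathSum δ r v = hG.pathSum δ r u + δ u v := by
  have hu := (hG.existsUnique_path r u).choose_spec.1
  have hv := (hG.existsUnique_path r v).choose_spec.1
  unfold pathSum
  by_cases hs : u ∈ (hG.existsUnique_path r v).choose.support
  · rw [hG.isAcyclic.path_concat hu hv h hs]
    simp [Walk.darts_concat]
  · have hs' := hG.isAcyclic.mem_support_of_ne_mem_support_of_adj_of_isPath hu hv h hs
    rw [hG.isAcyclic.path_concat hv hu h.symm hs']
    simp [Walk.darts_concat, hδ u v]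

theorem IsTree.exists_potential {M : Type*} [AddCommGroup M] (hG : G.IsTree) {δ : V → V → M}
    (hδ : ∀ u v, δ v u = -δ u v) : ∃ φ : V → M, ∀ u v, G.Adj u v → φ v = φ u + δ u v :=
  ⟨hG.pathSum δ hG.connected.nonempty.some, fun _ _ h => hG.pathSum_adj hδ _ h⟩

theorem Connected.eq_of_forall_adj {M : Type*} (hG : G.Connected) {φ : V → M}
    (h : ∀ u v, G.Adj u v → φ v = φ u) (u v : V) : φ v = φ u := by
  obtain ⟨p⟩ := hG.preconnected u v
  induction p with
  | nil => rfl
  | cons hadj _ ih => rw [ih, h _ _ hadj]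

theorem Connected.sub_eq_sub_of_forall_adj {M : Type*} [AddCommGroup M] (hG : G.Connected)
    {φ ψ : V → M} {δ : V → V → M} (hφ : ∀ u v, G.Adj u v → φ v = φ u + δ u v)
    (hψ : ∀ u v, G.Adj u v → ψ v = ψ u + δ u v) (u v : V) : φ v - ψ v = φ u - ψ u :=
  hG.eq_of_forall_adj (φ := fun x => φ x - ψ x)
    (fun x y h => by simp only [hφ x y h, hψ x y h]; abel) u v

/-- A divergence-free flow on a finite tree vanishes. -/
theorem IsTree.flow_eq_zero [Fintype V] (hG : G.IsTree) {δ : V → V → ℤ}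
    (hδ : ∀ u v, δ v u = -δ u v) (h0 : ∀ u v, ¬ G.Adj u v → δ u v = 0)
    (hdiv : ∀ u, ∑ v, δ u v = 0) (u v : V) : δ u v = 0 := by
  obtain ⟨φ, hφ⟩ := hG.exists_potential hδ
  -- On a tree the flow is the gradient of a potential `φ`. Summation by parts expresses its energy
  -- through divergences, which vanish.
  have key : ∑ u, ∑ v, δ u v * δ u v = 0 := by
    have h1 : ∀ u v, δ u v * δ u v = δ u v * φ v - δ u v * φ u := by
      intro u v
      by_cases h : G.Adj u v
      · rw [hφ u v h]; ring
      · simp [h0 u v h]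
    simp_rw [h1, Finset.sum_sub_distrib]
    have h2 : ∑ u, ∑ v, δ u v * φ v = 0 := by
      rw [Finset.sum_comm]
      refine Finset.sum_eq_zero fun v _ => ?_
      rw [← Finset.sum_mul]
      have : ∑ u, δ u v = -∑ u, δ v u := by
        rw [← Finset.sum_neg_distrib]
        exact Finset.sum_congr rfl fun u _ => hδ v u
      simp [this, hdiv]
    have h3 : ∑ u, ∑ v, δ u v * φ u = 0 := by
      refine Finset.sum_eq_zero fun v _ => ?_
      rw [← Finset.sum_mul, hdiv, zero_mul]
    rw [h2, h3, sub_zero]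
  have h4 := (Finset.sum_eq_zero_iff_of_nonneg
    (fun u _ => Finset.sum_nonneg fun v _ => mul_self_nonneg (δ u v))).1 key u (Finset.mem_univ _)
  have h5 := (Finset.sum_eq_zero_iff_of_nonneg (fun v _ => mul_self_nonneg (δ u v))).1 h4 v
    (Finset.mem_univ _)
  exact mul_self_eq_zero.1 h5

/-- The vertices on the side of `v` of the edge from `u` to `v`. -/
def side (G : SimpleGraph V) (u v : V) : Set V := {x | (G.deleteEdges {s(u, v)}).Reachable v x}

theorem mem_side_self (u v : V) : v ∈ G.side u v := Reachable.refl v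

theorem IsAcyclic.notMem_side (hG : G.IsAcyclic) {u v : V} (h : G.Adj u v) : u ∉ G.side u v := by
  have hb := isAcyclic_iff_forall_adj_isBridge.1 hG h
  rw [isBridge_iff] at hb
  exact fun hx => hb (Reachable.symm hx)

theorem mem_side_iff_of_adj {u v x y : V} (hxy : G.Adj x y) (hne : s(x, y) ≠ s(u, v)) :
    x ∈ G.side u v ↔ y ∈ G.side u v := by
  have h : (G.deleteEdges {s(u, v)}).Adj x y := by
    rw [deleteEdges_adj]; exact ⟨hxy, by simpa using hne⟩
  exact ⟨fun hx => hx.trans h.reachable, fun hy => hy.trans h.symm.reachable⟩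

/-- A set separated only by the edge from `u` to `v` is the side of `v`. -/
theorem Connected.eq_side (hG : G.Connected) {u v : V} {A : Set V} (hu : u ∉ A)
    (hv : v ∈ A) (hA : ∀ x y, G.Adj x y → s(x, y) ≠ s(u, v) → (x ∈ A → y ∈ A)) :
    A = G.side u v := by
  have key : ∀ x y, (G.deleteEdges {s(u, v)}).Reachable x y → x ∈ A → y ∈ A := by
    rintro x y ⟨p⟩
    induction p with
    | nil => exact id
    | cons hadj _ ih =>
      rw [deleteEdges_adj] at hadj
      exact fun hx => ih (hA _ _ hadj.1 (by simpa using hadj.2) hx)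
  have cover : ∀ x, (G.deleteEdges {s(u, v)}).Reachable u x ∨
      (G.deleteEdges {s(u, v)}).Reachable v x := by
    intro x
    obtain ⟨p⟩ := hG.preconnected x u
    induction p with
    | nil => exact Or.inl (Reachable.refl _)
    | @cons a b c hadj q ih =>
      by_cases hab : s(a, b) = s(c, v)
      · rw [Sym2.eq_iff] at hab
        rcases hab with ⟨rfl, rfl⟩ | ⟨rfl, rfl⟩
        · exact Or.inl (Reachable.refl _)
        · exact Or.inr (Reachable.refl _)
      · have h : (G.deleteEdges {s(c, v)}).Adj b a := by
          rw [deleteEdges_adj]; exact ⟨hadj.symm, fun hh => hab (Sym2.eq_swap.trans hh)⟩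
        exact (ih hu hA key).imp (fun k => k.trans h.reachable) (fun k => k.trans h.reachable)
  ext x
  refine ⟨fun hx => ?_, fun hx => key _ _ hx hv⟩
  rcases cover x with h | h
  · exact absurd (key _ _ h.symm hx) hu
  · exact h

theorem IsTree.side_compl (hG : G.IsTree) {u v : V} (h : G.Adj u v) :
    (G.side u v)ᶜ = G.side v u := by
  refine hG.connected.eq_side (by simpa using mem_side_self u v) (hG.isAcyclic.notMem_side h) ?_
  intro x y hxy hne hx hy
  exact hx ((mem_side_iff_of_adj hxy (by rwa [Sym2.eq_swap (a := u)])).2 hy)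

theorem IsTree.exists_mem_side (hG : G.IsTree) {u x : V} (h : x ≠ u) :
    ∃ w, G.Adj u w ∧ x ∈ G.side u w := by
  classical
  obtain ⟨p, hp, -⟩ := hG.existsUnique_path u x
  cases p with
  | nil => exact absurd rfl h
  | @cons _ w _ hadj q =>
    refine ⟨w, hadj, ?_⟩
    rw [Walk.cons_isPath_iff] at hp
    have : ∀ e ∈ q.edges, e ≠ s(u, w) := by
      rintro e he rfl
      exact hp.2 (q.fst_mem_support_of_mem_edges he)
    exact ⟨q.transfer _ fun e he => by
      simpa [edgeSet_deleteEdges] using ⟨q.edges_subset_edgeSet he, this e he⟩⟩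

/-- A walk inside `side u v` cannot use the edge between `u` and `w`, since it would pass through
`u`. So this whole side stays connected to `u` after that edge is deleted. -/
theorem IsTree.side_disjoint (hG : G.IsTree) {u v w x : V} (hv : G.Adj u v) (hw : G.Adj u w)
    (hne : v ≠ w) (hx : x ∈ G.side u v) : x ∉ G.side u w := by
  have hsub : G.side u v ⊆ G.side w u := by
    intro x hx
    have hx' : (G.deleteEdges {s(u, v)}).Reachable v x := hx
    obtain ⟨p⟩ := hx'
    have h0 : v ∈ G.side w u := by
      rw [← mem_side_iff_of_adj hv (by simp [hne, hv.ne'])]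
      exact mem_side_self _ _
    have : ∀ {a b}, (q : (G.deleteEdges {s(u, v)}).Walk a b) → a ∈ G.side u v →
        a ∈ G.side w u → b ∈ G.side w u := by
      intro a b q
      induction q with
      | nil => exact fun _ h => h
      | @cons a b c hab q ih =>
        intro h1 h2
        rw [deleteEdges_adj] at hab
        have hb := (mem_side_iff_of_adj hab.1 (by simpa using hab.2)).1 h1
        refine ih hb ?_
        rw [← mem_side_iff_of_adj hab.1 ?_]
        · exact h2
        · intro he
          rw [Sym2.eq_iff] at he
          rcases he with ⟨_, rfl⟩ | ⟨rfl, _⟩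
          · exact hG.isAcyclic.notMem_side hv hb
          · exact hG.isAcyclic.notMem_side hv h1
    exact this p (mem_side_self _ _) h0
  have := hsub hx
  rw [← hG.side_compl hw] at this
  exact this

end SimpleGraph

end

/-! ### Combinatorial types on arbitrary vertex sets and counting of flags -/

section

/-- The combinatorial type of a rational plane tropical curve on an arbitrary finite vertex set,
without any condition on the valences. -/
structure TropType (V : Type) [Fintype V] (d m : ℕ) where
  graph : SimpleGraph V
  isTree : graph.IsTree
  mark : Fin m → V
  ends : V → Fin 3 → ℕ
  ends_sum : ∀ j, ∑ v, ends v j = d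
  dir : V → V → Fin 2 → ℤ
  dir_antisymm : ∀ u v, dir v u = -dir u v
  dir_eq_zero : ∀ u v, ¬ graph.Adj u v → dir u v = 0
  balanced : ∀ u c, ∑ v, dir u v c + ∑ j, (ends u j : ℤ) * endDir j c = 0

/-- A combinatorial type together with lengths (not necessarily positive) and a compatible map
to the plane. -/
structure MCurve (V : Type) [Fintype V] (d m : ℕ) extends TropType V d m where
  pos : V → Pt
  len : V → V → ℝ
  len_symm : ∀ u v, len v u = len u v
  pos_eq : ∀ u v, graph.Adj u v → ∀ c, pos v c = pos u c + len u v * (dir u v c : ℝ)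

variable {V V' : Type} [Fintype V] [Fintype V'] {d m : ℕ}

/-- The number of flags at a vertex. -/
noncomputable def TropType.valence (T : TropType V d m) (u : V) : ℕ :=
  (T.graph.neighborSet u).ncard + {i | T.mark i = u}.ncard + ∑ j, T.ends u j

/-- The bijection `σ` identifies two combinatorial types. -/
structure TropType.IsIso (T : TropType V d m) (T' : TropType V' d m) (σ : V ≃ V') : Prop where
  adj : ∀ u v, T'.graph.Adj (σ u) (σ v) ↔ T.graph.Adj u v
  mark : ∀ i, T'.mark i = σ (T.mark i)
  ends : ∀ u, T'.ends (σ u) = T.ends u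
  dir : ∀ u v, T'.dir (σ u) (σ v) = T.dir u v

/-- The bijection `σ` is an isometry compatible with the maps to the plane. -/
structure MCurve.IsIso (X : MCurve V d m) (Y : MCurve V' d m) (σ : V ≃ V') : Prop extends
    TropType.IsIso X.toTropType Y.toTropType σ where
  len : ∀ u v, X.graph.Adj u v → Y.len (σ u) (σ v) = X.len u v
  pos : ∀ u, Y.pos (σ u) = X.pos u

/-- A plane tropical curve as a curve on its vertex set. -/
def PlaneTropCurve.toM (C : PlaneTropCurve d m) : MCurve (Fin C.k) d m where
  graph := C.graph
  isTree := C.isTree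
  mark := C.mark
  ends := C.ends
  ends_sum := C.ends_sum
  dir := C.dir
  dir_antisymm := C.dir_antisymm
  dir_eq_zero := C.dir_eq_zero
  balanced := C.balanced
  pos := C.pos
  len u v := C.len s(u, v)
  len_symm u v := by rw [Sym2.eq_swap]
  pos_eq := C.pos_eq

theorem PlaneTropCurve.valence_toM (C : PlaneTropCurve d m) (u : Fin C.k) :
    C.toM.valence u = C.valence u := rfl

theorem PlaneTropCurve.iso_iff {C D : PlaneTropCurve d m} :
    Iso C D ↔ ∃ σ, C.toM.IsIso D.toM σ :=
  exists_congr fun _ =>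
    ⟨fun ⟨h1, h2, h3, h4, h5, h6⟩ => ⟨⟨h1, h3, h4, h5⟩, h2, h6⟩,
      fun h => ⟨h.adj, h.len, h.mark, h.ends, h.dir, h.pos⟩⟩

theorem TropType.IsIso.symm {T : TropType V d m} {T' : TropType V' d m} {σ : V ≃ V'}
    (h : T.IsIso T' σ) : T'.IsIso T σ.symm where
  adj u v := by simpa using (h.adj (σ.symm u) (σ.symm v)).symm
  mark i := by simp [h.mark i]
  ends u := by simpa using (h.ends (σ.symm u)).symm
  dir u v := by simpa using (h.dir (σ.symm u) (σ.symm v)).symm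

theorem TropType.IsIso.trans {V'' : Type} [Fintype V''] {T : TropType V d m} {T' : TropType V' d m}
    {T'' : TropType V'' d m} {σ : V ≃ V'} {τ : V' ≃ V''} (h : T.IsIso T' σ) (h' : T'.IsIso T'' τ) :
    T.IsIso T'' (σ.trans τ) where
  adj u v := by simp [h'.adj, h.adj]
  mark i := by simp [h'.mark, h.mark]
  ends u := by simp [h'.ends, h.ends]
  dir u v := by simp [h'.dir, h.dir]

theorem TropType.IsIso.valence {T : TropType V d m} {T' : TropType V' d m} {σ : V ≃ V'}
    (h : T.IsIso T' σ) (u : V) : T'.valence (σ u) = T.valence u := by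
  unfold TropType.valence
  congr 1
  · congr 1
    · have : T'.graph.neighborSet (σ u) = σ '' T.graph.neighborSet u := by
        ext v
        obtain ⟨v, rfl⟩ := σ.surjective v
        simp [h.adj]
      rw [this, Set.ncard_image_of_injective _ σ.injective]
    · simp [h.mark]
  · simp [h.ends]

/-- Transport of a curve to the vertex set `Fin k`. -/
noncomputable def MCurve.toPlane (X : MCurve V d m) (hlen : ∀ u v, X.graph.Adj u v → 0 < X.len u v)
    (hval : ∀ u, 3 ≤ X.valence u) : PlaneTropCurve d m where
  k := Fintype.card V
  graph := X.graph.comap (Fintype.equivFin V).symm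
  isTree := (SimpleGraph.Iso.comap (Fintype.equivFin V).symm X.graph).isTree_iff.2 X.isTree
  len := Sym2.lift ⟨fun u v => X.len ((Fintype.equivFin V).symm u) ((Fintype.equivFin V).symm v),
    fun _ _ => X.len_symm _ _⟩
  len_pos e := by
    induction e with
    | _ u v => exact fun h => hlen _ _ h
  mark i := Fintype.equivFin V (X.mark i)
  ends u := X.ends ((Fintype.equivFin V).symm u)
  ends_sum j := by
    exact (Equiv.sum_comp (Fintype.equivFin V).symm (fun v => X.ends v j)).trans (X.ends_sum j)
  dir u v := X.dir ((Fintype.equivFin V).symm u) ((Fintype.equivFin V).symm v)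
  dir_antisymm u v := X.dir_antisymm _ _
  dir_eq_zero u v h := X.dir_eq_zero _ _ h
  pos u := X.pos ((Fintype.equivFin V).symm u)
  pos_eq u v h c := X.pos_eq _ _ h c
  balanced u c := by
    rw [← X.balanced ((Fintype.equivFin V).symm u) c]
    congr 1
    exact Equiv.sum_comp (Fintype.equivFin V).symm
      (fun v => X.dir ((Fintype.equivFin V).symm u) v c)
  three_le_valence u := by
    convert hval ((Fintype.equivFin V).symm u) using 1
    unfold TropType.valence
    congr 1
    congr 1
    · have : X.graph.neighborSet ((Fintype.equivFin V).symm u) =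
          (Fintype.equivFin V).symm ''
            (X.graph.comap (Fintype.equivFin V).symm).neighborSet u := by
        ext v
        obtain ⟨v, rfl⟩ := (Fintype.equivFin V).symm.surjective v
        simp
      rw [this, Set.ncard_image_of_injective _ (Fintype.equivFin V).symm.injective]
    · congr 1
      ext i
      simp [Equiv.eq_symm_apply]

theorem MCurve.isIso_toPlane (X : MCurve V d m) (hlen : ∀ u v, X.graph.Adj u v → 0 < X.len u v)
    (hval : ∀ u, 3 ≤ X.valence u) :
    X.IsIso (X.toPlane hlen hval).toM (Fintype.equivFin V) where
  adj u v := by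
    change X.graph.Adj ((Fintype.equivFin V).symm (Fintype.equivFin V u))
      ((Fintype.equivFin V).symm (Fintype.equivFin V v)) ↔ _
    simp
  mark i := rfl
  ends u := by
    change X.ends ((Fintype.equivFin V).symm (Fintype.equivFin V u)) = _
    simp
  dir u v := by
    change X.dir ((Fintype.equivFin V).symm (Fintype.equivFin V u))
      ((Fintype.equivFin V).symm (Fintype.equivFin V v)) = _
    simp
  len u v _ := by
    change X.len ((Fintype.equivFin V).symm (Fintype.equivFin V u))
      ((Fintype.equivFin V).symm (Fintype.equivFin V v)) = _
    simp
  pos u := by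
    change X.pos ((Fintype.equivFin V).symm (Fintype.equivFin V u)) = _
    simp

theorem SimpleGraph.sum_ncard_neighborSet_of_isTree {G : SimpleGraph V} (hG : G.IsTree) :
    ∑ u, (G.neighborSet u).ncard + 2 = 2 * Fintype.card V := by
  classical
  have h1 := G.sum_degrees_eq_twice_card_edges
  have h2 := hG.card_edgeFinset
  have h3 : ∀ u, (G.neighborSet u).ncard = G.degree u := by
    intro u
    rw [← G.card_neighborSet_eq_degree, Set.ncard_eq_toFinset_card', Set.toFinset_card]
  simp_rw [h3]
  lia

theorem sum_ncard_fiber {α β : Type*} [Fintype α] [Fintype β] (f : α → β) :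
    ∑ b, {a | f a = b}.ncard = Fintype.card α := by
  classical
  simp_rw [Set.ncard_eq_toFinset_card', Set.toFinset_ofPred]
  rw [← Finset.card_univ, Finset.card_eq_sum_card_fiberwise (f := f) (t := Finset.univ) (by simp)]

/-- Handshake lemma: a tree has `2(|V| - 1)` flags of bounded edges, to which `m` markings and `3d`
ends are added. All dimension counts rest on this. -/
theorem TropType.sum_valence (T : TropType V d m) :
    ∑ u, T.valence u + 2 = 2 * Fintype.card V + m + 3 * d := by
  unfold valence
  rw [Finset.sum_add_distrib, Finset.sum_add_distrib]
  have h1 := SimpleGraph.sum_ncard_neighborSet_of_isTree T.isTree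
  have h2 := sum_ncard_fiber T.mark
  have h3 : ∑ u, ∑ j, T.ends u j = 3 * d := by
    rw [Finset.sum_comm]; simp [T.ends_sum]
  simp only [Fintype.card_fin] at h2
  lia

theorem TropType.card_le (T : TropType V d m) (h : ∀ u, 3 ≤ T.valence u) :
    Fintype.card V + 2 ≤ m + 3 * d := by
  have h1 := T.sum_valence
  have h2 : ∑ _u : V, 3 ≤ ∑ u, T.valence u := Finset.sum_le_sum fun u _ => h u
  simp at h2
  lia

theorem TropType.card_eq (T : TropType V d m) (h : ∀ u, T.valence u = 3) :
    Fintype.card V + 2 = m + 3 * d := by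
  have h1 := T.sum_valence
  simp [h] at h1
  lia

theorem TropType.card_lt (T : TropType V d m) (h : ∀ u, 3 ≤ T.valence u)
    (hn : ¬ ∀ u, T.valence u = 3) : Fintype.card V + 3 ≤ m + 3 * d := by
  have h1 := T.sum_valence
  push Not at hn
  obtain ⟨w, hw⟩ := hn
  have h2 : ∑ _u : V, 3 < ∑ u, T.valence u :=
    Finset.sum_lt_sum (fun u _ => h u) ⟨w, Finset.mem_univ _, lt_of_le_of_ne (h w) hw.symm⟩
  simp at h2
  lia

theorem TropType.card_edgeSet (T : TropType V d m) :
    Nat.card T.graph.edgeSet + 1 = Fintype.card V := by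
  have := (SimpleGraph.isTree_iff_connected_and_card.1 T.isTree).2
  rwa [Nat.card_eq_fintype_card (α := V)] at this

/-- The directions of a type are determined by its tree and its ends. -/
theorem TropType.dir_unique {T T' : TropType V d m} (hg : T.graph = T'.graph)
    (he : T.ends = T'.ends) : T.dir = T'.dir := by
  funext u v c
  -- The two balancing conditions have the same source term, so the difference is a divergence-free
  -- flow.
  have := T.isTree.flow_eq_zero (δ := fun u v => T.dir u v c - T'.dir u v c)
    (fun u v => by simp [T.dir_antisymm u v, T'.dir_antisymm u v]; ring)
    (fun u v h => by simp [T.dir_eq_zero u v h, T'.dir_eq_zero u v (hg ▸ h)])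
    (fun u => by
      have h1 := T.balanced u c
      have h2 := T'.balanced u c
      rw [he] at h1
      rw [Finset.sum_sub_distrib]
      linarith) u v
  exact sub_eq_zero.1 this

end

/-! ### Determinants, coordinates on cells, and their independence of choices -/

section

variable {V V' : Type} [Fintype V] [Fintype V'] {d m : ℕ}

section AbsDet

variable {ι κ κ' : Type} [Fintype ι] [DecidableEq ι]

theorem absDet_eq (A : Matrix ι κ ℤ) (e : ι ≃ κ) :
    absDet A = (A.submatrix id e).det.natAbs := by
  unfold absDet
  rw [dif_pos ⟨e⟩]
  set h : ι ≃ κ := (⟨e⟩ : Nonempty (ι ≃ κ)).some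
  have : A.submatrix id h = (A.submatrix id e).submatrix id (h.trans e.symm) := by
    ext i j; simp
  rw [this, Matrix.det_permute', Int.natAbs_mul]
  rcases Int.units_eq_one_or (Equiv.Perm.sign (h.trans e.symm)) with h | h <;> simp [h]

theorem absDet_mul [Fintype κ] [DecidableEq κ] (A : Matrix ι κ ℤ) (P : Matrix κ κ' ℤ) (e : κ ≃ κ')
    (hP : (P.submatrix id e).det = 1) : absDet (A * P) = absDet A := by
  by_cases h : Nonempty (ι ≃ κ)
  · obtain ⟨f⟩ := h
    rw [absDet_eq _ (f.trans e), absDet_eq A f]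
    have : (A * P).submatrix id (f.trans e) =
        A.submatrix id f * (P.submatrix id e).submatrix f f := by
      ext i j
      simp only [Matrix.submatrix_apply, Matrix.mul_apply, id, Equiv.trans_apply]
      exact (Equiv.sum_comp f (fun x => A i x * P x (e (f j)))).symm
    rw [this, Matrix.det_mul, Matrix.det_submatrix_equiv_self, hP, mul_one]
  · have h' : ¬ Nonempty (ι ≃ κ') := fun ⟨g⟩ => h ⟨g.trans e.symm⟩
    unfold absDet
    rw [dif_neg h, dif_neg h']

theorem absDet_submatrix_right (A : Matrix ι κ ℤ) (e : κ' ≃ κ) :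
    absDet (A.submatrix id e) = absDet A := by
  by_cases h : Nonempty (ι ≃ κ)
  · obtain ⟨f⟩ := h
    rw [absDet_eq A f, absDet_eq _ (f.trans e.symm)]
    congr 2
    ext i j; simp
  · have h' : ¬ Nonempty (ι ≃ κ') := fun ⟨g⟩ => h ⟨g.trans e⟩
    unfold absDet
    rw [dif_neg h, dif_neg h']

theorem absDet_submatrix_left {ι' : Type} [Fintype ι'] [DecidableEq ι'] (A : Matrix ι κ ℤ)
    (e : ι' ≃ ι) : absDet (A.submatrix e id) = absDet A := by
  by_cases h : Nonempty (ι ≃ κ)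
  · obtain ⟨f⟩ := h
    rw [absDet_eq A f, absDet_eq _ (e.trans f), ← Matrix.det_submatrix_equiv_self e]
    rfl
  · have h' : ¬ Nonempty (ι' ≃ κ) := fun ⟨g⟩ => h ⟨e.symm.trans g⟩
    unfold absDet
    rw [dif_neg h, dif_neg h']

/-- A matrix with nonzero determinant is square and its columns are linearly independent. -/
theorem eq_zero_of_absDet_ne_zero [Fintype κ] (A : Matrix ι κ ℤ) (h : absDet A ≠ 0) (ξ : κ → ℝ)
    (hξ : ∀ i, ∑ x, (A i x : ℝ) * ξ x = 0) : ξ = 0 := by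
  by_cases hn : Nonempty (ι ≃ κ)
  · obtain ⟨e⟩ := hn
    rw [absDet_eq A e] at h
    have hdet : ((A.submatrix id e).map (Int.cast : ℤ → ℝ)).det ≠ 0 := by
      have := (Int.castRingHom ℝ).map_det (A.submatrix id e)
      rw [RingHom.mapMatrix_apply] at this
      change (Matrix.map _ (Int.castRingHom ℝ)).det ≠ 0
      rw [← this]
      simpa using h
    have h0 := Matrix.eq_zero_of_mulVec_eq_zero hdet (v := fun i => ξ (e i)) (by
      ext i
      rw [Matrix.mulVec, dotProduct]
      simp only [Matrix.map_apply, Matrix.submatrix_apply, id, Pi.zero_apply]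
      rw [← hξ i]
      exact Equiv.sum_comp e (fun x => (A i x : ℝ) * ξ x))
    funext x
    obtain ⟨i, rfl⟩ := e.surjective x
    exact congrFun h0 i
  · exact absurd (by unfold absDet; rw [dif_neg hn]) h

end AbsDet

variable {E E' : Type}

/-- A family of integral linear forms expressing the coordinates of the vertices in terms of
the lengths of the edges and the position of some reference point. -/
structure TropType.IsFrame (T : TropType V d m) (ε : E ≃ T.graph.edgeSet)
    (φ : V → Fin 2 → Fin 2 ⊕ E → ℤ) : Prop where
  inl : ∀ v c c', φ v c (Sum.inl c') = if c = c' then 1 else 0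
  inr : ∀ u v, T.graph.Adj u v → ∀ c f, φ v c (Sum.inr f) =
    φ u c (Sum.inr f) + open Classical in if (ε f : Sym2 V) = s(u, v) then T.dir u v c else 0

theorem TropType.exists_isFrame (T : TropType V d m) (ε : E ≃ T.graph.edgeSet) :
    ∃ φ, T.IsFrame ε φ := by
  classical
  have : ∀ (c : Fin 2) (f : E), ∃ ψ : V → ℤ, ∀ u v, T.graph.Adj u v →
      ψ v = ψ u + if (ε f : Sym2 V) = s(u, v) then T.dir u v c else 0 := by
    intro c f
    refine T.isTree.exists_potential fun u v => ?_
    rw [Sym2.eq_swap, T.dir_antisymm u v]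
    split_ifs <;> simp
  choose ψ hψ using this
  refine ⟨fun v c => Sum.elim (fun c' => if c = c' then 1 else 0) (fun f => ψ c f v),
    fun v c c' => rfl, fun u v h c f => ?_⟩
  simp only [Sum.elim_inr]
  rw [hψ c f u v h]

theorem PlaneTropCurve.isFrame_coordCoeff (C : PlaneTropCurve d m) :
    C.toM.IsFrame (Equiv.refl C.graph.edgeSet) C.coordCoeff where
  inl v c c' := rfl
  inr u v h c f := by
    classical
    have := C.isTree.pathSum_adj
      (δ := fun u v => if s(u, v) = f.1 then C.dir u v c else 0)
      (fun u v => by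
        rw [Sym2.eq_swap, C.dir_antisymm u v]
        split_ifs <;> simp) C.root h
    simp only [eq_comm (b := f.1)] at this
    convert this using 1
    · simp only [coordCoeff, SimpleGraph.IsTree.pathSum, eq_comm (b := f.1)]
      congr!
    · simp only [coordCoeff, SimpleGraph.IsTree.pathSum, eq_comm (b := f.1)]
      congr!

/-- The matrix of a family of linear forms. -/
def frameMatrix (φ : V → Fin 2 → Fin 2 ⊕ E → ℤ) : Matrix (V × Fin 2) (Fin 2 ⊕ E) ℤ :=
  Matrix.of fun r x => φ r.1 r.2 x

/-- Two frames differ only in their reference point, so after matching the edges the transition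
matrix is block unitriangular. Multiplicities may therefore be computed in whichever frame is
convenient. -/
theorem TropType.IsFrame.exists_mul [Fintype E] [DecidableEq E] {T : TropType V d m}
    {T' : TropType V' d m} {ε : E ≃ T.graph.edgeSet} {ε' : E' ≃ T'.graph.edgeSet}
    {φ : V → Fin 2 → Fin 2 ⊕ E → ℤ} {φ' : V' → Fin 2 → Fin 2 ⊕ E' → ℤ}
    (hφ : T.IsFrame ε φ) (hφ' : T'.IsFrame ε' φ') {σ : V ≃ V'}
    (hadj : ∀ u v, T'.graph.Adj (σ u) (σ v) ↔ T.graph.Adj u v)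
    (hdir : ∀ u v, T'.dir (σ u) (σ v) = T.dir u v) :
    ∃ (P : Matrix (Fin 2 ⊕ E) (Fin 2 ⊕ E') ℤ) (e : Fin 2 ⊕ E ≃ Fin 2 ⊕ E'),
      (P.submatrix id e).det = 1 ∧
      (frameMatrix φ').submatrix (Prod.map σ id) id = frameMatrix φ * P := by
  classical
  let g : T.graph ≃g T'.graph := ⟨σ, fun {u v} => hadj u v⟩
  let η : E ≃ E' := ε.trans (g.mapEdgeSet.trans ε'.symm)
  have hη : ∀ f, (ε' (η f) : Sym2 V') = Sym2.map σ (ε f) := by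
    intro f
    simp only [η, Equiv.trans_apply, Equiv.apply_symm_apply]
    rfl
  let r : V := T.isTree.connected.nonempty.some
  -- For a fixed edge the two families of forms have the same increments, so their difference is
  -- constant along the tree and may be read off at `r`.
  let X : Matrix (Fin 2) E ℤ := fun c f => φ' (σ r) c (Sum.inr (η f)) - φ r c (Sum.inr f)
  let e : Fin 2 ⊕ E ≃ Fin 2 ⊕ E' := Equiv.sumCongr (Equiv.refl _) η
  let P : Matrix (Fin 2 ⊕ E) (Fin 2 ⊕ E') ℤ :=
    (Matrix.fromBlocks 1 X 0 1).submatrix id e.symm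
  refine ⟨P, e, ?_, ?_⟩
  · have : P.submatrix id e = Matrix.fromBlocks 1 X 0 1 := by
      ext i j; simp [P]
    rw [this, Matrix.det_fromBlocks_zero₂₁]
    simp
  · ext ⟨v, c⟩ x
    obtain ⟨x, rfl⟩ := e.surjective x
    have hP : ∀ y, P y (e x) = Matrix.fromBlocks 1 X 0 1 y x := by
      intro y; simp [P]
    simp only [hP, Matrix.mul_apply, frameMatrix, Matrix.of_apply, Matrix.submatrix_apply, Prod.map, id]
    rw [Fintype.sum_sum_type]
    rcases x with c' | f
    · simp [hφ.inl, e, hφ'.inl, Matrix.one_apply]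
    · have key := T.isTree.connected.sub_eq_sub_of_forall_adj
        (φ := fun v => φ' (σ v) c (Sum.inr (η f))) (ψ := fun v => φ v c (Sum.inr f))
        (δ := fun u v => if (ε f : Sym2 V) = s(u, v) then T.dir u v c else 0)
        (fun u v h => by
          rw [hφ'.inr _ _ ((hadj u v).2 h), hη, hdir, ← Sym2.map_mk]
          simp only [(Sym2.map.injective σ.injective).eq_iff]
          )
        (fun u v h => by
          rw [hφ.inr _ _ h]
          ) r v
      have h1 : ∀ c', (Matrix.fromBlocks 1 X 0 1 : Matrix (Fin 2 ⊕ E) (Fin 2 ⊕ E) ℤ)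
          (Sum.inl c') (Sum.inr f) = φ' (σ r) c' (Sum.inr (η f)) - φ r c' (Sum.inr f) :=
        fun _ => rfl
      have h2 : ∀ f', (Matrix.fromBlocks 1 X 0 1 : Matrix (Fin 2 ⊕ E) (Fin 2 ⊕ E) ℤ)
          (Sum.inr f') (Sum.inr f) = if f' = f then 1 else 0 := fun _ => rfl
      simp only [h1, h2, hφ.inl, ite_mul, one_mul, zero_mul, mul_ite, mul_one, mul_zero,
        Finset.sum_ite_eq', Finset.sum_ite_eq, Finset.mem_univ, if_true, e,
        Equiv.sumCongr_apply, Sum.map_inr]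
      linarith

theorem TropType.IsFrame.absDet_mark_eq [Fintype E] {T : TropType V d m}
    {T' : TropType V' d m} {ε : E ≃ T.graph.edgeSet} {ε' : E' ≃ T'.graph.edgeSet}
    {φ : V → Fin 2 → Fin 2 ⊕ E → ℤ} {φ' : V' → Fin 2 → Fin 2 ⊕ E' → ℤ}
    (hφ : T.IsFrame ε φ) (hφ' : T'.IsFrame ε' φ') {σ : V ≃ V'} (h : T.IsIso T' σ) :
    absDet ((frameMatrix φ').submatrix (Prod.map T'.mark id) id) =
      absDet ((frameMatrix φ).submatrix (Prod.map T.mark id) id) := by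
  classical
  obtain ⟨P, e, hP, hm⟩ := hφ.exists_mul hφ' h.adj h.dir
  rw [← absDet_mul _ P e hP]
  have h1 : (frameMatrix φ').submatrix (Prod.map T'.mark id) id =
      ((frameMatrix φ').submatrix (Prod.map σ id) id).submatrix (Prod.map T.mark id) id := by
    ext ⟨i, c⟩ x
    simp [h.mark]
  rw [h1, hm]
  rfl

theorem evMult_eq_absDet (C : PlaneTropCurve d m) :
    evMult C = absDet ((frameMatrix C.coordCoeff).submatrix (Prod.map C.mark id) id) := rfl

theorem evMult_eq_of_isFrame [Fintype E] {T : TropType V d m} {ε : E ≃ T.graph.edgeSet}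
    {φ : V → Fin 2 → Fin 2 ⊕ E → ℤ} (hφ : T.IsFrame ε φ) {C : PlaneTropCurve d m}
    {σ : V ≃ Fin C.k} (h : T.IsIso C.toM.toTropType σ) :
    evMult C = absDet ((frameMatrix φ).submatrix (Prod.map T.mark id) id) :=
  hφ.absDet_mark_eq C.isFrame_coordCoeff h

theorem evMult_congr {C D : PlaneTropCurve d m} (h : C.Iso D) : evMult C = evMult D := by
  classical
  obtain ⟨σ, h⟩ := PlaneTropCurve.iso_iff.1 h
  exact (evMult_eq_of_isFrame C.isFrame_coordCoeff h.toIsIso).symm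

/-- The positions of the vertices given by the coordinates `ξ` of a frame. -/
def framePos [Fintype E] (φ : V → Fin 2 → Fin 2 ⊕ E → ℤ) : (Fin 2 ⊕ E → ℝ) →ₗ[ℝ] V → Pt where
  toFun ξ v c := ∑ x, (φ v c x : ℝ) * ξ x
  map_add' ξ ζ := by
    ext v c; simp [mul_add, Finset.sum_add_distrib]
  map_smul' a ξ := by
    ext v c
    change ∑ x, (φ v c x : ℝ) * (a * ξ x) = a * ∑ x, (φ v c x : ℝ) * ξ x
    rw [Finset.mul_sum]
    exact Finset.sum_congr rfl fun x _ => by ring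

theorem TropType.IsFrame.framePos_apply [Fintype E] {T : TropType V d m}
    {ε : E ≃ T.graph.edgeSet} {φ : V → Fin 2 → Fin 2 ⊕ E → ℤ} (hφ : T.IsFrame ε φ)
    (ξ : Fin 2 ⊕ E → ℝ) (v : V) (c : Fin 2) :
    framePos φ ξ v c = ξ (Sum.inl c) + ∑ f, (φ v c (Sum.inr f) : ℝ) * ξ (Sum.inr f) := by
  change ∑ x, (φ v c x : ℝ) * ξ x = _
  rw [Fintype.sum_sum_type]
  simp only [hφ.inl, Int.cast_ite, Int.cast_one, Int.cast_zero, ite_mul, one_mul, zero_mul,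
    Finset.sum_ite_eq, Finset.mem_univ, if_true]

theorem TropType.IsFrame.framePos_adj [Fintype E] {T : TropType V d m} {ε : E ≃ T.graph.edgeSet}
    {φ : V → Fin 2 → Fin 2 ⊕ E → ℤ} (hφ : T.IsFrame ε φ) (ξ : Fin 2 ⊕ E → ℝ) (f : E) {u v : V}
    (hf : (ε f : Sym2 V) = s(u, v)) (c : Fin 2) :
    framePos φ ξ v c = framePos φ ξ u c + ξ (Sum.inr f) * (T.dir u v c : ℝ) := by
  classical
  have h : T.graph.Adj u v := by
    have := (ε f).2
    rwa [hf] at this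
  have h1 : ∀ f', ((ε f' : Sym2 V) = s(u, v)) ↔ f' = f := by
    intro f'
    rw [← hf, Subtype.coe_inj, ε.apply_eq_iff_eq]
  simp only [hφ.framePos_apply, hφ.inr u v h, h1, Int.cast_add, add_mul, Finset.sum_add_distrib,
    add_assoc, Int.cast_ite, Int.cast_zero, ite_mul, zero_mul, Finset.sum_ite_eq',
    Finset.mem_univ, if_true]
  ring

/-- Lengths determine the positions up to a translation, and the two `Sum.inl` coordinates provide
exactly the translations. -/
theorem TropType.IsFrame.exists_framePos_eq [Fintype E] {T : TropType V d m}
    {ε : E ≃ T.graph.edgeSet} {φ : V → Fin 2 → Fin 2 ⊕ E → ℤ} (hφ : T.IsFrame ε φ)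
    {pos : V → Pt} {len : Sym2 V → ℝ}
    (h : ∀ u v, T.graph.Adj u v → ∀ c, pos v c = pos u c + len s(u, v) * (T.dir u v c : ℝ)) :
    ∃ ξ : Fin 2 ⊕ E → ℝ, framePos φ ξ = pos ∧ ∀ f, ξ (Sum.inr f) = len (ε f) := by
  classical
  let r : V := T.isTree.connected.nonempty.some
  let ξ₀ : Fin 2 ⊕ E → ℝ := Sum.elim 0 fun f => len (ε f)
  let ξ : Fin 2 ⊕ E → ℝ := Sum.elim (fun c => pos r c - framePos φ ξ₀ r c) fun f => len (ε f)
  have hξ : ∀ v c, framePos φ ξ v c = framePos φ ξ₀ v c + (pos r c - framePos φ ξ₀ r c) := by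
    intro v c
    simp only [hφ.framePos_apply, ξ, ξ₀, Sum.elim_inl, Sum.elim_inr, Pi.zero_apply]
    ring
  refine ⟨ξ, ?_, fun f => rfl⟩
  funext v c
  have := T.isTree.connected.sub_eq_sub_of_forall_adj
    (φ := fun v => framePos φ ξ v c) (ψ := fun v => pos v c)
    (δ := fun u v => len s(u, v) * (T.dir u v c : ℝ))
    (fun u v huv => by
      have := hφ.framePos_adj ξ (ε.symm ⟨s(u, v), huv⟩) (u := u) (v := v) (by simp) c
      simpa [ξ] using this)
    (fun u v huv => h u v huv c) r v
  have h2 := hξ r c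
  linarith

/-- On a cell of nonzero multiplicity the curve is determined by the positions of its markings. -/
theorem eq_zero_of_evMult_ne_zero {C : PlaneTropCurve d m} (hC : evMult C ≠ 0)
    {y : Fin C.k → Pt} {s : Sym2 (Fin C.k) → ℝ}
    (h : ∀ u v, C.graph.Adj u v → ∀ c, y v c = y u c + s s(u, v) * (C.dir u v c : ℝ))
    (hm : ∀ i, y (C.mark i) = 0) : y = 0 ∧ ∀ e ∈ C.graph.edgeSet, s e = 0 := by
  classical
  obtain ⟨ξ, h1, h2⟩ := C.isFrame_coordCoeff.exists_framePos_eq h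
  have h0 : ξ = 0 := by
    refine eq_zero_of_absDet_ne_zero _ (evMult_eq_absDet C ▸ hC) ξ ?_
    rintro ⟨i, c⟩
    exact (congrFun (congrFun h1 (C.mark i)) c).trans (congrFun (hm i) c)
  subst h0
  exact ⟨by rw [← h1, map_zero], fun e he => (h2 ⟨e, he⟩).symm⟩

end

/-! ### Rigidity of curves of nonzero multiplicity; dimension of cells -/

section

variable {V V' : Type} [Fintype V] [Fintype V'] {d m : ℕ}

/-- A curve of nonzero multiplicity has no nontrivial automorphisms. -/
theorem automorphism_eq_refl {C : PlaneTropCurve d m} (hC : evMult C ≠ 0) {σ : Fin C.k ≃ Fin C.k}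
    (h : C.toM.toTropType.IsIso C.toM.toTropType σ) : σ = Equiv.refl _ := by
  classical
  ext1 u
  by_contra hne
  obtain ⟨w, huw, hmem⟩ := C.isTree.exists_mem_side (u := u) (x := σ u) hne
  -- The deformation that lengthens the edge from `u` towards `σ u` by one. Its difference with its
  -- transform under `σ` fixes all markings, because `σ` does, so it must be zero. Evaluated at `u`,
  -- this gives `C.dir u w = 0`.
  let y : Fin C.k → Pt := fun v c => if v ∈ C.graph.side u w then (C.dir u w c : ℝ) else 0
  let s : Sym2 (Fin C.k) → ℝ := fun e => if e = s(u, w) then 1 else 0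
  have hu : u ∉ C.graph.side u w := C.isTree.isAcyclic.notMem_side huw
  have hw : w ∈ C.graph.side u w := SimpleGraph.mem_side_self u w
  have hy : ∀ a b, C.graph.Adj a b → ∀ c, y b c = y a c + s s(a, b) * (C.dir a b c : ℝ) := by
    intro a b hab c
    by_cases he : s(a, b) = s(u, w)
    · simp only [s, he, if_true]
      rw [Sym2.eq_iff] at he
      rcases he with ⟨rfl, rfl⟩ | ⟨rfl, rfl⟩
      · simp [y, hu, hw]
      · simp [y, hu, hw, C.dir_antisymm b a]
    · simp [s, he, y, SimpleGraph.mem_side_iff_of_adj hab he]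
  have hdir : ∀ a b, C.dir (σ a) (σ b) = C.dir a b := h.dir
  have hmark : ∀ i, σ (C.mark i) = C.mark i := fun i => (h.mark i).symm
  obtain ⟨h1, -⟩ := eq_zero_of_evMult_ne_zero hC (y := fun v => y (σ v) - y v)
    (s := fun e => s (e.map σ) - s e)
    (fun a b hab c => by
      have e1 := hy a b hab c
      have e2 := hy (σ a) (σ b) ((h.adj a b).2 hab) c
      rw [hdir] at e2
      simp only [Pi.sub_apply, Sym2.map_mk]
      rw [e1, e2]; ring)
    (fun i => by simp [hmark])
  have h2 := congrFun h1 u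
  have h3 : ∀ c, C.dir u w c = 0 := by
    intro c
    have := congrFun h2 c
    simpa [y, hu, hmem] using this
  -- The edge is thus contracted, and changing its length alone is a nonzero deformation that moves
  -- nothing.
  obtain ⟨-, h4⟩ := eq_zero_of_evMult_ne_zero hC (y := 0) (s := s)
    (fun a b hab c => by
      have := hy a b hab c
      simp [y, h3] at this
      simpa using this)
    (fun i => rfl)
  have := h4 s(u, w) huw
  simp [s] at this

/-- Two equal ends at a trivalent vertex leave room for one bounded edge and no marking. Lengthening
that edge moves only `u`, hence no marking, so the determinant would be zero. A second vertex
guarantees that the bounded edge exists. -/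
theorem ends_le_one_of_evMult_ne_zero {C : PlaneTropCurve d m} (hC : evMult C ≠ 0)
    (ht : C.Trivalent) (hk : 2 ≤ C.k) (u : Fin C.k) (j : Fin 3) : C.ends u j ≤ 1 := by
  classical
  by_contra! hcon
  have : Nontrivial (Fin C.k) := Fin.nontrivial_iff_two_le.2 hk
  obtain ⟨w, huw⟩ := C.isTree.connected.preconnected.exists_adj_of_nontrivial u
  have hval := ht u
  unfold PlaneTropCurve.valence at hval
  have hsum : C.ends u j ≤ ∑ j, C.ends u j :=
    Finset.single_le_sum (f := fun j => C.ends u j) (fun _ _ => Nat.zero_le _) (Finset.mem_univ j)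
  have hpos : 0 < (C.graph.neighborSet u).ncard :=
    (Set.ncard_pos (Set.toFinite _)).2 ⟨w, huw⟩
  have h1 : (C.graph.neighborSet u).ncard = 1 := by lia
  have h2 : {i | C.mark i = u}.ncard = 0 := by lia
  rw [Set.ncard_eq_zero (Set.toFinite _)] at h2
  obtain ⟨w', hw'⟩ := Set.ncard_eq_one.1 h1
  have hnb : ∀ b, C.graph.Adj u b → b = w := by
    intro b hb
    have e1 : b ∈ C.graph.neighborSet u := hb
    have e2 : w ∈ C.graph.neighborSet u := huw
    rw [hw'] at e1 e2
    rw [Set.mem_singleton_iff.1 e1, Set.mem_singleton_iff.1 e2]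
  obtain ⟨-, h4⟩ := eq_zero_of_evMult_ne_zero hC
    (y := fun v c => if v = u then (C.dir w u c : ℝ) else 0)
    (s := fun e => if e = s(u, w) then 1 else 0)
    (fun a b hab c => by
      by_cases ha : a = u
      · subst ha
        obtain rfl := hnb b hab
        simp [hab.ne', C.dir_antisymm a b]
      · by_cases hb : b = u
        · subst hb
          obtain rfl := hnb a hab.symm
          simp [ha, Sym2.eq_swap]
        · have : s(a, b) ≠ s(u, w) := by
            simp [ha, hb]
          simp [ha, hb, this])
    (fun i => by
      have : C.mark i ≠ u := fun h => by
        have h5 : i ∈ {i | C.mark i = u} := h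
        rw [h2] at h5
        exact h5
      ext c
      simp [this])
  have := h4 s(u, w) huw
  simp at this

/-- The linear span of the positions of the vertices of the curves of a given type. -/
def TropType.cell (T : TropType V d m) : Submodule ℝ (V → Pt) where
  carrier := {pos | ∃ len : Sym2 V → ℝ, ∀ u v, T.graph.Adj u v → ∀ c,
    pos v c = pos u c + len s(u, v) * (T.dir u v c : ℝ)}
  add_mem' := by
    rintro p q ⟨s, hs⟩ ⟨t, ht⟩
    refine ⟨s + t, fun u v h c => ?_⟩
    simp only [Pi.add_apply, hs u v h c, ht u v h c]
    ring
  zero_mem' := ⟨0, by simp⟩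
  smul_mem' := by
    rintro a p ⟨s, hs⟩
    refine ⟨a • s, fun u v h c => ?_⟩
    simp only [Pi.smul_apply, hs u v h c, smul_eq_mul]
    ring

theorem PlaneTropCurve.pos_mem_cell (C : PlaneTropCurve d m) : C.pos ∈ C.toM.cell :=
  ⟨C.len, C.pos_eq⟩

theorem TropType.const_mem_cell (T : TropType V d m) (q : Pt) : (fun _ => q) ∈ T.cell :=
  ⟨0, by simp⟩

theorem TropType.finrank_cell_le (T : TropType V d m) :
    Module.finrank ℝ T.cell ≤ Fintype.card V + 1 := by
  classical
  obtain ⟨φ, hφ⟩ := T.exists_isFrame (Equiv.refl _)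
  have h1 : T.cell ≤ LinearMap.range (framePos φ) := by
    rintro pos ⟨len, h⟩
    obtain ⟨ξ, h1, -⟩ := hφ.exists_framePos_eq h
    exact ⟨ξ, h1⟩
  have h2 := Submodule.finrank_mono h1
  have h3 := LinearMap.finrank_range_le (framePos φ)
  have h4 := T.card_edgeSet
  rw [Nat.card_eq_fintype_card] at h4
  rw [Module.finrank_fintype_fun_eq_card, Fintype.card_sum, Fintype.card_fin] at h3
  lia

/-- The directions need not be recorded, as the tree and the ends determine them, and the numbers of
ends are bounded by `d`. -/
instance TropType.finite [DecidableEq V] : Finite (TropType V d m) := by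
  classical
  refine Finite.of_injective (β := SimpleGraph V × (Fin m → V) × (V → Fin 3 → Fin (d + 1)))
    (fun T => (T.graph, T.mark, fun v j => ⟨T.ends v j, Nat.lt_succ_of_le (by
      have := Finset.single_le_sum (f := fun v => T.ends v j) (fun _ _ => Nat.zero_le _)
        (Finset.mem_univ v)
      rwa [T.ends_sum j] at this)⟩)) ?_
  intro T T' h
  simp only [Prod.mk.injEq] at h
  obtain ⟨h1, h2, h3⟩ := h
  have h4 : T.ends = T'.ends := by
    funext v j
    exact congrArg Fin.val (congrFun (congrFun h3 v) j)
  have h5 := TropType.dir_unique h1 h4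
  cases T; cases T'
  simp only at h1 h2 h4 h5
  subst h1 h2 h4 h5
  rfl

theorem isGeneric_of_finite {E ι : Type} [AddCommGroup E] [Module ℝ E] [Finite ι] {s : Set E}
    (A : ι → AffineSubspace ℝ E) (hA : ∀ i, A i ≠ ⊤) (h : ∀ x, x ∉ s → ∃ i, x ∈ A i) :
    IsGeneric s :=
  ⟨Set.range A, Set.finite_range A, by rintro ⟨i, hi⟩; exact hA i hi, fun x hx =>
    let ⟨i, hi⟩ := h x hx
    ⟨A i, ⟨i, rfl⟩, hi⟩⟩

/-- The image of an affine subspace of small dimension is contained in a proper affine subspace. -/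
theorem exists_affineSubspace_ne_top {E F G : Type} [AddCommGroup E] [Module ℝ E]
    [FiniteDimensional ℝ E] [AddCommGroup F] [Module ℝ F] [AddCommGroup G]
    [Module ℝ G] (W : Submodule ℝ E) (f : E →ₗ[ℝ] F)
    (g : E →ₗ[ℝ] G) (c : G) (hg : ∀ y, ∃ x ∈ W, g x = y)
    (hdim : Module.finrank ℝ W < Module.finrank ℝ F + Module.finrank ℝ G) :
    ∃ A : AffineSubspace ℝ F, A ≠ ⊤ ∧ ∀ x ∈ W, g x = c → f x ∈ A := by
  obtain ⟨x₀, hx₀, hc⟩ := hg c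
  let gW : W →ₗ[ℝ] G := g ∘ₗ W.subtype
  have hsurj : LinearMap.range gW = ⊤ := by
    rw [LinearMap.range_eq_top]
    intro y
    obtain ⟨x, hx, rfl⟩ := hg y
    exact ⟨⟨x, hx⟩, rfl⟩
  have hrn := LinearMap.finrank_range_add_finrank_ker gW
  rw [hsurj, finrank_top] at hrn
  let D : Submodule ℝ F := (LinearMap.ker gW).map (f ∘ₗ W.subtype)
  have hD : Module.finrank ℝ D ≤ Module.finrank ℝ (LinearMap.ker gW) :=
    Submodule.finrank_map_le _ _
  refine ⟨AffineSubspace.mk' (f x₀) D, fun htop => ?_, fun x hx hgx => ?_⟩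
  · have : D = ⊤ := by
      rw [← AffineSubspace.direction_mk' (f x₀) D, htop, AffineSubspace.direction_top]
    rw [this, finrank_top] at hD
    lia
  · rw [AffineSubspace.mem_mk']
    refine ⟨⟨x - x₀, W.sub_mem hx hx₀⟩, ?_, by simp⟩
    simp [gW, hgx, hc]

/-- The curves whose type has a small cell miss general values of `f` under a condition `g`. -/
theorem isGeneric_of_cells {F G κ : Type} [AddCommGroup F] [Module ℝ F] [AddCommGroup G]
    [Module ℝ G] [Finite κ] {s : Set F} (N : ℕ) (hN : N < Module.finrank ℝ F + Module.finrank ℝ G)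
    (f : ∀ k, TropType (Fin k) d m → (Fin k → Pt) →ₗ[ℝ] F)
    (g : κ → ∀ k, TropType (Fin k) d m → (Fin k → Pt) →ₗ[ℝ] G) (c : κ → G)
    (hg : ∀ i k T y, ∃ q : Pt, g i k T (fun _ => q) = y)
    (h : ∀ x, x ∉ s → ∃ (i : κ) (C : PlaneTropCurve d m), C.k + 1 ≤ N ∧
      f _ C.toM.toTropType C.pos = x ∧ g i _ C.toM.toTropType C.pos = c i) :
    IsGeneric s := by
  classical
  have key : ∀ (i : κ × Σ k : Fin N, TropType (Fin k) d m), ∃ A : AffineSubspace ℝ F, A ≠ ⊤ ∧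
      ∀ x ∈ i.2.2.cell, g i.1 _ i.2.2 x = c i.1 → f _ i.2.2 x ∈ A := by
    rintro ⟨i, k, T⟩
    refine exists_affineSubspace_ne_top T.cell (f _ T) (g i _ T) (c i) (fun y => ?_) ?_
    -- Every cell contains the translations, and these alone make the condition `g` surjective. It
    -- therefore cuts down the dimension by the full rank.
    · obtain ⟨q, hq⟩ := hg i _ T y
      exact ⟨_, T.const_mem_cell q, hq⟩
    · have h1 := T.finrank_cell_le
      have := k.2
      simp only [Fintype.card_fin] at h1
      lia
  choose A hA hA' using key
  refine isGeneric_of_finite A hA fun x hx => ?_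
  obtain ⟨i, C, hk, hf, hgc⟩ := h x hx
  exact ⟨⟨i, ⟨C.k, by lia⟩, C.toM.toTropType⟩, hf ▸ hA' ⟨i, ⟨C.k, by lia⟩, C.toM.toTropType⟩ _
    C.pos_mem_cell hgc⟩

theorem PlaneTropCurve.k_le (C : PlaneTropCurve d m) : C.k + 2 ≤ m + 3 * d := by
  simpa using C.toM.card_le C.three_le_valence

theorem PlaneTropCurve.k_lt (C : PlaneTropCurve d m) (h : ¬ C.Trivalent) :
    C.k + 3 ≤ m + 3 * d := by
  simpa using C.toM.card_lt C.three_le_valence h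

theorem PlaneTropCurve.k_eq (C : PlaneTropCurve d m) (h : C.Trivalent) :
    C.k + 2 = m + 3 * d := by
  simpa using C.toM.card_eq h

theorem finrank_points (n : ℕ) : Module.finrank ℝ (Fin n → Pt) = 2 * n := by
  rw [Module.finrank_pi_fintype]
  simp [mul_comm]

/-- A cell that is not maximal has dimension at most `m + 3d - 2 = 2m - 1`, one less than the space
of configurations. -/
theorem isGeneric_evGeneral (hm : m + 1 = 3 * d) : IsGeneric {p : Fin m → Pt | EvGeneral d p} := by
  refine isGeneric_of_cells (d := d) (m := m) (κ := Unit) (G := PUnit) (m + 3 * d - 2)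
    (by rw [finrank_points]; lia)
    (fun k T => LinearMap.funLeft ℝ Pt T.mark) (fun _ _ _ => 0) (fun _ => 0)
    (fun _ _ _ y => ⟨0, rfl⟩) fun p hp => ?_
  simp only [Set.mem_ofPred_eq, EvGeneral, not_forall] at hp
  obtain ⟨C, hC, ht⟩ := hp
  have := C.k_lt ht
  exact ⟨(), C, by lia, funext fun i => hC i, rfl⟩

/-- With `m + 1` markings and `m + 2 = 3d`, a cell that is not maximal has dimension at most `2m +
1`. Fixing the last marking costs two, so the other `m` points fill at most dimension `2m - 1`. -/
theorem isGeneric_evGeneral_snoc (hm : m + 2 = 3 * d) (q : Pt) :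
    IsGeneric {p : Fin m → Pt | EvGeneral d (Fin.snoc p q : Fin (m + 1) → Pt)} := by
  refine isGeneric_of_cells (d := d) (m := m + 1) (κ := Unit) (G := Pt) (m + 3 * d - 1)
    (by rw [finrank_points]; simp; lia)
    (fun k T => LinearMap.funLeft ℝ Pt (fun i : Fin m => T.mark i.castSucc))
    (fun _ _ T => LinearMap.proj (T.mark (Fin.last m))) (fun _ => q)
    (fun _ _ _ y => ⟨y, rfl⟩) fun p hp => ?_
  simp only [Set.mem_ofPred_eq, EvGeneral, not_forall] at hp
  obtain ⟨C, hC, ht⟩ := hp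
  have := C.k_lt ht
  refine ⟨(), C, by lia, funext fun i => ?_, ?_⟩
  · have := hC i.castSucc
    rwa [Fin.snoc_castSucc] at this
  · have := hC (Fin.last m)
    rwa [Fin.snoc_last] at this

end

/-! ### General position with respect to tropical curves; the case `n ≥ 2` -/

section

variable {d m : ℕ}

theorem IsGeneric.of_inter {E : Type} [AddCommGroup E] [Module ℝ E] {s t u : Set E}
    (hs : IsGeneric s) (ht : IsGeneric t) (h : s ∩ t ⊆ u) : IsGeneric u := by
  obtain ⟨S, hS, hS1, hS2⟩ := hs
  obtain ⟨T, hT, hT1, hT2⟩ := ht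
  refine ⟨S ∪ T, hS.union hT, fun h => h.elim hS1 hT1, fun x hx => ?_⟩
  by_cases hxs : x ∈ s
  · obtain ⟨A, hA, hxA⟩ := hT2 x fun hxt => hx (h ⟨hxs, hxt⟩)
    exact ⟨A, Or.inr hA, hxA⟩
  · obtain ⟨A, hA, hxA⟩ := hS2 x hxs
    exact ⟨A, Or.inl hA, hxA⟩

/-- The linear form `q ↦ (a - b) · q`. -/
def diffForm (a b : Fin 2 → ℕ) : Pt →ₗ[ℝ] ℝ where
  toFun q := ((a 0 : ℝ) - b 0) * q 0 + ((a 1 : ℝ) - b 1) * q 1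
  map_add' p q := by simp; ring
  map_smul' r q := by simp; ring

theorem diffForm_apply (a b : Fin 2 → ℕ) (q : Pt) :
    diffForm a b q = ((a 0 : ℝ) - b 0) * q 0 + ((a 1 : ℝ) - b 1) * q 1 := rfl

theorem exponent_ne {a b : Fin 2 → ℕ} (h : a ≠ b) :
    ((a 0 : ℝ) - b 0) ≠ 0 ∨ ((a 1 : ℝ) - b 1) ≠ 0 := by
  by_contra! hcon
  refine h (funext fun c => ?_)
  fin_cases c
  · exact_mod_cast sub_eq_zero.1 hcon.1
  · exact_mod_cast sub_eq_zero.1 hcon.2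

theorem diffForm_surjective {a b : Fin 2 → ℕ} (h : a ≠ b) (y : ℝ) : ∃ q, diffForm a b q = y := by
  rcases exponent_ne h with h | h
  · refine ⟨![y / ((a 0 : ℝ) - b 0), 0], ?_⟩
    rw [diffForm_apply]
    simp [mul_div_cancel₀ _ h]
  · refine ⟨![0, y / ((a 1 : ℝ) - b 1)], ?_⟩
    rw [diffForm_apply]
    simp [mul_div_cancel₀ _ h]

namespace TropPoly

theorem term_eq_term_iff (F : TropPoly) (a b : Fin 2 → ℕ) (q : Pt) :
    F.term a q = F.term b q ↔ diffForm a b q = F.coeff b - F.coeff a := by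
  rw [diffForm_apply]
  simp only [term, Fin.sum_univ_two]
  constructor <;> intro h <;> linarith

theorem term_eq_of_mem_argmax {F : TropPoly} {a b : Fin 2 → ℕ} {q : Pt} (ha : a ∈ F.argmax q)
    (hb : b ∈ F.argmax q) : F.term a q = F.term b q :=
  le_antisymm (hb.2 a ha.1) (ha.2 b hb.1)

/-- At a point of a tropical curve which is not in the interior of an edge the maximum is attained
at three monomials whose exponents are not collinear. -/
theorem exists_not_collinear {F : TropPoly} {q : Pt} (hq : q ∈ F.locus) (hne : ¬ F.IsEdgePoint q) :
    ∃ a ∈ F.argmax q, ∃ b ∈ F.argmax q, ∃ e ∈ F.argmax q,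
      ((a 0 : ℝ) - b 0) * ((e 1 : ℝ) - b 1) - ((a 1 : ℝ) - b 1) * ((e 0 : ℝ) - b 0) ≠ 0 := by
  by_contra! hcol
  obtain ⟨a, ha, b, hb, hab⟩ := hq
  have hfin : (F.argmax q).Finite := F.supp.finite_toSet.subset fun e he => he.1
  -- The maximal exponents are assumed collinear. Projecting them to the direction `a - b` orders
  -- them, and the extreme ones are the end points of the dual edge.
  let f : (Fin 2 → ℕ) → ℝ := fun e =>
    (e 0 : ℝ) * ((a 0 : ℝ) - b 0) + (e 1 : ℝ) * ((a 1 : ℝ) - b 1)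
  obtain ⟨a', ha', hmax⟩ := Set.exists_max_image _ f hfin ⟨a, ha⟩
  obtain ⟨b', hb', hmin⟩ := Set.exists_min_image _ f hfin ⟨a, ha⟩
  set x := (a 0 : ℝ) - b 0 with hx
  set y := (a 1 : ℝ) - b 1 with hy
  have hn : 0 < x * x + y * y := by
    rcases exponent_ne hab with h | h
    · nlinarith [mul_self_pos.2 h, mul_self_nonneg y]
    · nlinarith [mul_self_pos.2 h, mul_self_nonneg x]
  have hfab : f b < f a := by
    have : f a - f b = x * x + y * y := by simp only [f, hx, hy]; ring
    linarith
  have hlt : f b' < f a' := (hmin b hb).trans_lt (hfab.trans_le (hmax a ha))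
  have hpar : ∀ e ∈ F.argmax q, ∀ c, ((e c : ℝ) - b' c) * (x * x + y * y) =
      (f e - f b') * ![x, y] c := by
    intro e he c
    have h1 := hcol a ha b hb e he
    have h2 := hcol a ha b hb b' hb'
    rw [← hx, ← hy] at h1 h2
    have h3 : x * ((e 1 : ℝ) - b' 1) = y * ((e 0 : ℝ) - b' 0) := by linarith
    fin_cases c
    · simp only [Fin.zero_eta, Matrix.cons_val_zero, f, Fin.isValue]
      linear_combination (-y) * h3
    · simp only [Fin.mk_one, Matrix.cons_val_one, f, Fin.isValue, Matrix.cons_val_fin_one]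
      linear_combination x * h3
  refine hne ⟨fun c => (a' c : ℤ) - b' c, a', ha', b', hb', ?_, fun c => rfl, fun e he => ?_⟩
  · rintro rfl; exact lt_irrefl _ hlt
  · refine ⟨(f e - f b') / (f a' - f b'), div_nonneg (by linarith [hmin e he]) (by linarith),
      (div_le_one (by linarith)).2 (by linarith [hmax e he]), fun c => ?_⟩
    have h1 := hpar e he c
    have h2 := hpar a' ha' c
    have h3 : f a' - f b' ≠ 0 := by linarith
    have h4 : ((e c : ℝ) - b' c) * (f a' - f b') = (f e - f b') * ((a' c : ℝ) - b' c) := by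
      refine mul_right_cancel₀ hn.ne' ?_
      linear_combination (f a' - f b') * h1 - (f e - f b') * h2
    field_simp
    linear_combination h4

theorem exists_of_mem_locus_line {z q : Pt} (h : q ∈ (line z).locus) :
    ∃ a ∈ (line 0).supp, ∃ b ∈ (line 0).supp, a ≠ b ∧ diffForm a b q = diffForm a b z := by
  obtain ⟨a, ha, b, hb, hab⟩ := h
  refine ⟨a, ha.1, b, hb.1, hab, ?_⟩
  have := (term_eq_term_iff _ _ _ _).1 (term_eq_of_mem_argmax ha hb)
  rw [this, diffForm_apply]
  simp only [line, Fin.sum_univ_two]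
  ring

end TropPoly

theorem exists_solution_of_det_ne_zero {x y x' y' : ℝ} (h : x * y' - y * x' ≠ 0) (r r' : ℝ) :
    ∃ q : Pt, x * q 0 + y * q 1 = r ∧ x' * q 0 + y' * q 1 = r' := by
  refine ⟨![(r * y' - r' * y) / (x * y' - y * x'), (r' * x - r * x') / (x * y' - y * x')], ?_, ?_⟩
  all_goals
    simp only [Matrix.cons_val_zero, Matrix.cons_val_one, Matrix.cons_val_fin_one]
    rw [mul_div_assoc', mul_div_assoc', ← add_div, div_eq_iff h]
    ring

/-- Two dimension counts. A cell that is not maximal has dimension at most `2m`, and two equal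
monomials of `L` at the last marking cost one. An arbitrary cell has dimension at most `2m + 1`, and
a vertex of `L`, with three non-collinear maximal monomials, costs two. Both times less than `2m`
remains. -/
theorem isGeneric_incGeneral (hm : m + 1 = 3 * d) (L : TropPoly) :
    IsGeneric {p : Fin m → Pt | IncGeneral d ![L] p} := by
  have h1 : IsGeneric {p : Fin m → Pt | ∀ C ∈ incFibre d ![L] p, C.Trivalent} := by
    refine isGeneric_of_cells (d := d) (m := m + 1) (G := ℝ)
      (κ := {x : L.supp × L.supp // x.1 ≠ x.2}) (m + 1 + 3 * d - 2)
      (by rw [finrank_points]; simp; lia)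
      (fun k T => LinearMap.funLeft ℝ Pt (fun i : Fin m => T.mark i.castSucc))
      (fun x _ T => diffForm x.1.1 x.1.2 ∘ₗ LinearMap.proj (T.mark (Fin.last m)))
      (fun x => L.coeff x.1.2 - L.coeff x.1.1)
      (fun x _ _ y => diffForm_surjective (fun h => x.2 (Subtype.ext h)) y) fun p hp => ?_
    simp only [Set.mem_ofPred_eq, not_forall] at hp
    obtain ⟨C, hC, ht⟩ := hp
    have := C.k_lt ht
    obtain ⟨a, ha, b, hb, hab⟩ := hC.2 0
    refine ⟨⟨⟨⟨a, ha.1⟩, ⟨b, hb.1⟩⟩, fun h => hab (congrArg Subtype.val h)⟩, C, by lia,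
      funext fun i => hC.1 i, ?_⟩
    exact (TropPoly.term_eq_term_iff _ _ _ _).1 (TropPoly.term_eq_of_mem_argmax ha hb)
  have h2 : IsGeneric {p : Fin m → Pt | ∀ C ∈ incFibre d ![L] p,
      ∀ j, ((![L] : Fin 1 → TropPoly) j).IsEdgePoint (C.ev (Fin.last m))} := by
    refine isGeneric_of_cells (d := d) (m := m + 1) (G := ℝ × ℝ)
      (κ := {x : L.supp × L.supp × L.supp //
        ((x.1.1 0 : ℝ) - x.2.1.1 0) * ((x.2.2.1 1 : ℝ) - x.2.1.1 1) -
          ((x.1.1 1 : ℝ) - x.2.1.1 1) * ((x.2.2.1 0 : ℝ) - x.2.1.1 0) ≠ 0}) (m + 1 + 3 * d - 1)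
      (by rw [finrank_points]; simp; lia)
      (fun k T => LinearMap.funLeft ℝ Pt (fun i : Fin m => T.mark i.castSucc))
      (fun x _ T => ((diffForm x.1.1 x.1.2.1).prod (diffForm x.1.2.2 x.1.2.1)) ∘ₗ
        LinearMap.proj (T.mark (Fin.last m)))
      (fun x => (L.coeff x.1.2.1 - L.coeff x.1.1, L.coeff x.1.2.1 - L.coeff x.1.2.2))
      (fun x _ _ y => ?_) fun p hp => ?_
    · obtain ⟨⟨⟨a, _⟩, ⟨b, _⟩, ⟨e, _⟩⟩, hx⟩ := x
      simp only at hx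
      obtain ⟨q, h1, h2⟩ := exists_solution_of_det_ne_zero hx y.1 y.2
      exact ⟨q, Prod.ext h1 h2⟩
    · simp only [Set.mem_ofPred_eq, not_forall] at hp
      obtain ⟨C, hC, j, hj⟩ := hp
      have hjL : (![L] : Fin 1 → TropPoly) j = L := by
        rw [Subsingleton.elim j 0]; rfl
      rw [hjL] at hj
      obtain ⟨a, ha, b, hb, e, he, hne⟩ := TropPoly.exists_not_collinear (hC.2 0) hj
      have := C.k_le
      refine ⟨⟨⟨⟨a, ha.1⟩, ⟨b, hb.1⟩, ⟨e, he.1⟩⟩, hne⟩, C, by lia, funext fun i => hC.1 i, ?_⟩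
      exact Prod.ext
        ((TropPoly.term_eq_term_iff _ _ _ _).1 (TropPoly.term_eq_of_mem_argmax ha hb))
        ((TropPoly.term_eq_term_iff _ _ _ _).1 (TropPoly.term_eq_of_mem_argmax he hb))
  exact h1.of_inter h2 fun p hp C hC => ⟨hp.1 C hC, hp.2 C hC⟩

/-- Three vectors in the plane are dependent, by Cramer's rule. As the first is nonzero, the
relation can be chosen to involve one of the other two. -/
theorem exists_linear_relation {x y x₁ y₁ x₂ y₂ : ℝ} (h : x ≠ 0 ∨ y ≠ 0) :
    ∃ s s₁ s₂ : ℝ, (s₁ ≠ 0 ∨ s₂ ≠ 0) ∧ s * x + s₁ * x₁ + s₂ * x₂ = 0 ∧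
      s * y + s₁ * y₁ + s₂ * y₂ = 0 := by
  by_cases hp : x * y₁ - y * x₁ = 0
  · rcases h with h | h
    · refine ⟨-x₁, x, 0, Or.inl h, by ring, by linarith⟩
    · refine ⟨-y₁, y, 0, Or.inl h, by linarith, by ring⟩
  · exact ⟨x₁ * y₂ - y₁ * x₂, x₂ * y - y₂ * x, x * y₁ - y * x₁, Or.inr hp, by ring, by ring⟩

/-- Two general lines and a fixed tropical curve have no point in common. -/
theorem isGeneric_incFibre_eq_empty (L : TropPoly) {n : ℕ} (hn : 2 ≤ n) :
    IsGeneric {x : (Fin n → Pt) × (Fin m → Pt) | incFibre d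
      (Fin.cons L (fun j => TropPoly.line (x.1 j)) : Fin (n + 1) → TropPoly) x.2 = ∅} := by
  let S := (TropPoly.line 0).supp
  let E := (Fin n → Pt) × (Fin m → Pt)
  let i₁ : Fin n := ⟨0, by lia⟩
  let i₂ : Fin n := ⟨1, by lia⟩
  have hi : i₁ ≠ i₂ := by simp [i₁, i₂]
  have key : ∀ x : {x : (L.supp × L.supp) × (S × S) × (S × S) //
      x.1.1 ≠ x.1.2 ∧ x.2.1.1 ≠ x.2.1.2 ∧ x.2.2.1 ≠ x.2.2.2},
      ∃ A : AffineSubspace ℝ E, A ≠ ⊤ ∧ ∀ y : E, ∀ q : Pt,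
        diffForm x.1.1.1 x.1.1.2 q = L.coeff x.1.1.2 - L.coeff x.1.1.1 →
        diffForm x.1.2.1.1 x.1.2.1.2 q = diffForm x.1.2.1.1 x.1.2.1.2 (y.1 i₁) →
        diffForm x.1.2.2.1 x.1.2.2.2 q = diffForm x.1.2.2.1 x.1.2.2.2 (y.1 i₂) → y ∈ A := by
    rintro ⟨⟨⟨⟨a, _⟩, ⟨b, _⟩⟩, ⟨⟨a₁, _⟩, ⟨b₁, _⟩⟩, ⟨⟨a₂, _⟩, ⟨b₂, _⟩⟩⟩, h, h₁, h₂⟩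
    replace h : a ≠ b := fun e => h (Subtype.ext e)
    replace h₁ : a₁ ≠ b₁ := fun e => h₁ (Subtype.ext e)
    replace h₂ : a₂ ≠ b₂ := fun e => h₂ (Subtype.ext e)
    obtain ⟨s, s₁, s₂, hs, e₁, e₂⟩ := exists_linear_relation (x₁ := (a₁ 0 : ℝ) - b₁ 0)
      (y₁ := (a₁ 1 : ℝ) - b₁ 1) (x₂ := (a₂ 0 : ℝ) - b₂ 0) (y₂ := (a₂ 1 : ℝ) - b₂ 1)
      (exponent_ne h)
    -- Combining the equations of the three lines with the coefficients of the relation eliminates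
    -- the common point `q`. What is left is an affine equation for the two vertices, nontrivial
    -- because `s₁` or `s₂` is nonzero.
    let g : E →ₗ[ℝ] ℝ :=
      s₁ • (diffForm a₁ b₁ ∘ₗ LinearMap.proj i₁ ∘ₗ LinearMap.fst ℝ _ _) +
      s₂ • (diffForm a₂ b₂ ∘ₗ LinearMap.proj i₂ ∘ₗ LinearMap.fst ℝ _ _)
    have hg : ∀ y : E, g y = s₁ * diffForm a₁ b₁ (y.1 i₁) + s₂ * diffForm a₂ b₂ (y.1 i₂) :=
      fun y => rfl
    obtain ⟨A, hA, hA'⟩ := exists_affineSubspace_ne_top (⊤ : Submodule ℝ E) LinearMap.id g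
      (-s * (L.coeff b - L.coeff a)) (fun r => by
        rcases hs with hs | hs
        · obtain ⟨q, hq⟩ := diffForm_surjective h₁ (r / s₁)
          refine ⟨(Pi.single i₁ q, 0), trivial, ?_⟩
          rw [hg]
          simp only [Pi.single_eq_same, Pi.single_eq_of_ne hi.symm, hq, map_zero]
          field_simp; ring
        · obtain ⟨q, hq⟩ := diffForm_surjective h₂ (r / s₂)
          refine ⟨(Pi.single i₂ q, 0), trivial, ?_⟩
          rw [hg]
          simp only [Pi.single_eq_same, Pi.single_eq_of_ne hi, hq, map_zero]
          field_simp; ring) (by simp)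
    refine ⟨A, hA, fun y q h0 h1 h2 => hA' y trivial ?_⟩
    simp only at h0 h1 h2
    rw [hg, ← h1, ← h2, ← h0]
    simp only [diffForm_apply]
    linear_combination q 0 * e₁ + q 1 * e₂
  choose A hA hA' using key
  refine isGeneric_of_finite A hA fun y hy => ?_
  simp only [Set.mem_ofPred_eq] at hy
  obtain ⟨C, hC⟩ := Set.nonempty_iff_ne_empty.2 hy
  obtain ⟨a, ha, b, hb, hab⟩ : C.ev (Fin.last m) ∈ L.locus := by simpa using hC.2 0
  have hl : ∀ i : Fin n, C.ev (Fin.last m) ∈ (TropPoly.line (y.1 i)).locus := fun i => by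
    simpa using hC.2 i.succ
  obtain ⟨a₁, ha₁, b₁, hb₁, hab₁, h₁⟩ := TropPoly.exists_of_mem_locus_line (hl i₁)
  obtain ⟨a₂, ha₂, b₂, hb₂, hab₂, h₂⟩ := TropPoly.exists_of_mem_locus_line (hl i₂)
  exact ⟨⟨⟨⟨⟨a, ha.1⟩, ⟨b, hb.1⟩⟩, ⟨⟨a₁, ha₁⟩, ⟨b₁, hb₁⟩⟩, ⟨⟨a₂, ha₂⟩, ⟨b₂, hb₂⟩⟩⟩,
    fun h => hab (congrArg Subtype.val h), fun h => hab₁ (congrArg Subtype.val h),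
    fun h => hab₂ (congrArg Subtype.val h)⟩, hA' _ y (C.ev (Fin.last m))
      ((TropPoly.term_eq_term_iff _ _ _ _).1 (TropPoly.term_eq_of_mem_argmax ha hb)) h₁ h₂⟩

/-- Three or more incidence conditions for one marking are linearly dependent. -/
theorem incMult_eq_zero {n : ℕ} (hn : 2 ≤ n) (K : Fin (n + 1) → TropPoly)
    (C : PlaneTropCurve d (m + 1)) : incMult K C = 0 := by
  classical
  by_contra hne
  unfold incMult at hne
  set A : Matrix (Fin m × Fin 2 ⊕ Fin (n + 1)) (Fin 2 ⊕ C.graph.edgeSet) ℤ := Sum.elim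
    (fun (r : Fin m × Fin 2) => C.coordCoeff (C.mark r.1.castSucc) r.2)
    (fun (j : Fin (n + 1)) x => ∑ c, (K j).edgeNormal (C.ev (Fin.last m)) c *
      C.coordCoeff (C.mark (Fin.last m)) c x) with hA
  obtain ⟨e⟩ : Nonempty ((Fin m × Fin 2 ⊕ Fin (n + 1)) ≃ (Fin 2 ⊕ C.graph.edgeSet)) := by
    by_contra h
    exact hne (by unfold absDet; rw [dif_neg h])
  rw [absDet_eq A e] at hne
  have hdet : (A.submatrix id e).det ≠ 0 := by simpa using hne
  have hlin := Matrix.linearIndependent_rows_of_det_ne_zero hdet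
  -- All `n + 1 ≥ 3` rows of the incidence conditions lie in the span of the two rows that give the
  -- coordinates of the last marking.
  let w : Fin 2 → (Fin m × Fin 2 ⊕ Fin (n + 1)) → ℤ := fun c i =>
    C.coordCoeff (C.mark (Fin.last m)) c (e i)
  have hli : LinearIndependent ℤ fun j : Fin (n + 1) => (A.submatrix id e) (Sum.inr j) :=
    hlin.comp Sum.inr Sum.inr_injective
  have hspan : ∀ j : Fin (n + 1), (A.submatrix id e) (Sum.inr j) ∈
      Submodule.span ℤ (Set.range w) := by
    intro j
    have : (A.submatrix id e) (Sum.inr j) =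
        ∑ c, (K j).edgeNormal (C.ev (Fin.last m)) c • w c := by
      funext i
      rw [Finset.sum_apply]
      rfl
    rw [this]
    exact Submodule.sum_mem _ fun c _ => Submodule.smul_mem _ _ (Submodule.subset_span ⟨c, rfl⟩)
  have := linearIndependent_le_span' _ hli (Set.range w)
    (by rintro _ ⟨j, rfl⟩; exact hspan j)
  rw [Cardinal.mk_fin, Nat.cast_le] at this
  have h2 := this.trans (Fintype.card_range_le w)
  rw [Fintype.card_fin] at h2
  lia

theorem hasCount_zero {μ : PlaneTropCurve d m → ℕ} (S : Set (PlaneTropCurve d m))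
    (h : ∀ C, μ C = 0) : HasCount S μ 0 := by
  simp [HasCount, h]

end

/-! ### The degree of a family of linear maps on an orthant -/

section

open Filter Topology

section Degree

variable {𝒢 R : Type} [Fintype R] (B : 𝒢 → Matrix R R ℝ)

/-- `q` lies in the image of the open orthant under the matrix `B g`. -/
def InCone (g : 𝒢) (q : R → ℝ) : Prop := ∃ x : R → ℝ, (∀ r, 0 < x r) ∧ (B g).mulVec x = q

/-- `q` lies in the image of the relative interior of a facet of the orthant. -/
def InWall (g : 𝒢) (r : R) (q : R → ℝ) : Prop :=
  ∃ x : R → ℝ, x r = 0 ∧ (∀ s, s ≠ r → 0 < x s) ∧ (B g).mulVec x = q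

/-- `q` does not lie in the image of the boundary of an orthant of full dimension. -/
def ConeGeneral [DecidableEq R] (q : R → ℝ) : Prop :=
  ∀ g, (B g).det ≠ 0 → ∀ x : R → ℝ, (∀ r, 0 ≤ x r) → (B g).mulVec x = q → ∀ r, 0 < x r

open Classical in
/-- The contribution of the cone `g` to the degree. -/
noncomputable def coneMult [DecidableEq R] (g : 𝒢) (q : R → ℝ) : ℝ := if InCone B g q then |(B g).det| else 0

/-- The number of preimages of `q`, counted with multiplicity. -/
noncomputable def coneDegree [Fintype 𝒢] [DecidableEq R] (q : R → ℝ) : ℝ := ∑ g, coneMult B g q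

variable {B} [DecidableEq R]

theorem mulVec_eq_iff_cramer {A : Matrix R R ℝ} (hA : A.det ≠ 0) {x q : R → ℝ} :
    A.mulVec x = q ↔ ∀ r, x r = A.cramer q r / A.det := by
  constructor
  · rintro rfl r
    rw [eq_div_iff hA, Matrix.cramer_eq_adjugate_mulVec, Matrix.mulVec_mulVec,
      Matrix.adjugate_mul, Matrix.smul_mulVec, Matrix.one_mulVec]
    simp [mul_comm]
  · intro h
    have : x = A.det⁻¹ • A.cramer q := by
      funext r; rw [h r]; simp [div_eq_inv_mul]
    rw [this, Matrix.mulVec_smul, Matrix.mulVec_cramer, smul_smul, inv_mul_cancel₀ hA, one_smul]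

theorem inCone_iff {g : 𝒢} (hg : (B g).det ≠ 0) {q : R → ℝ} :
    InCone B g q ↔ ∀ r, 0 < (B g).cramer q r / (B g).det := by
  constructor
  · rintro ⟨x, hx, h⟩ r
    rw [← (mulVec_eq_iff_cramer hg).1 h r]
    exact hx r
  · exact fun h => ⟨_, h, (mulVec_eq_iff_cramer hg).2 fun _ => rfl⟩

theorem inWall_iff {g : 𝒢} (hg : (B g).det ≠ 0) {r : R} {q : R → ℝ} :
    InWall B g r q ↔ (B g).cramer q r / (B g).det = 0 ∧
      ∀ s, s ≠ r → 0 < (B g).cramer q s / (B g).det := by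
  constructor
  · rintro ⟨x, h0, hx, h⟩
    have := (mulVec_eq_iff_cramer hg).1 h
    exact ⟨this r ▸ h0, fun s hs => this s ▸ hx s hs⟩
  · exact fun h => ⟨_, h.1, h.2, (mulVec_eq_iff_cramer hg).2 fun _ => rfl⟩

/-- The change of the contribution of a cone along a line that meets its boundary in
general position. -/
theorem coneMult_jump (g : 𝒢) (q v : R → ℝ) (t : ℝ)
    (hv : (B g).det ≠ 0 → ∀ r, (B g).cramer (q + t • v) r = 0 → (B g).cramer v r ≠ 0)
    (hc : (B g).det ≠ 0 → (∀ r, 0 ≤ (B g).cramer (q + t • v) r / (B g).det) →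
      ∀ r s, (B g).cramer (q + t • v) r = 0 → (B g).cramer (q + t • v) s = 0 → r = s) :
    ∃ cl cr : ℝ, (∀ᶠ s in 𝓝[<] t, coneMult B g (q + s • v) = cl) ∧
      (∀ᶠ s in 𝓝[>] t, coneMult B g (q + s • v) = cr) ∧
      (cr - cl = ∑ r, open Classical in if InWall B g r (q + t • v) then
        (B g).det * SignType.sign ((B g).updateCol r v).det else 0) ∧
      ((∀ r, (B g).det ≠ 0 → ¬ InWall B g r (q + t • v)) →
        coneMult B g (q + t • v) = cl) := by
  classical
  by_cases hg : (B g).det = 0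
  · refine ⟨0, 0, .of_forall fun s => ?_, .of_forall fun s => ?_, ?_, fun _ => ?_⟩ <;>
      simp [coneMult, hg]
  set D := (B g).det with hD
  -- The coordinates of the moving point in the cone, which are affine functions of the time `s`.
  have hlin : ∀ s r, (B g).cramer (q + s • v) r / D =
      (B g).cramer (q + t • v) r / D + (s - t) * ((B g).cramer v r / D) := by
    intro s r
    simp only [map_add, map_smul, Pi.add_apply, Pi.smul_apply, smul_eq_mul]
    field_simp
    ring
  have hcont : ∀ r, Continuous fun s : ℝ => (B g).cramer (q + s • v) r / D := by
    intro r
    rw [show (fun s : ℝ => (B g).cramer (q + s • v) r / D) = _ from funext fun s => hlin s r]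
    fun_prop
  have hz : ∀ r, (B g).cramer (q + t • v) r / D = 0 → (B g).cramer (q + t • v) r = 0 :=
    fun r h => (div_eq_zero_iff.1 h).resolve_right hg
  -- Three cases: some coordinate is negative and the cone is not met nearby; no coordinate is
  -- negative but one vanishes, and by `hc` the point lies inside a single facet; all coordinates
  -- are positive. Only the second case produces a jump.
  by_cases hneg : ∃ r, (B g).cramer (q + t • v) r / D < 0
  · obtain ⟨r, hr⟩ := hneg
    have h1 : ∀ᶠ s in 𝓝 t, coneMult B g (q + s • v) = 0 := by
      filter_upwards [(hcont r).continuousAt.eventually_lt_const hr] with s hs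
      rw [coneMult, if_neg]
      rw [inCone_iff hg]
      exact fun h => lt_asymm (h r) hs
    refine ⟨0, 0, h1.filter_mono nhdsWithin_le_nhds, h1.filter_mono nhdsWithin_le_nhds, ?_,
      fun _ => h1.self_of_nhds⟩
    rw [sub_zero, eq_comm]
    refine Finset.sum_eq_zero fun s _ => if_neg ?_
    rw [inWall_iff hg]
    rintro ⟨h2, h3⟩
    by_cases hrs : r = s
    · subst hrs; linarith
    · linarith [h3 r hrs]
  push Not at hneg
  by_cases hzero : ∃ r, (B g).cramer (q + t • v) r / D = 0
  · obtain ⟨r, hr⟩ := hzero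
    have hpos : ∀ s, s ≠ r → 0 < (B g).cramer (q + t • v) s / D := by
      intro s hs
      refine lt_of_le_of_ne (hneg s) fun h => hs ?_
      exact hc hg hneg s r (hz s h.symm) (hz r hr)
    have hnear : ∀ᶠ s in 𝓝 t, ∀ r', r' ≠ r → 0 < (B g).cramer (q + s • v) r' / D := by
      rw [eventually_all]
      intro r'
      by_cases h : r' = r
      · exact .of_forall fun s h' => absurd h h'
      · filter_upwards [(hcont r').continuousAt.eventually_const_lt (hpos r' h)] with s hs _
        exact hs
    have hcone : ∀ᶠ s in 𝓝 t, (InCone B g (q + s • v) ↔ 0 < (s - t) * ((B g).cramer v r / D)) := by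
      filter_upwards [hnear] with s hs
      rw [inCone_iff hg]
      constructor
      · intro h
        have := h r
        rwa [hlin, hr, zero_add] at this
      · intro h r'
        by_cases h' : r' = r
        · rw [h', hlin, hr, zero_add]; exact h
        · exact hs r' h'
    have hb : (B g).cramer v r / D ≠ 0 := div_ne_zero (hv hg r (hz r hr)) hg
    have hsum : ∑ r', (if InWall B g r' (q + t • v) then
        (B g).det * SignType.sign ((B g).updateCol r' v).det else 0 : ℝ) =
        D * SignType.sign ((B g).cramer v r) := by
      rw [Finset.sum_eq_single r]
      · rw [if_pos ((inWall_iff hg).2 ⟨hr, hpos⟩), Matrix.cramer_apply]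
      · intro s _ hs
        rw [if_neg]
        rw [inWall_iff hg]
        exact fun h => (hpos s hs).ne' h.1
      · simp
    -- The sign of the velocity of the vanishing coordinate tells whether the point enters the cone,
    -- with jump `|D|`, or leaves it, with jump `-|D|`.
    have hsign : D * SignType.sign ((B g).cramer v r) =
        |D| * SignType.sign ((B g).cramer v r / D) := by
      rw [div_eq_mul_inv, sign_mul]
      rcases lt_or_gt_of_ne hg with h | h
      · rw [abs_of_neg h, sign_neg (inv_lt_zero.2 h)]; simp
      · rw [abs_of_pos h, sign_pos (inv_pos.2 h)]; simp
    have hwall : ¬ ∀ r, (B g).det ≠ 0 → ¬ InWall B g r (q + t • v) :=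
      fun h => h r hg ((inWall_iff hg).2 ⟨hr, hpos⟩)
    rcases lt_or_gt_of_ne hb with h | h
    · refine ⟨|D|, 0, ?_, ?_, ?_, fun h' => absurd h' hwall⟩
      · filter_upwards [hcone.filter_mono nhdsWithin_le_nhds, self_mem_nhdsWithin] with s hs hst
        exact if_pos (hs.2 (mul_pos_of_neg_of_neg (sub_neg.2 hst) h))
      · filter_upwards [hcone.filter_mono nhdsWithin_le_nhds, self_mem_nhdsWithin] with s hs hst
        refine if_neg fun h' => ?_
        have := hs.1 h'
        nlinarith [sub_pos.2 (show t < s from hst)]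
      · rw [hsum, hsign, sign_neg h]; simp
    · refine ⟨0, |D|, ?_, ?_, ?_, fun h' => absurd h' hwall⟩
      · filter_upwards [hcone.filter_mono nhdsWithin_le_nhds, self_mem_nhdsWithin] with s hs hst
        refine if_neg fun h' => ?_
        have := hs.1 h'
        nlinarith [sub_neg.2 (show s < t from hst)]
      · filter_upwards [hcone.filter_mono nhdsWithin_le_nhds, self_mem_nhdsWithin] with s hs hst
        exact if_pos (hs.2 (mul_pos (sub_pos.2 hst) h))
      · rw [hsum, hsign, sign_pos h]; simp
  · push Not at hzero
    have hpos : ∀ r, 0 < (B g).cramer (q + t • v) r / D :=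
      fun r => lt_of_le_of_ne (hneg r) (hzero r).symm
    have h1 : ∀ᶠ s in 𝓝 t, coneMult B g (q + s • v) = |D| := by
      have : ∀ᶠ s in 𝓝 t, ∀ r, 0 < (B g).cramer (q + s • v) r / D := by
        rw [eventually_all]
        exact fun r => (hcont r).continuousAt.eventually_const_lt (hpos r)
      filter_upwards [this] with s hs
      exact if_pos ((inCone_iff hg).2 hs)
    refine ⟨|D|, |D|, h1.filter_mono nhdsWithin_le_nhds, h1.filter_mono nhdsWithin_le_nhds, ?_,
      fun _ => h1.self_of_nhds⟩
    rw [sub_self, eq_comm]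
    refine Finset.sum_eq_zero fun s _ => if_neg ?_
    rw [inWall_iff hg]
    exact fun h => (hpos s).ne' h.1

/-- The constant value around each point, ignoring the point itself, is a locally constant function
on the connected line. -/
theorem eq_of_eventually_const_punctured {h : ℝ → ℝ} {a b : ℝ}
    (hloc : ∀ t, ∃ c, ∀ᶠ s in 𝓝[≠] t, h s = c)
    (ha : ∀ᶠ s in 𝓝[≠] a, h s = h a) (hb : ∀ᶠ s in 𝓝[≠] b, h s = h b) : h a = h b := by
  choose H hH using hloc
  have huniq : ∀ t c, (∀ᶠ s in 𝓝[≠] t, h s = c) → H t = c := by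
    intro t c hc
    obtain ⟨s, hs⟩ := ((hH t).and hc).exists
    exact hs.1.symm.trans hs.2
  have hlc : IsLocallyConstant H := by
    rw [IsLocallyConstant.iff_eventually_eq]
    intro t
    have h1 := eventually_eventually_nhdsWithin.2 (hH t)
    rw [eventually_nhdsWithin_iff] at h1
    filter_upwards [h1] with s hs
    by_cases hst : s = t
    · rw [hst]
    · refine huniq s _ ?_
      have h2 := hs hst
      rw [IsOpen.nhdsWithin_eq isOpen_compl_singleton hst] at h2
      exact h2.filter_mono nhdsWithin_le_nhds
  rw [← huniq a _ ha, ← huniq b _ hb]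
  exact hlc.apply_eq_of_preconnectedSpace a b

theorem exists_forall_dual_ne_zero {E ι : Type} [AddCommGroup E] [Module ℝ E] [Finite ι]
    (f : ι → E →ₗ[ℝ] ℝ) (hf : ∀ i, f i ≠ 0) : ∃ x, ∀ i, f i x ≠ 0 := by
  classical
  have := Fintype.ofFinite ι
  have h := Subspace.biUnion_ne_univ_of_top_notMem
    (s := Finset.univ.image fun i => LinearMap.ker (f i)) (by
      simp only [Finset.mem_image, Finset.mem_univ, true_and, not_exists]
      exact fun i hi => hf i (LinearMap.ker_eq_top.1 hi))
  obtain ⟨x, hx⟩ := (Set.ne_univ_iff_exists_notMem _).1 h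
  refine ⟨x, fun i hi => hx ?_⟩
  simp only [Set.mem_iUnion]
  exact ⟨LinearMap.ker (f i), Finset.mem_image_of_mem _ (Finset.mem_univ i), hi⟩

/-- The hypotheses on `q'` say that it lies on no facet hyperplane and that two coordinates of one
cone can vanish simultaneously on the line from `q` to `q'` only if they do so at `q`, where
`ConeGeneral` keeps the point off the closed cone. So walls are met one facet per cone at a time,
and `hbal` makes the jumps cancel. -/
theorem coneDegree_eq_of_line [Fintype 𝒢] (hbal : ∀ q v : R → ℝ, ∑ g, ∑ r, (open Classical in
      if InWall B g r q then (B g).det * SignType.sign ((B g).updateCol r v).det else 0 : ℝ) = 0)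
    {q q' : R → ℝ} (hq : ConeGeneral B q)
    (h1 : ∀ g, (B g).det ≠ 0 → ∀ r, (B g).cramer q' r ≠ 0)
    (h2 : ∀ g, (B g).det ≠ 0 → ∀ r s, r ≠ s → (B g).cramer q r ≠ 0 →
      (B g).cramer q r * (B g).cramer q' s - (B g).cramer q s * (B g).cramer q' r ≠ 0) :
    coneDegree B q = coneDegree B q' := by
  classical
  set v := q' - q with hv
  have hcr : ∀ g t r, (B g).cramer (q + t • v) r =
      (1 - t) * (B g).cramer q r + t * (B g).cramer q' r := by
    intro g t r
    simp only [hv, map_add, map_smul, map_sub, Pi.add_apply, Pi.smul_apply, Pi.sub_apply,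
      smul_eq_mul]
    ring
  have hjump := fun t g => coneMult_jump (B := B) g q v t
    (fun hg r hr hvr => by
      simp only [hv, map_sub, Pi.sub_apply] at hvr
      rw [hcr] at hr
      have : (B g).cramer q r = (B g).cramer q' r := by linarith
      rw [this] at hr
      exact h1 g hg r (by linarith))
    (fun hg hnn r s hr hs => by
      by_contra hne
      by_cases h0 : (B g).cramer q r = 0 ∧ (B g).cramer q s = 0
      · have hr' := hr
        rw [hcr, h0.1, mul_zero, zero_add] at hr'
        have ht : t = 0 := (mul_eq_zero.1 hr').resolve_right (h1 g hg r)
        subst ht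
        rw [zero_smul, add_zero] at hnn hr
        have := hq g hg _ hnn ((mulVec_eq_iff_cramer hg).2 fun _ => rfl) r
        rw [hr, zero_div] at this
        exact lt_irrefl _ this
      · rw [hcr] at hr hs
        have hdet : (B g).cramer q r * (B g).cramer q' s -
            (B g).cramer q s * (B g).cramer q' r = 0 := by
          by_cases ht : t = 0
          · subst ht
            have e1 : (B g).cramer q r = 0 := by linarith
            have e2 : (B g).cramer q s = 0 := by linarith
            exact absurd ⟨e1, e2⟩ h0
          · refine mul_left_cancel₀ ht ?_
            linear_combination (B g).cramer q r * hs - (B g).cramer q s * hr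
        by_cases hr0 : (B g).cramer q r = 0
        · have hs0 : (B g).cramer q s ≠ 0 := fun h => h0 ⟨hr0, h⟩
          exact h2 g hg s r (Ne.symm hne) hs0 (by linarith)
        · exact h2 g hg r s hne hr0 hdet)
  choose cl cr hl hr hj hgen using hjump
  have hsum : ∀ t, ∑ g, cr t g = ∑ g, cl t g := by
    intro t
    rw [← sub_eq_zero, ← Finset.sum_sub_distrib, ← hbal (q + t • v) v]
    exact Finset.sum_congr rfl fun g _ => hj t g
  have hpunct : ∀ t, ∀ᶠ s in 𝓝[≠] t, coneDegree B (q + s • v) = ∑ g, cl t g := by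
    intro t
    rw [← Set.Iio_union_Ioi, nhdsWithin_union, eventually_sup]
    constructor
    · filter_upwards [eventually_all.2 (hl t)] with s hs
      exact Finset.sum_congr rfl fun g _ => hs g
    · filter_upwards [eventually_all.2 (hr t)] with s hs
      rw [← hsum t]
      exact Finset.sum_congr rfl fun g _ => hs g
  have hnowall : ∀ t : ℝ, (∀ g r, (B g).det ≠ 0 → ¬ InWall B g r (q + t • v)) →
      ∀ᶠ s in 𝓝[≠] t, coneDegree B (q + s • v) = coneDegree B (q + t • v) := by
    intro t ht
    have : coneDegree B (q + t • v) = ∑ g, cl t g :=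
      Finset.sum_congr rfl fun g _ => hgen t g (ht g)
    rw [this]
    exact hpunct t
  have hfin := eq_of_eventually_const_punctured (h := fun t : ℝ => coneDegree B (q + t • v))
    (a := 0) (b := 1) (fun t => ⟨_, hpunct t⟩)
    (hnowall 0 fun g r hg ⟨x, hx0, hx, hBx⟩ => by
      rw [zero_smul, add_zero] at hBx
      have := hq g hg x (fun s => by
        by_cases hs : s = r
        · rw [hs, hx0]
        · exact (hx s hs).le) hBx r
      exact this.ne' hx0)
    (hnowall 1 fun g r hg hw => by
      rw [inWall_iff hg] at hw
      have := (div_eq_zero_iff.1 hw.1).resolve_right hg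
      rw [hcr] at this
      exact h1 g hg r (by linarith))
  simpa [hv] using hfin

/-- If the signed multiplicities of the cones adjacent to every wall cancel, the degree
does not depend on the choice of a general point. -/
theorem coneDegree_eq [Fintype 𝒢] (hbal : ∀ q v : R → ℝ, ∑ g, ∑ r, (open Classical in
      if InWall B g r q then (B g).det * SignType.sign ((B g).updateCol r v).det else 0 : ℝ) = 0)
    {q q' : R → ℝ} (hq : ConeGeneral B q) (hq' : ConeGeneral B q') :
    coneDegree B q = coneDegree B q' := by
  let coord : 𝒢 → R → (R → ℝ) →ₗ[ℝ] ℝ := fun g r => LinearMap.proj r ∘ₗ (B g).cramer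
  have hcoord : ∀ g r x, coord g r x = (B g).cramer x r := fun _ _ _ => rfl
  have hcol : ∀ g (r s : R), coord g r ((B g).col s) = if r = s then (B g).det else 0 := by
    intro g r s
    rw [hcoord, Matrix.cramer_apply]
    split_ifs with h
    · subst h
      rw [show (B g).col r = fun i => (B g) i r from rfl, Matrix.updateCol_eq_self]
    · refine Matrix.det_zero_of_column_eq (i := r) (j := s) h fun i => ?_
      rw [Matrix.updateCol_self, Matrix.updateCol_ne (Ne.symm h)]
      rfl
  -- An intermediate point `x` in general position to both `q` and `q'`. Each requirement is that a
  -- linear form in `x` does not vanish. These forms are nonzero because, up to the determinant, the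
  -- Cramer coordinates are dual to the columns of `B g`.
  obtain ⟨x, hx⟩ := exists_forall_dual_ne_zero
    (ι := {g : 𝒢 // (B g).det ≠ 0} × R ⊕
      {y : {g : 𝒢 // (B g).det ≠ 0} × {p : R × R // p.1 ≠ p.2} × Bool //
        coord y.1 y.2.1.1.1 (bif y.2.2 then q else q') ≠ 0})
    (fun i => match i with
      | .inl (g, r) => coord g r
      | .inr y => coord y.1.1 y.1.2.1.1.1 (bif y.1.2.2 then q else q') • coord y.1.1 y.1.2.1.1.2 -
          coord y.1.1 y.1.2.1.1.2 (bif y.1.2.2 then q else q') • coord y.1.1 y.1.2.1.1.1)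
    (by
      rintro (⟨g, r⟩ | ⟨⟨g, ⟨⟨r, s⟩, hrs⟩, b⟩, hy⟩) h
      · have := congrArg (fun f => f ((B g).col r)) h
        simp only [hcol, if_true, LinearMap.zero_apply] at this
        exact g.2 this
      · have := congrArg (fun f => f ((B g).col s)) h
        simp only [LinearMap.sub_apply, LinearMap.smul_apply, hcol, if_true, if_neg hrs,
          LinearMap.zero_apply, smul_eq_mul, mul_zero, sub_zero] at this
        exact (mul_ne_zero hy g.2) this)
  have key : ∀ b : Bool, ConeGeneral B (bif b then q else q') →
      coneDegree B (bif b then q else q') = coneDegree B x := by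
    intro b hb
    refine coneDegree_eq_of_line hbal hb (fun g hg r => hx (.inl (⟨g, hg⟩, r)))
      fun g hg r s hrs h0 => ?_
    exact hx (.inr ⟨⟨⟨g, hg⟩, ⟨⟨r, s⟩, hrs⟩, b⟩, h0⟩)
  exact (key true hq).trans (key false hq').symm

end Degree

end

/-! ### Exchanging two branches across an edge of a tree -/

section

namespace SimpleGraph

variable {W : Type} {G : SimpleGraph W} {a b β γ : W}

theorem IsTree.not_adj_of_adj_adj (hG : G.IsTree) {x y z : W} (hxy : G.Adj x y) (hyz : G.Adj y z) :
    ¬ G.Adj x z := by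
  intro hxz
  have h1 := mem_side_self (G := G) x y
  rw [mem_side_iff_of_adj hyz (by simp [hxz.ne', hxy.ne'])] at h1
  rw [mem_side_iff_of_adj hxz.symm (by simp [hyz.ne', hxz.ne'])] at h1
  exact hG.isAcyclic.notMem_side hxy h1

open Classical in
/-- The permutation of the edges which exchanges the end points `a` and `b` of the edges
from these vertices to `β` and `γ`. -/
noncomputable def flipPerm (a b β γ : W) : Equiv.Perm (Sym2 W) :=
  Equiv.swap s(a, β) s(b, β) * Equiv.swap s(a, γ) s(b, γ)

/-- The data for exchanging the branches `β` at `a` and `γ` at `b`, where `a` and `b` are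
adjacent. -/
structure IsFlip (G : SimpleGraph W) (a b β γ : W) : Prop where
  tree : G.IsTree
  ab : G.Adj a b
  aβ : G.Adj a β
  bγ : G.Adj b γ
  βb : β ≠ b
  γa : γ ≠ a

namespace IsFlip

theorem not_bβ (h : G.IsFlip a b β γ) : ¬ G.Adj b β := fun hb => h.tree.not_adj_of_adj_adj h.ab hb h.aβ
theorem not_aγ (h : G.IsFlip a b β γ) : ¬ G.Adj a γ := fun ha => h.tree.not_adj_of_adj_adj h.ab h.bγ ha
theorem βγ (h : G.IsFlip a b β γ) : β ≠ γ := by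
  rintro rfl; exact h.not_bβ h.bγ

theorem perm_aβ (h : G.IsFlip a b β γ) : flipPerm a b β γ s(a, β) = s(b, β) := by
  classical
  have h1 := h.ab.ne; have h2 := h.aβ.ne; have h3 := h.bγ.ne; have h4 := h.βγ
  have h5 := h.βb; have h6 := h.γa
  rw [flipPerm, Equiv.Perm.mul_apply, Equiv.swap_apply_of_ne_of_ne (a := s(a, γ)),
    Equiv.swap_apply_left] <;>
    simp only [ne_eq, Sym2.eq_iff] <;> grind

theorem perm_bβ (h : G.IsFlip a b β γ) : flipPerm a b β γ s(b, β) = s(a, β) := by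
  classical
  have h1 := h.ab.ne; have h2 := h.aβ.ne; have h3 := h.bγ.ne; have h4 := h.βγ
  have h5 := h.βb; have h6 := h.γa
  rw [flipPerm, Equiv.Perm.mul_apply, Equiv.swap_apply_of_ne_of_ne (a := s(a, γ)),
    Equiv.swap_apply_right] <;>
    simp only [ne_eq, Sym2.eq_iff] <;> grind

theorem perm_aγ (h : G.IsFlip a b β γ) : flipPerm a b β γ s(a, γ) = s(b, γ) := by
  classical
  have h1 := h.ab.ne; have h2 := h.aβ.ne; have h3 := h.bγ.ne; have h4 := h.βγ
  have h5 := h.βb; have h6 := h.γa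
  rw [flipPerm, Equiv.Perm.mul_apply, Equiv.swap_apply_left, Equiv.swap_apply_of_ne_of_ne] <;>
    simp only [ne_eq, Sym2.eq_iff] <;> grind

theorem perm_bγ (h : G.IsFlip a b β γ) : flipPerm a b β γ s(b, γ) = s(a, γ) := by
  classical
  have h1 := h.ab.ne; have h2 := h.aβ.ne; have h3 := h.bγ.ne; have h4 := h.βγ
  have h5 := h.βb; have h6 := h.γa
  rw [flipPerm, Equiv.Perm.mul_apply, Equiv.swap_apply_right, Equiv.swap_apply_of_ne_of_ne] <;>
    simp only [ne_eq, Sym2.eq_iff] <;> grind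

theorem perm_of_ne {e : Sym2 W} (h1 : e ≠ s(a, β)) (h2 : e ≠ s(b, β)) (h3 : e ≠ s(a, γ))
    (h4 : e ≠ s(b, γ)) : flipPerm a b β γ e = e := by
  classical
  rw [flipPerm, Equiv.Perm.mul_apply, Equiv.swap_apply_of_ne_of_ne h3 h4,
    Equiv.swap_apply_of_ne_of_ne h1 h2]

theorem perm_ab (h : G.IsFlip a b β γ) : flipPerm a b β γ s(a, b) = s(a, b) := by
  have h1 := h.ab.ne; have h2 := h.aβ.ne; have h3 := h.bγ.ne; have h4 := h.βγ
  have h5 := h.βb; have h6 := h.γa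
  apply perm_of_ne <;> simp only [ne_eq, Sym2.eq_iff] <;> grind

theorem perm_perm (h : G.IsFlip a b β γ) (e : Sym2 W) : flipPerm a b β γ (flipPerm a b β γ e) = e := by
  by_cases h1 : e = s(a, β)
  · rw [h1, h.perm_aβ, h.perm_bβ]
  by_cases h2 : e = s(b, β)
  · rw [h2, h.perm_bβ, h.perm_aβ]
  by_cases h3 : e = s(a, γ)
  · rw [h3, h.perm_aγ, h.perm_bγ]
  by_cases h4 : e = s(b, γ)
  · rw [h4, h.perm_bγ, h.perm_aγ]
  rw [perm_of_ne h1 h2 h3 h4, perm_of_ne h1 h2 h3 h4]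

theorem perm_comm (h : G.IsFlip a b β γ) : flipPerm a b γ β = flipPerm a b β γ := by
  classical
  have h1 := h.ab.ne; have h2 := h.aβ.ne; have h3 := h.bγ.ne; have h4 := h.βγ
  have h5 := h.βb; have h6 := h.γa
  refine (Equiv.Perm.disjoint_swap_swap ?_).commute
  simp only [List.nodup_cons, List.mem_cons, List.not_mem_nil, or_false, List.nodup_nil,
    Sym2.eq_iff]
  grind

end IsFlip

/-- A set which contains both or none of `a` and `b` separates an edge if and only if it separates
the corresponding edge of the flipped tree. -/
theorem exists_flipPerm_eq {S : Set W} (hS : a ∈ S ↔ b ∈ S) (h : G.IsFlip a b β γ) (x y : W) :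
    ∃ x' y', flipPerm a b β γ s(x, y) = s(x', y') ∧ (x' ∈ S ↔ x ∈ S) ∧ (y' ∈ S ↔ y ∈ S) := by
  have key : ∀ p q p' q', flipPerm a b β γ s(p, q) = s(p', q') → (p' ∈ S ↔ p ∈ S) →
      (q' ∈ S ↔ q ∈ S) → s(x, y) = s(p, q) →
      ∃ x' y', flipPerm a b β γ s(x, y) = s(x', y') ∧ (x' ∈ S ↔ x ∈ S) ∧ (y' ∈ S ↔ y ∈ S) := by
    intro p q p' q' h1 h2 h3 h4
    rw [h4, h1]
    rcases Sym2.eq_iff.1 h4 with ⟨rfl, rfl⟩ | ⟨rfl, rfl⟩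
    · exact ⟨_, _, rfl, h2, h3⟩
    · exact ⟨_, _, Sym2.eq_swap, h3, h2⟩
  by_cases h1 : s(x, y) = s(a, β)
  · exact key _ _ _ _ h.perm_aβ hS.symm Iff.rfl h1
  by_cases h2 : s(x, y) = s(b, β)
  · exact key _ _ _ _ h.perm_bβ hS Iff.rfl h2
  by_cases h3 : s(x, y) = s(a, γ)
  · exact key _ _ _ _ h.perm_aγ hS.symm Iff.rfl h3
  by_cases h4 : s(x, y) = s(b, γ)
  · exact key _ _ _ _ h.perm_bγ hS Iff.rfl h4
  exact ⟨x, y, IsFlip.perm_of_ne h1 h2 h3 h4, Iff.rfl, Iff.rfl⟩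

theorem not_isDiag_flipPerm (h : G.IsFlip a b β γ) (x : W) :
    flipPerm a b β γ s(x, x) = s(x, x) := by
  have h1 := h.ab.ne; have h2 := h.aβ.ne; have h3 := h.bγ.ne; have h4 := h.βγ
  have h5 := h.βb; have h6 := h.γa
  apply IsFlip.perm_of_ne <;> simp only [ne_eq, Sym2.eq_iff] <;> grind

/-- The graph obtained by exchanging the branches `β` at `a` and `γ` at `b`. -/
def flipGraph (G : SimpleGraph W) (a b β γ : W) : SimpleGraph W where
  Adj x y := x ≠ y ∧ flipPerm a b β γ s(x, y) ∈ G.edgeSet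
  symm := ⟨fun x y h => ⟨h.1.symm, Sym2.eq_swap (a := x) ▸ h.2⟩⟩
  loopless := ⟨fun x h => h.1 rfl⟩

namespace IsFlip

theorem adj_iff (h : G.IsFlip a b β γ) {x y : W} :
    (G.flipGraph a b β γ).Adj x y ↔ flipPerm a b β γ s(x, y) ∈ G.edgeSet := by
  refine ⟨fun k => k.2, fun k => ⟨?_, k⟩⟩
  rintro rfl
  rw [not_isDiag_flipPerm h] at k
  exact G.loopless.irrefl x k

theorem mem_edgeSet_iff (h : G.IsFlip a b β γ) {e : Sym2 W} :
    e ∈ (G.flipGraph a b β γ).edgeSet ↔ flipPerm a b β γ e ∈ G.edgeSet := by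
  induction e with
  | _ x y => exact h.adj_iff

theorem adj_ab (h : G.IsFlip a b β γ) : (G.flipGraph a b β γ).Adj a b := by
  rw [h.adj_iff, h.perm_ab]; exact h.ab

theorem adj_bβ (h : G.IsFlip a b β γ) : (G.flipGraph a b β γ).Adj b β := by
  rw [h.adj_iff, h.perm_bβ]; exact h.aβ

theorem adj_aγ (h : G.IsFlip a b β γ) : (G.flipGraph a b β γ).Adj a γ := by
  rw [h.adj_iff, h.perm_aγ]; exact h.bγ

/-- The two edges that disappear are bypassed through the edge between `a` and `b`, which is kept.
-/
theorem connected (h : G.IsFlip a b β γ) : (G.flipGraph a b β γ).Connected := by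
  have := h.tree.connected.nonempty
  have hadj : ∀ x y, G.Adj x y → (G.flipGraph a b β γ).Reachable x y := by
    intro x y hxy
    by_cases h1 : s(x, y) = s(a, β)
    · have : (G.flipGraph a b β γ).Reachable a β := h.adj_ab.reachable.trans h.adj_bβ.reachable
      rcases Sym2.eq_iff.1 h1 with ⟨rfl, rfl⟩ | ⟨rfl, rfl⟩
      exacts [this, this.symm]
    by_cases h4 : s(x, y) = s(b, γ)
    · have : (G.flipGraph a b β γ).Reachable b γ :=
        h.adj_ab.symm.reachable.trans h.adj_aγ.reachable
      rcases Sym2.eq_iff.1 h4 with ⟨rfl, rfl⟩ | ⟨rfl, rfl⟩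
      exacts [this, this.symm]
    refine Adj.reachable (h.adj_iff.2 ?_)
    rw [perm_of_ne h1 ?_ ?_ h4]
    · exact hxy
    · intro h2
      have h2' : s(b, β) ∈ G.edgeSet := h2 ▸ hxy
      exact h.not_bβ h2'
    · intro h2
      have h2' : s(a, γ) ∈ G.edgeSet := h2 ▸ hxy
      exact h.not_aγ h2'
  refine Connected.mk fun x y => ?_
  obtain ⟨p⟩ := h.tree.connected.preconnected x y
  induction p with
  | nil => exact Reachable.refl _
  | cons hxy _ ih => exact (hadj _ _ hxy).trans ih

-- Only the sizes of the neighbourhoods matter later, since they keep inner vertices trivalent and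
-- leaves univalent. The permutation swaps `β` and `γ` at `a` and `b`, and swaps `a` and `b` at `β`
-- and `γ`.
open Classical in
theorem neighborSet_eq (h : G.IsFlip a b β γ) (x : W) : ∃ π : Equiv.Perm W,
    (G.flipGraph a b β γ).neighborSet x = π ⁻¹' G.neighborSet x := by
  have h1 := h.ab.ne; have h2 := h.aβ.ne; have h3 := h.bγ.ne; have h4 := h.βγ
  have h5 := h.βb; have h6 := h.γa
  have hbβ : s(b, β) ∉ G.edgeSet := h.not_bβ
  have haγ : s(a, γ) ∉ G.edgeSet := h.not_aγ
  have haβ : s(a, β) ∈ G.edgeSet := h.aβ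
  have hbγ : s(b, γ) ∈ G.edgeSet := h.bγ
  have key : ∀ (π : Equiv.Perm W), (∀ y, flipPerm a b β γ s(x, y) ∈ G.edgeSet ↔ G.Adj x (π y)) →
      ∃ π : Equiv.Perm W, (G.flipGraph a b β γ).neighborSet x = π ⁻¹' G.neighborSet x :=
    fun π hπ => ⟨π, Set.ext fun y => (h.adj_iff.trans (hπ y))⟩
  by_cases hxa : x = a
  · subst hxa
    refine key (Equiv.swap β γ) fun y => ?_
    by_cases hy : y = β
    · subst hy
      rw [h.perm_aβ, Equiv.swap_apply_left]; exact iff_of_false hbβ haγ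
    by_cases hy' : y = γ
    · subst hy'
      rw [h.perm_aγ, Equiv.swap_apply_right]; exact iff_of_true hbγ haβ
    rw [Equiv.swap_apply_of_ne_of_ne hy hy', perm_of_ne]
    · rfl
    all_goals simp only [ne_eq, Sym2.eq_iff]; grind
  by_cases hxb : x = b
  · subst hxb
    refine key (Equiv.swap β γ) fun y => ?_
    by_cases hy : y = β
    · subst hy
      rw [h.perm_bβ, Equiv.swap_apply_left]; exact iff_of_true haβ hbγ
    by_cases hy' : y = γ
    · subst hy'
      rw [h.perm_bγ, Equiv.swap_apply_right]; exact iff_of_false haγ hbβ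
    rw [Equiv.swap_apply_of_ne_of_ne hy hy', perm_of_ne]
    · rfl
    all_goals simp only [ne_eq, Sym2.eq_iff]; grind
  by_cases hxβ : x = β
  · subst hxβ
    refine key (Equiv.swap a b) fun y => ?_
    by_cases hy : y = a
    · subst hy
      rw [Sym2.eq_swap, h.perm_aβ, Equiv.swap_apply_left]
      exact iff_of_false hbβ fun k => hbβ k.symm
    by_cases hy' : y = b
    · subst hy'
      rw [Sym2.eq_swap, h.perm_bβ, Equiv.swap_apply_right]; exact iff_of_true haβ h.aβ.symm
    rw [Equiv.swap_apply_of_ne_of_ne hy hy', perm_of_ne]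
    · rfl
    all_goals simp only [ne_eq, Sym2.eq_iff]; grind
  by_cases hxγ : x = γ
  · subst hxγ
    refine key (Equiv.swap a b) fun y => ?_
    by_cases hy : y = a
    · subst hy
      rw [Sym2.eq_swap, h.perm_aγ, Equiv.swap_apply_left]; exact iff_of_true hbγ h.bγ.symm
    by_cases hy' : y = b
    · subst hy'
      rw [Sym2.eq_swap, h.perm_bγ, Equiv.swap_apply_right]
      exact iff_of_false haγ fun k => haγ k.symm
    rw [Equiv.swap_apply_of_ne_of_ne hy hy', perm_of_ne]
    · rfl
    all_goals simp only [ne_eq, Sym2.eq_iff]; grind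
  · refine key (Equiv.refl W) fun y => ?_
    rw [perm_of_ne]
    · rfl
    all_goals simp only [ne_eq, Sym2.eq_iff]; grind

theorem ncard_neighborSet (h : G.IsFlip a b β γ) (x : W) :
    ((G.flipGraph a b β γ).neighborSet x).ncard = (G.neighborSet x).ncard := by
  obtain ⟨π, hπ⟩ := h.neighborSet_eq x
  rw [hπ, Set.ncard_preimage_of_injective_subset_range π.injective (by simp)]

/-- Flipping preserves the sides of all other edges. -/
theorem separates (h : G.IsFlip a b β γ) {S : Set W} (hS : a ∈ S ↔ b ∈ S) {e : Sym2 W}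
    (hsep : ∀ x y, G.Adj x y → s(x, y) ≠ e → (x ∈ S → y ∈ S)) (x y : W)
    (hxy : (G.flipGraph a b β γ).Adj x y) (hne : s(x, y) ≠ flipPerm a b β γ e) :
    x ∈ S → y ∈ S := by
  obtain ⟨x', y', h1, h2, h3⟩ := exists_flipPerm_eq hS h x y
  have h4 := h.adj_iff.1 hxy
  rw [h1] at h4
  rw [← h2, ← h3]
  refine hsep x' y' h4 fun h5 => hne ?_
  rw [← h5, ← h1, h.perm_perm]

/-- The new side of the edge between `a` and `b`. -/
theorem separates_ab (h : G.IsFlip a b β γ) (x y : W) (hxy : (G.flipGraph a b β γ).Adj x y) (hne : s(x, y) ≠ s(a, b)) :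
    x ∈ G.side a b \ G.side b γ ∪ G.side a β → y ∈ G.side a b \ G.side b γ ∪ G.side a β := by
  have hadj := h.adj_iff.1 hxy
  have hb : b ∈ G.side a b \ G.side b γ ∪ G.side a β :=
    Or.inl ⟨mem_side_self _ _, h.tree.isAcyclic.notMem_side h.bγ⟩
  have hβ : β ∈ G.side a b \ G.side b γ ∪ G.side a β := Or.inr (mem_side_self _ _)
  have ha : a ∉ G.side a b \ G.side b γ ∪ G.side a β := by
    rintro (⟨h1, -⟩ | h1)
    · exact h.tree.isAcyclic.notMem_side h.ab h1
    · exact h.tree.isAcyclic.notMem_side h.aβ h1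
  have hγ : γ ∉ G.side a b \ G.side b γ ∪ G.side a β := by
    rintro (⟨-, h1⟩ | h1)
    · exact h1 (mem_side_self _ _)
    · have h2 : γ ∈ G.side a b := by
        rw [← mem_side_iff_of_adj h.bγ (by simp [h.γa, h.ab.ne'])]
        exact mem_side_self _ _
      exact h.tree.side_disjoint h.ab h.aβ h.βb.symm h2 h1
  by_cases h1 : s(x, y) = s(a, β)
  · rw [h1, h.perm_aβ] at hadj; exact absurd hadj h.not_bβ
  by_cases h2 : s(x, y) = s(b, β)
  · rcases Sym2.eq_iff.1 h2 with ⟨rfl, rfl⟩ | ⟨rfl, rfl⟩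
    exacts [fun _ => hβ, fun _ => hb]
  by_cases h3 : s(x, y) = s(a, γ)
  · rcases Sym2.eq_iff.1 h3 with ⟨rfl, rfl⟩ | ⟨rfl, rfl⟩
    exacts [fun k => absurd k ha, fun k => absurd k hγ]
  by_cases h4 : s(x, y) = s(b, γ)
  · rw [h4, h.perm_bγ] at hadj; exact absurd hadj h.not_aγ
  rw [perm_of_ne h1 h2 h3 h4] at hadj
  simp only [Set.mem_union, Set.mem_sdiff, mem_side_iff_of_adj hadj hne,
    mem_side_iff_of_adj hadj h4, mem_side_iff_of_adj hadj h1]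
  exact id

theorem notMem_new (h : G.IsFlip a b β γ) : a ∉ G.side a b \ G.side b γ ∪ G.side a β := by
  rintro (⟨h1, -⟩ | h1)
  · exact h.tree.isAcyclic.notMem_side h.ab h1
  · exact h.tree.isAcyclic.notMem_side h.aβ h1

theorem mem_new (h : G.IsFlip a b β γ) : b ∈ G.side a b \ G.side b γ ∪ G.side a β :=
  Or.inl ⟨mem_side_self _ _, h.tree.isAcyclic.notMem_side h.bγ⟩

theorem reverse (h : G.IsFlip a b β γ) (ht : (G.flipGraph a b β γ).IsTree) :
    (G.flipGraph a b β γ).IsFlip a b γ β where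
  tree := ht
  ab := h.adj_ab
  aβ := h.adj_aγ
  bγ := h.adj_bβ
  βb := h.bγ.ne'
  γa := h.aβ.ne'

/-- Reversibility makes flipping an involution on trees with a marked edge and two chosen branches,
the basis of the double counting in `sum_treeTerm`. -/
theorem flip_flip (h : G.IsFlip a b β γ) (ht : (G.flipGraph a b β γ).IsTree) :
    (G.flipGraph a b β γ).flipGraph a b γ β = G := by
  ext x y
  rw [(h.reverse ht).adj_iff, h.mem_edgeSet_iff, h.perm_comm, h.perm_perm]
  rfl

end IsFlip

end SimpleGraph

end

/-! ### Labelled trivalent trees and the columns of their evaluation matrices -/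

section

/-- The directions of a set of leaves, a reference leaf and a family of marked leaves. -/
structure LeafData (I M : Type) [Fintype I] where
  dir : I → Fin 2 → ℤ
  base : I
  mark : M → I
  dir_sum : ∀ c, ∑ l, dir l c = 0
  -- This forces the column of a single leaf to vanish: either its direction is zero, or it
  -- separates no marked leaf from the reference leaf.
  dir_eq_zero : ∀ l, dir l = 0 ∨ l ≠ base ∧ ∀ i, mark i ≠ l

variable {U I M : Type} [Fintype U] [Fintype I] [Fintype M] [DecidableEq M] (D : LeafData I M)

namespace LeafData

/-- The total direction of a family of leaves. -/
def totalDir (χ : I → ℤ) (c : Fin 2) : ℤ := ∑ l, χ l * D.dir l c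

/-- The displacement of the marked leaves relative to the reference leaf if the leaves given
by `χ` are moved in their total direction. -/
def col (χ : I → ℤ) : M × Fin 2 → ℤ :=
  fun r => (χ (D.mark r.1) - χ D.base) * D.totalDir χ r.2

/-- Both factors change sign, the second because all directions add up to zero. Hence the column of
an edge does not depend on its orientation. -/
theorem col_compl (χ : I → ℤ) : D.col (fun l => 1 - χ l) = D.col χ := by
  funext r
  have : D.totalDir (fun l => 1 - χ l) r.2 = -D.totalDir χ r.2 := by
    simp only [totalDir, sub_mul, one_mul, Finset.sum_sub_distrib, D.dir_sum]
    ring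
  simp only [col, this]
  ring

/-- The balancing condition at a vertex of valence four. -/
theorem col_add_col_add_col {χα χβ χγ χδ : I → ℤ} (h : ∀ l, χα l + χβ l + χγ l + χδ l = 1)
    (r : M × Fin 2) :
    D.col (fun l => χγ l + χδ l) r + D.col (fun l => χδ l + χβ l) r +
      D.col (fun l => χγ l + χβ l) r = D.col χα r + D.col χβ r + D.col χγ r + D.col χδ r := by
  -- `col` is a quadratic form `Q`, and `Q(α) = Q(β + γ + δ)` by complementation. What remains is
  -- the identity `Q(β+γ) + Q(γ+δ) + Q(δ+β) = Q(β+γ+δ) + Q(β) + Q(γ) + Q(δ)`, valid for every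
  -- quadratic form.
  have h1 : ∀ l, χα l = 1 - χβ l - χγ l - χδ l := fun l => by linarith [h l]
  have h2 : D.totalDir χα r.2 =
      -D.totalDir χβ r.2 - D.totalDir χγ r.2 - D.totalDir χδ r.2 := by
    simp only [totalDir, h1, sub_mul, one_mul, Finset.sum_sub_distrib, D.dir_sum]
    ring
  have h3 : ∀ χ ψ : I → ℤ, D.totalDir (fun l => χ l + ψ l) r.2 =
      D.totalDir χ r.2 + D.totalDir ψ r.2 := fun χ ψ => by
    simp only [totalDir, add_mul, Finset.sum_add_distrib]
  simp only [col, h3, h2, h1]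
  ring

end LeafData

open Classical in
/-- The indicator function of the leaves in a set of vertices. -/
noncomputable def leafInd (S : Set (U ⊕ I)) (l : I) : ℤ := if Sum.inr l ∈ S then 1 else 0

/-- A trivalent tree with inner vertices `U` and leaves `I`. -/
structure IsTri (G : SimpleGraph (U ⊕ I)) : Prop where
  connected : G.Connected
  inner : ∀ u, (G.neighborSet (Sum.inl u)).ncard = 3
  leaf : ∀ l, (G.neighborSet (Sum.inr l)).ncard = 1

namespace IsTri

variable {G : SimpleGraph (U ⊕ I)}

/-- The degrees add up to `3|U| + |I|`, which for `|I| = |U| + 2` leaves one edge less than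
vertices. A connected graph with this count is a tree. -/
theorem isTree (hG : IsTri G) (hcard : Fintype.card U + 2 = Fintype.card I) : G.IsTree := by
  classical
  rw [SimpleGraph.isTree_iff_connected_and_card]
  refine ⟨hG.connected, ?_⟩
  have h1 := G.sum_degrees_eq_twice_card_edges
  have h3 : ∀ u, G.degree u = (G.neighborSet u).ncard := by
    intro u
    rw [← G.card_neighborSet_eq_degree, Set.ncard_eq_toFinset_card', Set.toFinset_card]
  simp only [h3, Fintype.sum_sum_type, hG.inner, hG.leaf, Finset.sum_const, Finset.card_univ,
    smul_eq_mul, mul_one] at h1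
  rw [Nat.card_eq_fintype_card, Nat.card_eq_fintype_card, Fintype.card_sum,
    ← SimpleGraph.edgeFinset_card]
  lia

/-- Two adjacent leaves would form a whole connected component, leaving no room for an inner vertex.
-/
theorem exists_nbr [Nonempty U] (hG : IsTri G) (l : I) :
    ∃ u, ∀ x, G.Adj (Sum.inr l) x ↔ x = Sum.inl u := by
  obtain ⟨x, hx⟩ := Set.ncard_eq_one.1 (hG.leaf l)
  have hadj : ∀ y, G.Adj (Sum.inr l) y ↔ y = x := by
    intro y
    have : y ∈ G.neighborSet (Sum.inr l) ↔ y ∈ ({x} : Set _) := by rw [hx]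
    simpa using this
  rcases x with u | l'
  · exact ⟨u, hadj⟩
  · exfalso
    obtain ⟨x', hx'⟩ := Set.ncard_eq_one.1 (hG.leaf l')
    have hadj' : ∀ y, G.Adj (Sum.inr l') y ↔ y = x' := by
      intro y
      have : y ∈ G.neighborSet (Sum.inr l') ↔ y ∈ ({x'} : Set _) := by rw [hx']
      simpa using this
    have hl : x' = Sum.inr l := ((hadj' _).1 ((hadj _).2 rfl).symm).symm
    subst hl
    have := hG.connected.eq_of_forall_adj (φ := fun x => x = Sum.inr l ∨ x = Sum.inr l')
      (fun x y hxy => by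
        refine propext ⟨?_, ?_⟩
        · rintro (rfl | rfl)
          · exact Or.inr ((hadj _).1 hxy.symm)
          · exact Or.inl ((hadj' _).1 hxy.symm)
        · rintro (rfl | rfl)
          · exact Or.inr ((hadj _).1 hxy)
          · exact Or.inl ((hadj' _).1 hxy)) (Sum.inr l) (Sum.inl (Classical.arbitrary U))
    simp at this

/-- The inner vertex adjacent to a leaf. -/
noncomputable def nbr [Nonempty U] (hG : IsTri G) (l : I) : U := (hG.exists_nbr l).choose

theorem adj_leaf_iff [Nonempty U] (hG : IsTri G) (l : I) (x : U ⊕ I) :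
    G.Adj (Sum.inr l) x ↔ x = Sum.inl (hG.nbr l) := (hG.exists_nbr l).choose_spec x

theorem side_leaf [Nonempty U] (hG : IsTri G) {u : U} {l : I}
    (h : G.Adj (Sum.inl u) (Sum.inr l)) : G.side (Sum.inl u) (Sum.inr l) = {Sum.inr l} := by
  refine (hG.connected.eq_side (by simp) (by simp) ?_).symm
  rintro x y hxy hne rfl
  have h1 := (hG.adj_leaf_iff l _).1 h.symm
  have h2 := (hG.adj_leaf_iff l _).1 hxy
  rw [h2, h1] at hne
  exact absurd Sym2.eq_swap hne

theorem comap_isTree [Nonempty U] (hG : IsTri G) (hcard : Fintype.card U + 2 = Fintype.card I) :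
    (G.comap Sum.inl : SimpleGraph U).IsTree where
  isAcyclic := (hG.isTree hcard).isAcyclic.of_comap ⟨Sum.inl, Sum.inl_injective⟩
  connected := by
    refine SimpleGraph.Connected.mk fun u v => ?_
    have key : ∀ {x y}, G.Walk x y → (G.comap Sum.inl : SimpleGraph U).Reachable
        (Sum.elim id hG.nbr x) (Sum.elim id hG.nbr y) := by
      intro x y p
      induction p with
      | nil => exact SimpleGraph.Reachable.refl _
      | @cons x y z hxy _ ih =>
        refine SimpleGraph.Reachable.trans ?_ ih
        rcases x with u | l
        · rcases y with v | l'
          · exact SimpleGraph.Adj.reachable hxy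
          · have := (hG.adj_leaf_iff _ _).1 hxy.symm
            rw [Sum.inl.injEq] at this
            simp [this]
        · rw [(hG.adj_leaf_iff _ _).1 hxy]
          exact SimpleGraph.Reachable.refl _
    obtain ⟨p⟩ := hG.connected.preconnected (Sum.inl u) (Sum.inl v)
    exact key p

end IsTri

/-- An edge between inner vertices. -/
def IsInnerEdge (G : SimpleGraph (U ⊕ I)) (e : Sym2 (U ⊕ I)) : Prop :=
  e ∈ G.edgeSet ∧ ∀ l, Sum.inr l ∉ e

/-- The inner edges are the edges of the tree of inner vertices. -/
noncomputable def innerEdgeEquiv (G : SimpleGraph (U ⊕ I)) :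
    (G.comap Sum.inl : SimpleGraph U).edgeSet ≃ {e // IsInnerEdge G e} :=
  Equiv.ofBijective
    (fun f => ⟨Sym2.map Sum.inl f.1, by
      obtain ⟨f, hf⟩ := f
      induction f with
      | _ u v => exact ⟨hf, by simp⟩⟩)
    (by
      constructor
      · intro f g h
        exact Subtype.ext (Sym2.map.injective Sum.inl_injective (congrArg Subtype.val h))
      · rintro ⟨e, he, hl⟩
        induction e with
        | _ x y =>
          rcases x with u | l
          · rcases y with v | l'
            · exact ⟨⟨s(u, v), he⟩, rfl⟩
            · exact absurd (by simp) (hl l')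
          · exact absurd (by simp) (hl l))

theorem innerEdgeEquiv_coe (G : SimpleGraph (U ⊕ I))
    (f : (G.comap Sum.inl : SimpleGraph U).edgeSet) :
    (innerEdgeEquiv G f : Sym2 (U ⊕ I)) = Sym2.map Sum.inl f.1 := rfl

/-- The column of the evaluation matrix belonging to an edge. -/
noncomputable def edgeCol (G : SimpleGraph (U ⊕ I)) (e : Sym2 (U ⊕ I)) : M × Fin 2 → ℤ :=
  D.col (leafInd (G.side (Quot.out e).1 (Quot.out e).2))

theorem leafInd_compl (S : Set (U ⊕ I)) : leafInd Sᶜ = fun l => 1 - leafInd S l := by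
  funext l
  by_cases h : Sum.inr l ∈ S <;> simp [leafInd, h]

theorem edgeCol_mk {G : SimpleGraph (U ⊕ I)} (hG : G.IsTree) {x y : U ⊕ I} (h : G.Adj x y) :
    edgeCol D G s(x, y) = D.col (leafInd (G.side x y)) := by
  unfold edgeCol
  have : s((Quot.out s(x, y)).1, (Quot.out s(x, y)).2) = s(x, y) := Quot.out_eq _
  rcases Sym2.eq_iff.1 this with ⟨h1, h2⟩ | ⟨h1, h2⟩
  · rw [h1, h2]
  · rw [h1, h2, ← hG.side_compl h, leafInd_compl, D.col_compl]

theorem edgeCol_eq {G : SimpleGraph (U ⊕ I)} (hG : G.IsTree) {S : Set (U ⊕ I)} {x y : U ⊕ I}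
    (h : G.Adj x y) (hx : x ∉ S) (hy : y ∈ S)
    (hS : ∀ p q, G.Adj p q → s(p, q) ≠ s(x, y) → (p ∈ S → q ∈ S)) :
    edgeCol D G s(x, y) = D.col (leafInd S) := by
  rw [edgeCol_mk D hG h, hG.connected.eq_side hx hy hS]

/-- The evaluation matrix of a tree, with columns labelled by means of `ε`. -/
noncomputable def triMatrix (G : SimpleGraph (U ⊕ I)) (ε : M × Fin 2 ≃ {e // IsInnerEdge G e}) :
    Matrix (M × Fin 2) (M × Fin 2) ℝ :=
  Matrix.of fun r x => (edgeCol D G (ε x) r : ℝ)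

section WallTerm

variable {R : Type} [Fintype R] [DecidableEq R]

/-- `q` lies on the wall `x` of the cone given by `A`. -/
def OnWall (A : Matrix R R ℝ) (x : R) (q : R → ℝ) : Prop :=
  ∃ y : R → ℝ, y x = 0 ∧ (∀ s, s ≠ x → 0 < y s) ∧ A.mulVec y = q

open Classical in
/-- The signed multiplicity of a cone adjacent to a wall. -/
noncomputable def wallTerm (A : Matrix R R ℝ) (x : R) (q v : R → ℝ) : ℝ :=
  if OnWall A x q then A.det * SignType.sign (A.updateCol x v).det else 0

/-- On the wall the coordinate `x` is zero and its column is not used. This is why the cones of the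
three flipped trees share the wall. -/
theorem onWall_updateCol (A : Matrix R R ℝ) (x : R) (q c : R → ℝ) :
    OnWall (A.updateCol x c) x q ↔ OnWall A x q := by
  refine exists_congr fun y => and_congr_right fun hy => and_congr_right fun _ => ?_
  have : (A.updateCol x c).mulVec y = A.mulVec y := by
    funext i
    simp only [Matrix.mulVec, dotProduct]
    refine Finset.sum_congr rfl fun j _ => ?_
    by_cases h : j = x
    · rw [h, hy, mul_zero, mul_zero]
    · rw [Matrix.updateCol_ne h]
  rw [this]

/-- Both determinants change by the sign of `π`, so their signed product does not. The numbering of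
the edges can therefore be chosen freely for each tree. -/
theorem wallTerm_submatrix (A : Matrix R R ℝ) (π : Equiv.Perm R) (x : R) (q v : R → ℝ) :
    wallTerm (A.submatrix id π) x q v = wallTerm A (π x) q v := by
  classical
  have h1 : OnWall (A.submatrix id π) x q ↔ OnWall A (π x) q := by
    have hmul : ∀ y : R → ℝ, (A.submatrix id π).mulVec (y ∘ π) = A.mulVec y := by
      intro y
      funext i
      simp only [Matrix.mulVec, dotProduct, Matrix.submatrix_apply, id, Function.comp]
      exact Equiv.sum_comp π (fun j => A i j * y j)
    constructor
    · rintro ⟨y, h1, h2, h3⟩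
      refine ⟨y ∘ π.symm, by simpa using h1, fun s hs => h2 _ fun h => hs ?_, ?_⟩
      · rw [← h]; simp
      · rw [← hmul, ← h3]
        congr 1
        funext i; simp
    · rintro ⟨y, h1, h2, h3⟩
      exact ⟨y ∘ π, h1, fun s hs => h2 _ fun h => hs (π.injective h), (hmul y).trans h3⟩
  have h2 : (A.submatrix id π).updateCol x v = (A.updateCol (π x) v).submatrix id π := by
    ext i j
    by_cases h : j = x
    · subst h; simp
    · simp [Matrix.updateCol_ne h, Matrix.updateCol_ne (π.injective.ne h)]
  unfold wallTerm
  rw [h2, Matrix.det_permute', Matrix.det_permute']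
  simp only [h1]
  split_ifs
  · rcases Int.units_eq_one_or (Equiv.Perm.sign π) with h | h <;> simp [h, Left.sign_neg]
  · rfl

theorem wallTerm_updateCol (A : Matrix R R ℝ) (x : R) (c q v : R → ℝ) :
    wallTerm (A.updateCol x c) x q v = open Classical in
      if OnWall A x q then (A.updateCol x c).det * SignType.sign (A.updateCol x v).det else 0 := by
  classical
  unfold wallTerm
  rw [Matrix.updateCol_idem]
  exact if_congr (onWall_updateCol A x q c) rfl rfl

end WallTerm

open Classical in
/-- The signed multiplicity of the edge `e` of the tree `G`. -/
noncomputable def treeTerm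
    (ε : ∀ G : SimpleGraph (U ⊕ I), IsTri G → M × Fin 2 ≃ {e // IsInnerEdge G e})
    (q v : M × Fin 2 → ℝ) (G : SimpleGraph (U ⊕ I)) (e : Sym2 (U ⊕ I)) : ℝ :=
  if h : IsTri G ∧ IsInnerEdge G e then
    wallTerm (triMatrix D G (ε G h.1)) ((ε G h.1).symm ⟨e, h.2⟩) q v else 0

theorem treeTerm_eq
    (ε : ∀ G : SimpleGraph (U ⊕ I), IsTri G → M × Fin 2 ≃ {e // IsInnerEdge G e})
    (q v : M × Fin 2 → ℝ) {G : SimpleGraph (U ⊕ I)} (hG : IsTri G) {e : Sym2 (U ⊕ I)}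
    (he : IsInnerEdge G e) (ε' : M × Fin 2 ≃ {e // IsInnerEdge G e}) :
    treeTerm D ε q v G e = wallTerm (triMatrix D G ε') (ε'.symm ⟨e, he⟩) q v := by
  unfold treeTerm
  rw [dif_pos ⟨hG, he⟩]
  have h1 : triMatrix D G ε' = (triMatrix D G (ε G hG)).submatrix id (ε'.trans (ε G hG).symm) := by
    ext i j; simp [triMatrix]
  rw [h1, wallTerm_submatrix]
  simp only [Equiv.trans_apply, Equiv.apply_symm_apply]

end

/-! ### Cancellation of the three cones at a wall -/

section

variable {U I M : Type} [Fintype U] [Fintype I] [Fintype M] [DecidableEq M] (D : LeafData I M)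

namespace SimpleGraph.IsFlip

variable {G : SimpleGraph (U ⊕ I)} {a b : U} {β γ : U ⊕ I}

theorem isTri (h : G.IsFlip (Sum.inl a) (Sum.inl b) β γ) (hG : IsTri G) :
    IsTri (G.flipGraph (Sum.inl a) (Sum.inl b) β γ) where
  connected := h.connected
  inner u := by rw [h.ncard_neighborSet, hG.inner]
  leaf l := by rw [h.ncard_neighborSet, hG.leaf]

theorem mem_flipPerm_iff (h : G.IsFlip (Sum.inl a) (Sum.inl b) β γ) (e : Sym2 (U ⊕ I)) (l : I) :
    Sum.inr l ∈ flipPerm (Sum.inl a) (Sum.inl b) β γ e ↔ Sum.inr l ∈ e := by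
  by_cases h1 : e = s(Sum.inl a, β)
  · rw [h1, h.perm_aβ]; simp
  by_cases h2 : e = s(Sum.inl b, β)
  · rw [h2, h.perm_bβ]; simp
  by_cases h3 : e = s(Sum.inl a, γ)
  · rw [h3, h.perm_aγ]; simp
  by_cases h4 : e = s(Sum.inl b, γ)
  · rw [h4, h.perm_bγ]; simp
  rw [perm_of_ne h1 h2 h3 h4]

/-- The correspondence of the inner edges of a tree and of the flipped tree. -/
noncomputable def innerEquiv (h : G.IsFlip (Sum.inl a) (Sum.inl b) β γ) :
    {e // IsInnerEdge G e} ≃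
      {e // IsInnerEdge (G.flipGraph (Sum.inl a) (Sum.inl b) β γ) e} :=
  (flipPerm (Sum.inl a) (Sum.inl b) β γ).subtypeEquiv fun e => by
    unfold IsInnerEdge
    rw [h.mem_edgeSet_iff, h.perm_perm]
    simp only [h.mem_flipPerm_iff]

/-- Every edge other than the one between `a` and `b` has both of these vertices on the same side,
so it separates the same leaves before and after the flip. -/
theorem edgeCol_flip (h : G.IsFlip (Sum.inl a) (Sum.inl b) β γ)
    (ht : (G.flipGraph (Sum.inl a) (Sum.inl b) β γ).IsTree) {e : Sym2 (U ⊕ I)}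
    (he : e ∈ G.edgeSet) (hne : e ≠ s(Sum.inl a, Sum.inl b)) :
    edgeCol D (G.flipGraph (Sum.inl a) (Sum.inl b) β γ)
      (flipPerm (Sum.inl a) (Sum.inl b) β γ e) = edgeCol D G e := by
  induction e with
  | _ x y =>
    have hxy : G.Adj x y := he
    rw [edgeCol_mk D h.tree hxy]
    have hS : Sum.inl a ∈ G.side x y ↔ Sum.inl b ∈ G.side x y :=
      mem_side_iff_of_adj h.ab hne.symm
    obtain ⟨x', y', h1, h2, h3⟩ := exists_flipPerm_eq hS h x y
    rw [h1]
    refine edgeCol_eq D ht ?_ ?_ ?_ fun p q hpq hpq' => ?_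
    · rw [h.adj_iff, ← h1, h.perm_perm]; exact hxy
    · rw [h2]; exact h.tree.isAcyclic.notMem_side hxy
    · rw [h3]; exact mem_side_self _ _
    · rw [← h1] at hpq'
      exact h.separates hS (fun x y hxy hne => (mem_side_iff_of_adj hxy hne).1) p q hpq hpq'

theorem edgeCol_flip_self (h : G.IsFlip (Sum.inl a) (Sum.inl b) β γ)
    (ht : (G.flipGraph (Sum.inl a) (Sum.inl b) β γ).IsTree) :
    edgeCol D (G.flipGraph (Sum.inl a) (Sum.inl b) β γ) s(Sum.inl a, Sum.inl b) =
      D.col (leafInd (G.side (Sum.inl a) (Sum.inl b) \ G.side (Sum.inl b) γ ∪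
        G.side (Sum.inl a) β)) :=
  edgeCol_eq D ht h.adj_ab h.notMem_new h.mem_new h.separates_ab

/-- The evaluation matrix of the flipped tree. -/
theorem triMatrix_flip (h : G.IsFlip (Sum.inl a) (Sum.inl b) β γ)
    (ht : (G.flipGraph (Sum.inl a) (Sum.inl b) β γ).IsTree)
    (ε : M × Fin 2 ≃ {e // IsInnerEdge G e}) (he : IsInnerEdge G s(Sum.inl a, Sum.inl b)) :
    triMatrix D (G.flipGraph (Sum.inl a) (Sum.inl b) β γ) (ε.trans h.innerEquiv) =
      (triMatrix D G ε).updateCol (ε.symm ⟨_, he⟩) fun r =>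
        (D.col (leafInd (G.side (Sum.inl a) (Sum.inl b) \ G.side (Sum.inl b) γ ∪
        G.side (Sum.inl a) β)) r : ℝ) := by
  ext r x
  by_cases hx : x = ε.symm ⟨_, he⟩
  · subst hx
    rw [Matrix.updateCol_self]
    simp only [triMatrix, Matrix.of_apply, Equiv.trans_apply, Equiv.apply_symm_apply]
    have : ((h.innerEquiv ⟨_, he⟩ : {e // IsInnerEdge _ e}) : Sym2 (U ⊕ I)) =
        s(Sum.inl a, Sum.inl b) := h.perm_ab
    rw [this, h.edgeCol_flip_self D ht]
  · rw [Matrix.updateCol_ne hx]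
    simp only [triMatrix, Matrix.of_apply, Equiv.trans_apply]
    have h1 : ((h.innerEquiv (ε x) : {e // IsInnerEdge _ e}) : Sym2 (U ⊕ I)) =
        flipPerm (Sum.inl a) (Sum.inl b) β γ (ε x) := rfl
    rw [h1, h.edgeCol_flip D ht (ε x).2.1]
    intro h2
    refine hx ?_
    rw [Equiv.eq_symm_apply]
    exact Subtype.ext h2

theorem innerEquiv_symm (h : G.IsFlip (Sum.inl a) (Sum.inl b) β γ)
    (ε : M × Fin 2 ≃ {e // IsInnerEdge G e}) (he : IsInnerEdge G s(Sum.inl a, Sum.inl b))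
    (he' : IsInnerEdge (G.flipGraph (Sum.inl a) (Sum.inl b) β γ) s(Sum.inl a, Sum.inl b)) :
    (ε.trans h.innerEquiv).symm ⟨_, he'⟩ = ε.symm ⟨_, he⟩ := by
  rw [Equiv.symm_apply_eq]
  simp only [Equiv.trans_apply, Equiv.apply_symm_apply]
  exact Subtype.ext h.perm_ab.symm

end SimpleGraph.IsFlip

open SimpleGraph

/-- The column of a flag at an inner edge other than `e` already occurs in the matrix, which
produces a repeated column. At a leaf the column is zero. -/
theorem det_updateCol_flag [Nonempty U] {G : SimpleGraph (U ⊕ I)} (hG : IsTri G) (ht : G.IsTree)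
    (ε : M × Fin 2 ≃ {e // IsInnerEdge G e}) (e : {e // IsInnerEdge G e}) {a : U} {w : U ⊕ I}
    (h : G.Adj (Sum.inl a) w) (hne : s(Sum.inl a, w) ≠ e) :
    ((triMatrix D G ε).updateCol (ε.symm e) fun r =>
      (D.col (leafInd (G.side (Sum.inl a) w)) r : ℝ)).det = 0 := by
  rcases w with w | l
  · let e' : {e // IsInnerEdge G e} := ⟨s(Sum.inl a, Sum.inl w), h, by simp⟩
    have hx : ε.symm e ≠ ε.symm e' := by
      rw [ε.symm.injective.ne_iff]
      intro h1
      exact hne (congrArg Subtype.val h1).symm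
    refine Matrix.det_zero_of_column_eq hx fun r => ?_
    rw [Matrix.updateCol_self, Matrix.updateCol_ne hx.symm]
    simp only [triMatrix, Matrix.of_apply, Equiv.apply_symm_apply, e', edgeCol_mk D ht h]
  · rw [hG.side_leaf h]
    have hz : D.col (leafInd ({Sum.inr l} : Set (U ⊕ I))) = 0 := by
      classical
      funext r
      have h1 : D.totalDir (leafInd ({Sum.inr l} : Set (U ⊕ I))) r.2 = D.dir l r.2 := by
        simp [LeafData.totalDir, leafInd]
      rcases D.dir_eq_zero l with h2 | ⟨h2, h3⟩
      · simp [LeafData.col, h1, h2]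
      · simp [LeafData.col, leafInd, h2.symm, h3]
    refine Matrix.det_eq_zero_of_column_eq_zero (ε.symm e) fun r => ?_
    rw [Matrix.updateCol_self, hz]
    simp

theorem leafInd_of_disjoint_union {S T : Set (U ⊕ I)} (l : I)
    (h : Sum.inr l ∈ S → Sum.inr l ∉ T) : leafInd (S ∪ T) l = leafInd S l + leafInd T l := by
  by_cases h1 : (Sum.inr l : U ⊕ I) ∈ S
  · simp [leafInd, h1, h h1]
  · by_cases h2 : (Sum.inr l : U ⊕ I) ∈ T <;> simp [leafInd, h1, h2]

/-- The signed multiplicities of the three trees adjacent to a wall cancel. -/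
theorem treeTerm_add [Nonempty U] (hcard : Fintype.card U + 2 = Fintype.card I)
    (ε : ∀ G : SimpleGraph (U ⊕ I), IsTri G → M × Fin 2 ≃ {e // IsInnerEdge G e})
    (q v : M × Fin 2 → ℝ) {G : SimpleGraph (U ⊕ I)} (hG : IsTri G) {a b : U} {α β γ γ' : U ⊕ I}
    (h : G.IsFlip (Sum.inl a) (Sum.inl b) β γ) (h' : G.IsFlip (Sum.inl a) (Sum.inl b) β γ')
    (hγ : γ ≠ γ') (hα : α ≠ β) (ha : ∀ x, G.Adj (Sum.inl a) x ↔ x = Sum.inl b ∨ x = α ∨ x = β)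
    (hα' : α ≠ Sum.inl b)
    (hb : ∀ x, G.Adj (Sum.inl b) x ↔ x = Sum.inl a ∨ x = γ ∨ x = γ') :
    treeTerm D ε q v G s(Sum.inl a, Sum.inl b) +
      treeTerm D ε q v (G.flipGraph (Sum.inl a) (Sum.inl b) β γ) s(Sum.inl a, Sum.inl b) +
      treeTerm D ε q v (G.flipGraph (Sum.inl a) (Sum.inl b) β γ') s(Sum.inl a, Sum.inl b) = 0 := by
  classical
  have ht := h.tree
  have he : IsInnerEdge G s(Sum.inl a, Sum.inl b) := ⟨h.ab, by simp⟩
  have he1 : IsInnerEdge (G.flipGraph (Sum.inl a) (Sum.inl b) β γ) s(Sum.inl a, Sum.inl b) :=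
    ⟨h.adj_ab, by simp⟩
  have he2 : IsInnerEdge (G.flipGraph (Sum.inl a) (Sum.inl b) β γ') s(Sum.inl a, Sum.inl b) :=
    ⟨h'.adj_ab, by simp⟩
  have ht1 := (h.isTri hG).isTree hcard
  have ht2 := (h'.isTri hG).isTree hcard
  rw [treeTerm_eq D ε q v hG he (ε G hG),
    treeTerm_eq D ε q v (h.isTri hG) he1 ((ε G hG).trans h.innerEquiv),
    treeTerm_eq D ε q v (h'.isTri hG) he2 ((ε G hG).trans h'.innerEquiv),
    h.triMatrix_flip D ht1 (ε G hG) he, h'.triMatrix_flip D ht2 (ε G hG) he,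
    h.innerEquiv_symm (ε G hG) he, h'.innerEquiv_symm (ε G hG) he, wallTerm_updateCol,
    wallTerm_updateCol]
  set x := (ε G hG).symm ⟨_, he⟩ with hx
  set A := triMatrix D G (ε G hG) with hA
  have hself : A.updateCol x (fun r =>
      (D.col (leafInd (G.side (Sum.inl a) (Sum.inl b))) r : ℝ)) = A := by
    have : (fun r => (D.col (leafInd (G.side (Sum.inl a) (Sum.inl b))) r : ℝ)) =
        fun r => A r x := by
      funext r
      simp only [hA, hx, triMatrix, Matrix.of_apply, Equiv.apply_symm_apply, edgeCol_mk D ht h.ab]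
    rw [this, Matrix.updateCol_eq_self]
  rw [wallTerm]
  by_cases hw : OnWall A x q
  swap
  · simp [hw]
  simp only [if_pos hw]
  -- Once column `x` is replaced by `v` the three matrices coincide, so the sign is a common factor.
  -- The three determinants combine, by linearity in column `x`, into one with the sum of the three
  -- columns.
  rw [← add_mul, ← add_mul]
  refine mul_eq_zero_of_left ?_ _
  conv_lhs => enter [1, 1]; rw [← hself]
  rw [← Matrix.det_updateCol_add, ← Matrix.det_updateCol_add]
  -- membership of the leaves in the four branches
  have haα : G.Adj (Sum.inl a) α := (ha _).2 (Or.inr (Or.inl rfl))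
  have hsub : ∀ {δ}, G.Adj (Sum.inl b) δ → δ ≠ Sum.inl a → ∀ {y}, y ∈ G.side (Sum.inl b) δ →
      y ∈ G.side (Sum.inl a) (Sum.inl b) := by
    intro δ hδ hδa y hy
    by_contra hcon
    have : y ∈ G.side (Sum.inl b) (Sum.inl a) := by
      rw [← ht.side_compl h.ab]; exact hcon
    exact ht.side_disjoint hδ h.ab.symm hδa hy this
  have hpart : ∀ l : I, leafInd (G.side (Sum.inl a) α) l + leafInd (G.side (Sum.inl a) β) l +
      leafInd (G.side (Sum.inl b) γ) l + leafInd (G.side (Sum.inl b) γ') l = 1 ∧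
      leafInd (G.side (Sum.inl a) (Sum.inl b)) l =
        leafInd (G.side (Sum.inl b) γ) l + leafInd (G.side (Sum.inl b) γ') l := by
    intro l
    obtain ⟨w, hw1, hw2⟩ := ht.exists_mem_side (u := Sum.inl a) (x := Sum.inr l) (by simp)
    have hnot : ∀ w', G.Adj (Sum.inl a) w' → w' ≠ w → Sum.inr l ∉ G.side (Sum.inl a) w' :=
      fun w' h1 h2 => ht.side_disjoint hw1 h1 h2.symm hw2
    rcases (ha w).1 hw1 with rfl | rfl | rfl
    · obtain ⟨z, hz1, hz2⟩ := ht.exists_mem_side (u := Sum.inl b) (x := Sum.inr l) (by simp)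
      have hnot' : ∀ w', G.Adj (Sum.inl b) w' → w' ≠ z → Sum.inr l ∉ G.side (Sum.inl b) w' :=
        fun w' h1 h2 => ht.side_disjoint hz1 h1 h2.symm hz2
      have n1 := hnot α haα hα'
      have n2 := hnot β h.aβ h.βb
      rcases (hb z).1 hz1 with rfl | rfl | rfl
      · rw [← ht.side_compl h.ab] at hz2
        exact absurd hw2 hz2
      · have n3 := hnot' γ' h'.bγ hγ.symm
        simp [leafInd, n1, n2, n3, hz2, hw2]
      · have n3 := hnot' γ h.bγ hγ
        simp [leafInd, n1, n2, n3, hz2, hw2]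
    · have n1 := hnot β h.aβ hα.symm
      have n2 := hnot _ h.ab hα'.symm
      have n3 : Sum.inr l ∉ G.side (Sum.inl b) γ := fun k => n2 (hsub h.bγ h.γa k)
      have n4 : Sum.inr l ∉ G.side (Sum.inl b) γ' := fun k => n2 (hsub h'.bγ h'.γa k)
      simp [leafInd, n1, n2, n3, n4, hw2]
    · have n1 := hnot α haα hα
      have n2 := hnot _ h.ab h.βb.symm
      have n3 : Sum.inr l ∉ G.side (Sum.inl b) γ := fun k => n2 (hsub h.bγ h.γa k)
      have n4 : Sum.inr l ∉ G.side (Sum.inl b) γ' := fun k => n2 (hsub h'.bγ h'.γa k)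
      simp [leafInd, n1, n2, n3, n4, hw2]
  have hdiff : ∀ {δ δ'}, G.Adj (Sum.inl b) δ → δ ≠ Sum.inl a → (∀ l : I,
      leafInd (G.side (Sum.inl a) (Sum.inl b)) l =
        leafInd (G.side (Sum.inl b) δ) l + leafInd (G.side (Sum.inl b) δ') l) →
      leafInd (G.side (Sum.inl a) (Sum.inl b) \ G.side (Sum.inl b) δ ∪ G.side (Sum.inl a) β) =
        fun l => leafInd (G.side (Sum.inl b) δ') l + leafInd (G.side (Sum.inl a) β) l := by
    intro δ δ' hδ hδa hl
    funext l
    rw [leafInd_of_disjoint_union]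
    · congr 1
      have h2 := hl l
      by_cases k1 : (Sum.inr l : U ⊕ I) ∈ G.side (Sum.inl b) δ
      · have k2 := hsub hδ hδa k1
        simp [leafInd, k1, k2] at h2 ⊢
        exact h2
      · by_cases k2 : (Sum.inr l : U ⊕ I) ∈ G.side (Sum.inl a) (Sum.inl b)
        · simp [leafInd, k1, k2] at h2 ⊢
          exact h2
        · simp [leafInd, k1, k2] at h2 ⊢
          exact h2
    · exact fun k => ht.side_disjoint h.ab h.aβ h.βb.symm k.1
  -- The four branches partition the leaves, so polarisation rewrites the sum of the three columns
  -- as the columns of the four flags. Each of them makes the determinant vanish.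
  have hcol : ((fun r => (D.col (leafInd (G.side (Sum.inl a) (Sum.inl b))) r : ℝ)) +
      (fun r => (D.col (leafInd (G.side (Sum.inl a) (Sum.inl b) \ G.side (Sum.inl b) γ ∪
        G.side (Sum.inl a) β)) r : ℝ)) +
      fun r => (D.col (leafInd (G.side (Sum.inl a) (Sum.inl b) \ G.side (Sum.inl b) γ' ∪
        G.side (Sum.inl a) β)) r : ℝ)) =
      (fun r => (D.col (leafInd (G.side (Sum.inl a) α)) r : ℝ)) +
      (fun r => (D.col (leafInd (G.side (Sum.inl a) β)) r : ℝ)) +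
      (fun r => (D.col (leafInd (G.side (Sum.inl b) γ)) r : ℝ)) +
      fun r => (D.col (leafInd (G.side (Sum.inl b) γ')) r : ℝ) := by
    funext r
    have := D.col_add_col_add_col (fun l => (hpart l).1) r
    rw [hdiff h.bγ h.γa (fun l => (hpart l).2),
      hdiff h'.bγ h'.γa (fun l => ((hpart l).2.trans (add_comm _ _))),
      show leafInd (G.side (Sum.inl a) (Sum.inl b)) = _ from funext fun l => (hpart l).2]
    simp only [Pi.add_apply]
    exact_mod_cast this
  rw [hcol, Matrix.det_updateCol_add, Matrix.det_updateCol_add, Matrix.det_updateCol_add,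
    det_updateCol_flag D hG ht (ε G hG) ⟨_, he⟩ haα
      (fun k => hα' (Sym2.congr_right.1 k)),
    det_updateCol_flag D hG ht (ε G hG) ⟨_, he⟩ h.aβ
      (fun k => h.βb (Sym2.congr_right.1 k)),
    det_updateCol_flag D hG ht (ε G hG) ⟨_, he⟩ h.bγ
      (by rw [ne_eq, Sym2.eq_iff]; simp [h.γa, h.ab.ne']),
    det_updateCol_flag D hG ht (ε G hG) ⟨_, he⟩ h'.bγ
      (by rw [ne_eq, Sym2.eq_iff]; simp [h'.γa, h.ab.ne'])]
  simp

theorem Set.exists_of_ncard_eq_three {α : Type*} {s : Set α} (hs : s.ncard = 3) {b : α}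
    (hb : b ∈ s) : ∃ x y, x ≠ y ∧ x ≠ b ∧ y ≠ b ∧ ∀ z, z ∈ s ↔ z = b ∨ z = x ∨ z = y := by
  obtain ⟨p, q, r, h1, h2, h3, rfl⟩ := Set.ncard_eq_three.1 hs
  simp only [Set.mem_insert_iff, Set.mem_singleton_iff] at hb ⊢
  rcases hb with rfl | rfl | rfl
  · exact ⟨q, r, h3, h1.symm, h2.symm, by tauto⟩
  · exact ⟨p, r, h2, h1, h3.symm, by tauto⟩
  · exact ⟨p, q, h1, h2, h3, by tauto⟩

/-- The signed multiplicities of all trees with a marked edge cancel. -/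
theorem sum_treeTerm [Nonempty U] (hcard : Fintype.card U + 2 = Fintype.card I)
    (ε : ∀ G : SimpleGraph (U ⊕ I), IsTri G → M × Fin 2 ≃ {e // IsInnerEdge G e})
    (q v : M × Fin 2 → ℝ) [Fintype (SimpleGraph (U ⊕ I))] [Fintype (Sym2 (U ⊕ I))] :
    ∑ G : SimpleGraph (U ⊕ I), ∑ e, treeTerm D ε q v G e = 0 := by
  classical
  let f := treeTerm D ε q v
  -- Double counting over a tree, an inner edge and one branch at each of its ends. There are four
  -- choices of branches, while the wall relation, used once for each branch at `a`, gives `-2`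
  -- times the term of the tree for the sum over its flips. Since flipping is an involution, the
  -- total `S` satisfies `4S = -2S`.
  let P : SimpleGraph (U ⊕ I) × Sym2 (U ⊕ I) × (U ⊕ I) × (U ⊕ I) → Prop := fun x =>
    IsTri x.1 ∧ IsInnerEdge x.1 x.2.1 ∧
      x.1.IsFlip (Quot.out x.2.1).1 (Quot.out x.2.1).2 x.2.2.1 x.2.2.2
  let flip : SimpleGraph (U ⊕ I) × Sym2 (U ⊕ I) × (U ⊕ I) × (U ⊕ I) →
      SimpleGraph (U ⊕ I) × Sym2 (U ⊕ I) × (U ⊕ I) × (U ⊕ I) := fun x =>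
    (x.1.flipGraph (Quot.out x.2.1).1 (Quot.out x.2.1).2 x.2.2.1 x.2.2.2, x.2.1, x.2.2.2, x.2.2.1)
  have hout : ∀ {G : SimpleGraph (U ⊕ I)} {e}, IsInnerEdge G e → ∃ a b : U,
      Quot.out e = (Sum.inl a, Sum.inl b) ∧ e = s(Sum.inl a, Sum.inl b) := by
    intro G e he
    have h1 : s((Quot.out e).1, (Quot.out e).2) = e := Quot.out_eq e
    have hl := he.2
    rcases h2 : Quot.out e with ⟨x, y⟩
    rw [h2] at h1
    rw [← h1] at hl
    rcases x with a | l
    · rcases y with b | l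
      · exact ⟨a, b, rfl, h1.symm⟩
      · exact absurd (by simp) (hl l)
    · exact absurd (by simp) (hl l)
  have hflip : ∀ x, P x → P (flip x) ∧ flip (flip x) = x := by
    rintro ⟨G, e, β, γ⟩ ⟨hG, he, hf⟩
    obtain ⟨a, b, h1, h2⟩ := hout he
    simp only at he hf hG h1 h2
    rw [h1] at hf
    have ht := (hf.isTri hG).isTree hcard
    simp only [flip, P, h1]
    refine ⟨⟨hf.isTri hG, ?_, hf.reverse ht⟩, ?_⟩
    · rw [h2]; exact ⟨hf.adj_ab, by simp⟩
    · rw [hf.flip_flip ht]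
  have hinv : ∑ x with P x, f (flip x).1 (flip x).2.1 = ∑ x with P x, f x.1 x.2.1 := by
    refine Finset.sum_nbij' flip flip ?_ ?_ ?_ ?_ ?_
    · intro x hx
      exact Finset.mem_filter.2 ⟨Finset.mem_univ _, (hflip x (Finset.mem_filter.1 hx).2).1⟩
    · intro x hx
      exact Finset.mem_filter.2 ⟨Finset.mem_univ _, (hflip x (Finset.mem_filter.1 hx).2).1⟩
    · exact fun x hx => (hflip x (Finset.mem_filter.1 hx).2).2
    · exact fun x hx => (hflip x (Finset.mem_filter.1 hx).2).2
    · exact fun x _ => rfl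
  have hloc : ∀ G e, ∑ β, ∑ γ, (if P (G, e, β, γ) then f G e else 0) = 4 * f G e ∧
      ∑ β, ∑ γ, (if P (G, e, β, γ) then
        f (G.flipGraph (Quot.out e).1 (Quot.out e).2 β γ) e else 0) = -2 * f G e := by
    intro G e
    by_cases hGe : IsTri G ∧ IsInnerEdge G e
    swap
    · have h0 : f G e = 0 := by
        simp only [f, treeTerm, dif_neg hGe]
      have hP : ∀ β γ, ¬ P (G, e, β, γ) := fun β γ h => hGe ⟨h.1, h.2.1⟩
      simp [h0, hP]
    obtain ⟨hG, he⟩ := hGe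
    have ht := hG.isTree hcard
    obtain ⟨a, b, h1, h2⟩ := hout he
    have hab : G.Adj (Sum.inl a) (Sum.inl b) := by
      have := he.1
      rwa [h2] at this
    obtain ⟨β₁, β₂, hβ, hβ₁, hβ₂, hNa⟩ := Set.exists_of_ncard_eq_three (hG.inner a)
      (b := Sum.inl b) hab
    obtain ⟨γ₁, γ₂, hγ, hγ₁, hγ₂, hNb⟩ := Set.exists_of_ncard_eq_three (hG.inner b)
      (b := Sum.inl a) hab.symm
    have hfl : ∀ {β γ}, (β = β₁ ∨ β = β₂) → (γ = γ₁ ∨ γ = γ₂) →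
        G.IsFlip (Sum.inl a) (Sum.inl b) β γ := by
      intro β γ hb hc
      refine ⟨ht, hab, (hNa β).2 (Or.inr hb), (hNb γ).2 (Or.inr hc), ?_, ?_⟩
      · rcases hb with rfl | rfl <;> assumption
      · rcases hc with rfl | rfl <;> assumption
    have hP : ∀ β γ, P (G, e, β, γ) ↔
        β ∈ ({β₁, β₂} : Finset (U ⊕ I)) ∧ γ ∈ ({γ₁, γ₂} : Finset (U ⊕ I)) := by
      intro β γ
      simp only [P, hG, he, true_and, h1, Finset.mem_insert, Finset.mem_singleton]
      refine ⟨fun h => ⟨((hNa β).1 h.aβ).resolve_left h.βb,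
        ((hNb γ).1 h.bγ).resolve_left h.γa⟩, fun h => hfl h.1 h.2⟩
    have hsum : ∀ F : U ⊕ I → U ⊕ I → ℝ, ∑ β, ∑ γ, (if P (G, e, β, γ) then F β γ else 0) =
        (F β₁ γ₁ + F β₁ γ₂) + (F β₂ γ₁ + F β₂ γ₂) := by
      intro F
      simp only [hP, ite_and]
      rw [← Finset.sum_pair hγ (f := F β₁), ← Finset.sum_pair hγ (f := F β₂),
        ← Finset.sum_pair hβ (f := fun β => ∑ γ ∈ {γ₁, γ₂}, F β γ)]
      have h3 := Finset.sum_ite_mem Finset.univ ({β₁, β₂} : Finset (U ⊕ I))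
        (fun β => ∑ γ ∈ {γ₁, γ₂}, F β γ)
      rw [Finset.univ_inter] at h3
      rw [← h3]
      refine Finset.sum_congr rfl fun β _ => ?_
      split_ifs
      · rw [Finset.sum_ite_mem, Finset.univ_inter]
      · simp
    rw [hsum, hsum, h1]
    refine ⟨by ring, ?_⟩
    have e1 := treeTerm_add D hcard ε q v hG (α := β₂) (hfl (.inl rfl) (.inl rfl))
      (hfl (.inl rfl) (.inr rfl)) hγ hβ.symm
      (fun x => (hNa x).trans (or_congr_right or_comm)) hβ₂ hNb
    have e2 := treeTerm_add D hcard ε q v hG (α := β₁) (hfl (.inr rfl) (.inl rfl))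
      (hfl (.inr rfl) (.inr rfl)) hγ hβ hNa hβ₁ hNb
    rw [← h2] at e1 e2
    simp only [f]
    linarith
  have hA : ∑ x with P x, f x.1 x.2.1 = 4 * ∑ G, ∑ e, f G e := by
    rw [Finset.sum_filter, Fintype.sum_prod_type, Finset.mul_sum]
    refine Finset.sum_congr rfl fun G _ => ?_
    rw [Fintype.sum_prod_type, Finset.mul_sum]
    refine Finset.sum_congr rfl fun e _ => ?_
    rw [Fintype.sum_prod_type]
    exact (hloc G e).1
  have hB : ∑ x with P x, f (flip x).1 (flip x).2.1 = -2 * ∑ G, ∑ e, f G e := by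
    rw [Finset.sum_filter, Fintype.sum_prod_type, Finset.mul_sum]
    refine Finset.sum_congr rfl fun G _ => ?_
    rw [Fintype.sum_prod_type, Finset.mul_sum]
    refine Finset.sum_congr rfl fun e _ => ?_
    rw [Fintype.sum_prod_type]
    exact (hloc G e).2
  rw [hinv, hA] at hB
  linarith

end

/-! ### Invariance of the weighted number of labelled trees -/

section

variable {U I M : Type} [Fintype U] [Fintype I] [Fintype M] [DecidableEq M] (D : LeafData I M)

/-- A trivalent tree with `2|M| + 3` leaves has `2|M|` inner edges, so the relative evaluation
matrix is square. -/
theorem IsTri.nonempty_equiv_innerEdge [Nonempty U] {G : SimpleGraph (U ⊕ I)} (hG : IsTri G)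
    (hcard : Fintype.card U + 2 = Fintype.card I) (hM : 2 * Fintype.card M + 3 = Fintype.card I) :
    Nonempty (M × Fin 2 ≃ {e // IsInnerEdge G e}) := by
  classical
  have h1 := (SimpleGraph.isTree_iff_connected_and_card.1 (hG.comap_isTree hcard)).2
  rw [Nat.card_eq_fintype_card, Nat.card_eq_fintype_card] at h1
  refine ⟨Equiv.trans (Fintype.equivOfCardEq ?_) (innerEdgeEquiv G)⟩
  rw [Fintype.card_prod, Fintype.card_fin]
  lia

/-- The number of labelled trees with given positions of the marked leaves does not depend on
these positions. -/
theorem coneDegree_triMatrix_eq [Nonempty U] [Fintype {G : SimpleGraph (U ⊕ I) // IsTri G}]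
    (hcard : Fintype.card U + 2 = Fintype.card I)
    (ε : ∀ G : SimpleGraph (U ⊕ I), IsTri G → M × Fin 2 ≃ {e // IsInnerEdge G e})
    {q q' : M × Fin 2 → ℝ}
    (hq : ConeGeneral (fun G : {G : SimpleGraph (U ⊕ I) // IsTri G} => triMatrix D G.1 (ε G.1 G.2)) q)
    (hq' : ConeGeneral
      (fun G : {G : SimpleGraph (U ⊕ I) // IsTri G} => triMatrix D G.1 (ε G.1 G.2)) q') :
    coneDegree (fun G : {G : SimpleGraph (U ⊕ I) // IsTri G} => triMatrix D G.1 (ε G.1 G.2)) q =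
      coneDegree
        (fun G : {G : SimpleGraph (U ⊕ I) // IsTri G} => triMatrix D G.1 (ε G.1 G.2)) q' := by
  classical
  refine coneDegree_eq (fun q v => ?_) hq hq'
  let _ : Fintype (SimpleGraph (U ⊕ I)) := Fintype.ofFinite _
  refine Eq.trans ?_ (sum_treeTerm D hcard ε q v)
  symm
  have h0 : ∀ G : SimpleGraph (U ⊕ I), ¬ IsTri G → ∑ e, treeTerm D ε q v G e = 0 := by
    intro G hG
    refine Finset.sum_eq_zero fun e _ => ?_
    unfold treeTerm
    rw [dif_neg fun h => hG h.1]
  rw [← Fintype.sum_subtype_add_sum_subtype (fun G => IsTri G)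
    (fun G => ∑ e, treeTerm D ε q v G e)]
  rw [Finset.sum_eq_zero (s := (Finset.univ : Finset {G // ¬ IsTri G})) (fun G _ => h0 G.1 G.2),
    add_zero]
  refine Finset.sum_congr (by ext; simp) fun G _ => ?_
  rw [← Fintype.sum_subtype_add_sum_subtype (fun e => IsInnerEdge G.1 e)
    (fun e => treeTerm D ε q v G.1 e), Finset.sum_eq_zero
      (s := (Finset.univ : Finset {e // ¬ IsInnerEdge G.1 e})), add_zero]
  · rw [← Equiv.sum_comp (ε G.1 G.2)]
    refine Finset.sum_congr rfl fun r _ => ?_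
    rw [treeTerm_eq D ε q v G.2 (ε G.1 G.2 r).2 (ε G.1 G.2)]
    simp only [Subtype.coe_eta, Equiv.symm_apply_apply]
    rfl
  · intro e _
    unfold treeTerm
    rw [dif_neg fun h => e.2 h.2]

end

/-! ### From labelled trees to combinatorial types of curves -/

section

/-- The labelled unbounded edges of a curve: the markings, and the ends of each direction. -/
abbrev Leaf (d m : ℕ) : Type := Fin m ⊕ Fin 3 × Fin d

/-- The directions of the unbounded edges; the first marking is the reference leaf. -/
def leafData (d m : ℕ) : LeafData (Leaf d (m + 1)) (Fin m) where
  dir := Sum.elim 0 fun x => endDir x.1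
  base := Sum.inl 0
  mark i := Sum.inl i.succ
  dir_sum c := by
    rw [Fintype.sum_sum_type, Fintype.sum_prod_type]
    fin_cases c <;> simp [endDir, Fin.sum_univ_three]
  dir_eq_zero l := by
    rcases l with i | x
    · exact Or.inl rfl
    · exact Or.inr ⟨by simp, by simp⟩

section TreeType

variable {U : Type} [Fintype U] [Nonempty U] {d m : ℕ} {G : SimpleGraph (U ⊕ Leaf d (m + 1))}

theorem LeafData.totalDir_compl {I M : Type} [Fintype I] (D : LeafData I M) (χ : I → ℤ) (c : Fin 2) :
    D.totalDir (fun l => 1 - χ l) c = -D.totalDir χ c := by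
  simp only [LeafData.totalDir, sub_mul, one_mul, Finset.sum_sub_distrib, D.dir_sum]
  ring

-- Every leaf lies behind exactly one flag at `u`, so the flags together carry the sum of all
-- directions. This is the balancing condition of the associated type.
open Classical in
theorem sum_totalDir_side (hG : G.IsTree) (u : U) (c : Fin 2) :
    ∑ x, (if G.Adj (Sum.inl u) x then
      (leafData d m).totalDir (leafInd (G.side (Sum.inl u) x)) c else 0) = 0 := by
  refine Eq.trans ?_ ((leafData d m).dir_sum c)
  simp only [LeafData.totalDir, ← Finset.sum_filter]
  rw [Finset.sum_comm]
  refine Finset.sum_congr rfl fun l _ => ?_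
  obtain ⟨w, hw, hl⟩ := hG.exists_mem_side (u := Sum.inl u) (x := Sum.inr l) (by simp)
  rw [Finset.sum_eq_single w]
  · simp [leafInd, hl]
  · intro x hx hne
    have := hG.side_disjoint hw (Finset.mem_filter.1 hx).2 hne.symm hl
    simp [leafInd, this]
  · simp [hw]

open Classical in
/-- The combinatorial type of a labelled tree. -/
noncomputable def IsTri.toType (hG : IsTri G) (hcard : Fintype.card U + 2 = (m + 1) + 3 * d) :
    TropType U d (m + 1) where
  graph := G.comap Sum.inl
  isTree := hG.comap_isTree (by simpa using hcard)
  mark i := hG.nbr (Sum.inl i)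
  ends u j := {t | hG.nbr (Sum.inr (j, t)) = u}.ncard
  ends_sum j := by rw [sum_ncard_fiber, Fintype.card_fin]
  dir u v c := if G.Adj (Sum.inl u) (Sum.inl v) then
    (leafData d m).totalDir (leafInd (G.side (Sum.inl u) (Sum.inl v))) c else 0
  dir_antisymm u v := by
    funext c
    simp only [G.adj_comm (Sum.inl v), Pi.neg_apply]
    split_ifs with h
    · rw [← (hG.isTree (by simpa using hcard)).side_compl h, leafInd_compl,
        LeafData.totalDir_compl]
    · rfl
  dir_eq_zero u v h := by
    funext c
    exact if_neg h
  balanced u c := by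
    have h := sum_totalDir_side (hG.isTree (by simpa using hcard)) u c
    rw [Fintype.sum_sum_type] at h
    convert h using 2
    have h1 : ∀ l, (if G.Adj (Sum.inl u) (Sum.inr l) then
        (leafData d m).totalDir (leafInd (G.side (Sum.inl u) (Sum.inr l))) c else 0) =
        if hG.nbr l = u then (leafData d m).dir l c else 0 := by
      intro l
      have h2 : G.Adj (Sum.inl u) (Sum.inr l) ↔ hG.nbr l = u := by
        rw [G.adj_comm, hG.adj_leaf_iff, Sum.inl.injEq, eq_comm]
      simp only [h2]
      split_ifs with h3
      · rw [hG.side_leaf (h2.2 h3)]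
        simp [LeafData.totalDir, leafInd]
      · rfl
    simp only [h1]
    rw [Fintype.sum_sum_type, Fintype.sum_prod_type]
    simp only [leafData, Sum.elim_inl, Pi.zero_apply, ite_self, Finset.sum_const_zero, zero_add,
      Sum.elim_inr]
    refine Finset.sum_congr rfl fun j _ => ?_
    rw [← Finset.sum_filter, Finset.sum_const, Set.ncard_eq_toFinset_card', nsmul_eq_mul]
    simp

theorem ncard_sum {α β : Type*} [Finite α] [Finite β] (s : Set (α ⊕ β)) :
    s.ncard = (Sum.inl ⁻¹' s).ncard + (Sum.inr ⁻¹' s).ncard := by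
  rw [← Set.ncard_image_of_injective (Sum.inl ⁻¹' s) Sum.inl_injective,
    ← Set.ncard_image_of_injective (Sum.inr ⁻¹' s) Sum.inr_injective, ← Set.ncard_union_eq]
  · congr 1
    ext x
    rcases x with x | x <;> simp
  · rw [Set.disjoint_left]
    rintro _ ⟨a, -, rfl⟩ ⟨b, -, h⟩
    simp at h

theorem ncard_prod {α β : Type*} [Fintype α] [Fintype β] (s : Set (α × β)) :
    s.ncard = ∑ a, {b | (a, b) ∈ s}.ncard := by
  classical
  rw [Set.ncard_eq_toFinset_card', Finset.card_eq_sum_card_fiberwise (f := Prod.fst)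
    (t := Finset.univ) (by simp)]
  refine Finset.sum_congr rfl fun a _ => ?_
  rw [Set.ncard_eq_toFinset_card', ← Finset.card_image_of_injective {b | (a, b) ∈ s}.toFinset
    (Prod.mk_right_injective a)]
  refine congrArg Finset.card ?_
  ext ⟨x, y⟩
  simp only [Finset.mem_filter, Set.mem_toFinset, Finset.mem_image, Set.mem_ofPred_eq,
    Prod.mk.injEq]
  constructor
  · rintro ⟨h, rfl⟩; exact ⟨y, h, rfl, rfl⟩
  · rintro ⟨b, h, rfl, rfl⟩; exact ⟨h, rfl⟩

theorem IsTri.valence_toType (hG : IsTri G) (hcard : Fintype.card U + 2 = (m + 1) + 3 * d) (u : U) :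
    (hG.toType hcard).valence u = 3 := by
  rw [← hG.inner u, ncard_sum (G.neighborSet (Sum.inl u)), ncard_sum (Sum.inr ⁻¹' _), ncard_prod]
  have h2 : ∀ l, G.Adj (Sum.inl u) (Sum.inr l) ↔ hG.nbr l = u := by
    intro l
    rw [G.adj_comm, hG.adj_leaf_iff, Sum.inl.injEq, eq_comm]
  rw [← add_assoc]
  unfold TropType.valence
  congr 1
  · congr 1
    congr 1
    ext i
    simp [h2]; rfl
  · refine Finset.sum_congr rfl fun j _ => ?_
    simp [h2, IsTri.toType]

/-- The leaves of a tree are attached to the vertices of its type. -/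
theorem IsTri.mem_side_nbr (hG : IsTri G) {e : Sym2 (U ⊕ Leaf d (m + 1))} (he : IsInnerEdge G e)
    (l : Leaf d (m + 1)) :
    Sum.inr l ∈ G.side (Quot.out e).1 (Quot.out e).2 ↔
      Sum.inl (hG.nbr l) ∈ G.side (Quot.out e).1 (Quot.out e).2 := by
  refine SimpleGraph.mem_side_iff_of_adj ((hG.adj_leaf_iff l _).2 rfl) fun h => ?_
  have h1 : s((Quot.out e).1, (Quot.out e).2) = e := Quot.out_eq e
  rw [h1] at h
  exact he.2 l (by rw [← h]; simp)

open Classical in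
/-- The coordinates relative to the position of the first marking. -/
noncomputable def IsTri.frame (hG : IsTri G) (v : U) (c : Fin 2) :
    Fin 2 ⊕ {e // IsInnerEdge G e} → ℤ
  | Sum.inl c' => if c = c' then 1 else 0
  | Sum.inr e => ((if Sum.inl v ∈ G.side (Quot.out e.1).1 (Quot.out e.1).2 then 1 else 0) -
      leafInd (G.side (Quot.out e.1).1 (Quot.out e.1).2) (leafData d m).base) *
      (leafData d m).totalDir (leafInd (G.side (Quot.out e.1).1 (Quot.out e.1).2)) c

theorem IsTri.isFrame (hG : IsTri G) (hcard : Fintype.card U + 2 = (m + 1) + 3 * d) :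
    (hG.toType hcard).IsFrame (innerEdgeEquiv G).symm hG.frame where
  inl v c c' := rfl
  inr u v h c f := by
    classical
    have ht := hG.isTree (by simpa using hcard)
    have hadj : G.Adj (Sum.inl u) (Sum.inl v) := h
    have h1 : s((Quot.out f.1).1, (Quot.out f.1).2) = f.1 := Quot.out_eq f.1
    have h2 : (((innerEdgeEquiv G).symm f : Sym2 U) = s(u, v)) ↔
        f.1 = s(Sum.inl u, Sum.inl v) := by
      conv_rhs => rw [← Equiv.apply_symm_apply (innerEdgeEquiv G) f, innerEdgeEquiv_coe]
      rw [← Sym2.map_mk, (Sym2.map.injective Sum.inl_injective).eq_iff]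
    have hd : (hG.toType hcard).dir u v c =
      (leafData d m).totalDir (leafInd (G.side (Sum.inl u) (Sum.inl v))) c := if_pos hadj
    have hd' : (hG.toType hcard).dir v u c =
      (leafData d m).totalDir (leafInd (G.side (Sum.inl v) (Sum.inl u))) c := if_pos hadj.symm
    have hanti := congrFun ((hG.toType hcard).dir_antisymm u v) c
    rw [Pi.neg_apply] at hanti
    suffices key : hG.frame v c (Sum.inr f) = hG.frame u c (Sum.inr f) +
        if f.1 = s(Sum.inl u, Sum.inl v) then (hG.toType hcard).dir u v c else 0 from
      key.trans (congrArg _ (if_congr h2.symm rfl rfl))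
    simp only [IsTri.frame]
    by_cases h3 : f.1 = s(Sum.inl u, Sum.inl v)
    · rw [if_pos h3]
      rcases Sym2.eq_iff.1 (h1.trans h3) with ⟨h4, h5⟩ | ⟨h4, h5⟩
      · rw [h4, h5, if_pos (SimpleGraph.mem_side_self _ _),
          if_neg (ht.isAcyclic.notMem_side hadj), hd]
        ring
      · rw [h4, h5, if_neg (ht.isAcyclic.notMem_side hadj.symm),
          if_pos (SimpleGraph.mem_side_self _ _), ← hd', hanti]
        ring
    · rw [if_neg h3, add_zero]
      have := SimpleGraph.mem_side_iff_of_adj (u := (Quot.out f.1).1) (v := (Quot.out f.1).2) hadj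
        (by rw [h1]; exact fun h => h3 h.symm)
      simp only [this]

/-- The frame is normalised so that the first marking has no length coefficients (`frame_base`). Its
other markings then reproduce the quadratic columns of `edgeCol`. -/
theorem IsTri.frame_mark (hG : IsTri G) (i : Fin m) (c : Fin 2) (e : {e // IsInnerEdge G e}) :
    hG.frame (hG.nbr (Sum.inl i.succ)) c (Sum.inr e) = edgeCol (leafData d m) G e.1 (i, c) := by
  classical
  unfold IsTri.frame edgeCol LeafData.col
  simp only
  rw [if_congr (hG.mem_side_nbr e.2 _).symm rfl rfl]
  rfl

theorem IsTri.frame_base (hG : IsTri G) (c : Fin 2) (e : {e // IsInnerEdge G e}) :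
    hG.frame (hG.nbr (Sum.inl 0)) c (Sum.inr e) = 0 := by
  classical
  unfold IsTri.frame
  simp only
  rw [if_congr (hG.mem_side_nbr e.2 _).symm rfl rfl]
  exact mul_eq_zero_of_left (sub_self _) _

/-- The first index is separated from the others. -/
def finSuccProdEquiv (m : ℕ) : Fin 2 ⊕ (Fin m × Fin 2) ≃ Fin (m + 1) × Fin 2 where
  toFun := Sum.elim (fun c => (0, c)) fun r => (r.1.succ, r.2)
  invFun r := Fin.cases (Sum.inl r.2) (fun i => Sum.inr (i, r.2)) r.1
  left_inv x := by rcases x with c | ⟨i, c⟩ <;> rfl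
  right_inv x := by
    obtain ⟨i, c⟩ := x
    induction i using Fin.cases <;> rfl

/-- The rows of the first marking are an identity block followed by zeros, so the determinant
reduces to the relative evaluation of the other markings. -/
theorem IsTri.evMult_eq (hG : IsTri G) (hcard : Fintype.card U + 2 = (m + 1) + 3 * d)
    (ε : Fin m × Fin 2 ≃ {e // IsInnerEdge G e}) {C : PlaneTropCurve d (m + 1)} {σ : U ≃ Fin C.k}
    (h : (hG.toType hcard).IsIso C.toM.toTropType σ) :
    (evMult C : ℝ) = |(triMatrix (leafData d m) G ε).det| := by
  classical
  have : Fintype {e // IsInnerEdge G e} := Fintype.ofEquiv _ ε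
  rw [evMult_eq_of_isFrame (hG.isFrame hcard) h, ← absDet_submatrix_left _ (finSuccProdEquiv m),
    ← absDet_submatrix_right _ (Equiv.sumCongr (Equiv.refl (Fin 2)) ε),
    absDet_eq _ (Equiv.refl _)]
  let A : Matrix (Fin m × Fin 2) (Fin m × Fin 2) ℤ :=
    Matrix.of fun r x => edgeCol (leafData d m) G (ε x) r
  let X : Matrix (Fin m × Fin 2) (Fin 2) ℤ := Matrix.of fun r c => if r.2 = c then 1 else 0
  have hA : triMatrix (leafData d m) G ε = A.map (Int.castRingHom ℝ) := rfl
  have hdet : (triMatrix (leafData d m) G ε).det = (A.det : ℝ) := by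
    rw [hA]
    exact ((Int.castRingHom ℝ).map_det A).symm
  rw [hdet]
  have : ((((frameMatrix hG.frame).submatrix (Prod.map (hG.toType hcard).mark id) id).submatrix
      (finSuccProdEquiv m) id).submatrix id
        (Equiv.sumCongr (Equiv.refl (Fin 2)) ε)).submatrix id (Equiv.refl _) =
      Matrix.fromBlocks 1 0 X A := by
    ext x y
    rcases x with c | r <;> rcases y with c' | s
    · rfl
    · exact hG.frame_base c (ε s)
    · rfl
    · exact hG.frame_mark r.1 r.2 (ε s)
  rw [this, Matrix.det_fromBlocks_zero₁₂, Matrix.det_one, one_mul, Nat.cast_natAbs, Int.cast_abs]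

end TreeType

end

/-! ### Counting the labellings of a type -/

section

section LabelGraph

variable {U V I : Type} [Fintype U] [Fintype V] [Fintype I]

/-- The graph obtained by attaching the leaves `I` to a graph. -/
def labelGraph (g : SimpleGraph V) (a : I → V) : SimpleGraph (V ⊕ I) where
  Adj
    | Sum.inl u, Sum.inl v => g.Adj u v
    | Sum.inl u, Sum.inr l => a l = u
    | Sum.inr l, Sum.inl u => a l = u
    | Sum.inr _, Sum.inr _ => False
  symm := ⟨fun
    | Sum.inl _, Sum.inl _ => fun h => h.symm
    | Sum.inl _, Sum.inr _ => id
    | Sum.inr _, Sum.inl _ => id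
    | Sum.inr _, Sum.inr _ => id⟩
  loopless := ⟨fun
    | Sum.inl u => g.irrefl (v := u)
    | Sum.inr _ => id⟩

theorem isTri_labelGraph {g : SimpleGraph V} (hg : g.Connected) {a : I → V}
    (h : ∀ u, (g.neighborSet u).ncard + {l | a l = u}.ncard = 3) : IsTri (labelGraph g a) where
  connected := by
    have h1 : ∀ u v, (labelGraph g a).Reachable (Sum.inl u) (Sum.inl v) := fun u v =>
      (hg.preconnected u v).map (⟨Sum.inl, fun h => h⟩ : g →g labelGraph g a)
    have h2 : ∀ x : V ⊕ I, ∃ u, (labelGraph g a).Reachable (Sum.inl u) x := by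
      rintro (u | l)
      · exact ⟨u, SimpleGraph.Reachable.refl _⟩
      · exact ⟨a l, SimpleGraph.Adj.reachable (show (labelGraph g a).Adj _ _ from rfl)⟩
    have : Nonempty V := hg.nonempty
    refine SimpleGraph.Connected.mk fun x y => ?_
    obtain ⟨u, hu⟩ := h2 x
    obtain ⟨v, hv⟩ := h2 y
    exact hu.symm.trans ((h1 u v).trans hv)
  inner u := by
    rw [← h u, ncard_sum]
    rfl
  leaf l := by
    rw [Set.ncard_eq_one]
    refine ⟨Sum.inl (a l), ?_⟩
    ext x
    rcases x with u | l'
    · simp [labelGraph, eq_comm]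
    · simp [labelGraph]

theorem IsTri.nbr_labelGraph [Nonempty V] {g : SimpleGraph V} {a : I → V}
    (h : IsTri (labelGraph g a)) (l : I) : h.nbr l = a l :=
  (Sum.inl_injective ((h.adj_leaf_iff l (Sum.inl (a l))).1 rfl)).symm

theorem IsTri.labelGraph_eq [Nonempty V] {G : SimpleGraph (V ⊕ I)} (hG : IsTri G) :
    labelGraph (G.comap Sum.inl) hG.nbr = G := by
  ext x y
  rcases x with u | l <;> rcases y with v | l'
  · rfl
  · rw [G.adj_comm, hG.adj_leaf_iff, Sum.inl.injEq, eq_comm]; rfl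
  · rw [hG.adj_leaf_iff, Sum.inl.injEq, eq_comm]; rfl
  · rw [hG.adj_leaf_iff]; simp [labelGraph]

end LabelGraph

/-- The number of labellings of a set with multiplicities at most one. -/
theorem card_labellings {V : Type} [Fintype V] {d : ℕ} {e : V → ℕ} (he : ∀ u, e u ≤ 1)
    (hsum : ∑ u, e u = d) :
    Nat.card {f : Fin d → V // ∀ u, {t | f t = u}.ncard = e u} = d.factorial := by
  classical
  have hS : Fintype.card {u // e u = 1} = d := by
    rw [Fintype.card_subtype, ← hsum, Finset.card_filter]
    refine Finset.sum_congr rfl fun u _ => ?_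
    have := he u
    split_ifs <;> lia
  have : Nat.card (Fin d ≃ {u // e u = 1}) = d.factorial := by
    rw [Nat.card_eq_fintype_card, Fintype.card_equiv (Fintype.equivOfCardEq (by simp [hS])),
      Fintype.card_fin]
  rw [← this]
  symm
  refine Nat.card_eq_of_bijective (fun φ => ⟨fun t => (φ t).1, fun u => ?_⟩) ⟨?_, ?_⟩
  · by_cases h : e u = 1
    · rw [h, Set.ncard_eq_one]
      refine ⟨φ.symm ⟨u, h⟩, ?_⟩
      ext t
      simp [Equiv.eq_symm_apply, Subtype.ext_iff]
    · have h0 : e u = 0 := by have := he u; lia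
      rw [h0, Set.ncard_eq_zero, Set.eq_empty_iff_forall_notMem]
      rintro t rfl
      exact h (φ t).2
  · intro φ ψ h
    ext t
    exact congrFun (congrArg Subtype.val h) t
  · rintro ⟨f, hf⟩
    have h1 : ∀ t, e (f t) = 1 := by
      intro t
      refine le_antisymm (he _) ?_
      rw [← hf, Nat.one_le_iff_ne_zero, ne_eq, Set.ncard_eq_zero]
      exact Set.Nonempty.ne_empty ⟨t, rfl⟩
    refine ⟨Equiv.ofBijective (fun t => ⟨f t, h1 t⟩) ⟨?_, ?_⟩, rfl⟩
    · intro t t' h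
      have h2 := hf (f t)
      rw [h1, Set.ncard_eq_one] at h2
      obtain ⟨s, hs⟩ := h2
      have h3 : t ∈ {t' | f t' = f t} := rfl
      have h4 : t' ∈ {t' | f t' = f t} := (congrArg Subtype.val h).symm
      rw [hs] at h3 h4
      exact h3.trans h4.symm
    · rintro ⟨u, hu⟩
      have h2 := hf u
      rw [hu, Set.ncard_eq_one] at h2
      obtain ⟨s, hs⟩ := h2
      have h3 : s ∈ {t | f t = u} := by rw [hs]; rfl
      exact ⟨s, Subtype.ext h3⟩

/-- A bijection compatible with trees, markings and ends is compatible with the directions. -/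
theorem TropType.isIso_of_ends {V V' : Type} [Fintype V] [Fintype V'] {d m : ℕ}
    {T : TropType V d m} {T' : TropType V' d m}
    {σ : V ≃ V'} (h1 : ∀ u v, T'.graph.Adj (σ u) (σ v) ↔ T.graph.Adj u v)
    (h2 : ∀ i, T'.mark i = σ (T.mark i)) (h3 : ∀ u, T'.ends (σ u) = T.ends u) :
    T.IsIso T' σ := by
  refine ⟨h1, h2, h3, fun u v => ?_⟩
  funext c
  have := T.isTree.flow_eq_zero (δ := fun u v => T'.dir (σ u) (σ v) c - T.dir u v c)
    (fun u v => by simp [T.dir_antisymm u v, T'.dir_antisymm (σ u) (σ v)]; ring)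
    (fun u v h => by simp [T.dir_eq_zero u v h, T'.dir_eq_zero _ _ (mt (h1 u v).1 h)])
    (fun u => by
      have e1 := T.balanced u c
      have e2 := T'.balanced (σ u) c
      rw [h3] at e2
      rw [Finset.sum_sub_distrib, Equiv.sum_comp σ (fun v => T'.dir (σ u) v c)]
      linarith) u v
  exact sub_eq_zero.1 this

/-- The number of labelled trees of a given type without automorphisms. -/
theorem card_labelled_trees {U V : Type} [Fintype U] [Fintype V] [Nonempty U] {d m : ℕ}
    (hcard : Fintype.card U + 2 = (m + 1) + 3 * d) (T : TropType V d (m + 1))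
    (hval : ∀ u, T.valence u = 3) (haut : ∀ σ, T.IsIso T σ → σ = Equiv.refl _)
    (hends : ∀ u j, T.ends u j ≤ 1) :
    Nat.card {G : {G : SimpleGraph (U ⊕ Leaf d (m + 1)) // IsTri G} //
      ∃ σ : U ≃ V, (G.2.toType hcard).IsIso T σ} = (Fintype.card U).factorial * d.factorial ^ 3 := by
  classical
  have hUV : Fintype.card U = Fintype.card V := by
    have := T.card_eq hval
    lia
  -- A labelling names the vertices and numbers the ends of each direction. Without automorphisms,
  -- different labellings give different labelled trees, so it is enough to count labellings.
  have hL : Nat.card ((U ≃ V) × {f : Fin 3 → Fin d → V //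
      ∀ j, ∀ u, {t | f j t = u}.ncard = T.ends u j}) = (Fintype.card U).factorial * d.factorial ^ 3 := by
    rw [Nat.card_prod, Nat.card_eq_fintype_card, Fintype.card_equiv (Fintype.equivOfCardEq hUV),
      Nat.card_congr (Equiv.subtypePiEquivPi (β := fun _ => Fin d → V)
        (p := fun j f => ∀ u, {t | f t = u}.ncard = T.ends u j)), Nat.card_pi]
    congr 1
    rw [Finset.prod_congr rfl fun j _ => card_labellings (fun u => hends u j) (T.ends_sum j)]
    simp
  rw [← hL]
  symm
  have htri : ∀ x : (U ≃ V) × {f : Fin 3 → Fin d → V //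
      ∀ j, ∀ u, {t | f j t = u}.ncard = T.ends u j},
      IsTri (labelGraph (T.graph.comap x.1) fun l : Leaf d (m + 1) =>
        x.1.symm (Sum.elim T.mark (fun y => x.2.1 y.1 y.2) l)) := by
    rintro ⟨σ, f, hf⟩
    refine isTri_labelGraph
      ((SimpleGraph.Iso.comap σ T.graph).connected_iff.2 T.isTree.connected) fun u => ?_
    refine Eq.trans ?_ (hval (σ u))
    unfold TropType.valence
    rw [add_assoc]
    congr 1
    · rw [← Set.ncard_image_of_injective _ σ.injective]
      congr 1
      ext v
      obtain ⟨v, rfl⟩ := σ.surjective v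
      simp
    · rw [ncard_sum, ncard_prod]
      congr 1
      · simp [Equiv.symm_apply_eq]
      · refine Finset.sum_congr rfl fun j _ => ?_
        rw [← hf]
        simp [Equiv.symm_apply_eq]
  have hiso : ∀ x, ((htri x).toType hcard).IsIso T x.1 := by
    rintro x
    refine TropType.isIso_of_ends (fun u v => Iff.rfl) (fun i => ?_) fun u => ?_
    · change _ = x.1 ((htri x).nbr _)
      rw [IsTri.nbr_labelGraph]
      simp
    · funext j
      change _ = Set.ncard {t | (htri x).nbr _ = u}
      simp only [IsTri.nbr_labelGraph, Equiv.symm_apply_eq, Sum.elim_inr]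
      exact (x.2.2 j (x.1 u)).symm
  refine Nat.card_eq_of_bijective
    (fun x => ⟨⟨_, htri x⟩, x.1, hiso x⟩) ⟨?_, ?_⟩
  · intro x y h
    have h1 : labelGraph _ _ = labelGraph _ _ := congrArg (fun z => z.1.1) h
    have h2 : ((htri x).toType hcard).IsIso T y.1 := by
      have := hiso y
      convert this using 2
    have h3 := haut _ ((hiso x).symm.trans h2)
    have h4 : x.1 = y.1 := by
      ext u
      have := congrArg (fun s => s (x.1 u)) h3
      simpa using this.symm
    refine Prod.ext h4 (Subtype.ext ?_)
    funext j t
    have h5 := (hiso x)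
    have h6 : (labelGraph (T.graph.comap x.1) fun l : Leaf d (m + 1) =>
        x.1.symm (Sum.elim T.mark (fun y => x.2.1 y.1 y.2) l)).Adj (Sum.inr (Sum.inr (j, t)))
        (Sum.inl (x.1.symm (x.2.1 j t))) := rfl
    rw [h1] at h6
    have h7 : y.1.symm (y.2.1 j t) = x.1.symm (x.2.1 j t) := h6
    rw [h4] at h7
    exact (y.1.symm.injective h7).symm
  · rintro ⟨⟨G, hG⟩, σ, hσ⟩
    refine ⟨⟨σ, fun j t => σ (hG.nbr (Sum.inr (j, t))), fun j u => ?_⟩, ?_⟩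
    · have := congrFun (hσ.ends (σ.symm u)) j
      rw [Equiv.apply_symm_apply] at this
      rw [this]
      simp only [← Equiv.eq_symm_apply]
      rfl
    · refine Subtype.ext (Subtype.ext ?_)
      refine Eq.trans ?_ hG.labelGraph_eq
      simp only
      congr 1
      · ext u v
        exact hσ.adj u v
      · funext l
        rcases l with i | ⟨j, t⟩
        · simp only [Sum.elim_inl]
          rw [hσ.mark i]
          simp; rfl
        · simp

end

/-! ### Realising types by curves; contraction of edges -/

section

variable {V W : Type} [Fintype V] [Fintype W] {d m : ℕ}

/-- A type together with positions which are compatible with positive lengths of the edges comes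
from a curve. -/
theorem TropType.exists_planeTropCurve (T : TropType V d m) (hval : ∀ u, 3 ≤ T.valence u)
    {pos : V → Pt} (hpos : ∀ u v, T.graph.Adj u v → ∃ t : ℝ, 0 < t ∧
      ∀ c, pos v c = pos u c + t * (T.dir u v c : ℝ)) :
    ∃ (C : PlaneTropCurve d m) (σ : V ≃ Fin C.k),
      T.IsIso C.toM.toTropType σ ∧ ∀ u, C.pos (σ u) = pos u := by
  classical
  have hs : ∀ e : Sym2 V, ∃ t : ℝ, ∀ u v, e = s(u, v) → T.graph.Adj u v → 0 < t ∧
      ∀ c, pos v c = pos u c + t * (T.dir u v c : ℝ) := by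
    intro e
    induction e with
    | _ x y =>
      by_cases h : T.graph.Adj x y
      · obtain ⟨t, h0, h1⟩ := hpos x y h
        refine ⟨t, fun u v huv _ => ⟨h0, fun c => ?_⟩⟩
        rcases Sym2.eq_iff.1 huv with ⟨rfl, rfl⟩ | ⟨rfl, rfl⟩
        · exact h1 c
        · rw [h1 c, T.dir_antisymm x y]
          simp
      · refine ⟨0, fun u v huv hadj => absurd ?_ h⟩
        rw [← SimpleGraph.mem_edgeSet, huv]
        exact hadj
  choose len hlen using hs
  let X : MCurve V d m :=
    { T with
      pos := pos
      len := fun u v => len s(u, v)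
      len_symm := fun u v => by rw [Sym2.eq_swap]
      pos_eq := fun u v h => (hlen _ u v rfl h).2 }
  have hX := X.isIso_toPlane (fun u v h => (hlen _ u v rfl h).1) hval
  exact ⟨_, _, hX.toIsIso, hX.pos⟩

open Classical in
/-- The image of a type under a map between the sets of vertices. -/
noncomputable def TropType.push (T : TropType V d m) (π : V → W) (g : SimpleGraph W)
    (hg : g.IsTree) (hadj : ∀ u v, T.graph.Adj u v → π u ≠ π v → g.Adj (π u) (π v)) :
    TropType W d m where
  graph := g
  isTree := hg
  mark i := π (T.mark i)
  ends x j := ∑ u, if π u = x then T.ends u j else 0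
  ends_sum j := by
    rw [Finset.sum_comm]
    simpa using T.ends_sum j
  dir x y := ∑ u, ∑ v, if π u = x ∧ π v = y then T.dir u v else 0
  dir_antisymm x y := by
    rw [Finset.sum_comm, ← Finset.sum_neg_distrib]
    refine Finset.sum_congr rfl fun u _ => ?_
    rw [← Finset.sum_neg_distrib]
    refine Finset.sum_congr rfl fun v _ => ?_
    rw [T.dir_antisymm u v]
    simp only [and_comm]
    split_ifs <;> simp
  dir_eq_zero x y h := by
    -- Edges collapsed into one vertex contribute there with both orientations, so the sum equals
    -- its own negative.
    by_cases hxy : x = y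
    · subst hxy
      refine self_eq_neg.1 ?_
      conv_lhs => rw [Finset.sum_comm]
      rw [← Finset.sum_neg_distrib]
      refine Finset.sum_congr rfl fun u _ => ?_
      rw [← Finset.sum_neg_distrib]
      refine Finset.sum_congr rfl fun v _ => ?_
      rw [T.dir_antisymm u v]
      simp only [and_comm]
      split_ifs <;> simp
    · refine Finset.sum_eq_zero fun u _ => Finset.sum_eq_zero fun v _ => ?_
      split_ifs with h1
      · obtain ⟨rfl, rfl⟩ := h1
        exact T.dir_eq_zero u v fun h2 => h (hadj u v h2 hxy)
      · rfl
  balanced x c := by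
    have h1 : ∑ y, (∑ u, ∑ v, if π u = x ∧ π v = y then T.dir u v else 0) c =
        ∑ u, if π u = x then ∑ v, T.dir u v c else 0 := by
      simp only [Finset.sum_apply]
      rw [Finset.sum_comm]
      refine Finset.sum_congr rfl fun u _ => ?_
      rw [Finset.sum_comm]
      split_ifs with h
      · refine Finset.sum_congr rfl fun v _ => ?_
        rw [Finset.sum_eq_single (π v)] <;> simp +contextual [h, eq_comm]
      · simp [h]
    have h2 : ∑ j, ((∑ u, if π u = x then T.ends u j else 0 : ℕ) : ℤ) * endDir j c =
        ∑ u, if π u = x then ∑ j, (T.ends u j : ℤ) * endDir j c else 0 := by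
      push_cast
      simp only [Finset.sum_mul]
      rw [Finset.sum_comm]
      refine Finset.sum_congr rfl fun u _ => ?_
      split_ifs with h <;> simp
    rw [h1, h2, ← Finset.sum_add_distrib]
    refine Finset.sum_eq_zero fun u _ => ?_
    split_ifs
    · exact T.balanced u c
    · rfl

section Contract

variable [DecidableEq V] {a b : V}

open Classical in
/-- The map that identifies `b` with `a`. -/
noncomputable def contractMap (h : a ≠ b) (v : V) : {v // v ≠ b} :=
  if hv : v = b then ⟨a, h⟩ else ⟨v, hv⟩

theorem contractMap_of_ne (h : a ≠ b) {v : V} (hv : v ≠ b) : contractMap h v = ⟨v, hv⟩ := dif_neg hv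

theorem contractMap_self (h : a ≠ b) : contractMap h b = ⟨a, h⟩ := dif_pos rfl

theorem contractMap_coe (h : a ≠ b) (x : {v // v ≠ b}) : contractMap h x.1 = x := dif_neg x.2

theorem contractMap_eq_iff (h : a ≠ b) {v : V} {x : {v // v ≠ b}} :
    contractMap h v = x ↔ v = x.1 ∨ v = b ∧ x.1 = a := by
  by_cases hv : v = b
  · subst hv
    rw [contractMap_self, Subtype.ext_iff]
    have := x.2.symm
    simp [this, eq_comm]
  · rw [contractMap_of_ne h hv, Subtype.ext_iff]
    simp [hv]

/-- The contraction of an edge. -/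
def contractGraph (G : SimpleGraph V) (h : a ≠ b) : SimpleGraph {v // v ≠ b} where
  Adj x y := x ≠ y ∧ ∃ u v, contractMap h u = x ∧ contractMap h v = y ∧ G.Adj u v
  symm := ⟨fun _ _ ⟨h1, u, v, h2, h3, h4⟩ => ⟨h1.symm, v, u, h3, h2, h4.symm⟩⟩
  loopless := ⟨fun _ h => h.1 rfl⟩

/-- The contraction stays connected and loses a vertex. At least one edge disappears, and
connectedness forbids losing more. -/
theorem isTree_contractGraph {G : SimpleGraph V} (hG : G.IsTree) (hab : G.Adj a b) :
    (contractGraph G hab.ne).IsTree := by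
  classical
  have hconn : (contractGraph G hab.ne).Connected := by
    have : Nonempty {v // v ≠ b} := ⟨⟨a, hab.ne⟩⟩
    refine SimpleGraph.Connected.mk fun x y => ?_
    have key : ∀ {u v}, G.Walk u v →
        (contractGraph G hab.ne).Reachable (contractMap hab.ne u) (contractMap hab.ne v) := by
      intro u v p
      induction p with
      | nil => exact SimpleGraph.Reachable.refl _
      | @cons u v w huv _ ih =>
        refine SimpleGraph.Reachable.trans ?_ ih
        by_cases h : contractMap hab.ne u = contractMap hab.ne v
        · rw [h]
        · exact SimpleGraph.Adj.reachable ⟨h, u, v, rfl, rfl, huv⟩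
    obtain ⟨p⟩ := hG.connected.preconnected x.1 y.1
    simpa only [contractMap_coe] using key p
  rw [SimpleGraph.isTree_iff_connected_and_card]
  refine ⟨hconn, le_antisymm ?_ hconn.card_vert_le_card_edgeSet_add_one⟩
  have h1 := (SimpleGraph.isTree_iff_connected_and_card.1 hG).2
  have h2 : Nat.card {v // v ≠ b} + 1 = Nat.card V := by
    rw [Nat.card_eq_fintype_card, Nat.card_eq_fintype_card, Fintype.card_subtype_compl,
      Fintype.card_subtype_eq]
    have : 0 < Fintype.card V := Fintype.card_pos_iff.2 ⟨a⟩
    lia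
  have h3 : (contractGraph G hab.ne).edgeSet ⊆
      Sym2.map (contractMap hab.ne) '' (G.edgeSet \ {s(a, b)}) := by
    intro e
    induction e with
    | _ x y =>
      rintro ⟨hne, u, v, rfl, rfl, huv⟩
      refine ⟨s(u, v), ⟨huv, fun h => hne ?_⟩, rfl⟩
      rcases Sym2.eq_iff.1 h with ⟨rfl, rfl⟩ | ⟨rfl, rfl⟩ <;>
        rw [contractMap_self, contractMap_of_ne _ hab.ne]
  have h4 := (Set.ncard_le_ncard h3).trans (Set.ncard_image_le (Set.toFinite _))
  rw [Set.ncard_sdiff_singleton_of_mem (by exact hab)] at h4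
  have h5 : G.edgeSet.ncard ≠ 0 := by
    rw [ne_eq, Set.ncard_eq_zero]
    exact Set.Nonempty.ne_empty ⟨s(a, b), hab⟩
  rw [Nat.card_coe_set_eq] at h1 ⊢
  lia

/-- The contraction of a bounded edge. -/
noncomputable def TropType.contract (T : TropType V d m) (hab : T.graph.Adj a b) :
    TropType {v // v ≠ b} d m :=
  T.push (contractMap hab.ne) (contractGraph T.graph hab.ne) (isTree_contractGraph T.isTree hab)
    fun u v h hne => ⟨hne, u, v, rfl, rfl, h⟩

/-- Two edges that become parallel under contraction would form a triangle with the contracted edge.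
-/
theorem SimpleGraph.IsTree.contractMap_inj {G : SimpleGraph V} (hG : G.IsTree) (hab : G.Adj a b)
    {u v u' v' : V} (h : G.Adj u v) (h' : G.Adj u' v')
    (hu : contractMap hab.ne u = contractMap hab.ne u')
    (hv : contractMap hab.ne v = contractMap hab.ne v')
    (hne : contractMap hab.ne u ≠ contractMap hab.ne v) : u = u' ∧ v = v' := by
  have key : ∀ x y, contractMap hab.ne x = contractMap hab.ne y →
      x = y ∨ (x = a ∧ y = b) ∨ (x = b ∧ y = a) := by
    intro x y hxy
    by_cases hy : y = b
    · subst hy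
      rw [contractMap_self, contractMap_eq_iff] at hxy
      tauto
    · rw [contractMap_of_ne _ hy, contractMap_eq_iff] at hxy
      tauto
  have hab' : contractMap hab.ne a = contractMap hab.ne b := by
    rw [contractMap_self, contractMap_of_ne _ hab.ne]
  rcases key _ _ hu with rfl | ⟨rfl, rfl⟩ | ⟨rfl, rfl⟩ <;>
    rcases key _ _ hv with rfl | ⟨rfl, rfl⟩ | ⟨rfl, rfl⟩
  · exact ⟨rfl, rfl⟩
  · exact absurd h' (hG.not_adj_of_adj_adj h hab)
  · exact absurd h (hG.not_adj_of_adj_adj h' hab)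
  · exact absurd h'.symm (hG.not_adj_of_adj_adj h.symm hab)
  · exact absurd rfl hne
  · exact absurd hab' hne
  · exact absurd h.symm (hG.not_adj_of_adj_adj h'.symm hab)
  · exact absurd hab'.symm hne
  · exact absurd rfl hne

theorem TropType.contract_dir (T : TropType V d m) (hab : T.graph.Adj a b) {u v : V}
    (h : T.graph.Adj u v) (hne : contractMap hab.ne u ≠ contractMap hab.ne v) :
    (T.contract hab).dir (contractMap hab.ne u) (contractMap hab.ne v) = T.dir u v := by
  classical
  unfold TropType.contract TropType.push
  dsimp only
  have h0 : ∀ u' v' (i : Decidable (contractMap hab.ne u' = contractMap hab.ne u ∧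
      contractMap hab.ne v' = contractMap hab.ne v)), ¬ (u' = u ∧ v' = v) →
      @ite _ _ i (T.dir u' v') 0 = 0 := by
    intro u' v' _ hn
    split_ifs with h1
    · refine T.dir_eq_zero u' v' fun h2 => hn ?_
      exact T.isTree.contractMap_inj hab h2 h h1.1 h1.2 (by rw [h1.1, h1.2]; exact hne)
    · rfl
  rw [Finset.sum_eq_single u, Finset.sum_eq_single v]
  · simp
  · exact fun v' _ hv => @h0 u v' _ fun h => hv h.2
  · simp
  · exact fun u' _ hu => Finset.sum_eq_zero fun v' _ => @h0 u' v' _ fun h => hu h.1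
  · simp

theorem TropType.contract_adj (T : TropType V d m) (hab : T.graph.Adj a b) {x y : {v // v ≠ b}}
    (h : (T.contract hab).graph.Adj x y) : ∃ u v, contractMap hab.ne u = x ∧
      contractMap hab.ne v = y ∧ T.graph.Adj u v ∧ (T.contract hab).dir x y = T.dir u v := by
  obtain ⟨hne, u, v, rfl, rfl, huv⟩ := h
  exact ⟨u, v, rfl, rfl, huv, T.contract_dir hab huv hne⟩

theorem TropType.contract_ends_of_ne (T : TropType V d m) (hab : T.graph.Adj a b)
    {x : {v // v ≠ b}} (hx : x.1 ≠ a) : (T.contract hab).ends x = T.ends x.1 := by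
  classical
  funext j
  unfold TropType.contract TropType.push
  simp [contractMap_eq_iff, hx]

theorem TropType.contract_ends_self (T : TropType V d m) (hab : T.graph.Adj a b) :
    (T.contract hab).ends ⟨a, hab.ne⟩ = T.ends a + T.ends b := by
  classical
  funext j
  unfold TropType.contract TropType.push
  simp only [contractMap_eq_iff, and_true]
  rw [← Finset.sum_filter]
  have : ({u | u = a ∨ u = b} : Finset V) = {a, b} := by ext; simp
  rw [this, Finset.sum_pair hab.ne]
  rfl

theorem TropType.contract_valence_of_ne (T : TropType V d m) (hab : T.graph.Adj a b)
    {x : {v // v ≠ b}} (hx : x.1 ≠ a) : (T.contract hab).valence x = T.valence x.1 := by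
  unfold TropType.valence
  rw [T.contract_ends_of_ne hab hx]
  congr 2
  · have hmap : contractMap hab.ne x.1 = x := contractMap_coe _ _
    have hne : ∀ v, T.graph.Adj x.1 v → contractMap hab.ne x.1 ≠ contractMap hab.ne v := by
      intro v hv h
      rw [hmap, eq_comm, contractMap_eq_iff] at h
      rcases h with rfl | ⟨-, h⟩
      · exact hv.ne rfl
      · exact hx h
    have : (T.contract hab).graph.neighborSet x =
        contractMap hab.ne '' T.graph.neighborSet x.1 := by
      ext y
      constructor
      · rintro ⟨h0, u, v, hu, rfl, huv⟩
        rw [contractMap_eq_iff] at hu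
        rcases hu with rfl | ⟨-, h⟩
        · exact ⟨v, huv, rfl⟩
        · exact absurd h hx
      · rintro ⟨v, hv, rfl⟩
        exact ⟨hmap ▸ hne v hv, x.1, v, hmap, rfl, hv⟩
    rw [this, Set.InjOn.ncard_image]
    intro v hv w hw h
    exact (T.isTree.contractMap_inj hab hv hw rfl h (hne v hv)).2
  · congr 1
    ext i
    change contractMap hab.ne (T.mark i) = x ↔ _
    simp [contractMap_eq_iff, hx]

/-- Compare the total valences: contraction removes one vertex, hence two from the total, and all
other valences are unchanged. -/
theorem TropType.contract_valence_self (T : TropType V d m) (hab : T.graph.Adj a b) :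
    (T.contract hab).valence ⟨a, hab.ne⟩ + 2 = T.valence a + T.valence b := by
  classical
  have h1 := T.sum_valence
  have h2 := (T.contract hab).sum_valence
  have h3 : Fintype.card {v // v ≠ b} + 1 = Fintype.card V := by
    rw [Fintype.card_subtype_compl, Fintype.card_subtype_eq]
    have : 0 < Fintype.card V := Fintype.card_pos_iff.2 ⟨a⟩
    lia
  have h4 : ∑ u, T.valence u = T.valence b + ∑ x : {v // v ≠ b}, T.valence x.1 := by
    rw [← Fintype.sum_subtype_add_sum_subtype (fun v => v = b)]
    congr 1
    simp
    rfl
  have h5 := Finset.add_sum_erase Finset.univ (fun x : {v // v ≠ b} => T.valence x.1)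
    (Finset.mem_univ ⟨a, hab.ne⟩)
  have h6 := Finset.add_sum_erase Finset.univ (fun x : {v // v ≠ b} => (T.contract hab).valence x)
    (Finset.mem_univ ⟨a, hab.ne⟩)
  have h7 := Finset.sum_congr (s₁ := Finset.univ.erase (⟨a, hab.ne⟩ : {v // v ≠ b})) rfl
    fun x hx => T.contract_valence_of_ne hab (x := x)
      (fun h => (Finset.mem_erase.1 hx).1 (Subtype.ext h))
  lia

end Contract

/-- A degenerate curve can be contracted to a curve that is not trivalent. -/
theorem TropType.exists_not_trivalent (n : ℕ) : ∀ {V : Type} [Fintype V] (_ : Fintype.card V = n)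
    (T : TropType V d m) (_ : ∀ u, 3 ≤ T.valence u) {pos : V → Pt}
    (_ : ∀ u v, T.graph.Adj u v → ∃ t : ℝ, 0 ≤ t ∧
      ∀ c, pos v c = pos u c + t * (T.dir u v c : ℝ))
    (_ : (∀ u, T.valence u = 3) → ∃ u v, T.graph.Adj u v ∧ ¬ ∃ t : ℝ, 0 < t ∧
      ∀ c, pos v c = pos u c + t * (T.dir u v c : ℝ)),
    ∃ C : PlaneTropCurve d m, ¬ C.Trivalent ∧ ∀ i, C.ev i = pos (T.mark i) := by
  induction n with
  | zero =>
    intro V _ hV T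
    have := T.isTree.connected.nonempty
    exact absurd hV Fintype.card_ne_zero
  | succ n ih =>
    intro V _ hV T hval pos hweak hdeg
    classical
    by_cases hpos : ∀ u v, T.graph.Adj u v → ∃ t : ℝ, 0 < t ∧
      ∀ c, pos v c = pos u c + t * (T.dir u v c : ℝ)
    · obtain ⟨C, σ, h1, h2⟩ := T.exists_planeTropCurve hval hpos
      refine ⟨C, fun ht => ?_, fun i => ?_⟩
      · obtain ⟨u, v, huv, hn⟩ := hdeg fun u => by
          rw [← h1.valence]
          exact ht _
        exact hn (hpos u v huv)
      · unfold PlaneTropCurve.ev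
        have := h1.mark i
        change C.mark i = _ at this
        rw [this, h2]
    · push Not at hpos
      -- An edge that admits no positive length has length zero, so both its ends have the same
      -- image and it can be contracted. The merged vertex has valence at least four, so from here
      -- on the type is not trivalent.
      obtain ⟨a, b, hab, hn⟩ := hpos
      have hpab : pos b = pos a := by
        obtain ⟨t, h0, ht⟩ := hweak a b hab
        rcases h0.eq_or_lt with rfl | h0
        · funext c
          simpa using ht c
        · obtain ⟨c, hc⟩ := hn t h0
          exact absurd (ht c) hc
      have hposπ : ∀ v, pos (contractMap hab.ne v).1 = pos v := by
        intro v
        by_cases hv : v = b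
        · rw [hv, contractMap_self, hpab]
        · rw [contractMap_of_ne _ hv]
      have hva : 4 ≤ (T.contract hab).valence ⟨a, hab.ne⟩ := by
        have := T.contract_valence_self hab
        have := hval a
        have := hval b
        lia
      obtain ⟨C, h1, h2⟩ := ih (V := {v // v ≠ b}) (by
          rw [Fintype.card_subtype_compl, Fintype.card_subtype_eq, hV]
          rfl) (T.contract hab) (fun x => by
          by_cases hx : x.1 = a
          · obtain rfl : x = ⟨a, hab.ne⟩ := Subtype.ext hx
            lia
          · rw [T.contract_valence_of_ne hab hx]
            exact hval _) (pos := fun x => pos x.1) (fun x y hxy => by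
          obtain ⟨u, v, rfl, rfl, huv, hd⟩ := T.contract_adj hab hxy
          rw [hd]
          simp only [hposπ]
          exact hweak u v huv) (fun h => by
          have := h ⟨a, hab.ne⟩
          lia)
      refine ⟨C, h1, fun i => (h2 i).trans ?_⟩
      exact hposπ _

end

/-! ### Cones against curves: `n_d` is well defined -/

section

variable {d m : ℕ}

/-- A curve of nonzero multiplicity is determined by its combinatorial type and the positions of its
markings. -/
theorem iso_of_isIso {C C' : PlaneTropCurve d m} (hC : evMult C ≠ 0) {τ : Fin C.k ≃ Fin C'.k}
    (h : C.toM.toTropType.IsIso C'.toM.toTropType τ) (hev : ∀ i, C'.ev i = C.ev i) : C.Iso C' := by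
  have hadj : ∀ u v, C'.graph.Adj (τ u) (τ v) ↔ C.graph.Adj u v := h.adj
  have hdir : ∀ u v, C'.dir (τ u) (τ v) = C.dir u v := h.dir
  have key := eq_zero_of_evMult_ne_zero hC (y := fun u c => C'.pos (τ u) c - C.pos u c)
    (s := fun e => C'.len (e.map τ) - C.len e)
    (fun u v huv c => by
      have h1 := C'.pos_eq (τ u) (τ v) ((hadj u v).2 huv) c
      have h2 := C.pos_eq u v huv c
      rw [hdir] at h1
      simp only [Sym2.map_mk]
      linarith)
    (fun i => by
      funext c
      have h1 := congrFun (hev i) c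
      have h2 : C'.mark i = τ (C.mark i) := h.mark i
      unfold PlaneTropCurve.ev at h1
      rw [h2] at h1
      simp [h1])
  refine PlaneTropCurve.iso_iff.2 ⟨τ, h, fun u v huv => ?_, fun u => ?_⟩
  · exact sub_eq_zero.1 (key.2 s(u, v) huv)
  · funext c
    exact sub_eq_zero.1 (congrFun (congrFun key.1 u) c)

section

variable {U : Type} [Fintype U] [Nonempty U] {G : SimpleGraph (U ⊕ Leaf d (m + 1))}

/-- The positions of the points relative to the first one. -/
def relPos (p : Fin (m + 1) → Pt) : Fin m × Fin 2 → ℝ := fun r => p r.1.succ r.2 - p 0 r.2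

theorem IsTri.framePos_base [Fintype {e // IsInnerEdge G e}] (hG : IsTri G)
    (hcard : Fintype.card U + 2 = (m + 1) + 3 * d)
    (ξ : Fin 2 ⊕ {e // IsInnerEdge G e} → ℝ) (c : Fin 2) :
    framePos hG.frame ξ (hG.nbr (Sum.inl 0)) c = ξ (Sum.inl c) := by
  rw [(hG.isFrame hcard).framePos_apply]
  simp [hG.frame_base]

theorem IsTri.relPos_framePos [Fintype {e // IsInnerEdge G e}] (hG : IsTri G)
    (hcard : Fintype.card U + 2 = (m + 1) + 3 * d) (ε : Fin m × Fin 2 ≃ {e // IsInnerEdge G e})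
    (ξ : Fin 2 ⊕ {e // IsInnerEdge G e} → ℝ) :
    relPos (fun i => framePos hG.frame ξ (hG.nbr (Sum.inl i))) =
      (triMatrix (leafData d m) G ε).mulVec fun r => ξ (Sum.inr (ε r)) := by
  funext ⟨i, c⟩
  simp only [relPos]
  rw [hG.framePos_base hcard, (hG.isFrame hcard).framePos_apply]
  simp only [hG.frame_mark, Matrix.mulVec, dotProduct, triMatrix, Matrix.of_apply]
  rw [Equiv.sum_comp ε fun f => (edgeCol (leafData d m) G f.1 (i, c) : ℝ) * ξ (Sum.inr f)]
  ring

theorem IsTri.exists_pos (hG : IsTri G) (hcard : Fintype.card U + 2 = (m + 1) + 3 * d)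
    (ε : Fin m × Fin 2 ≃ {e // IsInnerEdge G e}) {p : Fin (m + 1) → Pt} {x : Fin m × Fin 2 → ℝ}
    (hx : (triMatrix (leafData d m) G ε).mulVec x = relPos p) :
    ∃ pos : U → Pt, (∀ i, pos (hG.nbr (Sum.inl i)) = p i) ∧
      ∀ r u v, (ε r).1 = s(Sum.inl u, Sum.inl v) → ∀ c,
        pos v c = pos u c + x r * ((hG.toType hcard).dir u v c : ℝ) := by
  classical
  have : Fintype {e // IsInnerEdge G e} := Fintype.ofEquiv _ ε
  let ξ : Fin 2 ⊕ {e // IsInnerEdge G e} → ℝ := Sum.elim (p 0) fun f => x (ε.symm f)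
  have h1 := hG.relPos_framePos hcard ε ξ
  have h2 : (fun r => ξ (Sum.inr (ε r))) = x := by
    funext r; simp [ξ]
  rw [h2, hx] at h1
  have h0 : ∀ c, framePos hG.frame ξ (hG.nbr (Sum.inl 0)) c = p 0 c := fun c =>
    hG.framePos_base hcard ξ c
  refine ⟨framePos hG.frame ξ, fun i => ?_, fun r u v hr c => ?_⟩
  · induction i using Fin.cases with
    | zero => exact funext h0
    | succ i =>
      funext c
      have := congrFun h1 (i, c)
      unfold relPos at this
      simp only [h0] at this
      linarith
  · have := (hG.isFrame hcard).framePos_adj ξ (ε r) (u := u) (v := v) (by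
      apply Sym2.map.injective Sum.inl_injective
      have h3 := congrArg Subtype.val (Equiv.apply_symm_apply (innerEdgeEquiv G) (ε r))
      rw [innerEdgeEquiv_coe, hr] at h3
      exact h3) c
    rw [this]
    simp [ξ]

theorem IsTri.exists_edge (ε : Fin m × Fin 2 ≃ {e // IsInnerEdge G e}) {u v : U}
    (h : G.Adj (Sum.inl u) (Sum.inl v)) : ∃ r, (ε r).1 = s(Sum.inl u, Sum.inl v) :=
  ⟨ε.symm ⟨s(Sum.inl u, Sum.inl v), h, by simp⟩, by simp⟩

/-- A general configuration of points does not lie on the boundary of a cone. -/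
theorem coneGeneral_of_evGeneral (hcard : Fintype.card U + 2 = (m + 1) + 3 * d)
    (ε : ∀ G : SimpleGraph (U ⊕ Leaf d (m + 1)), IsTri G → Fin m × Fin 2 ≃ {e // IsInnerEdge G e})
    {p : Fin (m + 1) → Pt} (hp : EvGeneral d p) :
    ConeGeneral (fun G : {G : SimpleGraph (U ⊕ Leaf d (m + 1)) // IsTri G} =>
      triMatrix (leafData d m) G.1 (ε G.1 G.2)) (relPos p) := by
  rintro ⟨G, hG⟩ hdet x hx hq r
  by_contra hr
  have hr0 : x r = 0 := le_antisymm (not_lt.1 hr) (hx r)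
  obtain ⟨pos, h1, h2⟩ := hG.exists_pos hcard (ε G hG) hq
  have hw : ∀ u v, (hG.toType hcard).graph.Adj u v → ∃ t : ℝ, 0 ≤ t ∧
      ∀ c, pos v c = pos u c + t * ((hG.toType hcard).dir u v c : ℝ) := by
    intro u v huv
    obtain ⟨r, hr⟩ := IsTri.exists_edge (ε G hG) huv
    exact ⟨x r, hx r, h2 r u v hr⟩
  obtain ⟨C, hC, hev⟩ := TropType.exists_not_trivalent _ rfl (hG.toType hcard)
    (fun u => (hG.valence_toType hcard u).ge) hw (fun _ => by
      obtain ⟨⟨u, v⟩, hf⟩ : ∃ f : U × U, (ε G hG r).1 = s(Sum.inl f.1, Sum.inl f.2) := by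
        have := (ε G hG r).2
        generalize (ε G hG r).1 = e at this
        induction e with
        | _ x y =>
          rcases x with u | l
          · rcases y with v | l
            · exact ⟨(u, v), rfl⟩
            · exact absurd (by simp) (this.2 l)
          · exact absurd (by simp) (this.2 l)
      have huv : G.Adj (Sum.inl u) (Sum.inl v) := by
        have := (ε G hG r).2.1
        rwa [hf] at this
      refine ⟨u, v, huv, ?_⟩
      rintro ⟨t, ht, h3⟩
      -- An edge compatible both with length zero and with a positive length is contracted. Its
      -- column would vanish, contrary to the nonzero determinant.
      refine hdet (Matrix.det_eq_zero_of_column_eq_zero r fun s => ?_)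
      have h4 : (hG.toType hcard).dir u v s.2 = 0 := by
        have h5 := h2 r u v hf s.2
        rw [h3 s.2, hr0] at h5
        have : t * ((hG.toType hcard).dir u v s.2 : ℝ) = 0 := by linarith
        exact_mod_cast (mul_eq_zero.1 this).resolve_left ht.ne'
      have h6 : (hG.toType hcard).dir u v s.2 =
        (leafData d m).totalDir (leafInd (G.side (Sum.inl u) (Sum.inl v))) s.2 := if_pos huv
      simp only [triMatrix, Matrix.of_apply, hf]
      rw [edgeCol_mk _ (hG.isTree (by simpa using hcard)) huv, LeafData.col, ← h6, h4]
      simp)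
  exact hC (hp C fun i => (hev i).trans (h1 i))

theorem IsTri.exists_curve (hG : IsTri G) (hcard : Fintype.card U + 2 = (m + 1) + 3 * d)
    (ε : Fin m × Fin 2 ≃ {e // IsInnerEdge G e}) {p : Fin (m + 1) → Pt} {x : Fin m × Fin 2 → ℝ}
    (h0 : ∀ r, 0 < x r) (hx : (triMatrix (leafData d m) G ε).mulVec x = relPos p) :
    ∃ C ∈ evFibre d p, ∃ σ, (hG.toType hcard).IsIso C.toM.toTropType σ := by
  obtain ⟨pos, h1, h2⟩ := hG.exists_pos hcard ε hx
  obtain ⟨C, σ, h3, h4⟩ := (hG.toType hcard).exists_planeTropCurve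
    (fun u => (hG.valence_toType hcard u).ge) (pos := pos) (fun u v huv => by
      obtain ⟨r, hr⟩ := IsTri.exists_edge ε huv
      exact ⟨x r, h0 r, h2 r u v hr⟩)
  refine ⟨C, fun i => ?_, σ, h3⟩
  have h5 : C.mark i = _ := h3.mark i
  unfold PlaneTropCurve.ev
  rw [h5, h4]
  exact h1 i

theorem IsTri.exists_pos_mulVec_eq (hG : IsTri G) (hcard : Fintype.card U + 2 = (m + 1) + 3 * d)
    (ε : Fin m × Fin 2 ≃ {e // IsInnerEdge G e}) {p : Fin (m + 1) → Pt} {C : PlaneTropCurve d (m + 1)}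
    (hC : C ∈ evFibre d p) {σ : U ≃ Fin C.k} (h : (hG.toType hcard).IsIso C.toM.toTropType σ) :
    ∃ x : Fin m × Fin 2 → ℝ, (∀ r, 0 < x r) ∧
      (triMatrix (leafData d m) G ε).mulVec x = relPos p := by
  classical
  have : Fintype {e // IsInnerEdge G e} := Fintype.ofEquiv _ ε
  obtain ⟨ξ, h1, h2⟩ := (hG.isFrame hcard).exists_framePos_eq (pos := fun u => C.pos (σ u))
    (len := fun e => C.len (e.map σ)) (fun u v huv c => by
      have h3 : C.dir (σ u) (σ v) = _ := h.dir u v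
      rw [C.pos_eq (σ u) (σ v) ((h.adj u v).2 huv) c, h3]
      simp)
  refine ⟨fun r => ξ (Sum.inr (ε r)), fun r => ?_, ?_⟩
  · simp only
    rw [h2]
    apply C.len_pos
    have h3 := ((innerEdgeEquiv G).symm (ε r)).2
    generalize ((innerEdgeEquiv G).symm (ε r) : Sym2 U) = e at h3
    induction e with
    | _ u v => exact (h.adj u v).2 h3
  · rw [← hG.relPos_framePos hcard ε ξ, h1]
    congr 1
    funext i
    rw [← hC i]
    exact congrArg C.pos (h.mark i).symm

end

theorem two_le_k {C : PlaneTropCurve d (m + 1)} (hm : m + 2 = 3 * d) (ht : C.Trivalent) : 2 ≤ C.k := by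
  have := C.k_eq ht
  lia

/-- The number of labelled trees through a general configuration of points is a multiple of the
number of curves. -/
theorem hasCount_of_evGeneral (hm : m + 2 = 3 * d) {U : Type} [Fintype U] [Nonempty U]
    [Fintype {G : SimpleGraph (U ⊕ Leaf d (m + 1)) // IsTri G}]
    (hcard : Fintype.card U + 2 = (m + 1) + 3 * d)
    (ε : ∀ G : SimpleGraph (U ⊕ Leaf d (m + 1)), IsTri G → Fin m × Fin 2 ≃ {e // IsInnerEdge G e})
    {p : Fin (m + 1) → Pt} (hp : EvGeneral d p) :
    ∃ n, HasCount (evFibre d p) evMult n ∧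
      coneDegree (fun G : {G : SimpleGraph (U ⊕ Leaf d (m + 1)) // IsTri G} =>
        triMatrix (leafData d m) G.1 (ε G.1 G.2)) (relPos p) =
        ((Fintype.card U).factorial * d.factorial ^ 3 : ℕ) * (n : ℝ) := by
  classical
  set N := (Fintype.card U).factorial * d.factorial ^ 3 with hN
  let S : Set (TropModuli d (m + 1)) := {x | x.out ∈ evFibre d p ∧ evMult x.out ≠ 0}
  -- Incidence between labelled trees and classes of curves. Each class in `S` belongs to exactly
  -- `N` trees, and each tree to at most one class in `S`, since type and points determine the
  -- curve. Finiteness of `S` and the factor `N` both follow.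
  let R : {G : SimpleGraph (U ⊕ Leaf d (m + 1)) // IsTri G} → TropModuli d (m + 1) → Prop :=
    fun G x => ∃ σ, (G.2.toType hcard).IsIso x.out.toM.toTropType σ
  have hRcard : ∀ x ∈ S, Nat.card {G // R G x} = N := by
    rintro x ⟨hx, hx0⟩
    have ht := hp _ hx
    exact card_labelled_trees hcard x.out.toM.toTropType ht
      (fun σ hσ => automorphism_eq_refl hx0 hσ)
      (ends_le_one_of_evMult_ne_zero hx0 ht (two_le_k hm ht))
  have hRinj : ∀ G, ∀ x ∈ S, ∀ y ∈ S, R G x → R G y → x = y := by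
    rintro G x hx y hy ⟨σ, hσ⟩ ⟨τ, hτ⟩
    refine Quotient.out_equiv_out.1 ?_
    exact iso_of_isIso hx.2 (hσ.symm.trans hτ) fun i => (hy.1 i).trans (hx.1 i).symm
  have hSfin : S.Finite := by
    have hex : ∀ x : S, ∃ G, R G x.1 := by
      intro x
      have h1 := hRcard x.1 x.2
      have h2 : Nat.card {G // R G x.1} ≠ 0 := by
        rw [h1]; positivity
      obtain ⟨G, hG⟩ := (Nat.card_ne_zero.1 h2).1
      exact ⟨G, hG⟩
    choose f hf using hex
    have : Function.Injective f := fun x y hxy =>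
      Subtype.ext (hRinj _ x.1 x.2 y.1 y.2 (hf x) (hxy ▸ hf y))
    exact Set.finite_coe_iff.1 (Finite.of_injective f this)
  refine ⟨∑ x ∈ hSfin.toFinset, evMult x.out, ⟨hSfin, ?_⟩, ?_⟩
  · exact finsum_mem_eq_finite_toFinset_sum _ hSfin
  · have hG : ∀ G : {G : SimpleGraph (U ⊕ Leaf d (m + 1)) // IsTri G},
        coneMult (fun G : {G : SimpleGraph (U ⊕ Leaf d (m + 1)) // IsTri G} =>
          triMatrix (leafData d m) G.1 (ε G.1 G.2)) G (relPos p) =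
        ∑ x ∈ hSfin.toFinset, if R G x then (evMult x.out : ℝ) else 0 := by
      intro G
      by_cases hex : ∃ x ∈ S, R G x
      · obtain ⟨x, hx, hR⟩ := hex
        rw [Finset.sum_eq_single x]
        · obtain ⟨σ, hσ⟩ := hR
          rw [if_pos ⟨σ, hσ⟩, G.2.evMult_eq hcard (ε G.1 G.2) hσ]
          exact if_pos (G.2.exists_pos_mulVec_eq hcard _ hx.1 hσ)
        · intro y hy hne
          exact if_neg fun h => hne (hRinj G y (hSfin.mem_toFinset.1 hy) x hx h hR)
        · exact fun h => absurd (hSfin.mem_toFinset.2 hx) h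
      · rw [Finset.sum_eq_zero fun x hx => if_neg fun h => hex ⟨x, hSfin.mem_toFinset.1 hx, h⟩]
        unfold coneMult
        split_ifs with hin
        · obtain ⟨x, h0, hx⟩ := hin
          obtain ⟨C, hC, σ, hσ⟩ := G.2.exists_curve hcard (ε G.1 G.2) h0 hx
          rw [← G.2.evMult_eq hcard (ε G.1 G.2) hσ, Nat.cast_eq_zero]
          by_contra hne
          have hiso : C.Iso (⟦C⟧ : TropModuli d (m + 1)).out :=
            PlaneTropCurve.Iso.symm (Quotient.mk_out C)
          obtain ⟨τ, hτ⟩ := PlaneTropCurve.iso_iff.1 hiso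
          refine hex ⟨⟦C⟧, ⟨fun i => ?_, ?_⟩, _, hσ.trans hτ.toIsIso⟩
          · have h3 : (⟦C⟧ : TropModuli d (m + 1)).out.mark i = τ (C.mark i) := hτ.mark i
            have h4 : (⟦C⟧ : TropModuli d (m + 1)).out.pos (τ (C.mark i)) = _ := hτ.pos (C.mark i)
            unfold PlaneTropCurve.ev
            rw [h3, h4]
            exact hC i
          · rw [← evMult_congr hiso]
            exact hne
        · rfl
    unfold coneDegree
    rw [Finset.sum_congr rfl fun G _ => hG G, Finset.sum_comm, Nat.cast_sum, Finset.mul_sum]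
    refine Finset.sum_congr rfl fun x hx => ?_
    rw [← Finset.sum_filter, Finset.sum_const, ← hRcard x (hSfin.mem_toFinset.1 hx),
      Nat.card_eq_fintype_card, Fintype.card_subtype, nsmul_eq_mul]

/-- The number of curves through a general configuration of points does not depend on the
points. -/
theorem exists_hasCount (d : ℕ) : ∃ nd : ℕ, ∀ m, m + 1 = 3 * d → ∀ p : Fin m → Pt, EvGeneral d p →
    HasCount (evFibre d p) evMult nd := by
  classical
  suffices h : ∀ m, m + 2 = 3 * d → ∃ nd : ℕ, ∀ p : Fin (m + 1) → Pt, EvGeneral d p →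
      HasCount (evFibre d p) evMult nd by
    rcases Nat.eq_zero_or_pos d with rfl | hd
    · exact ⟨0, fun m hm => by lia⟩
    · obtain ⟨nd, hnd⟩ := h (3 * d - 2) (by lia)
      refine ⟨nd, fun m hm => ?_⟩
      obtain rfl : m = 3 * d - 2 + 1 := by lia
      exact hnd
  intro m hm
  have hcard : Fintype.card (Fin (m + 3 * d - 1)) + 2 = (m + 1) + 3 * d := by
    rw [Fintype.card_fin]; lia
  have : Nonempty (Fin (m + 3 * d - 1)) := ⟨⟨0, by lia⟩⟩
  let _ : Fintype {G : SimpleGraph (Fin (m + 3 * d - 1) ⊕ Leaf d (m + 1)) // IsTri G} :=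
    Fintype.ofFinite _
  have hε : ∀ G : SimpleGraph (Fin (m + 3 * d - 1) ⊕ Leaf d (m + 1)), IsTri G →
      Nonempty (Fin m × Fin 2 ≃ {e // IsInnerEdge G e}) := fun G hG =>
    hG.nonempty_equiv_innerEdge (by simpa using hcard) (by simp; lia)
  let ε := fun G hG => (hε G hG).some
  -- The number is read off at one general configuration `p₀`, and `coneDegree` carries it to all
  -- the others.
  by_cases hex : ∃ p : Fin (m + 1) → Pt, EvGeneral d p
  · obtain ⟨p₀, hp₀⟩ := hex
    obtain ⟨n, -, hn⟩ := hasCount_of_evGeneral hm hcard ε hp₀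
    refine ⟨n, fun p hp => ?_⟩
    obtain ⟨n', h1, hn'⟩ := hasCount_of_evGeneral hm hcard ε hp
    have h2 := coneDegree_triMatrix_eq (leafData d m) (by simpa using hcard) ε
      (coneGeneral_of_evGeneral hcard ε hp) (coneGeneral_of_evGeneral hcard ε hp₀)
    rw [hn, hn'] at h2
    have h3 : n' = n := by
      have h4 : (((Fintype.card (Fin (m + 3 * d - 1))).factorial * d.factorial ^ 3 : ℕ) : ℝ) ≠ 0 := by
        positivity
      exact_mod_cast mul_left_cancel₀ h4 h2
    rwa [← h3]
  · exact ⟨0, fun p hp => absurd ⟨p, hp⟩ hex⟩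

end

/-! ### Slopes of a tropical polynomial along lines and local intersection numbers -/

section

namespace TropPoly

variable {F : TropPoly}

/-- The slope of the monomial with exponent `a` in the direction `δ`. -/
def tslope (a : Fin 2 → ℕ) (δ : Fin 2 → ℤ) : ℤ := ∑ c, (a c : ℤ) * δ c

/-- The point at time `t` on the line through `q` with velocity `δ`. -/
def ray (q : Pt) (δ : Fin 2 → ℤ) (t : ℝ) : Pt := fun c => q c + t * (δ c : ℝ)

/-- The integers between the slopes in the direction `δ` of two monomials that are maximal
at `q`. -/
def jumpSet (F : TropPoly) (q : Pt) (δ : Fin 2 → ℤ) : Set ℤ :=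
  {s | ∃ a ∈ F.argmax q, ∃ b ∈ F.argmax q, tslope a δ < s ∧ s ≤ tslope b δ}

theorem term_ray (a : Fin 2 → ℕ) (q : Pt) (δ : Fin 2 → ℤ) (t : ℝ) :
    F.term a (ray q δ t) = F.term a q + t * tslope a δ := by
  simp only [term, ray, tslope, Fin.sum_univ_two, Int.cast_add, Int.cast_mul, Int.cast_natCast]
  ring

theorem argmax_nonempty (hF : F.supp.Nonempty) (q : Pt) : (F.argmax q).Nonempty := by
  obtain ⟨a, ha, hmax⟩ := F.supp.exists_max_image (fun a => F.term a q) hF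
  exact ⟨a, ha, hmax⟩

/-- Convexity: along a ray the slope of the maximal monomial never decreases. -/
theorem tslope_le_tslope {q : Pt} {δ : Fin 2 → ℤ} {t t' : ℝ} (h : t < t') {a b : Fin 2 → ℕ}
    (ha : a ∈ F.argmax (ray q δ t)) (hb : b ∈ F.argmax (ray q δ t')) : tslope a δ ≤ tslope b δ := by
  have h1 := ha.2 b hb.1
  have h2 := hb.2 a ha.1
  rw [term_ray, term_ray] at h1 h2
  by_contra! hlt
  have h3 : (tslope b δ : ℝ) < tslope a δ := by exact_mod_cast hlt
  nlinarith

/-- Separate the monomials of slope below `s` from the others. The maxima of both groups are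
continuous and change order between `t₀` and `t₁`. Where they agree, a monomial of each group
attains the overall maximum. -/
theorem exists_mem_jumpSet (hF : F.supp.Nonempty) {q : Pt} {δ : Fin 2 → ℤ} {t₀ t₁ : ℝ}
    (h : t₀ ≤ t₁) {s : ℤ}
    (h₀ : ∀ a ∈ F.argmax (ray q δ t₀), tslope a δ < s)
    (h₁ : ∀ a ∈ F.argmax (ray q δ t₁), s ≤ tslope a δ) :
    ∃ t ∈ Set.Ioo t₀ t₁, s ∈ F.jumpSet (ray q δ t) δ := by
  obtain ⟨α, hα⟩ := argmax_nonempty hF (ray q δ t₀)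
  obtain ⟨β, hβ⟩ := argmax_nonempty hF (ray q δ t₁)
  let A := F.supp.filter fun a => tslope a δ < s
  let B := F.supp.filter fun a => s ≤ tslope a δ
  have hαA : α ∈ A := Finset.mem_filter.2 ⟨hα.1, h₀ α hα⟩
  have hβB : β ∈ B := Finset.mem_filter.2 ⟨hβ.1, h₁ β hβ⟩
  have hA : A.Nonempty := ⟨α, hαA⟩
  have hB : B.Nonempty := ⟨β, hβB⟩
  let f : ℝ → ℝ := fun t => A.sup' hA fun a => F.term a q + t * tslope a δ
  let g : ℝ → ℝ := fun t => B.sup' hB fun a => F.term a q + t * tslope a δ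
  have hf : Continuous f := by
    refine Continuous.finset_sup'_apply hA fun a _ => ?_
    fun_prop
  have hg : Continuous g := by
    refine Continuous.finset_sup'_apply hB fun a _ => ?_
    fun_prop
  have hlt₀ : g t₀ < f t₀ := by
    refine (Finset.sup'_lt_iff hB).2 fun b hb => ?_
    refine lt_of_lt_of_le ?_ (Finset.le_sup' (f := fun a => F.term a q + t₀ * tslope a δ) hαA)
    obtain ⟨hb1, hb2⟩ := Finset.mem_filter.1 hb
    simp only [← term_ray]
    refine lt_of_le_of_ne (hα.2 b hb1) fun he => ?_
    exact absurd (h₀ b ⟨hb1, fun e hee => by rw [he]; exact hα.2 e hee⟩) (not_lt.2 hb2)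
  have hlt₁ : f t₁ < g t₁ := by
    refine (Finset.sup'_lt_iff hA).2 fun b hb => ?_
    refine lt_of_lt_of_le ?_ (Finset.le_sup' (f := fun a => F.term a q + t₁ * tslope a δ) hβB)
    obtain ⟨hb1, hb2⟩ := Finset.mem_filter.1 hb
    simp only [← term_ray]
    refine lt_of_le_of_ne (hβ.2 b hb1) fun he => ?_
    exact absurd (h₁ b ⟨hb1, fun e hee => by rw [he]; exact hβ.2 e hee⟩) (not_le.2 hb2)
  obtain ⟨t, ht, h0⟩ := intermediate_value_Ioo h ((hg.sub hf).continuousOn)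
    (show (0 : ℝ) ∈ Set.Ioo ((g - f) t₀) ((g - f) t₁) from
      ⟨sub_neg.2 hlt₀, sub_pos.2 hlt₁⟩)
  have heq : g t = f t := sub_eq_zero.1 h0
  have hle : ∀ e ∈ F.supp, F.term e (ray q δ t) ≤ f t := by
    intro e he
    rw [term_ray]
    by_cases hs : tslope e δ < s
    · exact Finset.le_sup' (f := fun a => F.term a q + t * tslope a δ)
        (Finset.mem_filter.2 ⟨he, hs⟩)
    · rw [← heq]
      exact Finset.le_sup' (f := fun a => F.term a q + t * tslope a δ)
        (Finset.mem_filter.2 ⟨he, (not_lt (a := tslope e δ)).1 hs⟩)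
  obtain ⟨a, haA, ha⟩ := A.exists_mem_eq_sup' hA fun a => F.term a q + t * tslope a δ
  obtain ⟨b, hbB, hb⟩ := B.exists_mem_eq_sup' hB fun a => F.term a q + t * tslope a δ
  refine ⟨t, ht, a, ⟨(Finset.mem_filter.1 haA).1, fun e he => ?_⟩, b,
    ⟨(Finset.mem_filter.1 hbB).1, fun e he => ?_⟩, (Finset.mem_filter.1 haA).2,
    (Finset.mem_filter.1 hbB).2⟩
  · rw [term_ray (a := a), ← ha]
    exact hle e he
  · rw [term_ray (a := b), ← hb]
    exact (hle e he).trans heq.ge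

theorem mem_locus_of_jumpSet {q : Pt} {δ : Fin 2 → ℤ} (h : (F.jumpSet q δ).Nonempty) :
    q ∈ F.locus := by
  obtain ⟨s, a, ha, b, hb, h1, h2⟩ := h
  refine ⟨a, ha, b, hb, ?_⟩
  rintro rfl
  lia

theorem ne_zero_of_jumpSet {q : Pt} {δ : Fin 2 → ℤ} (h : (F.jumpSet q δ).Nonempty) : δ ≠ 0 := by
  rintro rfl
  obtain ⟨s, a, ha, b, hb, h1, h2⟩ := h
  simp [tslope] at h1 h2
  lia

/-- The maximal exponents lie on the dual segment, so their slopes lie between those of its end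
points, which differ by the pairing of `w` with `δ`. -/
theorem jumpSet_eq_Ioc {q : Pt} {w : Fin 2 → ℤ} (h : F.IsEdgeNormal q w) (δ : Fin 2 → ℤ) :
    ∃ x y : ℤ, (∑ c, w c * δ c).natAbs = (y - x).toNat ∧ F.jumpSet q δ = Set.Ioc x y := by
  obtain ⟨a, ha, b, hb, -, hw, hseg⟩ := h
  have hsl : ∑ c, w c * δ c = tslope a δ - tslope b δ := by
    simp only [tslope, hw, Fin.sum_univ_two]
    ring
  have hbd : ∀ e ∈ F.argmax q, min (tslope a δ) (tslope b δ) ≤ tslope e δ ∧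
      tslope e δ ≤ max (tslope a δ) (tslope b δ) := by
    intro e he
    obtain ⟨t, h0, h1, ht⟩ := hseg e he
    have h2 : (tslope e δ : ℝ) = tslope b δ + t * (tslope a δ - tslope b δ) := by
      simp only [tslope, Fin.sum_univ_two, Int.cast_add, Int.cast_mul, Int.cast_natCast, ht]
      ring
    have h3 : min (tslope a δ : ℝ) (tslope b δ) ≤ tslope e δ ∧
        (tslope e δ : ℝ) ≤ max (tslope a δ : ℝ) (tslope b δ) := by
      rw [h2]
      rcases le_total (tslope a δ : ℝ) (tslope b δ) with hab | hab
      · rw [min_eq_left hab, max_eq_right hab]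
        constructor <;> nlinarith
      · rw [min_eq_right hab, max_eq_left hab]
        constructor <;> nlinarith
    exact_mod_cast h3
  refine ⟨min (tslope a δ) (tslope b δ), max (tslope a δ) (tslope b δ), ?_, ?_⟩
  · rw [hsl]
    rcases le_total (tslope a δ) (tslope b δ) with hab | hab
    · rw [min_eq_left hab, max_eq_right hab]; lia
    · rw [min_eq_right hab, max_eq_left hab]; lia
  · ext s
    constructor
    · rintro ⟨e, he, e', he', h1, h2⟩
      exact ⟨(hbd e he).1.trans_lt h1, h2.trans (hbd e' he').2⟩
    · rintro ⟨h1, h2⟩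
      rcases le_total (tslope a δ) (tslope b δ) with hab | hab
      · rw [min_eq_left hab] at h1
        rw [max_eq_right hab] at h2
        exact ⟨a, ha, b, hb, h1, h2⟩
      · rw [min_eq_right hab] at h1
        rw [max_eq_left hab] at h2
        exact ⟨b, hb, a, ha, h1, h2⟩

theorem nat_card_Ioc (x y : ℤ) : Nat.card (Set.Ioc x y) = (y - x).toNat := by
  rw [Nat.card_eq_fintype_card, Fintype.card_ofFinset, Int.card_Ioc]

/-- The size of the jump of the slope at an edge is the intersection multiplicity. -/
theorem card_jumpSet {q : Pt} (h : F.IsEdgePoint q) (δ : Fin 2 → ℤ) :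
    Nat.card (F.jumpSet q δ) = (∑ c, F.edgeNormal q c * δ c).natAbs := by
  have hw : F.IsEdgeNormal q (F.edgeNormal q) := by
    unfold edgeNormal
    rw [dif_pos h]
    exact h.choose_spec
  obtain ⟨x, y, h1, h2⟩ := jumpSet_eq_Ioc hw δ
  rw [h1, h2, nat_card_Ioc]

theorem finite_jumpSet (q : Pt) (δ : Fin 2 → ℤ) : (F.jumpSet q δ).Finite := by
  have : F.jumpSet q δ ⊆ ⋃ a ∈ F.supp, ⋃ b ∈ F.supp, Set.Ioc (tslope a δ) (tslope b δ) := by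
    rintro s ⟨a, ha, b, hb, h1, h2⟩
    simp only [Set.mem_iUnion]
    exact ⟨a, ha.1, b, hb.1, h1, h2⟩
  refine Set.Finite.subset ?_ this
  exact Set.Finite.biUnion F.supp.finite_toSet fun a _ =>
    Set.Finite.biUnion F.supp.finite_toSet fun b _ => Set.finite_Ioc _ _

/-- The jumps of the slope on a piece of a line, as a set of pairs. -/
theorem bijective_jump {q : Pt} {δ : Fin 2 → ℤ} {J : Set ℝ} {x y : ℤ}
    (hlow : ∀ t ∈ J, ∀ a ∈ F.argmax (ray q δ t), x ≤ tslope a δ ∧ tslope a δ ≤ y)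
    (hcov : ∀ s, x < s → s ≤ y → ∃ t ∈ J, s ∈ F.jumpSet (ray q δ t) δ) :
    Nat.card {z : Pt × ℤ // z.1 ∈ ray q δ '' J ∧ z.2 ∈ F.jumpSet z.1 δ} = (y - x).toNat ∧
    Finite {z : Pt × ℤ // z.1 ∈ ray q δ '' J ∧ z.2 ∈ F.jumpSet z.1 δ} := by
  let f : {z : Pt × ℤ // z.1 ∈ ray q δ '' J ∧ z.2 ∈ F.jumpSet z.1 δ} → Set.Ioc x y :=
    fun z => ⟨z.1.2, by
      obtain ⟨⟨t, ht, hz⟩, a, ha, b, hb, h1, h2⟩ := z.2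
      rw [← hz] at ha hb
      exact ⟨(hlow t ht a ha).1.trans_lt h1, h2.trans (hlow t ht b hb).2⟩⟩
  have hinj : Function.Injective f := by
    intro z₁ z₂ h
    have hs : z₁.1.2 = z₂.1.2 := congrArg Subtype.val h
    obtain ⟨⟨t₁, ht₁, e₁⟩, a, ha, b, hb, k1, k2⟩ := z₁.2
    obtain ⟨⟨t₂, ht₂, e₂⟩, a', ha', b', hb', k3, k4⟩ := z₂.2
    rw [← e₁] at ha hb
    rw [← e₂] at ha' hb'
    -- By monotonicity of the slopes each integer is jumped over at one time only.
    have ht : t₁ = t₂ := by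
      by_contra hne
      rcases lt_or_gt_of_ne hne with hlt | hlt
      · have := tslope_le_tslope hlt hb ha'
        lia
      · have := tslope_le_tslope hlt hb' ha
        lia
    exact Subtype.ext (Prod.ext (by rw [← e₁, ← e₂, ht]) hs)
  have hsurj : Function.Surjective f := by
    rintro ⟨s, h1, h2⟩
    obtain ⟨t, ht, hs⟩ := hcov s h1 h2
    exact ⟨⟨(_, s), ⟨t, ht, rfl⟩, hs⟩, rfl⟩
  exact ⟨(Nat.card_eq_of_bijective f ⟨hinj, hsurj⟩).trans (nat_card_Ioc x y),
    Finite.of_injective f hinj⟩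

theorem argmax_eq_singleton (hF : F.supp.Nonempty) {q : Pt} (hq : q ∉ F.locus) :
    ∃ α, F.argmax q = {α} := by
  obtain ⟨α, hα⟩ := argmax_nonempty hF q
  refine ⟨α, Set.eq_singleton_iff_unique_mem.2 ⟨hα, fun b hb => ?_⟩⟩
  by_contra hne
  exact hq ⟨b, hb, α, hα, hne⟩

theorem ray_zero (q : Pt) (δ : Fin 2 → ℤ) : ray q δ 0 = q := by
  funext c; simp [ray]

theorem card_jumps_edge (hF : F.supp.Nonempty) {q : Pt} {δ : Fin 2 → ℤ} {ℓ : ℝ} (hℓ : 0 < ℓ)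
    {α β : Fin 2 → ℕ} (hα : F.argmax q = {α}) (hβ : F.argmax (ray q δ ℓ) = {β}) :
    (Nat.card {z : Pt × ℤ // z.1 ∈ ray q δ '' Set.Ioo 0 ℓ ∧ z.2 ∈ F.jumpSet z.1 δ} : ℤ) =
      tslope β δ - tslope α δ ∧
    Finite {z : Pt × ℤ // z.1 ∈ ray q δ '' Set.Ioo 0 ℓ ∧ z.2 ∈ F.jumpSet z.1 δ} := by
  have hα' : F.argmax (ray q δ 0) = {α} := by rw [ray_zero, hα]
  have h := bijective_jump (F := F) (q := q) (δ := δ) (J := Set.Ioo 0 ℓ) (x := tslope α δ)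
    (y := tslope β δ)
    (fun t ht a ha => ⟨tslope_le_tslope ht.1 (by rw [hα']; rfl) ha,
      tslope_le_tslope ht.2 ha (by rw [hβ]; rfl)⟩)
    (fun s h1 h2 => exists_mem_jumpSet hF hℓ.le (by rw [hα']; rintro a rfl; exact h1)
      (by rw [hβ]; rintro a rfl; exact h2))
  refine ⟨?_, h.2⟩
  have h2 : tslope α δ ≤ tslope β δ :=
    tslope_le_tslope hℓ (F := F) (q := q) (by rw [hα']; rfl) (by rw [hβ]; rfl)
  rw [h.1]
  lia

theorem card_jumps_end (hF : F.supp.Nonempty) {q : Pt} {δ : Fin 2 → ℤ} {α : Fin 2 → ℕ}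
    (hα : F.argmax q = {α}) {y : ℤ} (hy : ∀ a ∈ F.supp, tslope a δ ≤ y)
    (hy' : ∃ a ∈ F.supp, tslope a δ = y) :
    (Nat.card {z : Pt × ℤ // z.1 ∈ ray q δ '' Set.Ioi 0 ∧ z.2 ∈ F.jumpSet z.1 δ} : ℤ) =
      y - tslope α δ ∧
    Finite {z : Pt × ℤ // z.1 ∈ ray q δ '' Set.Ioi 0 ∧ z.2 ∈ F.jumpSet z.1 δ} := by
  have hα' : F.argmax (ray q δ 0) = {α} := by rw [ray_zero, hα]
  have h := bijective_jump (F := F) (q := q) (δ := δ) (J := Set.Ioi 0) (x := tslope α δ)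
    (y := y)
    (fun t ht a ha => ⟨tslope_le_tslope ht (by rw [hα']; rfl) ha, hy a ha.1⟩)
    (fun s h1 h2 => by
      obtain ⟨b, hb, hby⟩ := hy'
      -- Far out on the ray the monomial `b` of the largest slope beats every monomial of slope
      -- below `s`. Slopes are integers, so the gap is at least one, which gives the explicit bound
      -- `T`.
      have hev : ∀ a ∈ F.supp, ∃ T : ℝ, ∀ t, T ≤ t → tslope a δ < s →
          F.term a (ray q δ t) < F.term b (ray q δ t) := by
        intro a _
        refine ⟨max 0 (F.term a q - F.term b q + 1), fun t ht hs => ?_⟩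
        have h0 := (le_max_left _ _).trans ht
        have h3 := (le_max_right _ _).trans ht
        have h4 : (tslope a δ : ℝ) + 1 ≤ tslope b δ := by
          have : tslope a δ + 1 ≤ tslope b δ := by lia
          exact_mod_cast this
        rw [term_ray, term_ray]
        nlinarith
      choose! T hT using hev
      obtain ⟨t₁, ht₁⟩ : ∃ t₁ : ℝ, 0 ≤ t₁ ∧ ∀ a ∈ F.supp, T a ≤ t₁ :=
        ⟨max 0 (F.supp.sup' hF T), le_max_left _ _, fun a ha =>
          (Finset.le_sup' T ha).trans (le_max_right _ _)⟩
      obtain ⟨t, ht, hs⟩ := exists_mem_jumpSet hF (q := q) ht₁.1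
        (by rw [hα']; rintro a rfl; exact h1) (s := s)
        (fun a ha => by
          by_contra! hlt
          exact absurd (ha.2 b hb) (not_le.2 (hT a ha.1 t₁ (ht₁.2 a ha.1) hlt)))
      exact ⟨t, ht.1, hs⟩)
  refine ⟨?_, h.2⟩
  have h2 : tslope α δ ≤ y := hy α (by
    have : α ∈ F.argmax q := by rw [hα]; rfl
    exact this.1)
  rw [h.1]
  lia

end TropPoly

end

/-! ### Bézout's theorem as a sum of slope changes -/

section

variable {V : Type} [Fintype V] {d m : ℕ}

/-- The sum of a symmetric function over pairs of adjacent vertices. -/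
theorem SimpleGraph.sum_sum_eq_two_mul_sum_edgeSet (G : SimpleGraph V) [Fintype G.edgeSet]
    {g : V → V → ℤ} (hsymm : ∀ u v, g u v = g v u) (h0 : ∀ u v, ¬ G.Adj u v → g u v = 0) :
    ∑ u, ∑ v, g u v = 2 * ∑ e : G.edgeSet, g (Quot.out e.1).1 (Quot.out e.1).2 := by
  classical
  have hout : ∀ a b, g (Quot.out s(a, b)).1 (Quot.out s(a, b)).2 = g a b := by
    intro a b
    have : s((Quot.out s(a, b)).1, (Quot.out s(a, b)).2) = s(a, b) := Quot.out_eq _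
    rcases Sym2.eq_iff.1 this with ⟨h1, h2⟩ | ⟨h1, h2⟩
    · rw [h1, h2]
    · rw [h1, h2, hsymm]
  rw [← Fintype.sum_prod_type',
    ← Finset.sum_fiberwise Finset.univ (fun x : V × V => s(x.1, x.2)) (fun x => g x.1 x.2)]
  rw [← Fintype.sum_subtype_add_sum_subtype (fun e => e ∈ G.edgeSet), Finset.mul_sum,
    Finset.sum_eq_zero (s := (Finset.univ : Finset {e // e ∉ G.edgeSet})), add_zero]
  · refine Finset.sum_congr (by ext; simp) fun e _ => ?_
    obtain ⟨e, he⟩ := e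
    induction e with
    | _ a b =>
      rw [hout]
      have : ({x | s(x.1, x.2) = s(a, b)} : Finset (V × V)) = {(a, b), (b, a)} := by
        ext ⟨x, y⟩
        simp [Prod.ext_iff]
      rw [this, Finset.sum_pair (by
        have : a ≠ b := G.ne_of_adj he
        simp [this]), hsymm b a]
      ring
  · rintro ⟨e, he⟩ _
    refine Finset.sum_eq_zero fun x hx => h0 _ _ fun h => he ?_
    have h1 : s(x.1, x.2) = e := (Finset.mem_filter.1 hx).2
    rw [← h1]
    exact h

open TropPoly

theorem TropPoly.tslope_neg (a : Fin 2 → ℕ) (δ : Fin 2 → ℤ) : tslope a (-δ) = -tslope a δ := by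
  simp [tslope]

/-- The total change of the slopes along a curve is given by its degree. -/
theorem TropType.sum_slope (T : TropType V d m) [Fintype T.graph.edgeSet] (α : V → Fin 2 → ℕ)
    (y : Fin 3 → ℤ) :
    ∑ e : T.graph.edgeSet,
      (tslope (α (Quot.out e.1).2) (T.dir (Quot.out e.1).1 (Quot.out e.1).2) -
        tslope (α (Quot.out e.1).1) (T.dir (Quot.out e.1).1 (Quot.out e.1).2)) +
      ∑ u, ∑ j, (T.ends u j : ℤ) * (y j - tslope (α u) (endDir j)) = d * ∑ j, y j := by
  have h1 := T.graph.sum_sum_eq_two_mul_sum_edgeSet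
    (g := fun u v => tslope (α v) (T.dir u v) - tslope (α u) (T.dir u v))
    (fun u v => by rw [T.dir_antisymm u v, tslope_neg, tslope_neg]; ring)
    (fun u v h => by rw [T.dir_eq_zero u v h]; simp [tslope])
  have h2 : ∑ u, ∑ v, tslope (α v) (T.dir u v) = -∑ u, ∑ v, tslope (α u) (T.dir u v) := by
    rw [Finset.sum_comm, ← Finset.sum_neg_distrib]
    refine Finset.sum_congr rfl fun u _ => ?_
    rw [← Finset.sum_neg_distrib]
    refine Finset.sum_congr rfl fun v _ => ?_
    rw [T.dir_antisymm u v, tslope_neg]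
  -- Since `tslope (α u)` is linear in the direction, balancing at `u` trades its bounded edges for
  -- its ends.
  have h3 : ∑ u, ∑ v, tslope (α u) (T.dir u v) =
      -∑ u, ∑ j, (T.ends u j : ℤ) * tslope (α u) (endDir j) := by
    rw [← Finset.sum_neg_distrib]
    refine Finset.sum_congr rfl fun u _ => ?_
    have hb0 := T.balanced u 0
    have hb1 := T.balanced u 1
    have e1 : ∑ v, tslope (α u) (T.dir u v) =
        (α u 0 : ℤ) * ∑ v, T.dir u v 0 + (α u 1 : ℤ) * ∑ v, T.dir u v 1 := by
      rw [Finset.mul_sum, Finset.mul_sum, ← Finset.sum_add_distrib]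
      exact Finset.sum_congr rfl fun v _ => by simp [tslope]
    have e2 : ∑ j, (T.ends u j : ℤ) * tslope (α u) (endDir j) =
        (α u 0 : ℤ) * ∑ j, (T.ends u j : ℤ) * endDir j 0 +
          (α u 1 : ℤ) * ∑ j, (T.ends u j : ℤ) * endDir j 1 := by
      rw [Finset.mul_sum, Finset.mul_sum, ← Finset.sum_add_distrib]
      exact Finset.sum_congr rfl fun v _ => by simp [tslope]; ring
    rw [e1, e2]
    linear_combination (α u 0 : ℤ) * hb0 + (α u 1 : ℤ) * hb1
  have h4 : ∑ u, ∑ j, (T.ends u j : ℤ) * (y j - tslope (α u) (endDir j)) =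
      ∑ j, (d : ℤ) * y j - ∑ u, ∑ j, (T.ends u j : ℤ) * tslope (α u) (endDir j) := by
    simp only [mul_sub, Finset.sum_sub_distrib]
    congr 1
    rw [Finset.sum_comm]
    refine Finset.sum_congr rfl fun j _ => ?_
    rw [← Finset.sum_mul]
    congr 1
    exact_mod_cast T.ends_sum j
  simp only [Finset.sum_sub_distrib] at h1 ⊢
  rw [h4, Finset.mul_sum]
  linarith

/-- The largest slope of a polynomial of degree `l` in the direction of an end. -/
def maxSlope (l : ℕ) : Fin 3 → ℤ := ![0, 0, l]

theorem TropPoly.HasDegree.slope_le {F : TropPoly} {l : ℕ} (hF : F.HasDegree l) (j : Fin 3)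
    {a : Fin 2 → ℕ} (ha : a ∈ F.supp) : tslope a (endDir j) ≤ maxSlope l j := by
  have := hF.1 a ha
  fin_cases j <;> simp [tslope, endDir, maxSlope] <;> lia

theorem TropPoly.HasDegree.exists_slope_eq {F : TropPoly} {l : ℕ} (hF : F.HasDegree l)
    (j : Fin 3) : ∃ a ∈ F.supp, tslope a (endDir j) = maxSlope l j := by
  fin_cases j
  · exact ⟨_, hF.2.1, by simp [tslope, endDir, maxSlope]⟩
  · exact ⟨_, hF.2.1, by simp [tslope, endDir, maxSlope]⟩
  · exact ⟨_, hF.2.2.1, by simp [tslope, endDir, maxSlope]⟩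

theorem TropPoly.HasDegree.supp_nonempty {F : TropPoly} {l : ℕ} (hF : F.HasDegree l) :
    F.supp.Nonempty := ⟨_, hF.2.1⟩

end

/-! ### Attaching a marking to an edge or an end -/

section

variable {V : Type} [Fintype V] {d m : ℕ}

/-- The graph obtained by adding a vertex `none` with set of neighbours `N` and removing the edges
inside of `N`. -/
def attachGraph (G : SimpleGraph V) (N : Set V) : SimpleGraph (Option V) where
  Adj
    | none, none => False
    | none, some v => v ∈ N
    | some u, none => u ∈ N
    | some u, some v => G.Adj u v ∧ ¬ (u ∈ N ∧ v ∈ N)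
  symm := ⟨fun
    | none, none => id
    | none, some _ => id
    | some _, none => id
    | some _, some _ => fun h => ⟨h.1.symm, fun h' => h.2 h'.symm⟩⟩
  loopless := ⟨fun
    | none => id
    | some _ => fun h => G.irrefl h.1⟩

/-- Each bypassed edge is replaced by a path through the new vertex, so the graph stays connected.
By `hcard` the number of edges grows by at most one, as does the number of vertices. -/
theorem isTree_attachGraph {G : SimpleGraph V} (hG : G.IsTree) {N : Set V} (hN : N.Nonempty)
    (hcard : N.ncard ≤ 1 + {e | e ∈ G.edgeSet ∧ ∀ x ∈ e, x ∈ N}.ncard) :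
    (attachGraph G N).IsTree := by
  classical
  have hconn : (attachGraph G N).Connected := by
    have key : ∀ {u v}, G.Walk u v → (attachGraph G N).Reachable (some u) (some v) := by
      intro u v p
      induction p with
      | nil => exact SimpleGraph.Reachable.refl _
      | @cons u v w huv _ ih =>
        refine SimpleGraph.Reachable.trans ?_ ih
        by_cases h : u ∈ N ∧ v ∈ N
        · have h1 : (attachGraph G N).Adj (some u) none := h.1
          have h2 : (attachGraph G N).Adj none (some v) := h.2
          exact h1.reachable.trans h2.reachable
        · have h1 : (attachGraph G N).Adj (some u) (some v) := ⟨huv, h⟩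
          exact h1.reachable
    obtain ⟨a, ha⟩ := hN
    have ha' : (attachGraph G N).Adj none (some a) := ha
    have h2 : ∀ x, (attachGraph G N).Reachable (some a) x := by
      rintro (_ | v)
      · exact ha'.symm.reachable
      · obtain ⟨p⟩ := hG.connected.preconnected a v
        exact key p
    exact SimpleGraph.Connected.mk fun x y => (h2 x).symm.trans (h2 y)
  rw [SimpleGraph.isTree_iff_connected_and_card]
  refine ⟨hconn, le_antisymm ?_ hconn.card_vert_le_card_edgeSet_add_one⟩
  have h1 := (SimpleGraph.isTree_iff_connected_and_card.1 hG).2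
  rw [Nat.card_coe_set_eq] at h1 ⊢
  have h2 : (attachGraph G N).edgeSet ⊆
      Sym2.map some '' (G.edgeSet \ {e | e ∈ G.edgeSet ∧ ∀ x ∈ e, x ∈ N}) ∪
        (fun v => s(none, some v)) '' N := by
    intro e
    induction e with
    | _ x y =>
      intro h
      rcases x with _ | u <;> rcases y with _ | v
      · exact h.elim
      · exact Or.inr ⟨v, h, rfl⟩
      · exact Or.inr ⟨u, h, Sym2.eq_swap⟩
      · refine Or.inl ⟨s(u, v), ⟨h.1, fun h' => h.2 ⟨h'.2 u (by simp), h'.2 v (by simp)⟩⟩, rfl⟩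
  have h3 := (Set.ncard_le_ncard h2).trans (Set.ncard_union_le _ _)
  have h4 := Set.ncard_image_le (f := Sym2.map (some : V → Option V))
    (Set.toFinite (G.edgeSet \ {e | e ∈ G.edgeSet ∧ ∀ x ∈ e, x ∈ N}))
  have h5 := Set.ncard_image_le (f := fun v : V => s(none, some v)) (Set.toFinite N)
  have h6 := Set.ncard_sdiff_add_ncard_of_subset
    (s := {e | e ∈ G.edgeSet ∧ ∀ x ∈ e, x ∈ N}) (t := G.edgeSet) (fun e he => he.1)
  rw [Nat.card_eq_fintype_card] at h1 ⊢
  rw [Fintype.card_option]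
  lia

/-- A place at which a marking can be attached: a bounded edge from `base` to `other`, or an end
at `base` (in which case `other = none`). -/
structure TropType.Site (T : TropType V d m) where
  base : V
  other : Option V
  ends : Fin 3 → ℕ
  dir : Fin 2 → ℤ
  of_some : ∀ b, other = some b → T.graph.Adj base b ∧ dir = T.dir base b ∧ ends = 0
  of_none : other = none → ∃ j, ends = Pi.single j 1 ∧ dir = endDir j ∧ T.ends base j ≠ 0

namespace TropType.Site

variable {T : TropType V d m} (s : T.Site)

/-- The vertices of the edge. -/
def nbrs : Set V := {v | v = s.base ∨ some v = s.other}

theorem ends_le (j : Fin 3) : s.ends j ≤ T.ends s.base j := by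
  rcases h : s.other with _ | b
  · obtain ⟨i, h1, -, h2⟩ := s.of_none h
    rw [h1]
    by_cases hj : j = i
    · subst hj
      simpa [Nat.one_le_iff_ne_zero] using h2
    · simp [hj]
  · rw [(s.of_some b h).2.2]
    simp

theorem sum_ends (c : Fin 2) :
    ∑ j, (s.ends j : ℤ) * endDir j c = if s.other = none then s.dir c else 0 := by
  rcases h : s.other with _ | b
  · obtain ⟨i, h1, h2, -⟩ := s.of_none h
    rw [h1, h2]
    simp [Pi.single_apply]
  · simp [(s.of_some b h).2.2]

-- The amount by which cutting the edge disturbs the balance at `u`. The flag towards the new vertex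
-- compensates for it.
open Classical in
theorem sum_dir_nbrs (u : V) (c : Fin 2) :
    ∑ v, (if u ∈ s.nbrs ∧ v ∈ s.nbrs then T.dir u v c else 0) =
      (if u = s.base ∧ s.other ≠ none then s.dir c else 0) -
        (if some u = s.other then s.dir c else 0) := by
  have hself : ∀ u, T.dir u u c = 0 := fun u => by
    rw [T.dir_eq_zero u u (T.graph.irrefl)]; rfl
  rcases h : s.other with _ | b
  · have hN : ∀ v, v ∈ s.nbrs ↔ v = s.base := by
      intro v
      simp [nbrs, h]
    simp only [hN]
    rw [Finset.sum_eq_zero]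
    · simp
    · intro v _
      split_ifs with h1
      · rw [h1.1, h1.2, hself]
      · rfl
  · obtain ⟨h1, h2, -⟩ := s.of_some b h
    have hN : ∀ v, v ∈ s.nbrs ↔ v = s.base ∨ v = b := by
      intro v
      simp [nbrs, h]
    simp only [hN, h2]
    have h3 : ∀ v, (if (u = s.base ∨ u = b) ∧ (v = s.base ∨ v = b) then T.dir u v c else 0) =
        (if v = s.base then (if u = b then T.dir b s.base c else 0) else 0) +
        (if v = b then (if u = s.base then T.dir s.base b c else 0) else 0) := by
      intro v
      have := h1.ne
      by_cases hu : u = s.base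
      · by_cases hv : v = s.base
        · subst hu; subst hv; simp [hself, this]
        · by_cases hv' : v = b
          · subst hu; subst hv'; simp [this, this.symm]
          · simp [hv, hv']
      · by_cases hu' : u = b
        · by_cases hv : v = s.base
          · subst hu'; subst hv; simp [this, this.symm]
          · by_cases hv' : v = b
            · subst hu'; subst hv'; simp [hself, this.symm]
            · simp [hv, hv']
        · simp [hu, hu']
    simp only [h3, Finset.sum_add_distrib, Finset.sum_ite_eq', Finset.mem_univ, if_true]
    rw [T.dir_antisymm s.base b]
    have := h1.ne
    by_cases hu : u = b
    · subst hu; simp [this.symm]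
    · by_cases hu' : u = s.base
      · subst hu'; simp [hu]
      · simp [hu, hu']

theorem isTree : (attachGraph T.graph s.nbrs).IsTree := by
  refine isTree_attachGraph T.isTree ⟨s.base, Or.inl rfl⟩ ?_
  rcases h : s.other with _ | b
  · have : s.nbrs = {s.base} := by ext v; simp [nbrs, h]
    rw [this, Set.ncard_singleton]
    lia
  · obtain ⟨h1, -, -⟩ := s.of_some b h
    have : s.nbrs = {s.base, b} := by ext v; simp [nbrs, h]
    rw [this, Set.ncard_pair h1.ne]
    have h2 : {s(s.base, b)} ⊆ {e | e ∈ T.graph.edgeSet ∧ ∀ x ∈ e, x ∈ ({s.base, b} : Set V)} := by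
      rintro e rfl
      exact ⟨h1, by simp⟩
    have h3 := Set.ncard_le_ncard h2
    rw [Set.ncard_singleton] at h3
    lia

end TropType.Site

open Classical in
/-- The type obtained by attaching a further marking. -/
noncomputable def TropType.attach (T : TropType V d m) (s : T.Site) :
    TropType (Option V) d (m + 1) where
  graph := attachGraph T.graph s.nbrs
  isTree := s.isTree
  mark := (Fin.snoc (fun i => some (T.mark i)) none : Fin (m + 1) → Option V)
  ends
    | none => s.ends
    -- The truncated subtraction is exact by `Site.ends_le`: an end moved to the new vertex was
    -- present at the base.
    | some u => fun j => T.ends u j - if u = s.base then s.ends j else 0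
  ends_sum j := by
    have h := T.ends_sum j
    have hle : ∀ u ∈ (Finset.univ : Finset V),
        (if u = s.base then s.ends j else 0) ≤ T.ends u j := by
      intro u _
      split_ifs with hu
      · rw [hu]; exact s.ends_le j
      · exact Nat.zero_le _
    have h2 := Finset.sum_le_sum hle
    rw [Fintype.sum_option, Finset.sum_tsub_distrib _ hle]
    simp only [Finset.sum_ite_eq', Finset.mem_univ, if_true] at h2 ⊢
    lia
  dir
    | none, none => 0
    | none, some v => (if some v = s.other then s.dir else 0) - (if v = s.base then s.dir else 0)
    | some v, none => -((if some v = s.other then s.dir else 0) - (if v = s.base then s.dir else 0))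
    | some u, some v => if u ∈ s.nbrs ∧ v ∈ s.nbrs then 0 else T.dir u v
  dir_antisymm
    | none, none => by simp
    | none, some v => by simp
    | some v, none => by simp
    | some u, some v => by
      simp only [and_comm, T.dir_antisymm u v]
      split_ifs <;> simp
  dir_eq_zero
    | none, none => fun _ => rfl
    | none, some v => fun h => by
      have h1 : v ≠ s.base := fun h' => h (Or.inl h')
      have h2 : some v ≠ s.other := fun h' => h (Or.inr h')
      simp [h1, h2]
    | some v, none => fun h => by
      have h1 : v ≠ s.base := fun h' => h (Or.inl h')
      have h2 : some v ≠ s.other := fun h' => h (Or.inr h')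
      simp [h1, h2]
    | some u, some v => fun h => by
      simp only
      split_ifs with h1
      · rfl
      · exact T.dir_eq_zero u v fun h2 => h ⟨h2, h1⟩
  balanced
    | none, c => by
      rw [Fintype.sum_option]
      simp only [s.sum_ends]
      have h1 : ∑ v, ((if some v = s.other then s.dir else 0) -
          (if v = s.base then s.dir else 0)) c = (if s.other = none then 0 else s.dir c) - s.dir c := by
        simp only [Pi.sub_apply, Finset.sum_sub_distrib]
        congr 1
        · rcases h : s.other with _ | b
          · simp
          · simp [ite_apply]
        · simp [ite_apply]
      rw [h1]
      split_ifs <;> simp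
    | some u, c => by
      rw [Fintype.sum_option]
      simp only
      have h1 : ∑ v, (if u ∈ s.nbrs ∧ v ∈ s.nbrs then 0 else T.dir u v) c =
          ∑ v, T.dir u v c - ∑ v, (if u ∈ s.nbrs ∧ v ∈ s.nbrs then T.dir u v c else 0) := by
        rw [← Finset.sum_sub_distrib]
        refine Finset.sum_congr rfl fun v _ => ?_
        split_ifs <;> simp
      have h2 : ∑ j, ((T.ends u j - if u = s.base then s.ends j else 0 : ℕ) : ℤ) * endDir j c =
          ∑ j, (T.ends u j : ℤ) * endDir j c -
            if u = s.base then ∑ j, (s.ends j : ℤ) * endDir j c else 0 := by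
        have : (if u = s.base then ∑ j, (s.ends j : ℤ) * endDir j c else 0) =
            ∑ j, if u = s.base then (s.ends j : ℤ) * endDir j c else 0 := by
          split_ifs <;> simp
        rw [this, ← Finset.sum_sub_distrib]
        refine Finset.sum_congr rfl fun j _ => ?_
        split_ifs with hu
        · rw [Nat.cast_sub (by rw [hu]; exact s.ends_le j)]
          ring
        · simp
      rw [h1, h2, s.sum_dir_nbrs, s.sum_ends]
      have h3 := T.balanced u c
      simp only [Pi.neg_apply, Pi.sub_apply, ite_apply, Pi.zero_apply]
      by_cases hu : u = s.base
      · by_cases ho : s.other = none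
        · simp [hu, ho] at h3 ⊢; linarith
        · simp [hu, ho] at h3 ⊢; linarith
      · simp [hu]; linarith

end

/-! ### Valences and coordinates after attaching a marking -/

section

variable {V : Type} [Fintype V] {d m : ℕ}

theorem ncard_option {α : Type*} [Finite α] (S : Set (Option α)) [Decidable (none ∈ S)] :
    S.ncard = (some ⁻¹' S).ncard + if none ∈ S then 1 else 0 := by
  rw [← Set.ncard_image_of_injective (some ⁻¹' S) (Option.some_injective α)]
  split_ifs with h
  · rw [← Set.ncard_insert_of_notMem (a := none) (by simp)]
    congr 1
    ext x
    rcases x with _ | x <;> simp [h]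
  · congr 1
    ext x
    rcases x with _ | x <;> simp [h]

namespace TropType

variable {T : TropType V d m} (s : T.Site)

theorem Site.sum_ends_eq : ∑ j, s.ends j = if s.other = none then 1 else 0 := by
  rcases h : s.other with _ | b
  · obtain ⟨i, h1, -, -⟩ := s.of_none h
    rw [h1]
    simp [Pi.single_apply]
  · simp [(s.of_some b h).2.2]

theorem attach_mark_castSucc (i : Fin m) : (T.attach s).mark i.castSucc = some (T.mark i) := by
  simp [attach]

theorem attach_mark_last : (T.attach s).mark (Fin.last m) = none := by
  simp [attach]

theorem attach_ends_none : (T.attach s).ends none = s.ends := rfl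

theorem valence_attach_none : (T.attach s).valence none = 3 := by
  classical
  unfold valence
  rw [attach_ends_none, s.sum_ends_eq]
  have h1 : {i | (T.attach s).mark i = none} = {Fin.last m} := by
    ext i
    induction i using Fin.lastCases with
    | last => simp [attach_mark_last]
    | cast i => simp [attach_mark_castSucc, Fin.castSucc_ne_last]
  rw [h1, Set.ncard_singleton, ncard_option]
  have h2 : some ⁻¹' (T.attach s).graph.neighborSet none = s.nbrs := rfl
  have h3 : none ∉ (T.attach s).graph.neighborSet none :=
    fun h => (T.attach s).graph.irrefl ((SimpleGraph.mem_neighborSet _ _ _).1 h)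
  rw [h2, if_neg h3]
  rcases h : s.other with _ | b
  · have : s.nbrs = {s.base} := by ext v; simp [Site.nbrs, h]
    rw [this, Set.ncard_singleton]
    rfl
  · have : s.nbrs = {s.base, b} := by ext v; simp [Site.nbrs, h]
    rw [this, Set.ncard_pair (s.of_some b h).1.ne]
    simp

/-- A vertex of the chosen edge exchanges one flag, an edge or an end, for the flag towards the new
vertex. -/
theorem valence_attach_some (u : V) : (T.attach s).valence (some u) = T.valence u := by
  classical
  unfold valence
  have h1 : {i | (T.attach s).mark i = some u} = Fin.castSucc '' {i | T.mark i = u} := by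
    ext i
    induction i using Fin.lastCases with
    | last => simp [attach_mark_last, Fin.castSucc_ne_last]
    | cast i => simp [attach_mark_castSucc]
  have h2 : some ⁻¹' (T.attach s).graph.neighborSet (some u) =
      {v | T.graph.Adj u v ∧ ¬ (u ∈ s.nbrs ∧ v ∈ s.nbrs)} := rfl
  have h3 : none ∈ (T.attach s).graph.neighborSet (some u) ↔ u ∈ s.nbrs := Iff.rfl
  have h4 : ∑ j, (T.attach s).ends (some u) j =
      ∑ j, T.ends u j - if u = s.base then ∑ j, s.ends j else 0 := by
    change ∑ j, (T.ends u j - if u = s.base then s.ends j else 0) = _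
    rw [Finset.sum_tsub_distrib]
    · split_ifs <;> simp
    · intro j _
      split_ifs with hu
      · rw [hu]; exact s.ends_le j
      · exact Nat.zero_le _
  have h5 : (if u = s.base then ∑ j, s.ends j else 0) ≤ ∑ j, T.ends u j := by
    split_ifs with hu
    · exact Finset.sum_le_sum fun j _ => hu ▸ s.ends_le j
    · exact Nat.zero_le _
  rw [h1, Set.ncard_image_of_injective _ (Fin.castSucc_injective m), ncard_option, h2, h4]
  simp only [h3]
  rw [s.sum_ends_eq] at h5 ⊢
  rcases h : s.other with _ | b
  · have hN : ∀ v, v ∈ s.nbrs ↔ v = s.base := by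
      intro v
      simp [Site.nbrs, h]
    simp only [hN, h, if_true] at h5 ⊢
    have h6 : {v | T.graph.Adj u v ∧ ¬ (u = s.base ∧ v = s.base)} = T.graph.neighborSet u := by
      ext v
      refine ⟨fun h => h.1, fun h => ⟨h, ?_⟩⟩
      rintro ⟨rfl, rfl⟩
      exact T.graph.irrefl h
    rw [h6]
    split_ifs at h5 ⊢ <;> lia
  · have hN : ∀ v, v ∈ s.nbrs ↔ v = s.base ∨ v = b := by
      intro v
      simp [Site.nbrs, h]
    have hab := (s.of_some b h).1
    simp only [hN, reduceCtorEq, if_false, ite_self, Nat.sub_zero]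
    by_cases hu : u = s.base ∨ u = b
    · obtain ⟨w, hw, hset⟩ : ∃ w, T.graph.Adj u w ∧
          {v | T.graph.Adj u v ∧ ¬ ((u = s.base ∨ u = b) ∧ (v = s.base ∨ v = b))} =
            T.graph.neighborSet u \ {w} := by
        rcases hu with rfl | rfl
        · refine ⟨b, hab, ?_⟩
          ext v
          simp only [true_or, true_and, Set.mem_ofPred_eq, Set.mem_sdiff, Set.mem_singleton_iff,
            SimpleGraph.mem_neighborSet]
          refine and_congr_right fun hv => ?_
          have := hv.ne'
          tauto
        · refine ⟨s.base, hab.symm, ?_⟩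
          ext v
          simp only [or_true, true_and, Set.mem_ofPred_eq, Set.mem_sdiff, Set.mem_singleton_iff,
            SimpleGraph.mem_neighborSet]
          refine and_congr_right fun hv => ?_
          have := hv.ne'
          tauto
      have h7 := Set.ncard_sdiff_singleton_add_one (s := T.graph.neighborSet u) (a := w) hw
      rw [hset, if_pos hu]
      lia
    · have hset : {v | T.graph.Adj u v ∧ ¬ ((u = s.base ∨ u = b) ∧ (v = s.base ∨ v = b))} =
          T.graph.neighborSet u := by
        ext v
        simp [hu]
      rw [hset, if_neg hu, add_zero]

/-- A bounded edge is split in two. The half at `other` inherits the old column, and the half at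
`base` is the new coordinate; its column repeats the old one on the old vertices, so `κ` selects the
split edge. For an end the only new edge moves no old vertex and `κ = 0`. In both cases the new
vertex moves by `s.dir` in addition, and this is the only new information in the extra column. -/
theorem exists_isFrame_attach {φ : V → Fin 2 → Fin 2 ⊕ T.graph.edgeSet → ℤ}
    [Fintype T.graph.edgeSet]
    (hφ : T.IsFrame (Equiv.refl _) φ) :
    ∃ (ε : T.graph.edgeSet ⊕ Unit ≃ (T.attach s).graph.edgeSet)
      (ψ : Option V → Fin 2 → Fin 2 ⊕ (T.graph.edgeSet ⊕ Unit) → ℤ)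
      (κ : Fin 2 ⊕ T.graph.edgeSet → ℤ), (T.attach s).IsFrame ε ψ ∧
      (∀ v c x, ψ (some v) c (Equiv.sumAssoc _ _ _ (Sum.inl x)) = φ v c x) ∧
      (∀ v c, ψ (some v) c (Sum.inr (Sum.inr ())) = ∑ x, φ v c x * κ x) ∧
      (∀ c x, ψ none c (Equiv.sumAssoc _ _ _ (Sum.inl x)) = φ s.base c x) ∧
      ∀ c, ψ none c (Sum.inr (Sum.inr ())) = ∑ x, φ s.base c x * κ x + s.dir c := by
  classical
  have hcard : Nat.card (T.graph.edgeSet ⊕ Unit) = Nat.card (T.attach s).graph.edgeSet := by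
    have h1 := T.card_edgeSet
    have h2 := (T.attach s).card_edgeSet
    rw [Fintype.card_option] at h2
    rw [Nat.card_sum, Nat.card_unique (α := Unit)]
    lia
  obtain ⟨g, κ, hg, hinj, hnone, hsome, hextra, hκ', hκ⟩ : ∃ (g : T.graph.edgeSet → Sym2 (Option V))
      (κ : Fin 2 ⊕ T.graph.edgeSet → ℤ), (∀ e, g e ∈ (T.attach s).graph.edgeSet) ∧
      Function.Injective g ∧
      (∀ e v, v ∈ s.nbrs → (g e = s(none, some v) ↔ some v = s.other ∧ e.1 = s(s.base, v))) ∧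
      (∀ e u v, T.graph.Adj u v → ¬ (u ∈ s.nbrs ∧ v ∈ s.nbrs) →
        (g e = s(some u, some v) ↔ e.1 = s(u, v))) ∧
      (∀ e, g e ≠ s(none, some s.base)) ∧
      (∀ u v c, (T.attach s).graph.Adj (some u) (some v) →
        ∑ x, φ u c x * κ x = ∑ x, φ v c x * κ x) ∧
      ∀ v c, some v = s.other → ∑ x, φ v c x * κ x = ∑ x, φ s.base c x * κ x + s.dir c := by
    have hn : ∀ (e : Sym2 V) v, e.map some ≠ s(none, some v) := by
      intro e v h
      have h1 : none ∈ e.map some := by rw [h]; simp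
      obtain ⟨_, -, h2⟩ := Sym2.mem_map.1 h1
      cases h2
    have hm : ∀ (e : Sym2 V) u v, e.map some = s(some u, some v) ↔ e = s(u, v) := by
      intro e u v
      rw [← Sym2.map_mk, (Sym2.map.injective (Option.some_injective V)).eq_iff]
    have hmem : ∀ e : T.graph.edgeSet, (¬ ∀ x ∈ e.1, x ∈ s.nbrs) →
        e.1.map some ∈ (T.attach s).graph.edgeSet := by
      rintro ⟨e, he⟩ h
      induction e with
      | _ u v => exact ⟨he, fun h' => h (by simpa using h')⟩
    rcases ho : s.other with _ | b
    · have hN : ∀ v, v ∈ s.nbrs ↔ v = s.base := by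
        intro v
        simp [Site.nbrs, ho]
      refine ⟨fun e => e.1.map some, 0, fun e => hmem e ?_, fun e e' h => ?_, fun e v _ => ?_,
        fun e u v _ _ => hm _ _ _, fun e => hn _ _, by simp, by simp⟩
      · obtain ⟨e, he⟩ := e
        induction e with
        | _ u v =>
          intro h
          simp only [Sym2.mem_iff, forall_eq_or_imp, forall_eq, hN] at h
          exact T.graph.ne_of_adj he (h.1.trans h.2.symm)
      · exact Subtype.ext (Sym2.map.injective (Option.some_injective V) h)
      · simp [hn]
    · obtain ⟨hab, hd, -⟩ := s.of_some b ho
      have hN : ∀ v, v ∈ s.nbrs ↔ v = s.base ∨ v = b := by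
        intro v
        simp [Site.nbrs, ho]
      have hκ : ∀ v c, ∑ x, φ v c x * (Pi.single (Sum.inr ⟨s(s.base, b), hab⟩) 1 : _ → ℤ) x =
          φ v c (Sum.inr ⟨s(s.base, b), hab⟩) := by
        intro v c
        simp [Pi.single_apply]
      refine ⟨fun e => if e.1 = s(s.base, b) then s(none, some b) else e.1.map some,
        Pi.single (Sum.inr ⟨s(s.base, b), hab⟩) 1, fun e => ?_, fun e e' h => ?_, fun e v hv => ?_,
        fun e u v huv hne => ?_, fun e => ?_, fun u v c huv => ?_, fun v c hv => ?_⟩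
      · dsimp only
        split_ifs with h
        · exact Or.inr ho.symm
        · refine hmem e fun h' => h ?_
          obtain ⟨e, he⟩ := e
          induction e with
          | _ u v =>
            simp only [Sym2.mem_iff, forall_eq_or_imp, forall_eq, hN] at h'
            have := T.graph.ne_of_adj he
            rw [Sym2.eq_iff]
            rcases h' with ⟨h1 | h1, h2 | h2⟩
            · exact absurd (h1.trans h2.symm) this
            · exact Or.inl ⟨h1, h2⟩
            · exact Or.inr ⟨h1, h2⟩
            · exact absurd (h1.trans h2.symm) this
      · simp only at h
        split_ifs at h with h1 h2 h2
        · exact Subtype.ext (h1.trans h2.symm)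
        · exact absurd h.symm (hn _ _)
        · exact absurd h (hn _ _)
        · exact Subtype.ext (Sym2.map.injective (Option.some_injective V) h)
      · simp only [Option.some.injEq]
        split_ifs with h
        · rw [h]
          constructor
          · intro h1
            simp at h1
            subst h1
            simp
          · rintro ⟨rfl, -⟩
            rfl
        · refine iff_of_false (hn _ _) ?_
          rintro ⟨rfl, h1⟩
          exact h h1
      · simp only
        split_ifs with h
        · rw [h]
          refine iff_of_false (by simp) fun h1 => hne ?_
          rcases Sym2.eq_iff.1 h1 with ⟨rfl, rfl⟩ | ⟨rfl, rfl⟩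
          · exact ⟨(hN _).2 (.inl rfl), (hN _).2 (.inr rfl)⟩
          · exact ⟨(hN _).2 (.inr rfl), (hN _).2 (.inl rfl)⟩
        · exact hm _ _ _
      · simp only
        split_ifs with h
        · simp [hab.ne']
        · exact hn _ _
      · rw [hκ, hκ, hφ.inr u v huv.1, if_neg, add_zero]
        intro h1
        refine huv.2 ?_
        rcases Sym2.eq_iff.1 h1 with ⟨rfl, rfl⟩ | ⟨rfl, rfl⟩
        · exact ⟨(hN _).2 (.inl rfl), (hN _).2 (.inr rfl)⟩
        · exact ⟨(hN _).2 (.inr rfl), (hN _).2 (.inl rfl)⟩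
      · obtain rfl : v = b := by simpa using hv
        rw [hκ, hκ, hd]
        exact (hφ.inr s.base v hab c _).trans (congrArg _ (if_pos rfl))
  have hbase : (T.attach s).graph.Adj none (some s.base) := Or.inl rfl
  let f : T.graph.edgeSet ⊕ Unit → (T.attach s).graph.edgeSet :=
    Sum.elim (fun e => ⟨g e, hg e⟩) fun _ => ⟨s(none, some s.base), hbase⟩
  have hf : Function.Injective f := by
    rintro (e | _) (e' | _) h
    · exact congrArg Sum.inl (hinj (congrArg Subtype.val h))
    · exact absurd (congrArg Subtype.val h) (hextra e)
    · exact absurd (congrArg Subtype.val h).symm (hextra e')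
    · rfl
  let ε := Equiv.ofBijective f (hf.bijective_of_nat_card_le hcard.ge)
  have hε1 : ∀ e, (ε (Sum.inl e)).1 = g e := fun _ => rfl
  have hε2 : (ε (Sum.inr ())).1 = s(none, some s.base) := rfl
  let ψ : Option V → Fin 2 → Fin 2 ⊕ (T.graph.edgeSet ⊕ Unit) → ℤ := fun o c y =>
    match o, (Equiv.sumAssoc _ _ _).symm y with
    | some v, Sum.inl x => φ v c x
    | none, Sum.inl x => φ s.base c x
    | some v, Sum.inr _ => ∑ x, φ v c x * κ x
    | none, Sum.inr _ => ∑ x, φ s.base c x * κ x + s.dir c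
  refine ⟨ε, ψ, κ, ⟨fun o c c' => ?_, ?_⟩, fun v c x => ?_, fun v c => rfl, fun c x => ?_, fun c => rfl⟩
  · rcases o with _ | v
    · exact hφ.inl _ c c'
    · exact hφ.inl _ c c'
  · have hnb : ∀ v, (T.attach s).graph.Adj none (some v) → ∀ c f, ψ (some v) c (Sum.inr f) =
        ψ none c (Sum.inr f) +
          if (ε f : Sym2 (Option V)) = s(none, some v) then (T.attach s).dir none (some v) c else 0 := by
      intro v hv c f
      have hdir : (T.attach s).dir none (some v) =
        (if some v = s.other then s.dir else 0) - (if v = s.base then s.dir else 0) := rfl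
      rw [hdir]
      rcases f with e | _
      · rw [hε1]
        simp only [hnone e v hv]
        change φ v c (Sum.inr e) = φ s.base c (Sum.inr e) + _
        by_cases ho : some v = s.other
        · obtain ⟨hab, hd, -⟩ := s.of_some v ho.symm
          refine (hφ.inr s.base v hab c e).trans (congrArg _ ?_)
          simp only [ho, if_true, true_and, if_neg hab.ne', sub_zero, hd]
          rfl
        · rcases hv with rfl | hv
          · simp [ho]
          · exact absurd hv ho
      · rw [hε2]
        change ∑ x, φ v c x * κ x = ∑ x, φ s.base c x * κ x + s.dir c + _
        by_cases ho : some v = s.other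
        · obtain ⟨hab, hd, -⟩ := s.of_some v ho.symm
          rw [hκ v c ho, if_neg (by simp [hab.ne]), add_zero]
        · rcases hv with rfl | hv
          · simp [ho]
          · exact absurd hv ho
    have hswap : ∀ x y, (∀ c f, ψ y c (Sum.inr f) = ψ x c (Sum.inr f) +
          if (ε f : Sym2 (Option V)) = s(x, y) then (T.attach s).dir x y c else 0) →
        ∀ c f, ψ x c (Sum.inr f) = ψ y c (Sum.inr f) +
          if (ε f : Sym2 (Option V)) = s(y, x) then (T.attach s).dir y x c else 0 := by
      intro x y h c f
      rw [h c f, (T.attach s).dir_antisymm x y, Sym2.eq_swap (a := y)]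
      split_ifs <;> simp
    intro x y hxy
    rcases x with _ | u <;> rcases y with _ | v
    · exact absurd hxy (T.attach s).graph.irrefl
    · intro c f
      convert hnb v hxy c f
    · intro c f
      convert hswap _ _ (hnb u hxy.symm) c f
    · intro c f
      have hdir : (T.attach s).dir (some u) (some v) = T.dir u v := if_neg hxy.2
      rw [hdir]
      rcases f with e | _
      · rw [hε1]
        simp only [hsome e u v hxy.1 hxy.2]
        exact hφ.inr u v hxy.1 c e
      · rw [hε2, if_neg (by simp), add_zero]
        exact (hκ' u v c hxy).symm
  · simp only [ψ, Equiv.symm_apply_apply]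
  · simp only [ψ, Equiv.symm_apply_apply]

end TropType

end

/-! ### The multiplicity of a curve with an attached marking -/

section

variable {V : Type} [Fintype V] {d m n : ℕ}

theorem absDet_fromBlocks {ι κ : Type} [Fintype ι] [DecidableEq ι] [Finite κ] (A : Matrix ι κ ℤ)
    (X : Matrix (Fin (0 + 1)) κ ℤ) (S : Matrix (Fin (0 + 1)) Unit ℤ) :
    absDet (Matrix.fromBlocks A 0 X S) = absDet A * (S 0 ()).natAbs := by
  by_cases h : Nonempty (ι ≃ κ)
  · obtain ⟨f⟩ := h
    let g : Fin (0 + 1) ≃ Unit := Equiv.ofUnique (Fin 1) Unit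
    rw [absDet_eq A f, absDet_eq _ (Equiv.sumCongr f g)]
    have : (Matrix.fromBlocks A 0 X S).submatrix id (Equiv.sumCongr f g) =
        Matrix.fromBlocks (A.submatrix id f) 0 (X.submatrix id f) (S.submatrix id g) := by
      ext (i | i) (j | j) <;> rfl
    have h1 : (S.submatrix id g).det = S 0 () := Matrix.det_fin_one _
    rw [this, Matrix.det_fromBlocks_zero₁₂, Int.natAbs_mul, h1]
  · have := Fintype.ofFinite κ
    have h' : ¬ Nonempty (ι ⊕ Fin (0 + 1) ≃ κ ⊕ Unit) := by
      rintro ⟨e⟩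
      have := Nat.card_congr e
      rw [Nat.card_sum, Nat.card_sum] at this
      simp only [Nat.card_eq_fintype_card, Fintype.card_fin, Fintype.card_unit, zero_add,
        add_left_inj] at this
      exact h ⟨Fintype.equivOfCardEq this⟩
    unfold absDet
    rw [dif_neg h, dif_neg h', zero_mul]

/-- Subtracting the combination `q` of the other columns from the last one clears it except for the
corner `t`. -/
theorem absDet_bordered {ι κ : Type} [Fintype ι] [DecidableEq ι] [Fintype κ] [DecidableEq κ]
    (M : Matrix (ι ⊕ Fin (0 + 1)) (κ ⊕ Unit) ℤ) (A : Matrix ι κ ℤ) (x q : κ → ℤ) (t : ℤ)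
    (h11 : ∀ i k, M (Sum.inl i) (Sum.inl k) = A i k)
    (h12 : ∀ i u, M (Sum.inl i) (Sum.inr u) = ∑ k, A i k * q k)
    (h21 : ∀ j k, M (Sum.inr j) (Sum.inl k) = x k)
    (h22 : ∀ j u, M (Sum.inr j) (Sum.inr u) = ∑ k, x k * q k + t) :
    absDet M = absDet A * t.natAbs := by
  let X : Matrix (Fin (0 + 1)) κ ℤ := Matrix.of fun _ k => x k
  let S : Matrix (Fin (0 + 1)) Unit ℤ := Matrix.of fun _ _ => t
  let Q : Matrix κ Unit ℤ := Matrix.of fun k _ => q k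
  let N : Matrix (ι ⊕ Fin (0 + 1)) (κ ⊕ Unit) ℤ := Matrix.fromBlocks A 0 X S
  let R : Matrix (κ ⊕ Unit) (κ ⊕ Unit) ℤ := Matrix.fromBlocks 1 Q 0 1
  have key : M = N * R := by
    simp only [N, R, Matrix.fromBlocks_multiply]
    ext (i | j) (k | u)
    · simp [h11]
    · simp [h12, Matrix.mul_apply, Q]
    · simp [h21, X]
    · simp [h22, Matrix.mul_apply, X, Q, S]
  rw [key, absDet_mul N R (Equiv.refl _), absDet_fromBlocks]
  · rfl
  · have : R.submatrix id (Equiv.refl _) = R := rfl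
    rw [this, Matrix.det_fromBlocks_zero₂₁]
    simp

/-- The linear forms of the positions of all markings but the last, and the values of the
covectors `w` at the position of the last marking. -/
def TropType.incRows {E : Type} (T : TropType V d (m + 1)) (w : Fin (n + 1) → Fin 2 → ℤ)
    (φ : V → Fin 2 → Fin 2 ⊕ E → ℤ) : Matrix (Fin m × Fin 2 ⊕ Fin (n + 1)) (Fin 2 ⊕ E) ℤ :=
  Matrix.of (Sum.elim (fun r => φ (T.mark r.1.castSucc) r.2)
    (fun j x => ∑ c, w j c * φ (T.mark (Fin.last m)) c x))

theorem incMult_eq_of_isFrame {E : Type} [Fintype E] {T : TropType V d (m + 1)}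
    {ε : E ≃ T.graph.edgeSet} {φ : V → Fin 2 → Fin 2 ⊕ E → ℤ} (hφ : T.IsFrame ε φ)
    {C : PlaneTropCurve d (m + 1)} {σ : V ≃ Fin C.k} (h : T.IsIso C.toM.toTropType σ)
    (K : Fin (n + 1) → TropPoly) :
    incMult K C =
      absDet (T.incRows (fun j => (K j).edgeNormal (C.ev (Fin.last m))) φ) := by
  classical
  obtain ⟨P, e, hP, hm⟩ := hφ.exists_mul C.isFrame_coordCoeff h.adj h.dir
  rw [← absDet_mul _ P e hP]
  have h1 : ∀ v c x, C.coordCoeff (σ v) c x = ∑ y, φ v c y * P y x := fun v c x =>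
    congrFun (congrFun hm (v, c)) x
  have h2 : ∀ i, C.mark i = σ (T.mark i) := h.mark
  unfold incMult
  congr 1
  ext (r | j) x
  · simp only [Sum.elim_inl, TropType.incRows, Matrix.mul_apply, Matrix.of_apply, h2, h1]
  · simp only [Sum.elim_inr, TropType.incRows, Matrix.mul_apply, Matrix.of_apply, h2, h1]
    simp only [Finset.mul_sum, Finset.sum_mul]
    rw [Finset.sum_comm]
    exact Finset.sum_congr rfl fun _ _ => Finset.sum_congr rfl fun _ _ => by ring

theorem incMult_congr {C D : PlaneTropCurve d (m + 1)} (h : C.Iso D) (K : Fin (n + 1) → TropPoly) :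
    incMult K C = incMult K D := by
  classical
  obtain ⟨σ, h⟩ := PlaneTropCurve.iso_iff.1 h
  rw [incMult_eq_of_isFrame C.isFrame_coordCoeff h.toIsIso]
  have : D.ev (Fin.last m) = C.ev (Fin.last m) := by
    have h1 : D.mark (Fin.last m) = σ (C.mark (Fin.last m)) := h.mark _
    rw [PlaneTropCurve.ev, h1]
    exact h.pos _
  rw [this]
  rfl

theorem TropType.exists_absDet_incRows_attach {T : TropType V d m} (s : T.Site)
    [Fintype T.graph.edgeSet] {φ : V → Fin 2 → Fin 2 ⊕ T.graph.edgeSet → ℤ}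
    (hφ : T.IsFrame (Equiv.refl _) φ) :
    ∃ (ε : T.graph.edgeSet ⊕ Unit ≃ (T.attach s).graph.edgeSet) (ψ : _),
      (T.attach s).IsFrame ε ψ ∧ ∀ w : Fin (0 + 1) → Fin 2 → ℤ,
        absDet ((T.attach s).incRows w ψ) =
          absDet ((frameMatrix φ).submatrix (Prod.map T.mark id) id) *
            (∑ c, w 0 c * s.dir c).natAbs := by
  classical
  obtain ⟨ε, ψ, κ, hψ, h1, h2, h3, h4⟩ := TropType.exists_isFrame_attach s hφ
  refine ⟨ε, ψ, hψ, fun w => ?_⟩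
  rw [← absDet_submatrix_right _ (Equiv.sumAssoc _ _ _)]
  have hj : ∀ j : Fin (0 + 1), j = 0 := fun j => Subsingleton.elim (α := Fin 1) _ _
  refine absDet_bordered _ _ (fun x => ∑ c, w 0 c * φ s.base c x) κ _ (fun r x => ?_)
    (fun r _ => ?_) (fun j x => ?_) fun j _ => ?_
  · simpa [TropType.incRows, TropType.attach_mark_castSucc, frameMatrix] using h1 _ _ _
  · simp only [TropType.incRows, TropType.attach_mark_castSucc, frameMatrix, Matrix.submatrix_apply,
      id, Matrix.of_apply, Sum.elim_inl, Equiv.sumAssoc_apply_inr, h2, Prod.map]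
  · simp [TropType.incRows, TropType.attach_mark_last, hj j, h3]
  · simp only [TropType.incRows, TropType.attach_mark_last, Matrix.submatrix_apply, id,
      Matrix.of_apply, Sum.elim_inr, Equiv.sumAssoc_apply_inr, h4, hj j]
    simp only [mul_add, Finset.sum_add_distrib, Finset.mul_sum, Finset.sum_mul]
    rw [Finset.sum_comm]
    simp only [mul_assoc]

/-- Attaching a marking on an edge multiplies the multiplicity by the local intersection
multiplicity. -/
theorem incMult_attach {C : PlaneTropCurve d m} (s : C.toM.toTropType.Site)
    {D : PlaneTropCurve d (m + 1)} {σ : Option (Fin C.k) ≃ Fin D.k}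
    (h : (C.toM.toTropType.attach s).IsIso D.toM.toTropType σ) (L : TropPoly) :
    incMult ![L] D =
      evMult C * (∑ c, L.edgeNormal (D.ev (Fin.last m)) c * s.dir c).natAbs := by
  classical
  have : Fintype C.toM.graph.edgeSet := Fintype.ofFinite _
  obtain ⟨ε, ψ, hψ, hw⟩ :=
    TropType.exists_absDet_incRows_attach s (φ := C.coordCoeff) C.isFrame_coordCoeff
  rw [incMult_eq_of_isFrame hψ h, hw]
  rfl

end

/-! ### Places on a curve and curves with a marking at a place -/

section

open TropPoly

variable {V V' : Type} [Fintype V] [Fintype V'] {d m n : ℕ}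

/-- On a cell of nonzero multiplicity the curve is determined by the positions of its markings. -/
theorem eq_zero_of_incMult_ne_zero {K : Fin (n + 1) → TropPoly} {C : PlaneTropCurve d (m + 1)}
    (hC : incMult K C ≠ 0) {y : Fin C.k → Pt} {s : Sym2 (Fin C.k) → ℝ}
    (h : ∀ u v, C.graph.Adj u v → ∀ c, y v c = y u c + s s(u, v) * (C.dir u v c : ℝ))
    (hm : ∀ i, y (C.mark i) = 0) : y = 0 ∧ ∀ e ∈ C.graph.edgeSet, s e = 0 := by
  classical
  obtain ⟨ξ, h1, h2⟩ := C.isFrame_coordCoeff.exists_framePos_eq h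
  have h3 : ∀ i c, ∑ x, (C.coordCoeff (C.mark i) c x : ℝ) * ξ x = 0 := fun i c =>
    (congrFun (congrFun h1 (C.mark i)) c).trans (congrFun (hm i) c)
  have h0 : ξ = 0 := by
    refine eq_zero_of_absDet_ne_zero _ hC ξ ?_
    rintro (⟨i, c⟩ | j)
    · exact h3 _ _
    · simp only [Sum.elim_inr, Int.cast_sum, Int.cast_mul, Finset.sum_mul]
      rw [Finset.sum_comm]
      refine Finset.sum_eq_zero fun c _ => ?_
      simp only [mul_assoc]
      rw [← Finset.mul_sum, h3, mul_zero]
  subst h0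
  exact ⟨by rw [← h1, map_zero], fun e he => (h2 ⟨e, he⟩).symm⟩

/-- Changing the length of a contracted edge moves no vertex, so it would be a nonzero vector in the
kernel. -/
theorem dir_ne_zero_of_incMult_ne_zero {K : Fin (n + 1) → TropPoly} {C : PlaneTropCurve d (m + 1)}
    (hC : incMult K C ≠ 0) {u v : Fin C.k} (huv : C.graph.Adj u v) : C.dir u v ≠ 0 := by
  classical
  intro h0
  have := (eq_zero_of_incMult_ne_zero hC (y := 0) (s := fun e => if e = s(u, v) then 1 else 0)
    (fun a b _ c => by
      simp only [Pi.zero_apply, zero_add]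
      split_ifs with h
      · rcases Sym2.eq_iff.1 h with ⟨rfl, rfl⟩ | ⟨rfl, rfl⟩
        · simp [h0]
        · simp [C.dir_antisymm b a, h0]
      · simp) (fun _ => rfl)).2 s(u, v) huv
  simp at this

/-- Two curves without contracted edges are isomorphic if there is an isomorphism of types that
respects the positions of the vertices. -/
theorem iso_of_isIso_of_pos {C C' : PlaneTropCurve d m}
    (hC : ∀ u v, C.graph.Adj u v → C.dir u v ≠ 0) {τ : Fin C.k ≃ Fin C'.k}
    (h : C.toM.toTropType.IsIso C'.toM.toTropType τ) (hpos : ∀ u, C'.pos (τ u) = C.pos u) :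
    C.Iso C' := by
  refine PlaneTropCurve.iso_iff.2 ⟨τ, h, fun u v huv => ?_, hpos⟩
  have hdir : C'.dir (τ u) (τ v) = C.dir u v := h.dir u v
  obtain ⟨c, hc⟩ := Function.ne_iff.1 (hC u v huv)
  have h1 := C.pos_eq u v huv c
  have h2 := C'.pos_eq (τ u) (τ v) ((h.adj u v).2 huv) c
  rw [hpos, hpos, hdir, h1] at h2
  have h3 : ((C.dir u v c : ℤ) : ℝ) ≠ 0 := by exact_mod_cast hc
  exact (mul_right_cancel₀ h3 (add_left_cancel h2)).symm

namespace TropType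

variable {T : TropType V d m}

/-- The point `q` lies in the relative interior of the image of the edge. -/
def Site.Contains (s : T.Site) (pos : V → Pt) (q : Pt) : Prop :=
  ∃ t : ℝ, 0 < t ∧ q = ray (pos s.base) s.dir t ∧
    ∀ b, s.other = some b → ∃ t' : ℝ, 0 < t' ∧ pos b = ray q s.dir t'

/-- A bounded edge as a site. -/
noncomputable def edgeSite (T : TropType V d m) (e : T.graph.edgeSet) : T.Site where
  base := (Quot.out e.1).1
  other := some (Quot.out e.1).2
  ends := 0
  dir := T.dir (Quot.out e.1).1 (Quot.out e.1).2
  of_some := by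
    rintro _ ⟨⟩
    refine ⟨?_, rfl, rfl⟩
    have h1 : s((Quot.out e.1).1, (Quot.out e.1).2) = e.1 := Quot.out_eq _
    have h2 := e.2
    rwa [← h1] at h2
  of_none h := by cases h

/-- An end as a site. -/
def endSite (T : TropType V d m) (u : V) (j : Fin 3) (h : T.ends u j ≠ 0) : T.Site where
  base := u
  other := none
  ends := Pi.single j 1
  dir := endDir j
  of_some _ h := by cases h
  of_none _ := ⟨j, rfl, rfl, h⟩

theorem mem_nbrs_edgeSite (e : T.graph.edgeSet) (v : V) : v ∈ (T.edgeSite e).nbrs ↔ v ∈ e.1 := by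
  have h1 : s((Quot.out e.1).1, (Quot.out e.1).2) = e.1 := Quot.out_eq _
  have h2 : v ∈ e.1 ↔ v = (Quot.out e.1).1 ∨ v = (Quot.out e.1).2 := by
    conv_lhs => rw [← h1]
    exact Sym2.mem_iff
  rw [h2]
  simp [Site.nbrs, edgeSite]

theorem mem_nbrs_endSite {u : V} {j : Fin 3} {h : T.ends u j ≠ 0} (v : V) :
    v ∈ (T.endSite u j h).nbrs ↔ v = u := by
  simp [Site.nbrs, endSite]

/-- The edges of a curve, bounded or not. -/
abbrev Place (T : TropType V d m) : Type :=
  T.graph.edgeSet ⊕ {x : V × Fin 3 // T.ends x.1 x.2 ≠ 0}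

/-- The site of an edge. -/
noncomputable def Place.site : T.Place → T.Site
  | Sum.inl e => T.edgeSite e
  | Sum.inr x => T.endSite x.1.1 x.1.2 x.2

/-- The orientation of a bounded edge comes from an arbitrary choice. Its set of vertices, together
with the direction of an end, identifies the place regardless of it. -/
theorem Place.site_injective {i i' : T.Place} (hN : i.site.nbrs = i'.site.nbrs)
    (hends : i.site.ends = i'.site.ends) : i = i' := by
  have h0 : ∀ j : Fin 3, (0 : Fin 3 → ℕ) ≠ Pi.single j 1 := fun j h => by
    simpa using congrFun h j
  rcases i with e | ⟨⟨u, j⟩, h⟩ <;> rcases i' with e' | ⟨⟨u', j'⟩, h'⟩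
  · refine congrArg Sum.inl (Subtype.ext (Sym2.ext fun v => ?_))
    rw [← mem_nbrs_edgeSite, ← mem_nbrs_edgeSite]
    exact Set.ext_iff.1 hN v
  · exact absurd hends (h0 _)
  · exact absurd hends.symm (h0 _)
  · have h1 : u = u' := (mem_nbrs_endSite (h := h') u).1
      ((Set.ext_iff.1 hN u).1 ((mem_nbrs_endSite (h := h) u).2 rfl))
    have h2 : j = j' := by
      by_contra hne
      have : (Pi.single j 1 : Fin 3 → ℕ) j = (Pi.single j' 1 : Fin 3 → ℕ) j := congrFun hends j
      simp [hne] at this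
    subst h1 h2
    rfl

/-- Every site is, up to orientation, the site of an edge. -/
theorem Site.exists_place {T' : TropType V' d m} {σ : V ≃ V'} (h : T.IsIso T' σ) (s : T.Site) :
    ∃ i : T'.Place, (∀ v, σ v ∈ i.site.nbrs ↔ v ∈ s.nbrs) ∧ i.site.ends = s.ends := by
  rcases ho : s.other with _ | b
  · obtain ⟨j, h1, -, h2⟩ := s.of_none ho
    have h3 : T'.ends (σ s.base) j ≠ 0 := by rwa [h.ends]
    refine ⟨Sum.inr ⟨(σ s.base, j), h3⟩, fun v => ?_, h1.symm⟩
    refine (mem_nbrs_endSite (h := h3) _).trans ?_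
    simp [nbrs, ho]
  · obtain ⟨hab, -, h1⟩ := s.of_some b ho
    refine ⟨Sum.inl ⟨s(σ s.base, σ b), (h.adj _ _).2 hab⟩, fun v => ?_, h1.symm⟩
    refine (mem_nbrs_edgeSite _ _).trans ?_
    simp [nbrs, ho]

theorem attach_dir_none (s : T.Site) (v : V) [Decidable (some v = s.other)]
    [Decidable (v = s.base)] : (T.attach s).dir none (some v) =
      (if some v = s.other then s.dir else 0) - (if v = s.base then s.dir else 0) := by
  unfold attach
  dsimp only
  congr!

theorem Site.other_ne_base (s : T.Site) : some s.base ≠ s.other := fun h =>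
  (s.of_some _ h.symm).1.ne rfl

theorem attach_dir_base (s : T.Site) : (T.attach s).dir none (some s.base) = -s.dir := by
  classical
  rw [attach_dir_none, if_neg s.other_ne_base, if_pos rfl, zero_sub]

theorem attach_dir_other (s : T.Site) {b : V} (h : s.other = some b) :
    (T.attach s).dir none (some b) = s.dir := by
  classical
  rw [attach_dir_none, if_pos h.symm, if_neg (s.of_some b h).1.ne', sub_zero]

end TropType

/-- Attaching a marking at a point of an edge. -/
theorem exists_attach {C : PlaneTropCurve d m} {s : C.toM.toTropType.Site} {q : Pt}
    (hq : s.Contains C.pos q) :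
    ∃ (D : PlaneTropCurve d (m + 1)) (σ : Option (Fin C.k) ≃ Fin D.k),
      (C.toM.toTropType.attach s).IsIso D.toM.toTropType σ ∧
      (∀ u, D.pos (σ (some u)) = C.pos u) ∧ D.pos (σ none) = q := by
  obtain ⟨t, ht, hqt, hother⟩ := hq
  have hnone : ∀ v, v ∈ s.nbrs → ∃ t : ℝ, 0 < t ∧ ∀ c, C.pos v c =
      q c + t * ((C.toM.toTropType.attach s).dir none (some v) c : ℝ) := by
    rintro v (rfl | hv)
    · refine ⟨t, ht, fun c => ?_⟩
      rw [TropType.attach_dir_base, hqt]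
      simp [ray]
    · obtain ⟨t', ht', h⟩ := hother v hv.symm
      refine ⟨t', ht', fun c => ?_⟩
      rw [TropType.attach_dir_other s hv.symm, h]
      rfl
  obtain ⟨D, σ, h1, h2⟩ := (C.toM.toTropType.attach s).exists_planeTropCurve
    (pos := fun o => o.elim q C.pos) (fun u => by
      rcases u with _ | u
      · rw [TropType.valence_attach_none]
      · rw [TropType.valence_attach_some]
        exact C.three_le_valence u) (fun x y hxy => by
      rcases x with _ | u <;> rcases y with _ | v
      · exact hxy.elim
      · exact hnone v hxy
      · obtain ⟨t, ht, h⟩ := hnone u hxy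
        refine ⟨t, ht, fun c => ?_⟩
        have := h c
        rw [(C.toM.toTropType.attach s).dir_antisymm none (some u)]
        simp only [Option.elim_none, Option.elim_some, Pi.neg_apply, Int.cast_neg]
        linarith
      · have hd : (C.toM.toTropType.attach s).dir (some u) (some v) = C.dir u v := if_neg hxy.2
        rw [hd]
        exact ⟨C.len s(u, v), C.len_pos _ hxy.1, C.pos_eq u v hxy.1⟩)
  exact ⟨D, σ, h1, fun u => h2 (some u), h2 none⟩

theorem TropType.Site.contains_of_isIso {T : TropType V d m} {s : T.Site}
    {D : PlaneTropCurve d (m + 1)} {σ : Option V ≃ Fin D.k}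
    (h : (T.attach s).IsIso D.toM.toTropType σ) {pos : V → Pt}
    (hpos : ∀ u, D.pos (σ (some u)) = pos u) :
    s.Contains pos (D.ev (Fin.last m)) := by
  have hmark : D.mark (Fin.last m) = σ none := by
    have : D.mark (Fin.last m) = _ := h.mark (Fin.last m)
    rw [this, attach_mark_last]
  have key : ∀ v, v ∈ s.nbrs → ∃ t : ℝ, 0 < t ∧ ∀ c, pos v c =
      D.ev (Fin.last m) c + t * ((T.attach s).dir none (some v) c : ℝ) := by
    intro v hv
    have hadj : D.graph.Adj (σ none) (σ (some v)) := (h.adj none (some v)).2 hv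
    refine ⟨D.len s(σ none, σ (some v)), D.len_pos _ hadj, fun c => ?_⟩
    have h1 := D.pos_eq _ _ hadj c
    have h2 : D.dir (σ none) (σ (some v)) = _ := h.dir none (some v)
    rw [hpos, h2] at h1
    rw [h1, PlaneTropCurve.ev, hmark]
  obtain ⟨t, ht, h1⟩ := key s.base (Or.inl rfl)
  refine ⟨t, ht, ?_, fun b hb => ?_⟩
  · funext c
    have := h1 c
    rw [attach_dir_base] at this
    simp only [Pi.neg_apply, Int.cast_neg] at this
    simp only [ray]
    linarith
  · obtain ⟨t', ht', h2⟩ := key b (Or.inr hb.symm)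
    refine ⟨t', ht', ?_⟩
    funext c
    rw [h2 c, attach_dir_other s hb]
    rfl

end

/-! ### Intersection of a curve with `L`, and transfer of generality -/

section

open TropPoly

variable {d m : ℕ}

namespace PlaneTropCurve

variable {C : PlaneTropCurve d m}

theorem contains_edgeSite_iff (e : C.toM.toTropType.graph.edgeSet) {q : Pt}
    (h : (C.toM.toTropType.edgeSite e).dir ≠ 0) :
    (C.toM.toTropType.edgeSite e).Contains C.pos q ↔
      q ∈ ray (C.pos (Quot.out e.1).1) (C.dir (Quot.out e.1).1 (Quot.out e.1).2) ''
        Set.Ioo 0 (C.len e.1) := by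
  have hadj : C.graph.Adj (Quot.out e.1).1 (Quot.out e.1).2 :=
    ((C.toM.toTropType.edgeSite e).of_some _ rfl).1
  have he : s((Quot.out e.1).1, (Quot.out e.1).2) = e.1 := Quot.out_eq _
  have hpos := C.pos_eq _ _ hadj
  rw [he] at hpos
  obtain ⟨c, hc⟩ := Function.ne_iff.1 h
  have hc' : ((C.dir (Quot.out e.1).1 (Quot.out e.1).2 c : ℤ) : ℝ) ≠ 0 := by exact_mod_cast hc
  constructor
  · rintro ⟨t, ht, rfl, h2⟩
    obtain ⟨t', ht', h3⟩ := h2 _ rfl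
    refine ⟨t, ⟨ht, ?_⟩, rfl⟩
    have h4 := congrFun h3 c
    rw [hpos c] at h4
    have h5 : C.len e.1 * ((C.dir (Quot.out e.1).1 (Quot.out e.1).2 c : ℤ) : ℝ) =
        (t + t') * ((C.dir (Quot.out e.1).1 (Quot.out e.1).2 c : ℤ) : ℝ) := by
      have : ray (ray (C.pos (Quot.out e.1).1) (C.dir (Quot.out e.1).1 (Quot.out e.1).2) t)
        (C.dir (Quot.out e.1).1 (Quot.out e.1).2) t' c = C.pos (Quot.out e.1).1 c +
          (t + t') * ((C.dir (Quot.out e.1).1 (Quot.out e.1).2 c : ℤ) : ℝ) := by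
        simp only [ray]
        ring
      exact add_left_cancel (h4.trans this)
    have := mul_right_cancel₀ hc' h5
    linarith
  · rintro ⟨t, ⟨ht, ht'⟩, rfl⟩
    refine ⟨t, ht, rfl, ?_⟩
    rintro _ ⟨⟩
    refine ⟨C.len e.1 - t, sub_pos.2 ht', ?_⟩
    funext c
    rw [hpos c]
    change _ = C.pos (Quot.out e.1).1 c +
      t * ((C.dir (Quot.out e.1).1 (Quot.out e.1).2 c : ℤ) : ℝ) +
      (C.len e.1 - t) * ((C.dir (Quot.out e.1).1 (Quot.out e.1).2 c : ℤ) : ℝ)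
    ring

theorem contains_endSite_iff {u : Fin C.k} {j : Fin 3} (h : C.toM.ends u j ≠ 0) {q : Pt} :
    (C.toM.toTropType.endSite u j h).Contains C.pos q ↔
      q ∈ ray (C.pos u) (endDir j) '' Set.Ioi 0 := by
  constructor
  · rintro ⟨t, ht, rfl, -⟩
    exact ⟨t, ht, rfl⟩
  · rintro ⟨t, ht, rfl⟩
    exact ⟨t, ht, rfl, fun b hb => by cases hb⟩

/-- The jumps of the slopes of `L` in the interior of an edge. -/
abbrev Jump (C : PlaneTropCurve d m) (L : TropPoly) (i : C.toM.toTropType.Place) : Type :=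
  {z : Pt × ℤ // i.site.Contains C.pos z.1 ∧ z.2 ∈ L.jumpSet z.1 i.site.dir}

/-- The jumps of the slopes of `L` on a ray. -/
abbrev EndJump (C : PlaneTropCurve d m) (L : TropPoly) (u : Fin C.k) (j : Fin 3) : Type :=
  {z : Pt × ℤ // z.1 ∈ ray (C.pos u) (endDir j) '' Set.Ioi 0 ∧ z.2 ∈ L.jumpSet z.1 (endDir j)}

/-- The intersection numbers of `L` with the edges of `C` add up to the product of the degrees. -/
theorem sum_card_jump {L : TropPoly} {l : ℕ} (hL : L.HasDegree l)
    [Fintype C.toM.toTropType.graph.edgeSet] (hC : ∀ u, C.pos u ∉ L.locus) :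
    (∀ i, Finite (C.Jump L i)) ∧ ∑ e, Nat.card (C.Jump L (Sum.inl e)) +
      ∑ u, ∑ j, C.ends u j * Nat.card (C.EndJump L u j) = l * d := by
  choose α hα using fun u => argmax_eq_singleton hL.supp_nonempty (hC u)
  have hend : ∀ u j, (Nat.card (C.EndJump L u j) : ℤ) = maxSlope l j - tslope (α u) (endDir j) ∧
      Finite (C.EndJump L u j) := fun u j =>
    card_jumps_end hL.supp_nonempty (hα u) (fun a ha => hL.slope_le j ha) (hL.exists_slope_eq j)
  have hedge : ∀ e : C.toM.toTropType.graph.edgeSet, (Nat.card (C.Jump L (Sum.inl e)) : ℤ) =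
      tslope (α (Quot.out e.1).2) (C.dir (Quot.out e.1).1 (Quot.out e.1).2) -
        tslope (α (Quot.out e.1).1) (C.dir (Quot.out e.1).1 (Quot.out e.1).2) ∧
      Finite (C.Jump L (Sum.inl e)) := by
    intro e
    have hadj : C.graph.Adj (Quot.out e.1).1 (Quot.out e.1).2 :=
      ((C.toM.toTropType.edgeSite e).of_some _ rfl).1
    have he : s((Quot.out e.1).1, (Quot.out e.1).2) = e.1 := Quot.out_eq _
    have hpos := C.pos_eq _ _ hadj
    rw [he] at hpos
    have h1 : ray (C.pos (Quot.out e.1).1) (C.dir (Quot.out e.1).1 (Quot.out e.1).2) (C.len e.1) =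
        C.pos (Quot.out e.1).2 := funext fun c => (hpos c).symm
    have h2 := card_jumps_edge (F := L) hL.supp_nonempty (C.len_pos e.1 e.2)
      (hα (Quot.out e.1).1) (h1 ▸ hα (Quot.out e.1).2)
    have h3 : C.Jump L (Sum.inl e) ≃ {z : Pt × ℤ // z.1 ∈ ray (C.pos (Quot.out e.1).1)
        (C.dir (Quot.out e.1).1 (Quot.out e.1).2) '' Set.Ioo 0 (C.len e.1) ∧
        z.2 ∈ L.jumpSet z.1 (C.dir (Quot.out e.1).1 (Quot.out e.1).2)} :=
      Equiv.subtypeEquivRight fun z => and_congr_left fun hz =>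
        contains_edgeSite_iff e (ne_zero_of_jumpSet ⟨_, hz⟩)
    have := h2.2
    exact ⟨by rw [Nat.card_congr h3]; exact h2.1, Finite.of_equiv _ h3.symm⟩
  refine ⟨?_, ?_⟩
  · rintro (e | ⟨⟨u, j⟩, h⟩)
    · exact (hedge e).2
    · have := (hend u j).2
      exact Finite.of_equiv (C.EndJump L u j)
        (Equiv.subtypeEquivRight fun z => and_congr_left fun _ => (contains_endSite_iff h).symm)
  · have h := C.toM.toTropType.sum_slope α (maxSlope l)
    have h2 : ∑ j, maxSlope l j = l := by simp [maxSlope, Fin.sum_univ_three]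
    rw [h2] at h
    zify
    rw [mul_comm (l : ℤ), ← h]
    congr 1
    · exact Finset.sum_congr rfl fun e _ => (hedge e).1
    · exact Finset.sum_congr rfl fun u _ => Finset.sum_congr rfl fun j _ => by
        rw [(hend u j).1]; rfl

theorem card_jump_inr (L : TropPoly) (u : Fin C.k) (j : Fin 3) (h : C.toM.ends u j ≠ 0) :
    Nat.card (C.Jump L (Sum.inr ⟨(u, j), h⟩)) = Nat.card (C.EndJump L u j) :=
  Nat.card_congr (Equiv.subtypeEquivRight fun _ => and_congr_left fun _ => contains_endSite_iff h)

/-- The intersection number `l * d` is positive, so there is at least one crossing. It provides a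
curve satisfying the incidence conditions over every curve through the points. -/
theorem exists_jump {L : TropPoly} {l : ℕ} (hL : L.HasDegree l) (hl : l ≠ 0) (hd : d ≠ 0)
    (hC : ∀ u, C.pos u ∉ L.locus) : ∃ i, Nonempty (C.Jump L i) := by
  classical
  have : Fintype C.toM.toTropType.graph.edgeSet := Fintype.ofFinite _
  by_contra! hcon
  have h := (C.sum_card_jump hL hC).2
  rw [Finset.sum_eq_zero fun e _ => ?_, Finset.sum_eq_zero fun u _ => ?_] at h
  · exact Nat.mul_ne_zero hl hd h.symm
  · refine Finset.sum_eq_zero fun j _ => ?_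
    by_cases h0 : C.ends u j = 0
    · rw [h0, zero_mul]
    · have := hcon (Sum.inr ⟨(u, j), h0⟩)
      rw [← C.card_jump_inr L u j h0, Nat.card_of_isEmpty, mul_zero]
  · have := hcon (Sum.inl e)
    exact Nat.card_of_isEmpty

/-- The points of intersection of `L` with the edges of `C`. -/
abbrev Crossing (C : PlaneTropCurve d m) (L : TropPoly) : Type :=
  {z : C.toM.toTropType.Place × Pt //
    z.1.site.Contains C.pos z.2 ∧ (L.jumpSet z.2 z.1.site.dir).Nonempty}

/-- A place remembers only that there is some end of a given direction at a vertex. With at most one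
such end, counting places is counting edges and ends. -/
theorem sum_crossing {L : TropPoly} {l : ℕ} (hL : L.HasDegree l)
    (hC : ∀ u, C.pos u ∉ L.locus) (hends : ∀ u j, C.ends u j ≤ 1) :
    Finite (C.Crossing L) ∧
      ∑ᶠ z : C.Crossing L, Nat.card (L.jumpSet z.1.2 z.1.1.site.dir) = l * d := by
  classical
  have : Fintype C.toM.toTropType.graph.edgeSet := Fintype.ofFinite _
  obtain ⟨h1, h2⟩ := C.sum_card_jump hL hC
  let e : (Σ i, C.Jump L i) ≃ Σ z : C.Crossing L, L.jumpSet z.1.2 z.1.1.site.dir :=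
    { toFun := fun x => ⟨⟨(x.1, x.2.1.1), x.2.2.1, ⟨_, x.2.2.2⟩⟩, ⟨x.2.1.2, x.2.2.2⟩⟩
      invFun := fun x => ⟨x.1.1.1, ⟨(x.1.1.2, x.2.1), x.1.2.1, x.2.2⟩⟩
      left_inv := fun _ => rfl
      right_inv := fun _ => rfl }
  have hfin : Finite (C.Crossing L) := by
    have : Finite (Σ z : C.Crossing L, L.jumpSet z.1.2 z.1.1.site.dir) := Finite.of_equiv _ e
    refine Finite.of_surjective
      (Sigma.fst : (Σ z : C.Crossing L, L.jumpSet z.1.2 z.1.1.site.dir) → _) fun z => ?_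
    obtain ⟨s, hs⟩ := z.2.2
    exact ⟨⟨z, s, hs⟩, rfl⟩
  refine ⟨hfin, ?_⟩
  have := Fintype.ofFinite (C.Crossing L)
  have : ∀ z : C.Crossing L, Finite (L.jumpSet z.1.2 z.1.1.site.dir) := fun z =>
    (finite_jumpSet _ _).to_subtype
  rw [finsum_eq_sum_of_fintype, ← Nat.card_sigma, ← Nat.card_congr e, Nat.card_sigma,
    Fintype.sum_sum_type, ← h2]
  congr 1
  have h3 : ∀ x : {x : Fin C.k × Fin 3 // C.toM.ends x.1 x.2 ≠ 0},
      Nat.card (C.Jump L (Sum.inr x)) = C.ends x.1.1 x.1.2 * Nat.card (C.EndJump L x.1.1 x.1.2) := by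
    rintro ⟨⟨u, j⟩, h⟩
    have h4 : C.ends u j = 1 := le_antisymm (hends u j) (Nat.one_le_iff_ne_zero.2 h)
    rw [C.card_jump_inr L u j h, h4, one_mul]
  rw [Finset.sum_congr rfl fun x _ => h3 x, ← Finset.sum_product', Finset.univ_product_univ,
    ← Finset.sum_filter_add_sum_filter_not Finset.univ
      fun x : Fin C.k × Fin 3 => C.toM.ends x.1 x.2 ≠ 0]
  refine (add_zero _).symm.trans (congrArg₂ (· + ·) ?_ (Finset.sum_eq_zero ?_).symm)
  · exact (Finset.sum_subtype _ (fun x => by simp)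
      fun x : Fin C.k × Fin 3 => C.ends x.1 x.2 * Nat.card (C.EndJump L x.1 x.2)).symm
  · intro x hx
    have h5 : C.ends x.1 x.2 = 0 := not_not.1 (Finset.mem_filter.1 hx).2
    rw [h5, zero_mul]

/-- The curve with an additional marking at a vertex. -/
def addMark (C : PlaneTropCurve d m) (u : Fin C.k) : PlaneTropCurve d (m + 1) where
  __ := C
  mark := Fin.snoc (α := fun _ => Fin C.k) C.mark u
  three_le_valence v := by
    refine (C.three_le_valence v).trans ?_
    gcongr
    refine (Set.ncard_image_of_injective _ (Fin.castSucc_injective m)).symm.le.trans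
      (Set.ncard_le_ncard ?_)
    rintro _ ⟨i, hi, rfl⟩
    simpa using hi

theorem not_trivalent_addMark (C : PlaneTropCurve d m) (u : Fin C.k) :
    ¬ (C.addMark u).Trivalent := by
  intro h
  have h1 := h u
  have h2 := C.three_le_valence u
  have h3 : {i | C.mark i = u}.ncard + 1 ≤ {i | (C.addMark u).mark i = u}.ncard := by
    have h4 : insert (Fin.last m) (Fin.castSucc '' {i | C.mark i = u}) ⊆
        {i | (C.addMark u).mark i = u} := by
      rintro i (rfl | ⟨i, hi, rfl⟩)
      · simp [addMark]
      · simpa [addMark] using hi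
    rw [← Set.ncard_image_of_injective _ (Fin.castSucc_injective m),
      ← Set.ncard_insert_of_notMem (a := Fin.last m) (by simp [Fin.castSucc_ne_last])]
    exact Set.ncard_le_ncard h4
  have h5 : (C.addMark u).valence u = (C.graph.neighborSet u).ncard +
    {i | (C.addMark u).mark i = u}.ncard + ∑ j, C.ends u j := rfl
  lia

end PlaneTropCurve

/-- A further marking at a vertex on `L` would satisfy the conditions on a curve with a vertex of
valence at least four. -/
theorem IncGeneral.pos_notMem {L : TropPoly} {p : Fin m → Pt} (h : IncGeneral d ![L] p)
    {C : PlaneTropCurve d m} (hC : C ∈ evFibre d p) (u : Fin C.k) : C.pos u ∉ L.locus := by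
  intro hu
  refine C.not_trivalent_addMark u (h (C.addMark u) ⟨fun i => ?_, fun j => ?_⟩).1
  · rw [← hC i]
    simp [PlaneTropCurve.ev, PlaneTropCurve.addMark]
  · have : (C.addMark u).ev (Fin.last m) = C.pos u := by
      simp [PlaneTropCurve.ev, PlaneTropCurve.addMark]
    rw [this]
    simpa using hu

theorem mem_incFibre_of_isIso_attach {L : TropPoly} {p : Fin m → Pt} {C : PlaneTropCurve d m}
    (hC : C ∈ evFibre d p) {s : C.toM.toTropType.Site} {D : PlaneTropCurve d (m + 1)}
    {σ : Option (Fin C.k) ≃ Fin D.k} (h : (C.toM.toTropType.attach s).IsIso D.toM.toTropType σ)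
    (hpos : ∀ u, D.pos (σ (some u)) = C.pos u) (hL : D.ev (Fin.last m) ∈ L.locus) :
    D ∈ incFibre d ![L] p := by
  refine ⟨fun i => ?_, fun j => by simpa using hL⟩
  have h1 : D.mark i.castSucc = _ := h.mark i.castSucc
  rw [PlaneTropCurve.ev, h1, TropType.attach_mark_castSucc, hpos]
  exact hC i

theorem ev_last_of_isIso_attach {V : Type} [Fintype V] {T : TropType V d m} {s : T.Site}
    {D : PlaneTropCurve d (m + 1)}
    {σ : Option V ≃ Fin D.k} (h : (T.attach s).IsIso D.toM.toTropType σ) :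
    D.ev (Fin.last m) = D.pos (σ none) := by
  have h1 : D.mark (Fin.last m) = _ := h.mark (Fin.last m)
  rw [PlaneTropCurve.ev, h1, TropType.attach_mark_last]

/-- Attach a marking at a crossing with `L`. The result is trivalent by assumption, and attaching
did not change the old valences. -/
theorem IncGeneral.evGeneral {L : TropPoly} {l : ℕ} (hL : L.HasDegree l) (hl : l ≠ 0) (hd : d ≠ 0)
    {p : Fin m → Pt} (h : IncGeneral d ![L] p) : EvGeneral d p := by
  intro C hC u
  obtain ⟨i, ⟨⟨q, s⟩, h1, h2⟩⟩ := C.exists_jump hL hl hd (h.pos_notMem hC)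
  obtain ⟨D, σ, h3, h4, h5⟩ := exists_attach h1
  have h6 : D.ev (Fin.last m) = q := (ev_last_of_isIso_attach h3).trans h5
  have h7 := (h D (mem_incFibre_of_isIso_attach hC h3 h4 (by
    rw [h6]; exact mem_locus_of_jumpSet ⟨_, h2⟩))).1 (σ (some u))
  rw [← D.valence_toM, h3.valence, TropType.valence_attach_some] at h7
  exact h7

end

/-! ### Recovering a curve and a place from the curve with a marking -/

section

open TropPoly

variable {V V' : Type} [Fintype V] [Fintype V'] {d m : ℕ}

namespace TropType

variable {T : TropType V d m} {T' : TropType V' d m}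

theorem adj_iff_attach (s : T.Site) (u v : V) : T.graph.Adj u v ↔
    u ≠ v ∧ ((T.attach s).graph.Adj (some u) (some v) ∨
      (T.attach s).graph.Adj none (some u) ∧ (T.attach s).graph.Adj none (some v)) := by
  change _ ↔ u ≠ v ∧ ((T.graph.Adj u v ∧ ¬ (u ∈ s.nbrs ∧ v ∈ s.nbrs)) ∨ u ∈ s.nbrs ∧ v ∈ s.nbrs)
  constructor
  · intro h
    refine ⟨h.ne, ?_⟩
    by_cases h' : u ∈ s.nbrs ∧ v ∈ s.nbrs
    · exact Or.inr h'
    · exact Or.inl ⟨h, h'⟩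
  · rintro ⟨hne, h | ⟨rfl | h1, rfl | h2⟩⟩
    · exact h.1
    · exact absurd rfl hne
    · exact (s.of_some _ h2.symm).1
    · exact (s.of_some _ h1.symm).1.symm
    · exact absurd (Option.some_injective _ (h1.trans h2.symm)) hne

theorem attach_ends_some (s : T.Site) (u : V) (j : Fin 3) [Decidable (u = s.base)] :
    (T.attach s).ends (some u) j = T.ends u j - if u = s.base then s.ends j else 0 := by
  unfold attach
  dsimp only
  congr!

theorem ends_eq_attach (s : T.Site) (u : V) (j : Fin 3) [Decidable (u ∈ s.nbrs)] :
    T.ends u j = (T.attach s).ends (some u) j + if u ∈ s.nbrs then s.ends j else 0 := by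
  classical
  have h2 : (if u ∈ s.nbrs then s.ends j else 0) = if u = s.base then s.ends j else 0 := by
    rcases ho : s.other with _ | b
    · simp [Site.nbrs, ho]
    · simp [(s.of_some b ho).2.2]
  have h3 : (if u = s.base then s.ends j else 0) ≤ T.ends u j := by
    split_ifs with hu
    · rw [hu]; exact s.ends_le j
    · exact Nat.zero_le _
  rw [attach_ends_some, h2]
  lia

theorem IsIso.attach {σ : V ≃ V'} (h : T.IsIso T' σ) {s : T.Site} {s' : T'.Site}
    (hN : ∀ v, σ v ∈ s'.nbrs ↔ v ∈ s.nbrs) (hends : s'.ends = s.ends) :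
    (T.attach s).IsIso (T'.attach s') (Equiv.optionCongr σ) := by
  classical
  refine isIso_of_ends (fun x y => ?_) (fun i => ?_) fun x => ?_
  · rcases x with _ | u <;> rcases y with _ | v
    · exact Iff.rfl
    · exact hN v
    · exact hN u
    · exact and_congr (h.adj u v) (not_congr (and_congr (hN u) (hN v)))
  · induction i using Fin.lastCases with
    | last => simp [attach_mark_last]
    | cast i => simp [attach_mark_castSucc, h.mark]
  · rcases x with _ | u
    · exact hends
    · funext j
      have h1 := ends_eq_attach s u j
      have h2 := ends_eq_attach s' (σ u) j
      rw [h.ends, h1, hends] at h2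
      simp only [hN] at h2
      exact (Nat.add_right_cancel h2).symm

/-- The last marking sits at `none` on both sides, so `τ` restricts to the old vertices. The
neighbours and ends of `none` record exactly what attaching has changed, hence the old types can be
reconstructed. -/
theorem IsIso.of_attach {s : T.Site} {s' : T'.Site} {τ : Option V ≃ Option V'}
    (h : (T.attach s).IsIso (T'.attach s') τ) :
    ∃ σ : V ≃ V', T.IsIso T' σ ∧ (∀ v, τ (some v) = some (σ v)) ∧ τ none = none ∧
      (∀ v, σ v ∈ s'.nbrs ↔ v ∈ s.nbrs) ∧ s'.ends = s.ends := by
  classical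
  have hnone : τ none = none := by
    have := h.mark (Fin.last m)
    rw [attach_mark_last, attach_mark_last] at this
    exact this.symm
  have hsome : ∀ v, some (Equiv.removeNone τ v) = τ (some v) := by
    intro v
    refine Equiv.removeNone_some _ (Option.ne_none_iff_exists'.1 fun h' => ?_)
    have := τ.injective (h'.trans hnone.symm)
    cases this
  have hN : ∀ v, Equiv.removeNone τ v ∈ s'.nbrs ↔ v ∈ s.nbrs := by
    intro v
    have := h.adj none (some v)
    rw [hnone, ← hsome] at this
    exact this
  have hends : s'.ends = s.ends := by
    have := h.ends none
    rw [hnone] at this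
    exact this
  refine ⟨Equiv.removeNone τ, isIso_of_ends (fun u v => ?_) (fun i => ?_) fun u => ?_,
    fun v => (hsome v).symm, hnone, hN, hends⟩
  · have h1 := h.adj (some u) (some v)
    have h2 := h.adj none (some u)
    have h3 := h.adj none (some v)
    rw [← hsome, ← hsome] at h1
    rw [hnone, ← hsome] at h2 h3
    rw [adj_iff_attach s, adj_iff_attach s', h1, h2, h3, (Equiv.removeNone τ).injective.ne_iff]
  · have := h.mark i.castSucc
    rw [attach_mark_castSucc, attach_mark_castSucc, ← hsome] at this
    exact Option.some_injective _ this
  · funext j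
    have h1 := congrFun (h.ends (some u)) j
    rw [← hsome] at h1
    rw [ends_eq_attach s, ends_eq_attach s', h1, hends]
    simp only [hN]

end TropType

/-- A curve of nonzero multiplicity is recovered from the curve with an attached marking. -/
theorem iso_of_attach {C C' : PlaneTropCurve d m} (hC : evMult C ≠ 0)
    {s : C.toM.toTropType.Site} {s' : C'.toM.toTropType.Site} {D D' : PlaneTropCurve d (m + 1)}
    {σ : Option (Fin C.k) ≃ Fin D.k} (h : (C.toM.toTropType.attach s).IsIso D.toM.toTropType σ)
    {σ' : Option (Fin C'.k) ≃ Fin D'.k}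
    (h' : (C'.toM.toTropType.attach s').IsIso D'.toM.toTropType σ')
    (hpos : ∀ u, D.pos (σ (some u)) = C.pos u) (hpos' : ∀ u, D'.pos (σ' (some u)) = C'.pos u)
    (hD : D.Iso D') :
    C.Iso C' ∧ ∃ ρ : Fin C.k ≃ Fin C'.k, C.toM.toTropType.IsIso C'.toM.toTropType ρ ∧
      (∀ v, ρ v ∈ s'.nbrs ↔ v ∈ s.nbrs) ∧ s'.ends = s.ends := by
  obtain ⟨τ, hτ⟩ := PlaneTropCurve.iso_iff.1 hD
  obtain ⟨ρ, h1, h2, -, h3, h4⟩ := ((h.trans hτ.toIsIso).trans h'.symm).of_attach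
  refine ⟨iso_of_isIso hC h1 fun i => ?_, ρ, h1, h3, h4⟩
  have h5 : C'.mark i = ρ (C.mark i) := h1.mark i
  have h6 := h2 (C.mark i)
  simp only [Equiv.trans_apply, Equiv.symm_apply_eq] at h6
  have h7 : D'.pos (τ (σ (some (C.mark i)))) = D.pos (σ (some (C.mark i))) := hτ.pos _
  rw [h6, hpos', hpos] at h7
  rw [PlaneTropCurve.ev, PlaneTropCurve.ev, h5, h7]

/-- The isomorphism gives the place up to automorphisms of `C`, and there are none. -/
theorem place_eq_of_attach {C : PlaneTropCurve d m} (hC : evMult C ≠ 0)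
    {i i' : C.toM.toTropType.Place} {D D' : PlaneTropCurve d (m + 1)}
    {σ : Option (Fin C.k) ≃ Fin D.k}
    (h : (C.toM.toTropType.attach i.site).IsIso D.toM.toTropType σ)
    {σ' : Option (Fin C.k) ≃ Fin D'.k}
    (h' : (C.toM.toTropType.attach i'.site).IsIso D'.toM.toTropType σ')
    (hpos : ∀ u, D.pos (σ (some u)) = C.pos u) (hpos' : ∀ u, D'.pos (σ' (some u)) = C.pos u)
    (hD : D.Iso D') : i = i' := by
  obtain ⟨-, ρ, h1, h2, h3⟩ := iso_of_attach hC h h' hpos hpos' hD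
  obtain rfl := automorphism_eq_refl hC h1
  exact TropType.Place.site_injective (Set.ext fun v => (h2 v).symm) h3.symm

theorem PlaneTropCurve.Iso.ev_eq {D D' : PlaneTropCurve d m} (h : D.Iso D') (i : Fin m) :
    D'.ev i = D.ev i := by
  obtain ⟨τ, hτ⟩ := PlaneTropCurve.iso_iff.1 h
  have h1 : D'.mark i = τ (D.mark i) := hτ.mark i
  rw [PlaneTropCurve.ev, h1]
  exact hτ.pos _

end

/-! ### Forgetting the last marking -/

section

open TropPoly

variable {V : Type} [Fintype V] {d m : ℕ}

theorem contractGraph_adj_iff [DecidableEq V] {G : SimpleGraph V} {a b : V} (h : a ≠ b)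
    {x y : {v // v ≠ b}} : (contractGraph G h).Adj x y ↔
      x ≠ y ∧ (G.Adj x y ∨ (x.1 = a ∧ G.Adj b y) ∨ (y.1 = a ∧ G.Adj x b)) := by
  constructor
  · rintro ⟨hne, u, v, hu, hv, huv⟩
    refine ⟨hne, ?_⟩
    rw [contractMap_eq_iff] at hu hv
    rcases hu with rfl | ⟨rfl, hx⟩ <;> rcases hv with rfl | ⟨rfl, hy⟩
    · exact Or.inl huv
    · exact Or.inr (Or.inr ⟨hy, huv⟩)
    · exact Or.inr (Or.inl ⟨hx, huv⟩)
    · exact absurd huv G.irrefl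
  · rintro ⟨hne, h1 | ⟨hx, h1⟩ | ⟨hy, h1⟩⟩
    · exact ⟨hne, _, _, contractMap_coe h x, contractMap_coe h y, h1⟩
    · exact ⟨hne, _, _, (contractMap_eq_iff h).2 (Or.inr ⟨rfl, hx⟩), contractMap_coe h y, h1⟩
    · exact ⟨hne, _, _, contractMap_coe h x, (contractMap_eq_iff h).2 (Or.inr ⟨rfl, hy⟩), h1⟩

namespace TropType

/-- The type without its last marking. -/
def dropMark (T : TropType V d (m + 1)) : TropType V d m where
  __ := T
  mark i := T.mark i.castSucc

/-- The possible shapes of a trivalent vertex with a marking. -/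
theorem exists_adj_mark (T : TropType V d (m + 1))
    (hval : T.valence (T.mark (Fin.last m)) = 3) (hV : 2 ≤ Fintype.card V)
    (hdir : ∀ u v, T.graph.Adj u v → T.dir u v ≠ 0) :
    ∃ a, T.graph.Adj a (T.mark (Fin.last m)) ∧
      (∀ i : Fin m, T.mark i.castSucc ≠ T.mark (Fin.last m)) ∧
      ((∃ b, b ≠ a ∧ (∀ x, T.graph.Adj (T.mark (Fin.last m)) x ↔ x = a ∨ x = b) ∧
          T.ends (T.mark (Fin.last m)) = 0 ∧
          T.dir a (T.mark (Fin.last m)) = T.dir (T.mark (Fin.last m)) b) ∨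
        ((∀ x, T.graph.Adj (T.mark (Fin.last m)) x ↔ x = a) ∧
          ∃ j, T.ends (T.mark (Fin.last m)) = Pi.single j 1)) := by
  classical
  set v := T.mark (Fin.last m) with hv
  unfold valence at hval
  have hmem : Fin.last m ∈ {i | T.mark i = v} := hv.symm
  have hmark : 1 ≤ {i | T.mark i = v}.ncard :=
    Nat.one_le_iff_ne_zero.2 fun h => by
      rw [Set.ncard_eq_zero] at h
      exact (Set.ext_iff.1 h (Fin.last m)).1 hmem
  have hone : {i | T.mark i = v}.ncard = 1 → ∀ i : Fin m, T.mark i.castSucc ≠ v := by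
    intro h i hi
    obtain ⟨x, hx⟩ := Set.ncard_eq_one.1 h
    have h1 : i.castSucc = x := (Set.ext_iff.1 hx _).1 hi
    have h2 : Fin.last m = x := (Set.ext_iff.1 hx _).1 hmem
    exact Fin.castSucc_ne_last i (h1.trans h2.symm)
  have : Nontrivial V := Fintype.one_lt_card_iff_nontrivial.1 hV
  obtain ⟨a, hva⟩ := T.isTree.connected.preconnected.exists_adj_of_nontrivial v
  have hN : (T.graph.neighborSet v).ncard ≠ 0 := fun h => by
    rw [Set.ncard_eq_zero] at h
    exact (Set.ext_iff.1 h a).1 hva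
  have hbal : ∀ c, ∑ w ∈ (T.graph.neighborSet v).toFinset, T.dir v w c +
      ∑ j, (T.ends v j : ℤ) * endDir j c = 0 := by
    intro c
    rw [← T.balanced v c]
    congr 1
    refine Finset.sum_subset (Finset.subset_univ _) fun w _ hw => ?_
    rw [T.dir_eq_zero v w (by simpa using hw)]
    rfl
  have hzero : ∑ j, T.ends v j = 0 → T.ends v = 0 := by
    intro h
    funext j
    exact Finset.sum_eq_zero_iff.1 h j (Finset.mem_univ j)
  by_cases h2 : (T.graph.neighborSet v).ncard = 2
  · obtain ⟨x, y, hxy, hset⟩ := Set.ncard_eq_two.1 h2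
    have hx : ∀ z, T.graph.Adj v z ↔ z = x ∨ z = y := fun z => Set.ext_iff.1 hset z
    have hends := hzero (by lia)
    refine ⟨x, ((hx x).2 (Or.inl rfl)).symm, hone (by lia), Or.inl ⟨y, hxy.symm, hx, hends, ?_⟩⟩
    funext c
    have h3 := hbal c
    have h4 : (T.graph.neighborSet v).toFinset = {x, y} := by ext z; simp [hx]
    rw [h4, Finset.sum_pair hxy, hends] at h3
    rw [T.dir_antisymm v x]
    simp only [Pi.zero_apply, Nat.cast_zero, zero_mul, Finset.sum_const_zero, add_zero] at h3
    simp only [Pi.neg_apply]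
    lia
  · by_cases h3 : (T.graph.neighborSet v).ncard = 1
    · obtain ⟨x, hset⟩ := Set.ncard_eq_one.1 h3
      have hx : ∀ z, T.graph.Adj v z ↔ z = x := fun z => Set.ext_iff.1 hset z
      have hvx := (hx x).2 rfl
      -- Without an end at `v`, balancing would make its only bounded edge contracted.
      have h4 : ∑ j, T.ends v j ≠ 0 := by
        intro h0
        refine hdir v x hvx ?_
        funext c
        have h5 := hbal c
        have h6 : (T.graph.neighborSet v).toFinset = {x} := by ext z; simp [hx]
        rw [h6, Finset.sum_singleton, hzero h0] at h5
        simpa using h5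
      have h5 : ∑ j, T.ends v j = 1 := by lia
      refine ⟨x, hvx.symm, hone (by lia), Or.inr ⟨hx, ?_⟩⟩
      obtain ⟨j, -, hj⟩ := Finset.exists_ne_zero_of_sum_ne_zero h4
      refine ⟨j, ?_⟩
      have h6 := Finset.add_sum_erase Finset.univ (T.ends v) (Finset.mem_univ j)
      have h7 : ∑ i ∈ Finset.univ.erase j, T.ends v i = 0 := by lia
      funext i
      by_cases hi : i = j
      · subst hi
        simp only [Pi.single_eq_same]
        lia
      · rw [Pi.single_eq_of_ne hi]
        exact Finset.sum_eq_zero_iff.1 h7 i (by simp [hi])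
    · lia

/-- Every type whose last marking is attached to an edge is obtained by attaching a marking. -/
theorem exists_isIso_attach (T : TropType V d (m + 1))
    (hval : T.valence (T.mark (Fin.last m)) = 3) (hV : 2 ≤ Fintype.card V)
    (hdir : ∀ u v, T.graph.Adj u v → T.dir u v ≠ 0) {pos : V → Pt}
    (hpos : ∀ u v, T.graph.Adj u v → ∃ t : ℝ, 0 < t ∧
      ∀ c, pos v c = pos u c + t * (T.dir u v c : ℝ)) :
    ∃ (W : Type) (_ : Fintype W) (T' : TropType W d m) (s : T'.Site) (σ : Option W ≃ V),
      (T'.attach s).IsIso T σ ∧ ∀ x y, T'.graph.Adj x y → ∃ t : ℝ, 0 < t ∧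
        ∀ c, pos (σ (some y)) c = pos (σ (some x)) c + t * (T'.dir x y c : ℝ) := by
  classical
  obtain ⟨a, hav, hmark, hcase⟩ := T.exists_adj_mark hval hV hdir
  set v := T.mark (Fin.last m) with hv
  -- Contracting the edge from `a` to the marked vertex straightens the path `a`, `v`, `b` to one
  -- edge, or returns the end at `v` to `a`.
  let T' : TropType {x // x ≠ v} d m := (T.contract hav).dropMark
  have hadj : ∀ x y : {x // x ≠ v}, T'.graph.Adj x y ↔
      x ≠ y ∧ (T.graph.Adj x y ∨ (x.1 = a ∧ T.graph.Adj v y) ∨ (y.1 = a ∧ T.graph.Adj x v)) :=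
    fun x y => contractGraph_adj_iff hav.ne
  have hdir1 : ∀ x y : {x // x ≠ v}, T.graph.Adj x y → T'.dir x y = T.dir x y := by
    intro x y h
    have := T.contract_dir hav h (by
      rw [contractMap_coe, contractMap_coe]
      exact fun h' => h.ne (congrArg Subtype.val h'))
    rwa [contractMap_coe, contractMap_coe] at this
  have hdir2 : ∀ y : {x // x ≠ v}, y.1 ≠ a → T.graph.Adj v y →
      T'.dir ⟨a, hav.ne⟩ y = T.dir v y := by
    intro y hya h
    have := T.contract_dir hav h (by
      rw [contractMap_coe, contractMap_self]
      exact fun h' => hya (congrArg Subtype.val h').symm)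
    rwa [contractMap_coe, contractMap_self] at this
  have hend1 : T'.ends ⟨a, hav.ne⟩ = T.ends a + T.ends v := T.contract_ends_self hav
  have hend2 : ∀ x : {x // x ≠ v}, x.1 ≠ a → T'.ends x = T.ends x.1 := fun x hx =>
    T.contract_ends_of_ne hav hx
  have hdirv : ∀ y, y ≠ a → T.graph.Adj v y → T.dir a v = T.dir v y := by
    intro y hya hy
    rcases hcase with ⟨b, hba, hN, -, h⟩ | ⟨hN, -⟩
    · rcases (hN y).1 hy with rfl | rfl
      · exact absurd rfl hya
      · exact h
    · exact absurd ((hN y).1 hy) hya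
  obtain ⟨s, hbase, hsends, hsN⟩ : ∃ s : T'.Site, s.base = ⟨a, hav.ne⟩ ∧ s.ends = T.ends v ∧
      ∀ x : {x // x ≠ v}, x ∈ s.nbrs ↔ T.graph.Adj v x := by
    rcases hcase with ⟨b, hba, hN, h0, -⟩ | ⟨hN, j, hj⟩
    · have hvb := (hN b).2 (Or.inr rfl)
      refine ⟨⟨⟨a, hav.ne⟩, some ⟨b, hvb.ne'⟩, 0, T'.dir ⟨a, hav.ne⟩ ⟨b, hvb.ne'⟩, ?_, ?_⟩, rfl,
        h0.symm, fun x => ?_⟩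
      · rintro _ ⟨⟩
        refine ⟨(hadj _ _).2 ⟨fun h => hba (congrArg Subtype.val h).symm, ?_⟩, rfl, rfl⟩
        exact Or.inr (Or.inl ⟨rfl, hvb⟩)
      · intro h
        cases h
      · refine Iff.trans ?_ (hN _).symm
        simp [Site.nbrs, Subtype.ext_iff]
    · refine ⟨⟨⟨a, hav.ne⟩, none, Pi.single j 1, endDir j, ?_, ?_⟩, rfl, hj.symm, fun x => ?_⟩
      · intro _ h
        cases h
      · intro _
        refine ⟨j, rfl, rfl, ?_⟩
        rw [hend1, hj]
        simp
      · rw [hN]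
        simp [Site.nbrs, Subtype.ext_iff]
  refine ⟨{x // x ≠ v}, inferInstance, T', s, Equiv.optionSubtypeNe v,
    isIso_of_ends (fun x y => ?_) (fun i => ?_) fun x => ?_, fun x y hxy => ?_⟩
  · rcases x with _ | x <;> rcases y with _ | y
    · exact iff_of_false T.graph.irrefl id
    · exact (hsN y).symm
    · exact (T.graph.adj_comm _ _).trans (hsN x).symm
    · change T.graph.Adj x y ↔ T'.graph.Adj x y ∧ ¬ (x ∈ s.nbrs ∧ y ∈ s.nbrs)
      rw [hadj, hsN, hsN]
      constructor
      · intro h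
        refine ⟨⟨fun h' => h.ne (congrArg Subtype.val h'), Or.inl h⟩, fun h' => ?_⟩
        exact T.isTree.not_adj_of_adj_adj h'.1.symm h'.2 h
      · rintro ⟨⟨-, h | ⟨hx, hy⟩ | ⟨hy, hx⟩⟩, h'⟩
        · exact h
        · exact absurd ⟨hx ▸ hav.symm, hy⟩ h'
        · exact absurd ⟨hx.symm, hy ▸ hav.symm⟩ h'
  · induction i using Fin.lastCases with
    | last =>
      rw [attach_mark_last]
      rfl
    | cast i =>
      rw [attach_mark_castSucc]
      have : T'.mark i = ⟨T.mark i.castSucc, hmark i⟩ := contractMap_of_ne hav.ne (hmark i)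
      rw [this]
      rfl
  · rcases x with _ | x
    · exact hsends.symm
    · funext j
      rw [attach_ends_some, hbase, hsends]
      change T.ends x.1 j = _
      by_cases hx : x = ⟨a, hav.ne⟩
      · rw [if_pos hx, hx, hend1]
        simp
      · rw [if_neg hx, hend2 x fun h => hx (Subtype.ext h)]
        simp
  · have key : ∀ y : {x // x ≠ v}, y.1 ≠ a → T.graph.Adj v y → ∃ t : ℝ, 0 < t ∧
        ∀ c, pos y.1 c = pos a c + t * (T'.dir ⟨a, hav.ne⟩ y c : ℝ) := by
      intro y hya hvy
      obtain ⟨t, ht, h1⟩ := hpos a v hav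
      obtain ⟨t', ht', h2⟩ := hpos v y hvy
      refine ⟨t + t', add_pos ht ht', fun c => ?_⟩
      rw [h2 c, h1 c, hdir2 y hya hvy, hdirv y hya hvy]
      ring
    obtain ⟨hne, h | ⟨hx, hy⟩ | ⟨hy, hx⟩⟩ := (hadj x y).1 hxy
    · rw [hdir1 x y h]
      exact hpos _ _ h
    · obtain rfl : x = ⟨a, hav.ne⟩ := Subtype.ext hx
      exact key y (fun h => hne (Subtype.ext h).symm) hy
    · obtain rfl : y = ⟨a, hav.ne⟩ := Subtype.ext hy
      obtain ⟨t, ht, h⟩ := key x (fun h => hne (Subtype.ext h)) hx.symm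
      refine ⟨t, ht, fun c => ?_⟩
      have := h c
      rw [T'.dir_antisymm ⟨a, hav.ne⟩ x]
      simp only [Equiv.optionSubtypeNe_some, Pi.neg_apply, Int.cast_neg]
      linarith

end TropType

end

/-! ### The count for `n = 0` -/

section

open TropPoly

variable {d m : ℕ}

theorem mem_incFibre_congr {n : ℕ} {K : Fin (n + 1) → TropPoly} {p : Fin m → Pt}
    {D D' : PlaneTropCurve d (m + 1)} (h : D.Iso D') (hD : D ∈ incFibre d K p) :
    D' ∈ incFibre d K p :=
  ⟨fun i => (h.ev_eq _).trans (hD.1 i), fun j => by rw [h.ev_eq]; exact hD.2 j⟩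

theorem IncGeneral.incMult_eq {L : TropPoly} {p : Fin m → Pt} (h : IncGeneral d ![L] p)
    {C : PlaneTropCurve d m} {s : C.toM.toTropType.Site} {D : PlaneTropCurve d (m + 1)}
    {σ : Option (Fin C.k) ≃ Fin D.k} (hσ : (C.toM.toTropType.attach s).IsIso D.toM.toTropType σ)
    (hD : D ∈ incFibre d ![L] p) :
    incMult ![L] D = evMult C * Nat.card (L.jumpSet (D.ev (Fin.last m)) s.dir) := by
  rw [incMult_attach s hσ, card_jumpSet]
  simpa using (h D hD).2 0

/-- Forgetting the last marking. -/
theorem IncGeneral.exists_attach_out {L : TropPoly} {p : Fin m → Pt} (h : IncGeneral d ![L] p)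
    (hm : m + 1 = 3 * d) {D : PlaneTropCurve d (m + 1)} (hD : D ∈ incFibre d ![L] p)
    (h0 : incMult ![L] D ≠ 0) :
    ∃ (x : TropModuli d m) (i : x.out.toM.toTropType.Place) (σ : Option (Fin x.out.k) ≃ Fin D.k),
      x.out ∈ evFibre d p ∧ (x.out.toM.toTropType.attach i.site).IsIso D.toM.toTropType σ ∧
      ∀ u, D.pos (σ (some u)) = x.out.pos u := by
  have ht := (h D hD).1
  obtain ⟨W, _, T, s, σ, h1, h2⟩ := D.toM.toTropType.exists_isIso_attach (ht _)
    (by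
      have := D.k_eq ht
      rw [Fintype.card_fin]
      lia)
    (fun u v huv => dir_ne_zero_of_incMult_ne_zero h0 huv) (pos := D.pos)
    (fun u v huv => ⟨D.len s(u, v), D.len_pos _ huv, D.pos_eq u v huv⟩)
  obtain ⟨C, τ, h3, h4⟩ := T.exists_planeTropCurve (pos := fun w => D.pos (σ (some w)))
    (fun u => by
      rw [← TropType.valence_attach_some s, ← h1.valence]
      exact D.three_le_valence _) h2
  obtain ⟨ρ, hρ⟩ := PlaneTropCurve.iso_iff.1
    (PlaneTropCurve.Iso.symm (Quotient.mk_out C : PlaneTropCurve.Iso _ _))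
  have h5 := h3.trans hρ.toIsIso
  obtain ⟨i, h6, h7⟩ := s.exists_place h5
  have h8 : ∀ w, (⟦C⟧ : TropModuli d m).out.pos ((τ.trans ρ) w) = D.pos (σ (some w)) := fun w =>
    (hρ.pos (τ w)).trans (h4 w)
  refine ⟨⟦C⟧, i, _, fun j => ?_, (h5.attach h6 h7).symm.trans h1, fun u => ?_⟩
  · have h9 : (⟦C⟧ : TropModuli d m).out.mark j = (τ.trans ρ) (T.mark j) := h5.mark j
    have h10 : D.mark j.castSucc = σ _ := h1.mark j.castSucc
    rw [TropType.attach_mark_castSucc] at h10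
    rw [← hD.1 j, PlaneTropCurve.ev, PlaneTropCurve.ev, h9, h10, h8]
  · obtain ⟨w, rfl⟩ := (τ.trans ρ).surjective u
    rw [h8, Equiv.trans_apply]
    have h9 : some ((τ.trans ρ) w) = (τ.trans ρ).optionCongr (some w) := rfl
    rw [h9, Equiv.symm_apply_apply]

/-- The number of curves that meet `L` is obtained from the number of curves by Bézout's theorem. -/
theorem IncGeneral.hasCount {L : TropPoly} {l : ℕ} (hL : L.HasDegree l) (hl : l ≠ 0)
    (hm : m + 1 = 3 * d) {p : Fin m → Pt} (h : IncGeneral d ![L] p) {N : ℕ}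
    (hN : HasCount (evFibre d p) evMult N) :
    HasCount (incFibre d ![L] p) (incMult ![L]) (l * d * N) := by
  classical
  have hgen : EvGeneral d p := h.evGeneral hL hl (by lia)
  set X := {x : TropModuli d m | x.out ∈ evFibre d p ∧ evMult x.out ≠ 0} with hX
  set Y := {y : TropModuli d (m + 1) | y.out ∈ incFibre d ![L] p ∧ incMult ![L] y.out ≠ 0} with hY
  have hcross : ∀ x : X, Finite (x.1.out.Crossing L) ∧
      ∑ᶠ z : x.1.out.Crossing L, Nat.card (L.jumpSet z.1.2 z.1.1.site.dir) = l * d := by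
    intro x
    have ht := hgen _ x.2.1
    refine x.1.out.sum_crossing hL (h.pos_notMem x.2.1)
      (ends_le_one_of_evMult_ne_zero x.2.2 ht ?_)
    have := x.1.out.k_eq ht
    lia
  choose D σ hσ hpos hq using fun w : (Σ x : X, x.1.out.Crossing L) => exists_attach w.2.2.1
  have hev : ∀ w, (D w).ev (Fin.last m) = w.2.1.2 := fun w =>
    (ev_last_of_isIso_attach (hσ w)).trans (hq w)
  have hmem : ∀ w, D w ∈ incFibre d ![L] p := fun w =>
    mem_incFibre_of_isIso_attach w.1.2.1 (hσ w) (hpos w) (by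
      rw [hev]
      exact mem_locus_of_jumpSet w.2.2.2)
  have hmult : ∀ w, incMult ![L] (D w) =
      evMult w.1.1.out * Nat.card (L.jumpSet w.2.1.2 w.2.1.1.site.dir) := fun w => by
    rw [h.incMult_eq (hσ w) (hmem w), hev]
  have hne : ∀ w, incMult ![L] (D w) ≠ 0 := fun w => by
    rw [hmult]
    refine Nat.mul_ne_zero w.1.2.2 ?_
    have := w.2.2.2.to_subtype
    have := (finite_jumpSet (F := L) w.2.1.2 w.2.1.1.site.dir).to_subtype
    exact Nat.card_pos.ne'
  have hout : ∀ w, PlaneTropCurve.Iso (⟦D w⟧ : TropModuli d (m + 1)).out (D w) := fun w =>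
    Quotient.mk_out (D w)
  -- Curves with a marking on `L` correspond to pairs of a curve through the points and a crossing.
  -- Multiplicities are products, and the second factors add up to `l * d` over the crossings of
  -- each curve.
  let F : (Σ x : X, x.1.out.Crossing L) → Y := fun w =>
    ⟨⟦D w⟧, mem_incFibre_congr (hout w).symm (hmem w), by
      rw [incMult_congr (hout w)]
      exact hne w⟩
  have hinj : Function.Injective F := by
    rintro ⟨x, z⟩ ⟨x', z'⟩ hF
    have hiso : (D ⟨x, z⟩).Iso (D ⟨x', z'⟩) := Quotient.exact (congrArg Subtype.val hF)
    obtain rfl : x = x' := Subtype.ext (Quotient.out_equiv_out.1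
      (iso_of_attach x.2.2 (hσ ⟨x, z⟩) (hσ ⟨x', z'⟩) (hpos ⟨x, z⟩) (hpos ⟨x', z'⟩) hiso).1)
    have h1 : z.1.1 = z'.1.1 :=
      place_eq_of_attach x.2.2 (hσ ⟨x, z⟩) (hσ ⟨x, z'⟩) (hpos ⟨x, z⟩) (hpos ⟨x, z'⟩) hiso
    have h2 : z'.1.2 = z.1.2 := by
      rw [← hev ⟨x, z'⟩, ← hev ⟨x, z⟩]
      exact hiso.ev_eq _
    rw [Subtype.ext (Prod.ext h1 h2.symm) (a1 := z) (a2 := z')]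
  have hsurj : Function.Surjective F := by
    rintro ⟨y, hy, hy0⟩
    obtain ⟨x, i, τ, h1, h2, h3⟩ := h.exists_attach_out hm hy hy0
    have h4 := h.incMult_eq h2 hy
    have h5 : evMult x.out ≠ 0 := fun h0 => hy0 (by rw [h4, h0, zero_mul])
    have h6 : (L.jumpSet (y.out.ev (Fin.last m)) i.site.dir).Nonempty := by
      by_contra h0
      rw [Set.not_nonempty_iff_eq_empty] at h0
      exact hy0 (by rw [h4, h0]; simp)
    refine ⟨⟨⟨x, h1, h5⟩, ⟨(i, y.out.ev (Fin.last m)),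
      TropType.Site.contains_of_isIso h2 h3, h6⟩⟩, Subtype.ext ?_⟩
    set w : (Σ x : X, x.1.out.Crossing L) := ⟨⟨x, h1, h5⟩, ⟨(i, y.out.ev (Fin.last m)),
      TropType.Site.contains_of_isIso h2 h3, h6⟩⟩ with hw
    -- Both curves have the same type and the same positions of all vertices. There are no
    -- contracted edges, so the lengths agree too.
    have h7 : y.out.Iso (D w) := by
      refine iso_of_isIso_of_pos (fun u v huv => dir_ne_zero_of_incMult_ne_zero hy0 huv)
        (h2.symm.trans (hσ w)) fun u => ?_
      obtain ⟨o, rfl⟩ := τ.surjective u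
      rw [Equiv.trans_apply, Equiv.symm_apply_apply]
      rcases o with _ | u
      · rw [hq w, ← ev_last_of_isIso_attach h2]
      · rw [hpos w, h3]
    change ⟦D w⟧ = y
    rw [← Quotient.out_eq y]
    exact Quotient.sound h7.symm
  have hbij : Function.Bijective F := ⟨hinj, hsurj⟩
  have hXfin : Finite X := hN.1.to_subtype
  have := fun x => (hcross x).1
  have hYfin : Finite Y := Finite.of_surjective F hsurj
  refine ⟨hYfin, ?_⟩
  have := Fintype.ofFinite X
  have := fun x : X => Fintype.ofFinite (x.1.out.Crossing L)
  have hsum := hN.2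
  rw [← finsum_set_coe_eq_finsum_mem, finsum_eq_sum_of_fintype] at hsum
  rw [← finsum_set_coe_eq_finsum_mem, ← finsum_eq_of_bijective F hbij
    (f := fun w => evMult w.1.1.out * Nat.card (L.jumpSet w.2.1.2 w.2.1.1.site.dir))
    (fun w => by rw [← hmult w, ← incMult_congr (hout w)]), finsum_eq_sum_of_fintype,
    Fintype.sum_sigma, ← hsum, Finset.mul_sum]
  refine Finset.sum_congr rfl fun x _ => ?_
  rw [← (hcross x).2, finsum_eq_sum_of_fintype, mul_comm, Finset.mul_sum]

end

/-! ### The theorem -/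

theorem lemma4 (d : ℕ) (hd : 1 ≤ d) :
    ∃ nd : ℕ,
      -- `nd` is the number of rational tropical curves of degree `d` through `3d-1` general points
      (IsGeneric {p : Fin (3 * d - 1) → Pt | EvGeneral d p} ∧
        ∀ p : Fin (3 * d - 1) → Pt, EvGeneral d p → HasCount (evFibre d p) evMult nd) ∧
      ∀ (l : ℕ) (_ : 1 ≤ l) (L : TropPoly) (_ : L.HasDegree l),
        -- `n = 0`: the last marking lies on `L`
        (IsGeneric {p : Fin (3 * d - 1) → Pt | IncGeneral d ![L] p} ∧
          ∀ p : Fin (3 * d - 1) → Pt, IncGeneral d ![L] p →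
            HasCount (incFibre d ![L] p) (incMult ![L]) (l * d * nd)) ∧
        -- `n = 1`: the last marking lies at a fixed point `q` of `L`
        (∀ q ∈ L.locus,
          IsGeneric {p : Fin (3 * d - 2) → Pt | EvGeneral d (Fin.snoc p q : Fin (3 * d - 2 + 1) → Pt)} ∧
          ∀ p : Fin (3 * d - 2) → Pt, EvGeneral d (Fin.snoc p q : Fin (3 * d - 2 + 1) → Pt) →
            HasCount (evFibre d (Fin.snoc p q : Fin (3 * d - 2 + 1) → Pt)) evMult nd) ∧
        -- `n ≥ 2`: the last marking lies on `L` and on `n` general lines, with vertices `z`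
        (∀ n : ℕ, 2 ≤ n →
          IsGeneric {x : (Fin n → Pt) × (Fin (3 * d - 1 - n) → Pt) |
            incFibre d (Fin.cons L (fun j => TropPoly.line (x.1 j)) : Fin (n + 1) → TropPoly) x.2 = ∅} ∧
          ∀ (z : Fin n → Pt) (p : Fin (3 * d - 1 - n) → Pt),
            IncGeneral d (Fin.cons L (fun j => TropPoly.line (z j)) : Fin (n + 1) → TropPoly) p →
            HasCount
              (incFibre d (Fin.cons L (fun j => TropPoly.line (z j)) : Fin (n + 1) → TropPoly) p)
              (incMult (Fin.cons L (fun j => TropPoly.line (z j)) : Fin (n + 1) → TropPoly)) 0) := by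
  obtain ⟨nd, hnd⟩ := exists_hasCount d
  -- For `n = 1` the tuple `p` followed by `q` is itself a general configuration. `hnd` is stated
  -- for every `m` with `m + 1 = 3 * d`, so it applies to `Fin (3 * d - 2 + 1)` without a cast.
  refine ⟨nd, ⟨isGeneric_evGeneral (by lia), hnd _ (by lia)⟩, fun l hl L hL =>
    ⟨⟨isGeneric_incGeneral (by lia) L, fun p hp => ?_⟩, fun q _ =>
      ⟨isGeneric_evGeneral_snoc (by lia) q, fun p hp => hnd _ (by lia) _ hp⟩, fun n hn =>
      ⟨isGeneric_incFibre_eq_empty L hn, fun z p _ => hasCount_zero _ (incMult_eq_zero hn _)⟩⟩⟩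
  have hl0 : l ≠ 0 := by lia
  have hm : 3 * d - 1 + 1 = 3 * d := by lia
  exact hp.hasCount hL hl0 hm (hnd _ hm p (hp.evGeneral hL hl0 (by lia)))
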